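/- Let $(V,b)$ be a real symplectic vector space of (even) dimension $n\ge 4$, i.e. $b$ is a non-degenerate skew-symmetric bilinear form on $V$. Put $Sp(V)=\{A\in GL(V): b(Av,Aw)=b(v,w)\}$, let $CSp(V)=\{A\in GL(V):\exists\lambda\in\mathbb R\ \forall v,w:\ b(Av,Aw)=\lambda b(v,w)\}$, with Lie algebra $\mathfrak{csp}(V)=\{X\in L(V,V):\exists\lambda\in\mathbb R\ \forall v,w:\ b(Xv,w)+b(v,Xw)=\lambda b(v,w)\}$, and let $\Lambda^3_0V^*\subset\Lambda^3V^*$ be the kernel of the contraction $\Lambda^3V^*\to V^*$ with $b^{-1}$. For a Lie algebra $\mathfrak g\subset L(V,V)$ let $\partial:V^*\otimes\mathfrak g\to\Lambda^2V^*\otimes V$, $\partial\Phi(v,w)=\Phi(v)(w)-\Phi(w)(v)$, and $\mathfrak g^{(1)}=\ker\partial$. Let $M$ be a smooth manifold of dimension $n$. An almost conformally symplectic structure on $M$ is a smooth line subbundle $\ell\subset\Lambda^2T^*M$ all of whose non-zero elements are non-degenerate; it is conformally symplectic if around each point there is a local smooth section of $\ell$ which is closed as a two-form and non-zero at this point. A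 first order structure with structure group $G=CSp(V)$ is a smooth principal $G$-bundle $p:\mathcal P\to M$ with a smooth $G$-equivariant one-form $\theta\in\Omega^1(\mathcal P,V)$ with $\ker\theta=\ker Tp$; thus each $u\in\mathcal P_x$ gives an isomorphism $\bar\theta_u:T_xM\to V$. A morphism over a smooth map $f:M\to M'$ is a smooth $G$-equivariant map $F:\mathcal P\to\mathcal P'$ covering $f$ with $F^*\theta'=\theta$. The intrinsic torsion of $\mathcal P$ is the class of the torsion of any linear connection on $TM$ induced by a principal connection on $\mathcal P$, in the quotient of $\Lambda^2T^*M\otimes TM$ by the subbundle corresponding to $\operatorname{im}(\partial)\subset\Lambda^2V^*\otimes V$ for $\mathfrak g=\mathfrak{csp}(V)$. (1) First order structures with structure group $CSp(V)$ are equivalent to almost conformally symplectic structures: for every such $(\mathcal P,\theta)$ there is exactly one almost conformally symplectic structure $\ell$ on $M$ with $\ell_x=\mathbb R\cdot\bar\theta_u^*b$ for all $x\in M$ and $u\in\mathcal P_x$; every almost conformally symplectic structure arises in this way; and if $(\mathcal P,\theta)$ over $M$ determines $\ell$ and $(\mathcal P',\theta')$ over $M'$ determines $\ell'$, then a smooth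 map $f:M\to M'$ satisfies $f^*\ell'=\ell$ (i.e. $\ell_x=\{(T_xf)^*\tau:\tau\in\ell'_{f(x)}\}$ for all $x$) if and only if there is a morphism $\mathcal P\to\mathcal P'$ over $f$, and there is at most one such morphism. (2) For $\mathfrak g=\mathfrak{csp}(V)$ one has $\mathfrak g^{(1)}\cong S^3V$ and $(\Lambda^2V^*\otimes V)/\operatorname{im}(\partial)\cong\Lambda^3_0V^*$ as representations of $Sp(V)$. In particular, $\partial$ is surjective if $n=4$. (3) If $n>4$, then an almost conformally symplectic structure is conformally symplectic if and only if the intrinsic torsion of the corresponding first order structure vanishes. (4) Let $\ell$ be conformally symplectic and let $\nabla$ be a torsion-free linear connection on $TM$ which is compatible with $\ell$, i.e. the induced connection on $\Lambda^2T^*M$ preserves $\ell$. Then the induced connection on $\ell$ is flat, and a local smooth section of $\ell$ is parallel if and only if it is closed as a two-form. -/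

import Mathlib

open Bundle Set Topology Module
open scoped Manifold ContDiff TensorProduct

set_option linter.unusedSectionVars false

/-- A symplectic inner product on a real vector space: a non-degenerate skew symmetric bilinear
form. -/
structure SymplecticForm (V : Type*) [NormedAddCommGroup V] [NormedSpace ℝ V] where
  /-- The underlying alternating bilinear form. -/
  form : V [⋀^Fin 2]→L[ℝ] ℝ
  nondegenerate : ∀ v, (∀ w, form ![v, w] = 0) → v = 0

namespace SymplecticForm

variable {V : Type*} [NormedAddCommGroup V] [NormedSpace ℝ V] (b : SymplecticForm V)

/-- The value `b(v, w)`. -/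
def eval (v w : V) : ℝ := b.form ![v, w]

instance : CoeFun (SymplecticForm V) (fun _ => V → V → ℝ) := ⟨eval⟩

theorem update_zero (v w x : V) : Function.update ![v, w] 0 x = ![x, w] := by
  funext i; fin_cases i <;> rfl

theorem update_one (v w x : V) : Function.update ![v, w] 1 x = ![v, x] := by
  funext i; fin_cases i <;> rfl

theorem add_left (v v' w : V) : b (v + v') w = b v w + b v' w := by
  have h := b.form.toContinuousMultilinearMap.map_update_add ![v, w] 0 v v'
  simp only [update_zero] at h
  exact h

theorem smul_left (c : ℝ) (v w : V) : b (c • v) w = c * b v w := by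
  have h := b.form.toContinuousMultilinearMap.map_update_smul ![v, w] 0 c v
  simp only [update_zero] at h
  exact h

theorem add_right (v w w' : V) : b v (w + w') = b v w + b v w' := by
  have h := b.form.toContinuousMultilinearMap.map_update_add ![v, w] 1 w w'
  simp only [update_one] at h
  exact h

theorem smul_right (c : ℝ) (v w : V) : b v (c • w) = c * b v w := by
  have h := b.form.toContinuousMultilinearMap.map_update_smul ![v, w] 1 c w
  simp only [update_one] at h
  exact h

/-- The symplectic inner product as a bilinear map. -/
def bilin : V →ₗ[ℝ] V →ₗ[ℝ] ℝ :=
  LinearMap.mk₂ ℝ (fun v w => b v w) b.add_left b.smul_left b.add_right b.smul_right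

@[simp] theorem bilin_apply (v w : V) : b.bilin v w = b v w := rfl

theorem sub_left (v v' w : V) : b (v - v') w = b v w - b v' w := by
  exact LinearMap.map_sub₂ b.bilin v v' w

theorem sub_right (v w w' : V) : b v (w - w') = b v w - b v w' := by
  exact (b.bilin v).map_sub w w'

theorem zero_left (w : V) : b 0 w = 0 := by
  exact LinearMap.map_zero₂ b.bilin w

/-- The symplectic group `Sp(V)`. -/
def Sp : Subgroup (V →L[ℝ] V)ˣ where
  carrier := {A | ∀ v w, b (A.val v) (A.val w) = b v w}
  one_mem' := fun v w => rfl
  mul_mem' := fun {A B} hA hB v w => by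
    rw [Set.mem_ofPred_eq] at hA hB
    simpa using (hA _ _).trans (hB v w)
  inv_mem' := fun {A} hA v w => by
    have hv : ∀ v, A.val (A⁻¹.val v) = v := fun v => by
      rw [← mul_apply_eq_comp, A.mul_inv]; rfl
    rw [← hA, hv, hv]

/-- The conformally symplectic group `CSp(V)`. -/
def CSp : Subgroup (V →L[ℝ] V)ˣ where
  carrier := {A | ∃ c : ℝ, ∀ v w, b (A.val v) (A.val w) = c * b v w}
  one_mem' := ⟨1, fun v w => by simp⟩
  mul_mem' := fun {A B} hA hB => by
    obtain ⟨c, hc⟩ := hA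
    obtain ⟨d, hd⟩ := hB
    refine ⟨c * d, fun v w => ?_⟩
    rw [mul_assoc, ← hd]
    simpa using hc (B.val v) (B.val w)
  inv_mem' := fun {A} hA => by
    obtain ⟨c, hc⟩ := hA
    have hv : ∀ v, A.val (A⁻¹.val v) = v := fun v => by
      rw [← mul_apply_eq_comp, A.mul_inv]; rfl
    refine ⟨c⁻¹, fun v w => ?_⟩
    have h := hc (A⁻¹.val v) (A⁻¹.val w)
    rw [hv, hv] at h
    rw [h]
    rcases eq_or_ne c 0 with rfl | h0
    · have := hc (A⁻¹.val (A⁻¹.val v)) (A⁻¹.val (A⁻¹.val w))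
      rw [hv, hv] at this
      simpa using this
    · field_simp

/-- The symplectic Lie algebra `sp(V)`. -/
def sp : Submodule ℝ (V →L[ℝ] V) where
  carrier := {X | ∀ v w, b (X v) w + b v (X w) = 0}
  zero_mem' := fun v w => by
    have := b.smul_right 0 v 0
    simp only [zero_smul, zero_mul] at this
    simp [this, b.zero_left]
  add_mem' := fun {X Y} hX hY v w => by
    have h1 := hX v w
    have h2 := hY v w
    simp only [_root_.add_apply, b.add_left, b.add_right]
    linarith
  smul_mem' := fun c X hX v w => by
    have h1 := hX v w
    simp only [_root_.smul_apply, b.smul_left, b.smul_right]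
    linear_combination c * h1

/-- The conformally symplectic Lie algebra `csp(V) = ℝ ⊕ sp(V)`. -/
def csp : Submodule ℝ (V →L[ℝ] V) where
  carrier := {X | ∃ c : ℝ, ∀ v w, b (X v) w + b v (X w) = c * b v w}
  zero_mem' := ⟨0, fun v w => by simpa using b.sp.zero_mem v w⟩
  add_mem' := fun {X Y} ⟨c, hX⟩ ⟨d, hY⟩ => ⟨c + d, fun v w => by
    have h1 := hX v w
    have h2 := hY v w
    simp only [_root_.add_apply, b.add_left, b.add_right]
    linarith⟩
  smul_mem' := fun r X ⟨c, hX⟩ => ⟨r * c, fun v w => by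
    have h1 := hX v w
    simp only [_root_.smul_apply, b.smul_left, b.smul_right]
    linear_combination r * h1⟩

/-! ### The Lie group structure of `CSp(V)`

`CSp(V)` is a closed subgroup of `GL(V)`. Its smooth structure is given by the left translates of
the Cayley chart `A ↦ (μ, (A - μ) (A + μ)⁻¹) ∈ ℝ × sp(V)`, where `μ > 0` is the square root of the
factor by which `A` rescales `b`. It is the unique smooth structure for which the inclusion into
the space of endomorphisms is an embedding, see `CSp.contMDiffAt_iff`. -/

section LieGroup

theorem exists_pair [Nontrivial V] : ∃ p : V × V, b p.1 p.2 = 1 := by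
  obtain ⟨v, hv⟩ := exists_ne (0 : V)
  by_contra! h
  refine hv (b.nondegenerate v fun w => ?_)
  by_contra hw
  refine h (v, (b v w)⁻¹ • w) ?_
  rw [b.smul_right]
  exact inv_mul_cancel₀ hw

variable [FiniteDimensional ℝ V] [Nontrivial V]

/-- The factor by which an element of `CSp(V)` rescales `b`. -/
noncomputable def scale (A : V →L[ℝ] V) : ℝ := b (A b.exists_pair.choose.1) (A b.exists_pair.choose.2)

theorem scale_eq {A : V →L[ℝ] V} {c : ℝ} (h : ∀ v w, b (A v) (A w) = c * b v w) :
    b.scale A = c := by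
  rw [scale, h, b.exists_pair.choose_spec, mul_one]

/-- A continuous linear projection onto `sp(V)`. -/
theorem exists_proj : ∃ p : (V →L[ℝ] V) →L[ℝ] b.sp, ∀ X : b.sp, p X = X := by
  obtain ⟨f, hf⟩ := LinearMap.exists_leftInverse_of_injective b.sp.subtype
    (LinearMap.ker_eq_bot.2 b.sp.subtype_injective)
  refine ⟨LinearMap.toContinuousLinearMap f, fun X => ?_⟩
  exact LinearMap.congr_fun hf X

/-- The Cayley chart as a map on all endomorphisms. -/
noncomputable def cayley (A : V →L[ℝ] V) : ℝ × b.sp :=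
  (√(b.scale A), b.exists_proj.choose
    ((A - √(b.scale A) • 1) * Ring.inverse (A + √(b.scale A) • 1)))

/-- The inverse of the Cayley chart. -/
noncomputable def cayleyInv (y : ℝ × b.sp) : V →L[ℝ] V :=
  y.1 • ((1 + (y.2 : V →L[ℝ] V)) * Ring.inverse (1 - (y.2 : V →L[ℝ] V)))

/-- Endomorphisms to which the Cayley chart applies. -/
def cayleySource : Set (V →L[ℝ] V) := {A | 0 < b.scale A ∧ IsUnit (A + √(b.scale A) • 1)}

/-- The image of the Cayley chart. -/
def cayleyTarget : Set (ℝ × b.sp) := {y | 0 < y.1 ∧ IsUnit (1 - (y.2 : V →L[ℝ] V))}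

theorem contDiff_scale : ContDiff ℝ ∞ b.scale := by
  have h : b.scale = fun A : V →L[ℝ] V => b.form (fun i => A
      (![b.exists_pair.choose.1, b.exists_pair.choose.2] i)) := by
    funext A
    unfold scale
    refine congrArg b.form ?_
    funext i
    fin_cases i <;> rfl
  rw [h]
  refine b.form.toContinuousMultilinearMap.contDiff.comp (contDiff_pi.2 fun i => ?_)
  fun_prop

theorem isOpen_cayleySource : IsOpen b.cayleySource := by
  have hs := b.contDiff_scale.continuous
  have h : Continuous fun A : V →L[ℝ] V => A + √(b.scale A) • (1 : V →L[ℝ] V) := by fun_prop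
  exact (isOpen_lt continuous_const hs).inter (Units.isOpen.preimage h)

theorem isOpen_cayleyTarget : IsOpen b.cayleyTarget := by
  have h : Continuous fun y : ℝ × b.sp => 1 - (y.2 : V →L[ℝ] V) := by fun_prop
  exact (isOpen_lt continuous_const continuous_fst).inter (Units.isOpen.preimage h)

theorem contDiffOn_cayley : ContDiffOn ℝ ∞ b.cayley b.cayleySource := by
  intro A hA
  have h1 : ContDiffAt ℝ ∞ (fun A => √(b.scale A)) A :=
    b.contDiff_scale.contDiffAt.sqrt hA.1.ne'
  have h2 : ContDiffAt ℝ ∞ (fun A : V →L[ℝ] V => √(b.scale A) • (1 : V →L[ℝ] V)) A :=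
    h1.smul contDiffAt_const
  have hp : ContDiff ℝ ∞ b.exists_proj.choose := ContinuousLinearMap.contDiff _
  refine (h1.prodMk (hp.contDiffAt.comp A
    ((contDiffAt_id.sub h2).mul ?_))).contDiffWithinAt
  obtain ⟨u, hu⟩ := hA.2
  have h3 : ContDiffAt ℝ ∞ Ring.inverse (A + √(b.scale A) • 1) := hu ▸ contDiffAt_ringInverse ℝ u
  exact h3.comp A (contDiffAt_id.add h2)

theorem contDiffOn_cayleyInv : ContDiffOn ℝ ∞ b.cayleyInv b.cayleyTarget := by
  intro y hy
  have hs : ContDiff ℝ ∞ b.sp.subtypeL := ContinuousLinearMap.contDiff _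
  have h1 : ContDiffAt ℝ ∞ (fun y : ℝ × b.sp => (y.2 : V →L[ℝ] V)) y :=
    hs.contDiffAt.comp y contDiffAt_snd
  refine (contDiffAt_fst.smul ((contDiffAt_const.add h1).mul ?_)).contDiffWithinAt
  obtain ⟨u, hu⟩ := hy.2
  have h3 : ContDiffAt ℝ ∞ Ring.inverse (1 - (y.2 : V →L[ℝ] V)) := hu ▸ contDiffAt_ringInverse ℝ u
  exact h3.comp y (contDiffAt_const.sub h1)

theorem cayley_prod_mem_sp {A : V →L[ℝ] V} (hA : A ∈ b.cayleySource)
    (h : ∃ c : ℝ, ∀ v w, b (A v) (A w) = c * b v w) :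
    (A - √(b.scale A) • 1) * Ring.inverse (A + √(b.scale A) • 1) ∈ b.sp := by
  obtain ⟨c, hc⟩ := h
  obtain ⟨hpos, u, hu⟩ := hA
  have hsc := b.scale_eq hc
  rw [hsc] at hpos hu ⊢
  have hm : √c * √c = c := Real.mul_self_sqrt hpos.le
  rw [← hu, Ring.inverse_unit]
  intro v w
  have hv : ∀ v, u.val (u⁻¹.val v) = v := fun v => by
    rw [← mul_apply_eq_comp, u.mul_inv]; rfl
  have key : ∀ v w, b ((A - √c • 1 : V →L[ℝ] V) v) (u.val w) +
      b (u.val v) ((A - √c • 1 : V →L[ℝ] V) w) = 0 := by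
    intro v w
    rw [hu]
    simp only [_root_.add_apply, _root_.sub_apply,
      _root_.smul_apply, one_apply_eq_self, b.add_left, b.add_right,
      b.sub_left, b.sub_right, b.smul_left, b.smul_right, hc]
    linear_combination (-2 * b v w) * hm
  have := key (u⁻¹.val v) (u⁻¹.val w)
  rw [hv, hv] at this
  exact this

theorem cayleyInv_cayley {A : V →L[ℝ] V} (hA : A ∈ b.cayleySource)
    (h : ∃ c : ℝ, ∀ v w, b (A v) (A w) = c * b v w) :
    b.cayley A ∈ b.cayleyTarget ∧ b.cayleyInv (b.cayley A) = A := by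
  have hmem := b.cayley_prod_mem_sp hA h
  obtain ⟨hpos, u, hu⟩ := hA
  set m := √(b.scale A) with hm
  have hm0 : 0 < m := Real.sqrt_pos.2 hpos
  have hX : ((b.cayley A).2 : V →L[ℝ] V) = (A - m • 1) * u⁻¹.val := by
    have := b.exists_proj.choose_spec ⟨_, hmem⟩
    simp only [cayley]
    rw [← hm]
    rw [this]
    simp only [← hu, Ring.inverse_unit]
  have h1 : (1 : V →L[ℝ] V) = (A + m • 1) * u⁻¹.val := by rw [← hu, u.mul_inv]
  have h2 : 1 - ((b.cayley A).2 : V →L[ℝ] V) = (2 * m) • u⁻¹.val := by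
    rw [hX]
    nth_rewrite 1 [h1]
    rw [← sub_mul]
    have : A + m • (1 : V →L[ℝ] V) - (A - m • 1) = (2 * m) • 1 := by module
    rw [this, smul_mul_assoc, one_mul]
  have h3 : 1 + ((b.cayley A).2 : V →L[ℝ] V) = (2 : ℝ) • (A * u⁻¹.val) := by
    rw [hX]
    nth_rewrite 1 [h1]
    rw [← add_mul]
    have : A + m • (1 : V →L[ℝ] V) + (A - m • 1) = (2 : ℝ) • A := by module
    rw [this, smul_mul_assoc]
  have h2m : (2 * m) ≠ 0 := by positivity
  let w : (V →L[ℝ] V)ˣ := ⟨(2 * m) • u⁻¹.val, (2 * m)⁻¹ • u.val,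
    by rw [smul_mul_smul_comm, mul_inv_cancel₀ h2m, u.inv_mul, one_smul],
    by rw [smul_mul_smul_comm, inv_mul_cancel₀ h2m, u.mul_inv, one_smul]⟩
  have hw : 1 - ((b.cayley A).2 : V →L[ℝ] V) = w.val := h2
  refine ⟨⟨hm0, hw ▸ w.isUnit⟩, ?_⟩
  have hw' : w⁻¹.val = (2 * m)⁻¹ • u.val := rfl
  have hfst : (b.cayley A).1 = m := rfl
  rw [cayleyInv, hw, Ring.inverse_unit, h3, hw', hfst, smul_mul_smul_comm, mul_assoc, u.inv_mul,
    mul_one, smul_smul]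
  have : m * (2 * (2 * m)⁻¹) = 1 := by field_simp
  rw [this, one_smul]

theorem cayley_cayleyInv {y : ℝ × b.sp} (hy : y ∈ b.cayleyTarget) :
    IsUnit (b.cayleyInv y) ∧ (∃ c : ℝ, ∀ v w, b (b.cayleyInv y v) (b.cayleyInv y w) = c * b v w) ∧
      b.cayleyInv y ∈ b.cayleySource ∧ b.cayley (b.cayleyInv y) = y := by
  obtain ⟨t, X⟩ := y
  obtain ⟨ht, u, hu⟩ := hy
  simp only at ht hu
  have hv : ∀ v, u.val (u⁻¹.val v) = v := fun v => by
    rw [← mul_apply_eq_comp, u.mul_inv]; rfl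
  have hA : b.cayleyInv (t, X) = t • ((1 + (X : V →L[ℝ] V)) * u⁻¹.val) := by
    simp only [cayleyInv]
    rw [← hu, Ring.inverse_unit]
  have hX := X.2
  have hcross : ∀ v w, b ((1 + (X : V →L[ℝ] V)) v) ((1 + (X : V →L[ℝ] V)) w) =
      b (u.val v) (u.val w) := by
    intro v w
    have := hX v w
    rw [hu]
    simp only [_root_.add_apply, _root_.sub_apply,
      one_apply_eq_self, b.add_left, b.add_right, b.sub_left, b.sub_right]
    linear_combination 2 * this
  have hc : ∀ v w, b (b.cayleyInv (t, X) v) (b.cayleyInv (t, X) w) = (t * t) * b v w := by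
    intro v w
    rw [hA]
    simp only [_root_.smul_apply, mul_apply_eq_comp, b.smul_left,
      b.smul_right, hcross, hv]
    ring
  have hsc := b.scale_eq hc
  have hsq : √(b.scale (b.cayleyInv (t, X))) = t := by rw [hsc, Real.sqrt_mul_self ht.le]
  have hunit : IsUnit (b.cayleyInv (t, X)) := by
    rw [ContinuousLinearMap.isUnit_iff_bijective]
    have hinj : Function.Injective (b.cayleyInv (t, X)) := by
      rw [injective_iff_map_eq_zero]
      intro v hv0
      refine b.nondegenerate v fun w => ?_
      have := hc v w
      rw [hv0, b.zero_left] at this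
      have ht2 : t * t ≠ 0 := by positivity
      exact (mul_eq_zero.1 this.symm).resolve_left ht2
    exact ⟨hinj, (LinearMap.injective_iff_surjective
      (f := (b.cayleyInv (t, X)).toLinearMap)).1 hinj⟩
  have h1 : (1 : V →L[ℝ] V) = (1 - (X : V →L[ℝ] V)) * u⁻¹.val := by rw [← hu, u.mul_inv]
  have h2 : b.cayleyInv (t, X) + t • 1 = (2 * t) • u⁻¹.val := by
    rw [hA]
    nth_rewrite 2 [h1]
    rw [← smul_add, ← add_mul]
    have : 1 + (X : V →L[ℝ] V) + (1 - X) = (2 : ℝ) • 1 := by module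
    rw [this, smul_mul_assoc, one_mul, smul_smul, mul_comm]
  have h3 : b.cayleyInv (t, X) - t • 1 = (2 * t) • (X * u⁻¹.val) := by
    rw [hA]
    nth_rewrite 2 [h1]
    rw [← smul_sub, ← sub_mul]
    have : 1 + (X : V →L[ℝ] V) - (1 - X) = (2 : ℝ) • X := by module
    rw [this, smul_mul_assoc, smul_smul, mul_comm]
  have h2m : (2 * t) ≠ 0 := by positivity
  let w : (V →L[ℝ] V)ˣ := ⟨(2 * t) • u⁻¹.val, (2 * t)⁻¹ • u.val,
    by rw [smul_mul_smul_comm, mul_inv_cancel₀ h2m, u.inv_mul, one_smul],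
    by rw [smul_mul_smul_comm, inv_mul_cancel₀ h2m, u.mul_inv, one_smul]⟩
  have hw : b.cayleyInv (t, X) + t • 1 = w.val := h2
  have hw' : w⁻¹.val = (2 * t)⁻¹ • u.val := rfl
  refine ⟨hunit, ⟨_, hc⟩, ⟨by rw [hsc]; positivity, by rw [hsq, hw]; exact w.isUnit⟩, ?_⟩
  rw [cayley, hsq, hw, Ring.inverse_unit, h3, hw', smul_mul_smul_comm, mul_assoc (X : V →L[ℝ] V),
    u.inv_mul, mul_inv_cancel₀ h2m, one_smul, mul_one, b.exists_proj.choose_spec X]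

namespace CSp

variable {b}

theorem isEmbedding_val : IsEmbedding (fun a : b.CSp => (a.1.val : V →L[ℝ] V)) :=
  Units.isOpenEmbedding_val.isEmbedding.comp IsEmbedding.subtypeVal

open Classical in
/-- The Cayley chart centred at the element `g` of `CSp(V)`. -/
noncomputable def chart (g : b.CSp) : OpenPartialHomeomorph b.CSp (ℝ × b.sp) where
  toFun a := b.cayley (g⁻¹ * a).1.val
  invFun y := if h : y ∈ b.cayleyTarget then
    g * ⟨(b.cayley_cayleyInv h).1.unit, (b.cayley_cayleyInv h).2.1⟩ else 1
  source := {a | (g⁻¹ * a).1.val ∈ b.cayleySource}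
  target := b.cayleyTarget
  map_source' a ha := (b.cayleyInv_cayley ha (g⁻¹ * a).2).1
  map_target' y hy := by
    simp only [hy, dif_pos, Set.mem_ofPred_eq, inv_mul_cancel_left]
    exact (b.cayley_cayleyInv hy).2.2.1
  left_inv' a ha := by
    have h := b.cayleyInv_cayley ha (g⁻¹ * a).2
    simp only [h.1, dif_pos]
    rw [← eq_inv_mul_iff_mul_eq]
    exact Subtype.ext (Units.ext h.2)
  right_inv' y hy := by
    simp only [hy, dif_pos, inv_mul_cancel_left]
    exact (b.cayley_cayleyInv hy).2.2.2
  open_source := b.isOpen_cayleySource.preimage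
    (isEmbedding_val.continuous.comp (continuous_const.mul continuous_id))
  open_target := b.isOpen_cayleyTarget
  continuousOn_toFun := b.contDiffOn_cayley.continuousOn.comp
    (isEmbedding_val.continuous.comp (continuous_const.mul continuous_id)).continuousOn
    fun _ h => h
  continuousOn_invFun := by
    rw [isEmbedding_val.continuousOn_iff]
    refine ContinuousOn.congr (f := fun y => g.1.val * b.cayleyInv y)
      (continuousOn_const.mul b.contDiffOn_cayleyInv.continuousOn) fun y hy => ?_
    simp only [Function.comp_apply, hy, dif_pos]
    rfl

theorem val_chart_symm (g : b.CSp) {y : ℝ × b.sp} (hy : y ∈ b.cayleyTarget) :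
    ((chart g).symm y).1.val = g.1.val * b.cayleyInv y := by
  classical
  have h : (chart g).symm y =
      g * ⟨(b.cayley_cayleyInv hy).1.unit, (b.cayley_cayleyInv hy).2.1⟩ := dif_pos hy
  rw [h]
  rfl

theorem mem_chart_source (g : b.CSp) : g ∈ (chart g).source := by
  change (g⁻¹ * g).1.val ∈ b.cayleySource
  rw [inv_mul_cancel]
  have h : b.scale (1 : V →L[ℝ] V) = 1 := b.scale_eq fun v w => by simp
  change 0 < b.scale (1 : V →L[ℝ] V) ∧ IsUnit ((1 : V →L[ℝ] V) + √(b.scale 1) • 1)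
  rw [h, Real.sqrt_one, one_smul]
  refine ⟨one_pos, ⟨⟨1 + 1, (2 : ℝ)⁻¹ • 1, ?_, ?_⟩, rfl⟩⟩
  · rw [mul_smul_comm, mul_one, smul_add, ← add_smul]; norm_num
  · rw [smul_mul_assoc, one_mul, smul_add, ← add_smul]; norm_num

noncomputable instance : ChartedSpace (ℝ × b.sp) b.CSp where
  atlas := Set.range chart
  chartAt := chart
  mem_chart_source := mem_chart_source
  chart_mem_atlas g := ⟨g, rfl⟩

instance : IsManifold 𝓘(ℝ, ℝ × b.sp) ∞ b.CSp := by
  refine isManifold_of_contDiffOn _ _ _ ?_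
  rintro _ _ ⟨g, rfl⟩ ⟨h, rfl⟩
  simp only [modelWithCornersSelf_coe, modelWithCornersSelf_coe_symm, Function.comp_id,
    Function.id_comp, Set.preimage_id, Set.range_id, Set.inter_univ]
  have hsrc : ∀ y ∈ ((chart g).symm ≫ₕ chart h).source,
      (h⁻¹.1.val * g.1.val * b.cayleyInv y) ∈ b.cayleySource ∧ y ∈ b.cayleyTarget ∧
      ((chart g).symm ≫ₕ chart h) y = b.cayley (h⁻¹.1.val * g.1.val * b.cayleyInv y) := by
    intro y hy
    rw [OpenPartialHomeomorph.trans_source] at hy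
    have hy1 : y ∈ b.cayleyTarget := hy.1
    have hval : (h⁻¹ * (chart g).symm y).1.val = h⁻¹.1.val * g.1.val * b.cayleyInv y := by
      rw [mul_assoc, ← val_chart_symm g hy1]; rfl
    refine ⟨hval ▸ hy.2, hy1, ?_⟩
    rw [← hval]
    rfl
  refine ContDiffOn.congr (f := fun y => b.cayley (h⁻¹.1.val * g.1.val * b.cayleyInv y)) ?_
    fun y hy => (hsrc y hy).2.2
  refine b.contDiffOn_cayley.comp ?_ fun y hy => (hsrc y hy).1
  exact contDiffOn_const.mul (b.contDiffOn_cayleyInv.mono fun y hy => (hsrc y hy).2.1)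

theorem contMDiff_val :
    ContMDiff 𝓘(ℝ, ℝ × b.sp) 𝓘(ℝ, V →L[ℝ] V) ∞ (fun a : b.CSp => (a.1.val : V →L[ℝ] V)) := by
  intro g
  rw [contMDiffAt_iff_source]
  refine ContDiffWithinAt.contMDiffWithinAt ?_
  have hg : b.cayley (g⁻¹ * g).1.val ∈ b.cayleyTarget := (chart g).map_source (mem_chart_source g)
  refine ContDiffAt.contDiffWithinAt ?_
  refine ContDiffAt.congr_of_eventuallyEq (f := fun y => g.1.val * b.cayleyInv y) ?_ ?_
  · exact contDiffAt_const.mul (b.contDiffOn_cayleyInv.contDiffAt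
      (b.isOpen_cayleyTarget.mem_nhds hg))
  · filter_upwards [b.isOpen_cayleyTarget.mem_nhds hg] with y hy
    exact val_chart_symm g hy

section

variable {E H N : Type*} [NormedAddCommGroup E] [NormedSpace ℝ E] [TopologicalSpace H]
  {I : ModelWithCorners ℝ E H} [TopologicalSpace N] [ChartedSpace H N]

/-- A map into `CSp(V)` is smooth if and only if it is smooth as a map into the endomorphisms. -/
theorem contMDiffAt_iff {f : N → b.CSp} {x : N} :
    ContMDiffAt I 𝓘(ℝ, ℝ × b.sp) ∞ f x ↔
      ContMDiffAt I 𝓘(ℝ, V →L[ℝ] V) ∞ (fun y => ((f y).1.val : V →L[ℝ] V)) x := by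
  refine ⟨fun h => ContMDiffAt.comp (f := f) x (contMDiff_val (f x)) h, fun h => ?_⟩
  rw [contMDiffAt_iff_target]
  refine ⟨isEmbedding_val.continuousAt_iff.2 h.continuousAt, ?_⟩
  have hmem : (f x)⁻¹.1.val * (f x).1.val ∈ b.cayleySource := mem_chart_source (f x)
  have h1 : ContMDiffAt 𝓘(ℝ, V →L[ℝ] V) 𝓘(ℝ, ℝ × b.sp) ∞
      (fun A : V →L[ℝ] V => b.cayley ((f x)⁻¹.1.val * A)) (f x).1.val := by
    refine ContDiffAt.contMDiffAt ?_
    exact (b.contDiffOn_cayley.contDiffAt (b.isOpen_cayleySource.mem_nhds hmem)).comp _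
      (contDiffAt_const.mul contDiffAt_id)
  exact ContMDiffAt.comp (f := fun y => ((f y).1.val : V →L[ℝ] V)) x h1 h

end

instance : LieGroup 𝓘(ℝ, ℝ × b.sp) ∞ b.CSp where
  contMDiff_mul p := by
    rw [contMDiffAt_iff]
    have h : ContMDiffAt (𝓘(ℝ, ℝ × b.sp).prod 𝓘(ℝ, ℝ × b.sp)) 𝓘(ℝ, (V →L[ℝ] V) × (V →L[ℝ] V)) ∞
        (fun p : b.CSp × b.CSp => ((p.1.1.val, p.2.1.val) : (V →L[ℝ] V) × (V →L[ℝ] V))) p :=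
      ((contMDiff_val.comp contMDiff_fst).prodMk_space (contMDiff_val.comp contMDiff_snd)) p
    have h2 : ContMDiffAt 𝓘(ℝ, (V →L[ℝ] V) × (V →L[ℝ] V)) 𝓘(ℝ, V →L[ℝ] V) ∞
        (fun q : (V →L[ℝ] V) × (V →L[ℝ] V) => q.1 * q.2) (p.1.1.val, p.2.1.val) :=
      (contDiff_fst.mul contDiff_snd).contDiffAt.contMDiffAt
    exact ContMDiffAt.comp
      (f := fun p : b.CSp × b.CSp => ((p.1.1.val, p.2.1.val) : (V →L[ℝ] V) × (V →L[ℝ] V))) p h2 h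
  contMDiff_inv a := by
    rw [contMDiffAt_iff]
    have h2 : ContMDiffAt 𝓘(ℝ, V →L[ℝ] V) 𝓘(ℝ, V →L[ℝ] V) ∞ Ring.inverse a.1.val :=
      (contDiffAt_ringInverse ℝ a.1).contMDiffAt
    refine (h2.comp a (contMDiff_val a)).congr_of_eventuallyEq (Filter.Eventually.of_forall ?_)
    intro c
    exact (Ring.inverse_unit c.1).symm

end CSp

end LieGroup

end SymplecticForm

section Spencer

variable {V : Type*} [NormedAddCommGroup V] [NormedSpace ℝ V]

/-- The Spencer differential `∂ : V* ⊗ 𝔤 → Λ²V* ⊗ V` of a space `𝔤` of endomorphisms of `V`,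
given by `∂Φ(v, w) = Φ(v)(w) - Φ(w)(v)`. -/
def spencer (𝔤 : Submodule ℝ (V →L[ℝ] V)) : (V →ₗ[ℝ] 𝔤) →ₗ[ℝ] (V [⋀^Fin 2]→ₗ[ℝ] V) where
  toFun Φ :=
    { toFun := fun v => (Φ (v 0) : V →L[ℝ] V) (v 1) - (Φ (v 1) : V →L[ℝ] V) (v 0)
      map_update_add' := fun v i x y => by
        fin_cases i <;> simp <;> abel
      map_update_smul' := fun v i c x => by
        fin_cases i <;> simp [smul_sub]
      map_eq_zero_of_eq' := fun v i j h hij => by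
        fin_cases i <;> fin_cases j <;> simp_all }
  map_add' Φ Ψ := by ext v; simp; abel
  map_smul' c Φ := by ext v; simp [smul_sub]

/-- The first prolongation `𝔤⁽¹⁾ ⊂ V* ⊗ 𝔤`. -/
def prolongation (𝔤 : Submodule ℝ (V →L[ℝ] V)) : Submodule ℝ (V →ₗ[ℝ] 𝔤) :=
  LinearMap.ker (spencer 𝔤)

end Spencer

section SymPower

variable {V : Type*} [AddCommGroup V] [Module ℝ V]

/-- The linear map `S³V → S³V` induced by an endomorphism of `V`. -/
noncomputable def symCubeMap (f : V →ₗ[ℝ] V) : Sym[ℝ]^3 V →ₗ[ℝ] Sym[ℝ]^3 V where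
  __ := AddCon.lift (addConGen (SymmetricPower.Rel ℝ (Fin 3) V))
    ((SymmetricPower.mk ℝ (Fin 3) V) ∘ₗ (PiTensorProduct.map fun _ => f)).toAddMonoidHom
    (AddCon.addConGen_le.2 fun x y h => by
      induction h with
      | perm e v =>
        rw [AddCon.ker_rel]
        simp only [LinearMap.toAddMonoidHom_coe, LinearMap.comp_apply, PiTensorProduct.map_tprod]
        exact (SymmetricPower.tprod_equiv e fun i => f (v i)).symm)
  map_smul' c x := by
    induction x using AddCon.induction_on with
    | H x => exact ((SymmetricPower.mk ℝ (Fin 3) V) ∘ₗ (PiTensorProduct.map fun _ => f)).map_smul c x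

theorem symCubeMap_tprod (f : V →ₗ[ℝ] V) (v : Fin 3 → V) :
    symCubeMap f (SymmetricPower.tprod ℝ v) = SymmetricPower.tprod ℝ fun i => f (v i) := by
  change SymmetricPower.mk ℝ (Fin 3) V (PiTensorProduct.map (fun _ => f)
    (PiTensorProduct.tprod ℝ v)) = _
  rw [PiTensorProduct.map_tprod]
  rfl

theorem symCube_hom_ext {f g : Sym[ℝ]^3 V →ₗ[ℝ] Sym[ℝ]^3 V}
    (h : ∀ v : Fin 3 → V, f (SymmetricPower.tprod ℝ v) = g (SymmetricPower.tprod ℝ v)) : f = g :=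
  LinearMap.ext_on_range (SymmetricPower.span_tprod_eq_top ℝ (Fin 3) V) h

end SymPower

namespace SymplecticForm

variable {V : Type*} [NormedAddCommGroup V] [NormedSpace ℝ V] (b : SymplecticForm V)

/-- The standard representation of `Sp(V)` on `V`. -/
def stdRep : Representation ℝ b.Sp V where
  toFun g := g.1.val.toLinearMap
  map_one' := rfl
  map_mul' _ _ := rfl

/-- The representation of `Sp(V)` on `Λᵏ V* ⊗ W` induced by a representation on `W`. -/
def altRep {W : Type*} [AddCommGroup W] [Module ℝ W] (σ : Representation ℝ b.Sp W) (k : ℕ) :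
    Representation ℝ b.Sp (V [⋀^Fin k]→ₗ[ℝ] W) where
  toFun g :=
    { toFun := fun T => (σ g).compAlternatingMap (T.compLinearMap (b.stdRep g⁻¹))
      map_add' := fun S T => by ext v; simp
      map_smul' := fun c T => by ext v; simp }
  map_one' := by ext T v; simp
  map_mul' g h := by ext T v; simp

/-- The adjoint representation of `Sp(V)` on `csp(V)`. -/
def adRep : Representation ℝ b.Sp b.csp where
  toFun g :=
    { toFun := fun X => ⟨g.1.val * X.1 * (g⁻¹).1.val, by
        obtain ⟨X, c, hX⟩ := X
        refine ⟨c, fun v w => ?_⟩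
        have hv : ∀ v, g.1.val ((g⁻¹).1.val v) = v := fun v => by
          rw [← mul_apply_eq_comp]
          exact DFunLike.congr_fun g.1.mul_inv v
        have hg : ∀ v w, b (g.1.val v) (g.1.val w) = b v w := g.2
        have h := hX ((g⁻¹).1.val v) ((g⁻¹).1.val w)
        rw [← hg (X _), ← hg _ (X _), ← hg _ ((g⁻¹).1.val w), hv, hv] at h
        exact h⟩
      map_add' := fun X Y => Subtype.ext (by simp [mul_add, add_mul])
      map_smul' := fun c X => Subtype.ext (by simp) }
  map_one' := by ext X : 2; simp
  map_mul' g h := by ext X : 2; simp [mul_assoc]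

/-- The representation of `Sp(V)` on `V* ⊗ csp(V)`. -/
def homRep : Representation ℝ b.Sp (V →ₗ[ℝ] b.csp) := Representation.linHom b.stdRep b.adRep

/-- The representation of `Sp(V)` on `S³V`. -/
noncomputable def symCubeRep : Representation ℝ b.Sp Sym[ℝ]^3 V where
  toFun g := symCubeMap (b.stdRep g)
  map_one' := symCube_hom_ext fun v => by simp [symCubeMap_tprod]
  map_mul' g h := symCube_hom_ext fun v => by simp [symCubeMap_tprod]

theorem spencer_homRep (g : b.Sp) (Φ : V →ₗ[ℝ] b.csp) :
    spencer b.csp (b.homRep g Φ) = b.altRep b.stdRep 2 g (spencer b.csp Φ) := by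
  ext v
  change g.1.val ((Φ ((g⁻¹).1.val (v 0)) : V →L[ℝ] V) ((g⁻¹).1.val (v 1))) -
      g.1.val ((Φ ((g⁻¹).1.val (v 1)) : V →L[ℝ] V) ((g⁻¹).1.val (v 0))) =
    g.1.val ((Φ ((g⁻¹).1.val (v 0)) : V →L[ℝ] V) ((g⁻¹).1.val (v 1)) -
      (Φ ((g⁻¹).1.val (v 1)) : V →L[ℝ] V) ((g⁻¹).1.val (v 0)))
  rw [map_sub]

/-- The representation of `Sp(V)` on `csp(V)⁽¹⁾`. -/
def prolongationRep : Representation ℝ b.Sp (prolongation b.csp) :=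
  b.homRep.subrepresentation (prolongation b.csp) fun g Φ hΦ => by
    have h : spencer b.csp Φ = 0 := hΦ
    change spencer b.csp (b.homRep g Φ) = 0
    rw [spencer_homRep, h, map_zero]

/-- The representation of `Sp(V)` on `(Λ²V* ⊗ V) / im ∂` for `𝔤 = csp(V)`. -/
def torsionRep : Representation ℝ b.Sp
    ((V [⋀^Fin 2]→ₗ[ℝ] V) ⧸ LinearMap.range (spencer b.csp)) :=
  (b.altRep b.stdRep 2).quotient (LinearMap.range (spencer b.csp)) fun g T hT => by
    obtain ⟨Φ, rfl⟩ := hT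
    exact ⟨b.homRep g Φ, b.spencer_homRep g Φ⟩

section TraceFree

variable [FiniteDimensional ℝ V]

/-- The isomorphism `V ≅ V*`, `v ↦ b(v, ·)`. -/
noncomputable def flat : V ≃ₗ[ℝ] Module.Dual ℝ V :=
  b.bilin.linearEquivOfInjective
    (LinearMap.ker_eq_bot.1 <| LinearMap.ker_eq_bot'.2 fun v hv =>
      b.nondegenerate v fun w => LinearMap.congr_fun hv w)
    Subspace.dual_finrank_eq.symm

theorem flat_symm_apply (f : Module.Dual ℝ V) (w : V) : b (b.flat.symm f) w = f w :=
  LinearMap.congr_fun (b.flat.apply_symm_apply f) w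

theorem update_three (x y v z : V) : Function.update ![x, y, v] 0 z = ![z, y, v] ∧
    Function.update ![x, y, v] 1 z = ![x, z, v] ∧ Function.update ![x, y, v] 2 z = ![x, y, z] := by
  refine ⟨?_, ?_, ?_⟩ <;> funext i <;> fin_cases i <;> rfl

/-- For a three-form `α` and `v ∈ V` the endomorphism `A` such that `b(A x, y) = α(x, y, v)`. -/
noncomputable def raise (α : V [⋀^Fin 3]→ₗ[ℝ] ℝ) (v : V) : V →ₗ[ℝ] V :=
  b.flat.symm.toLinearMap ∘ₗ LinearMap.mk₂ ℝ (fun x y => α ![x, y, v])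
    (fun x x' y => by
      have h := α.map_update_add ![x, y, v] 0 x x'
      simp only [update_three] at h
      exact h)
    (fun c x y => by
      have h := α.map_update_smul ![x, y, v] 0 c x
      simp only [update_three] at h
      exact h)
    (fun x y y' => by
      have h := α.map_update_add ![x, y, v] 1 y y'
      simp only [update_three] at h
      exact h)
    (fun c x y => by
      have h := α.map_update_smul ![x, y, v] 1 c y
      simp only [update_three] at h
      exact h)

theorem raise_spec (α : V [⋀^Fin 3]→ₗ[ℝ] ℝ) (v x y : V) :
    b (b.raise α v x) y = α ![x, y, v] :=
  b.flat_symm_apply _ y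

theorem eq_of_forall {x y : V} (h : ∀ w, b x w = b y w) : x = y :=
  sub_eq_zero.1 (b.nondegenerate _ fun w => (b.sub_left x y w).trans (sub_eq_zero.2 (h w)))

/-- The contraction `Λ³V* → V*` with the inverse bivector of `b`: the value at `v` of the
contraction of `α` is the trace, taken with respect to `b`, of the two-form `α(·, ·, v)`. -/
noncomputable def contract : (V [⋀^Fin 3]→ₗ[ℝ] ℝ) →ₗ[ℝ] Module.Dual ℝ V where
  toFun α :=
    { toFun := fun v => LinearMap.trace ℝ V (b.raise α v)
      map_add' := fun v w => by
        rw [← map_add]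
        congr 1
        ext x
        refine b.eq_of_forall fun y => ?_
        rw [LinearMap.add_apply, b.add_left]
        simp only [raise_spec]
        have h := α.map_update_add ![x, y, v] 2 v w
        simp only [update_three] at h
        exact h
      map_smul' := fun c v => by
        rw [RingHom.id_apply, ← map_smul]
        congr 1
        ext x
        refine b.eq_of_forall fun y => ?_
        rw [LinearMap.smul_apply, b.smul_left]
        simp only [raise_spec]
        have h := α.map_update_smul ![x, y, v] 2 c v
        simp only [update_three] at h
        exact h }
  map_add' α η := by
    ext v
    change LinearMap.trace ℝ V _ = LinearMap.trace ℝ V _ + LinearMap.trace ℝ V _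
    rw [← map_add]
    congr 1
    ext x
    refine b.eq_of_forall fun y => ?_
    rw [LinearMap.add_apply, b.add_left]
    simp only [raise_spec]
    rfl
  map_smul' c α := by
    ext v
    change LinearMap.trace ℝ V _ = c • LinearMap.trace ℝ V _
    rw [← map_smul]
    congr 1
    ext x
    refine b.eq_of_forall fun y => ?_
    rw [LinearMap.smul_apply, b.smul_left]
    simp only [raise_spec]
    rfl

/-- The tracefree part `Λ³₀V*` of `Λ³V*`. -/
noncomputable def traceFree : Submodule ℝ (V [⋀^Fin 3]→ₗ[ℝ] ℝ) := LinearMap.ker b.contract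

/-- The representation of `Sp(V)` on `Λ³₀V*`. -/
noncomputable def traceFreeRep : Representation ℝ b.Sp b.traceFree :=
  (b.altRep (Representation.trivial ℝ b.Sp ℝ) 3).subrepresentation b.traceFree fun g α hα => by
    have h : ∀ v, LinearMap.trace ℝ V (b.raise α v) = 0 := fun v => LinearMap.congr_fun hα v
    refine LinearMap.ext fun v => ?_
    change LinearMap.trace ℝ V _ = 0
    have hv : ∀ v, g.1.val ((g⁻¹).1.val v) = v := fun v => by
      rw [← mul_apply_eq_comp]
      exact DFunLike.congr_fun g.1.mul_inv v
    have hg : ∀ v w, b (g.1.val v) (g.1.val w) = b v w := g.2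
    have : b.raise (b.altRep (Representation.trivial ℝ b.Sp ℝ) 3 g α) v =
        b.stdRep g ∘ₗ (b.raise α (b.stdRep g⁻¹ v) ∘ₗ b.stdRep g⁻¹) := by
      ext x
      refine b.eq_of_forall fun y => ?_
      change _ = b (g.1.val _) y
      rw [raise_spec, ← hv y, hg, hv y]
      change _ = b (b.raise α _ _) _
      rw [raise_spec]
      change α _ = α _
      congr 1
      ext i
      fin_cases i <;> rfl
    rw [this, LinearMap.trace_comp_comm']
    rw [LinearMap.comp_assoc]
    have h1 : b.stdRep g⁻¹ ∘ₗ b.stdRep g = LinearMap.id := by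
      change b.stdRep g⁻¹ * b.stdRep g = 1
      rw [← map_mul, inv_mul_cancel, map_one]
    rw [h1, LinearMap.comp_id, h]

end TraceFree

end SymplecticForm

/-! ### Two-forms and almost conformally symplectic structures on manifolds -/

section TwoForms

variable {E : Type*} [NormedAddCommGroup E] [NormedSpace ℝ E]
  {M : Type*} [TopologicalSpace M] [ChartedSpace E M]

variable (E) in
/-- The space `Λ²T*ₓM`. -/
abbrev TwoCovector (x : M) : Type _ := TangentSpace 𝓘(ℝ, E) x [⋀^Fin 2]→L[ℝ] ℝ

variable (E M) in
/-- Sections of `Λ²T*M`, without any regularity. -/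
abbrev TwoForm : Type _ := Π x : M, TwoCovector E x

/-- A two-form is smooth on `U` if it is smooth there as a section of `Λ²T*M`. -/
def TwoForm.SmoothOn [IsManifold 𝓘(ℝ, E) ∞ M] (τ : TwoForm E M) (U : Set M) : Prop :=
  ContMDiffOn 𝓘(ℝ, E) (𝓘(ℝ, E).prod 𝓘(ℝ, E [⋀^Fin 2]→L[ℝ] ℝ)) ∞
    (fun x => (⟨x, τ x⟩ : TotalSpace (E [⋀^Fin 2]→L[ℝ] ℝ)
      (fun x : M => TangentSpace 𝓘(ℝ, E) x [⋀^Fin 2]→L[ℝ] Bundle.Trivial M ℝ x))) U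

/-- The coordinate expression of a two-form in the preferred chart at `x`, that is, its pullback
along the inverse of this chart. -/
noncomputable def TwoForm.inChart (τ : TwoForm E M) (x : M) (y : E) : E [⋀^Fin 2]→L[ℝ] ℝ :=
  (τ ((extChartAt 𝓘(ℝ, E) x).symm y)).compContinuousLinearMap
    (mfderiv 𝓘(ℝ, E) 𝓘(ℝ, E) (extChartAt 𝓘(ℝ, E) x).symm y)

/-- The exterior derivative of a two-form, computed in the preferred chart at `x`. -/
noncomputable def TwoForm.extDeriv (τ : TwoForm E M) (x : M) :
    TangentSpace 𝓘(ℝ, E) x [⋀^Fin 3]→L[ℝ] ℝ :=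
  (_root_.extDeriv (τ.inChart x) (extChartAt 𝓘(ℝ, E) x x)).compContinuousLinearMap
    (mfderiv 𝓘(ℝ, E) 𝓘(ℝ, E) (extChartAt 𝓘(ℝ, E) x) x)

variable (E M) in
/-- An almost conformally symplectic structure: a smooth line subbundle of `Λ²T*M` all of whose
non-zero elements are non-degenerate. -/
@[ext]
structure AlmostConformallySymplectic [IsManifold 𝓘(ℝ, E) ∞ M] where
  /-- The fibres of the line subbundle. -/
  line : Π x : M, Submodule ℝ (TwoCovector E x)
  smooth : ∀ x : M, ∃ U : Set M, IsOpen U ∧ x ∈ U ∧ ∃ τ : TwoForm E M, τ.SmoothOn U ∧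
    ∀ y ∈ U, τ y ≠ 0 ∧ line y = Submodule.span ℝ {τ y}
  nondegenerate : ∀ (x : M), ∀ τ ∈ line x, τ ≠ 0 →
    ∀ v : TangentSpace 𝓘(ℝ, E) x, (∀ w : TangentSpace 𝓘(ℝ, E) x, τ ![v, w] = 0) → v = 0

namespace AlmostConformallySymplectic

variable [IsManifold 𝓘(ℝ, E) ∞ M] (ℓ : AlmostConformallySymplectic E M)

/-- `τ` restricts to a smooth section of the line bundle over `U`. -/
def IsSectionOn (τ : TwoForm E M) (U : Set M) : Prop :=
  τ.SmoothOn U ∧ ∀ x ∈ U, τ x ∈ ℓ.line x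

/-- The structure is conformally symplectic: around each point there is a smooth section which is
closed as a two-form and non-zero in this point. -/
def IsConformallySymplectic : Prop :=
  ∀ x : M, ∃ U : Set M, IsOpen U ∧ x ∈ U ∧ ∃ τ : TwoForm E M,
    ℓ.IsSectionOn τ U ∧ (∀ y ∈ U, τ.extDeriv y = 0) ∧ τ x ≠ 0

end AlmostConformallySymplectic

/-! ### Linear connections -/

variable [IsManifold 𝓘(ℝ, E) ∞ M]

variable (E M) in
/-- Linear connections on the tangent bundle. -/
abbrev LinearConnection : Type _ :=
  CovariantDerivative 𝓘(ℝ, E) E (fun x : M => TangentSpace 𝓘(ℝ, E) x)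

namespace LinearConnection

/-- `β = ∇_v τ` at the point `x` for the connection on `Λ²T*M` induced by `∇`, that is
`β(X, Y) = v · τ(X, Y) - τ(∇_v X, Y) - τ(X, ∇_v Y)` for all vector fields `X` and `Y`. -/
def IsTwoFormDerivAt (D : LinearConnection E M) (τ : TwoForm E M) (x : M)
    (v : TangentSpace 𝓘(ℝ, E) x) (β : TwoCovector E x) : Prop :=
  ∀ X Y : Π y : M, TangentSpace 𝓘(ℝ, E) y,
    MDifferentiableAt 𝓘(ℝ, E) 𝓘(ℝ, E).tangent (fun y => (⟨y, X y⟩ : TangentBundle 𝓘(ℝ, E) M)) x →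
    MDifferentiableAt 𝓘(ℝ, E) 𝓘(ℝ, E).tangent (fun y => (⟨y, Y y⟩ : TangentBundle 𝓘(ℝ, E) M)) x →
    β ![X x, Y x] = mvfderiv 𝓘(ℝ, E) (fun y => τ y ![X y, Y y]) x v
      - τ x ![D X x v, Y x] - τ x ![X x, D Y x v]

open Classical in
/-- The induced connection on `Λ²T*M`: the value `∇_v τ` at `x`. The defining property determines
it uniquely, and it exists whenever `τ` is differentiable in `x`. -/
noncomputable def twoFormDeriv (D : LinearConnection E M) (τ : TwoForm E M) (x : M)
    (v : TangentSpace 𝓘(ℝ, E) x) : TwoCovector E x :=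
  if h : ∃ β, D.IsTwoFormDerivAt τ x v β then h.choose else 0

/-- The connection is smooth: it maps smooth vector fields to smooth sections of `Hom(TM, TM)`. -/
def IsSmooth (D : LinearConnection E M) : Prop :=
  CovariantDerivative.ContMDiffCovariantDerivative D ∞

/-- The connection is compatible with an almost conformally symplectic structure: the induced
connection on `Λ²T*M` preserves the line subbundle. -/
def IsCompatible (D : LinearConnection E M) (ℓ : AlmostConformallySymplectic E M) : Prop :=
  ∀ (U : Set M) (τ : TwoForm E M), IsOpen U → ℓ.IsSectionOn τ U →
    ∀ x ∈ U, ∀ v : TangentSpace 𝓘(ℝ, E) x, D.twoFormDeriv τ x v ∈ ℓ.line x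

/-- The connection induced on the line bundle is flat: its curvature
`∇_X ∇_Y τ - ∇_Y ∇_X τ - ∇_[X,Y] τ` vanishes for all local sections `τ` of the line bundle and all
local vector fields `X` and `Y`. -/
def IsFlatOn (D : LinearConnection E M) (ℓ : AlmostConformallySymplectic E M) : Prop :=
  ∀ (U : Set M) (τ : TwoForm E M) (X Y : Π y : M, TangentSpace 𝓘(ℝ, E) y),
    IsOpen U → ℓ.IsSectionOn τ U →
    ContMDiffOn 𝓘(ℝ, E) 𝓘(ℝ, E).tangent ∞
      (fun y => (⟨y, X y⟩ : TangentBundle 𝓘(ℝ, E) M)) U →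
    ContMDiffOn 𝓘(ℝ, E) 𝓘(ℝ, E).tangent ∞
      (fun y => (⟨y, Y y⟩ : TangentBundle 𝓘(ℝ, E) M)) U →
    ∀ x ∈ U, D.twoFormDeriv (fun y => D.twoFormDeriv τ y (Y y)) x (X x)
      - D.twoFormDeriv (fun y => D.twoFormDeriv τ y (X y)) x (Y x)
      - D.twoFormDeriv τ x (VectorField.mlieBracket 𝓘(ℝ, E) X Y x) = 0

/-- `τ` is parallel on `U` for the connection on `Λ²T*M` induced by `∇`. -/
def IsParallelOn (D : LinearConnection E M) (τ : TwoForm E M) (U : Set M) : Prop :=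
  ∀ x ∈ U, ∀ v : TangentSpace 𝓘(ℝ, E) x, D.twoFormDeriv τ x v = 0

/-- The torsion in the point `x` as an element of `Λ²T*ₓM ⊗ TₓM`. -/
noncomputable def torsionAt [FiniteDimensional ℝ E] (D : LinearConnection E M) (x : M) :
    TangentSpace 𝓘(ℝ, E) x [⋀^Fin 2]→ₗ[ℝ] TangentSpace 𝓘(ℝ, E) x where
  toFun v := CovariantDerivative.torsion D x (v 0) (v 1)
  map_update_add' := fun v i y z => by
    fin_cases i <;> simp
  map_update_smul' := fun v i c y => by
    fin_cases i <;> simp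
  map_eq_zero_of_eq' := fun v i j h hij => by
    have key : ∀ w, CovariantDerivative.torsion D x w w = 0 :=
      fun w => CovariantDerivative.torsion_self D w
    fin_cases i <;> fin_cases j <;> simp_all

end LinearConnection

end TwoForms

/-! ### First order structures -/

section GStructures

variable {𝔤 : Type*} [NormedAddCommGroup 𝔤] [NormedSpace ℝ 𝔤]
  {G : Type*} [Group G] [TopologicalSpace G] [ChartedSpace 𝔤 G]
  {V : Type*} [NormedAddCommGroup V] [NormedSpace ℝ V]
  (ρ : G →* (V →L[ℝ] V)ˣ)

variable (𝔤) in
/-- The Lie algebra of a Lie group `G` represented on `V`, as a space of endomorphisms of `V`: the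
image of the derivative of the representation in the identity. -/
noncomputable def lieAlg : Submodule ℝ (V →L[ℝ] V) :=
  LinearMap.range (mvfderiv 𝓘(ℝ, 𝔤) (fun g : G => ((ρ g).val : V →L[ℝ] V)) 1).toLinearMap

universe w

variable (𝔤) in
/-- A first order structure on the manifold `M` (modelled on `E`) with structure group the Lie group
`G` (modelled on `𝔤`), which is represented on `V` via `ρ`: a smooth principal `G`-bundle over `M`
together with a smooth equivariant strictly horizontal `V`-valued one-form, where
`dim M = dim V`. -/
structure FirstOrderStructure (E : Type*) [NormedAddCommGroup E] [NormedSpace ℝ E]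
    (M : Type*) [TopologicalSpace M] [ChartedSpace E M] where
  /-- The total space. -/
  Total : Type w
  [topologicalSpace : TopologicalSpace Total]
  [chartedSpace : ChartedSpace (ModelProd E 𝔤) Total]
  [isManifold : IsManifold (𝓘(ℝ, E).prod 𝓘(ℝ, 𝔤)) ∞ Total]
  /-- The bundle projection. -/
  proj : Total → M
  /-- The principal right action. -/
  act : Total → G → Total
  act_one : ∀ u, act u 1 = u
  act_mul : ∀ u g h, act u (g * h) = act (act u g) h
  proj_act : ∀ u g, proj (act u g) = proj u
  /-- Locally there are smooth equivariant trivializations. -/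
  locally_trivial : ∀ x : M, ∃ (U : Set M) (φ : OpenPartialHomeomorph Total (M × G)),
    IsOpen U ∧ x ∈ U ∧ φ.source = proj ⁻¹' U ∧ φ.target = U ×ˢ Set.univ ∧
    ContMDiffOn (𝓘(ℝ, E).prod 𝓘(ℝ, 𝔤)) (𝓘(ℝ, E).prod 𝓘(ℝ, 𝔤)) ∞ φ φ.source ∧
    ContMDiffOn (𝓘(ℝ, E).prod 𝓘(ℝ, 𝔤)) (𝓘(ℝ, E).prod 𝓘(ℝ, 𝔤)) ∞ φ.symm φ.target ∧
    ∀ u ∈ φ.source, (φ u).1 = proj u ∧ ∀ g, φ (act u g) = (proj u, (φ u).2 * g)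
  /-- The soldering form. -/
  θ : Π u : Total, TangentSpace (𝓘(ℝ, E).prod 𝓘(ℝ, 𝔤)) u →L[ℝ] V
  smooth_θ : ContMDiff (𝓘(ℝ, E).prod 𝓘(ℝ, 𝔤))
    ((𝓘(ℝ, E).prod 𝓘(ℝ, 𝔤)).prod 𝓘(ℝ, (E × 𝔤) →L[ℝ] V)) ∞
    (fun u => (⟨u, θ u⟩ : TotalSpace ((E × 𝔤) →L[ℝ] V)
      (fun u : Total => TangentSpace (𝓘(ℝ, E).prod 𝓘(ℝ, 𝔤)) u →L[ℝ] Bundle.Trivial Total V u)))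
  /-- The soldering form is equivariant. -/
  equivariant_θ : ∀ (u : Total) (g : G) (ξ : TangentSpace (𝓘(ℝ, E).prod 𝓘(ℝ, 𝔤)) u),
    θ (act u g) (mfderiv (𝓘(ℝ, E).prod 𝓘(ℝ, 𝔤)) (𝓘(ℝ, E).prod 𝓘(ℝ, 𝔤)) (fun u => act u g) u ξ) =
      (ρ g)⁻¹.val (θ u ξ)
  /-- The soldering form is strictly horizontal: its kernel is the vertical bundle. -/
  horizontal_θ : ∀ (u : Total) (ξ : TangentSpace (𝓘(ℝ, E).prod 𝓘(ℝ, 𝔤)) u),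
    θ u ξ = 0 ↔ mfderiv (𝓘(ℝ, E).prod 𝓘(ℝ, 𝔤)) 𝓘(ℝ, E) proj u ξ = 0
  finrank_eq : finrank ℝ E = finrank ℝ V

namespace FirstOrderStructure

attribute [instance] topologicalSpace chartedSpace isManifold

variable {ρ}
  {E : Type*} [NormedAddCommGroup E] [NormedSpace ℝ E]
  {M : Type*} [TopologicalSpace M] [ChartedSpace E M]
  (P : FirstOrderStructure 𝔤 ρ E M)

/-- The derivative of the bundle projection. -/
noncomputable abbrev dproj (u : P.Total) :
    TangentSpace (𝓘(ℝ, E).prod 𝓘(ℝ, 𝔤)) u →L[ℝ] TangentSpace 𝓘(ℝ, E) (P.proj u) :=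
  mfderiv (𝓘(ℝ, E).prod 𝓘(ℝ, 𝔤)) 𝓘(ℝ, E) P.proj u

/-- The derivative of the principal right action of an element of the structure group. -/
noncomputable abbrev dact (u : P.Total) (g : G) :
    TangentSpace (𝓘(ℝ, E).prod 𝓘(ℝ, 𝔤)) u →L[ℝ]
      TangentSpace (𝓘(ℝ, E).prod 𝓘(ℝ, 𝔤)) (P.act u g) :=
  mfderiv (𝓘(ℝ, E).prod 𝓘(ℝ, 𝔤)) (𝓘(ℝ, E).prod 𝓘(ℝ, 𝔤)) (fun u => P.act u g) u

theorem mdifferentiableAt_proj (u : P.Total) :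
    MDifferentiableAt (𝓘(ℝ, E).prod 𝓘(ℝ, 𝔤)) 𝓘(ℝ, E) P.proj u := by
  obtain ⟨U, φ, hU, hx, hs, ht, h1, h2, h3⟩ := P.locally_trivial (P.proj u)
  have hu : u ∈ φ.source := by rw [hs]; exact hx
  have h := (h1.contMDiffAt (φ.open_source.mem_nhds hu)).mdifferentiableAt (by simp)
  refine (mdifferentiableAt_fst.comp u h).congr_of_eventuallyEq ?_
  filter_upwards [φ.open_source.mem_nhds hu] with v hv
  exact (h3 v hv).1.symm

theorem surjective_dproj (u : P.Total) : Function.Surjective (P.dproj u) := by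
  obtain ⟨U, φ, hU, hx, hs, ht, h1, h2, h3⟩ := P.locally_trivial (P.proj u)
  have hu : u ∈ φ.source := by rw [hs]; exact hx
  have hφu : φ u = (P.proj u, (φ u).2) := Prod.ext (h3 u hu).1 rfl
  let σ : M → P.Total := fun y => φ.symm (y, (φ u).2)
  have hσu : σ (P.proj u) = u := by
    change φ.symm (P.proj u, (φ u).2) = u
    rw [← hφu, φ.left_inv hu]
  have hmem : (P.proj u, (φ u).2) ∈ φ.target := by rw [← hφu]; exact φ.map_source hu
  have hσ : MDifferentiableAt 𝓘(ℝ, E) (𝓘(ℝ, E).prod 𝓘(ℝ, 𝔤)) σ (P.proj u) := by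
    have h := (h2.contMDiffAt (φ.open_target.mem_nhds hmem)).mdifferentiableAt (by simp)
    exact MDifferentiableAt.comp (f := fun y => (y, (φ u).2)) (P.proj u) h
      (mdifferentiableAt_id.prodMk mdifferentiableAt_const)
  have hcomp : P.proj ∘ σ =ᶠ[𝓝 (P.proj u)] id := by
    filter_upwards [hU.mem_nhds hx] with y hy
    have hy' : (y, (φ u).2) ∈ φ.target := by rw [ht]; exact ⟨hy, trivial⟩
    have h := (h3 _ (φ.map_target hy')).1
    rw [φ.right_inv hy'] at h
    exact h.symm
  have hp := P.mdifferentiableAt_proj (σ (P.proj u))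
  have hd := mfderiv_comp (P.proj u) hp hσ
  rw [hcomp.mfderiv_eq, mfderiv_id] at hd
  have key : Function.Surjective (P.dproj (σ (P.proj u))) := by
    intro v
    exact ⟨mfderiv 𝓘(ℝ, E) (𝓘(ℝ, E).prod 𝓘(ℝ, 𝔤)) σ (P.proj u) v, (DFunLike.congr_fun hd v).symm⟩
  rw [hσu] at key
  exact key

variable [FiniteDimensional ℝ E] [FiniteDimensional ℝ V]

theorem exists_frame (u : P.Total) : ∃ L : TangentSpace 𝓘(ℝ, E) (P.proj u) ≃L[ℝ] V,
    ∀ ξ, L (P.dproj u ξ) = P.θ u ξ := by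
  obtain ⟨s, hs⟩ := LinearMap.exists_rightInverse_of_surjective (P.dproj u).toLinearMap
    (LinearMap.range_eq_top.2 (P.surjective_dproj u))
  have hs' : ∀ v, P.dproj u (s v) = v := fun v => LinearMap.congr_fun hs v
  have : FiniteDimensional ℝ (TangentSpace 𝓘(ℝ, E) (P.proj u)) :=
    inferInstanceAs (FiniteDimensional ℝ E)
  have : T2Space (TangentSpace 𝓘(ℝ, E) (P.proj u)) := inferInstanceAs (T2Space E)
  have hinj : Function.Injective ((P.θ u).toLinearMap ∘ₗ s) := by
    rw [injective_iff_map_eq_zero]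
    intro v hv
    rw [← hs' v]
    exact (P.horizontal_θ u _).1 hv
  refine ⟨(LinearEquiv.ofInjectiveOfFinrankEq _ hinj P.finrank_eq).toContinuousLinearEquiv,
    fun ξ => ?_⟩
  change P.θ u (s (P.dproj u ξ)) = P.θ u ξ
  rw [← sub_eq_zero, ← map_sub]
  refine (P.horizontal_θ u _).2 ?_
  change P.dproj u _ = 0
  rw [map_sub, hs', sub_self]

/-- The linear isomorphism `TₓM → V` to which `θ(u)` descends, for `u` over `x`. -/
noncomputable def frame (u : P.Total) : TangentSpace 𝓘(ℝ, E) (P.proj u) ≃L[ℝ] V :=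
  (P.exists_frame u).choose

theorem frame_dproj (u : P.Total) (ξ : TangentSpace (𝓘(ℝ, E).prod 𝓘(ℝ, 𝔤)) u) :
    P.frame u (P.dproj u ξ) = P.θ u ξ :=
  (P.exists_frame u).choose_spec ξ

/-- A principal connection form, viewed as taking values in the endomorphisms of `V`. -/
structure PrincipalConnection where
  /-- The connection form. -/
  form : Π u : P.Total, TangentSpace (𝓘(ℝ, E).prod 𝓘(ℝ, 𝔤)) u →L[ℝ] (V →L[ℝ] V)
  smooth : ContMDiff (𝓘(ℝ, E).prod 𝓘(ℝ, 𝔤))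
    ((𝓘(ℝ, E).prod 𝓘(ℝ, 𝔤)).prod 𝓘(ℝ, (E × 𝔤) →L[ℝ] (V →L[ℝ] V))) ∞
    (fun u => (⟨u, form u⟩ : TotalSpace ((E × 𝔤) →L[ℝ] (V →L[ℝ] V))
      (fun u : P.Total => TangentSpace (𝓘(ℝ, E).prod 𝓘(ℝ, 𝔤)) u →L[ℝ]
        Bundle.Trivial P.Total (V →L[ℝ] V) u)))
  mem_lieAlg : ∀ u ξ, form u ξ ∈ lieAlg 𝔤 ρ
  /-- The connection form is equivariant. -/
  equivariant : ∀ u g ξ,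
    form (P.act u g) (P.dact u g ξ) = (ρ g)⁻¹.val * form u ξ * (ρ g).val
  /-- The connection form reproduces the generators of fundamental vector fields. -/
  reproducing : ∀ (u : P.Total) (A : TangentSpace 𝓘(ℝ, 𝔤) (1 : G)),
    form (P.act u 1) (mfderiv 𝓘(ℝ, 𝔤) (𝓘(ℝ, E).prod 𝓘(ℝ, 𝔤)) (fun g => P.act u g) 1 A) =
      mvfderiv 𝓘(ℝ, 𝔤) (fun g : G => ((ρ g).val : V →L[ℝ] V)) 1 A

/-- The linear connection `D` on `TM` is induced by the principal connection `γ`: identifying a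
vector field `Y` with the equivariant function `f : u ↦ θ(u)(Y)`, the derivative of `Y` in the
direction of the projection of `ξ` corresponds to `df(ξ) + γ(ξ)(f)`, which is the derivative of `f`
in the direction of the horizontal part of `ξ`. -/
def PrincipalConnection.Induces [IsManifold 𝓘(ℝ, E) ∞ M] {P : FirstOrderStructure 𝔤 ρ E M} (γ : P.PrincipalConnection)
    (D : LinearConnection E M) : Prop :=
  ∀ (u : P.Total) (ξ : TangentSpace (𝓘(ℝ, E).prod 𝓘(ℝ, 𝔤)) u)
    (Y : Π y : M, TangentSpace 𝓘(ℝ, E) y),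
    MDifferentiableAt 𝓘(ℝ, E) 𝓘(ℝ, E).tangent
      (fun y => (⟨y, Y y⟩ : TangentBundle 𝓘(ℝ, E) M)) (P.proj u) →
    P.frame u (D Y (P.proj u) (P.dproj u ξ)) =
      mvfderiv (𝓘(ℝ, E).prod 𝓘(ℝ, 𝔤)) (fun u => P.frame u (Y (P.proj u))) u ξ +
        γ.form u ξ (P.frame u (Y (P.proj u)))

/-- The linear isomorphism `TₓM → V` to which `θ(u)` descends, for `u` over the given point `x`. -/
noncomputable def frameAt {x : M} (u : P.Total) (h : P.proj u = x) :
    TangentSpace 𝓘(ℝ, E) x ≃L[ℝ] V :=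
  h ▸ P.frame u

/-- The isomorphism `Λ²T*ₓM ⊗ TₓM → Λ²V* ⊗ V` induced by an isomorphism `TₓM → V`. -/
def transport {W : Type*} [AddCommGroup W] [Module ℝ W] [TopologicalSpace W]
    (L : W ≃L[ℝ] V) : (W [⋀^Fin 2]→ₗ[ℝ] W) →ₗ[ℝ] (V [⋀^Fin 2]→ₗ[ℝ] V) where
  toFun T := L.toLinearMap.compAlternatingMap (T.compLinearMap L.symm.toLinearMap)
  map_add' S T := by ext v; simp
  map_smul' c T := by ext v; simp

/-- The subspace of `Λ²T*ₓM ⊗ TₓM` which corresponds to the image of the Spencer differential (for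
one, or equivalently any, point `u` over `x`). -/
noncomputable def spencerImage (x : M) :
    Submodule ℝ (TangentSpace 𝓘(ℝ, E) x [⋀^Fin 2]→ₗ[ℝ] TangentSpace 𝓘(ℝ, E) x) :=
  ⨅ (u : P.Total) (h : P.proj u = x),
    (LinearMap.range (spencer (lieAlg 𝔤 ρ))).comap (transport (P.frameAt u h))

variable [IsManifold 𝓘(ℝ, E) ∞ M]

/-- The section `T` of the quotient of `Λ²T*M ⊗ TM` by the image of the Spencer differential is the
intrinsic torsion of the structure: it is the class of the torsion of each linear connection which
is induced by a principal connection. -/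
def IsIntrinsicTorsion
    (T : Π x : M, (TangentSpace 𝓘(ℝ, E) x [⋀^Fin 2]→ₗ[ℝ] TangentSpace 𝓘(ℝ, E) x) ⧸
      P.spencerImage x) : Prop :=
  ∀ (γ : P.PrincipalConnection) (D : LinearConnection E M), γ.Induces D →
    ∀ x, (P.spencerImage x).mkQ (D.torsionAt x) = T x

/-- The intrinsic torsion vanishes. -/
def HasVanishingIntrinsicTorsion : Prop := P.IsIntrinsicTorsion fun _ => 0

end FirstOrderStructure

/-- A morphism of first order structures over the map `f`: a smooth equivariant map covering `f`
which is compatible with the soldering forms. -/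
structure FirstOrderStructure.IsMorphism {ρ : G →* (V →L[ℝ] V)ˣ}
    {E : Type*} [NormedAddCommGroup E] [NormedSpace ℝ E]
    {M : Type*} [TopologicalSpace M] [ChartedSpace E M]
    {M' : Type*} [TopologicalSpace M'] [ChartedSpace E M']
    (P : FirstOrderStructure 𝔤 ρ E M) (P' : FirstOrderStructure 𝔤 ρ E M')
    (f : M → M') (F : P.Total → P'.Total) : Prop where
  smooth : ContMDiff (𝓘(ℝ, E).prod 𝓘(ℝ, 𝔤)) (𝓘(ℝ, E).prod 𝓘(ℝ, 𝔤)) ∞ F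
  proj_map : ∀ u, P'.proj (F u) = f (P.proj u)
  map_act : ∀ u g, F (P.act u g) = P'.act (F u) g
  pullback_θ : ∀ (u : P.Total) (ξ : TangentSpace (𝓘(ℝ, E).prod 𝓘(ℝ, 𝔤)) u),
    P'.θ (F u) (mfderiv (𝓘(ℝ, E).prod 𝓘(ℝ, 𝔤)) (𝓘(ℝ, E).prod 𝓘(ℝ, 𝔤)) F u ξ) = P.θ u ξ

end GStructures

section CSpStructures

universe w

variable {V : Type*} [NormedAddCommGroup V] [NormedSpace ℝ V] [FiniteDimensional ℝ V]
  [Nontrivial V] (b : SymplecticForm V)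
  (E : Type*) [NormedAddCommGroup E] [NormedSpace ℝ E] [FiniteDimensional ℝ E]
  (M : Type*) [TopologicalSpace M] [ChartedSpace E M]

/-- First order structures with structure group `CSp(V)`. -/
abbrev CSpStructure : Type _ :=
  FirstOrderStructure.{w} (ℝ × b.sp) b.CSp.subtype E M

variable {b E M}

/-- The almost conformally symplectic structure `ℓ` is the one determined by `P`: for each `u` over
`x`, the line `ℓₓ` is spanned by the pullback of `b` along the isomorphism `TₓM → V` given by
`u`. -/
def CSpStructure.Determines [IsManifold 𝓘(ℝ, E) ∞ M] (P : CSpStructure.{w} b E M)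
    (ℓ : AlmostConformallySymplectic E M) : Prop :=
  ∀ u : P.Total, ℓ.line (P.proj u) =
    Submodule.span ℝ {b.form.compContinuousLinearMap (P.frame u).toContinuousLinearMap}

/-- `ℓ` is the pullback of `ℓ'` along `f`. -/
def AlmostConformallySymplectic.IsPullback [IsManifold 𝓘(ℝ, E) ∞ M]
    {M' : Type*} [TopologicalSpace M'] [ChartedSpace E M'] [IsManifold 𝓘(ℝ, E) ∞ M']
    (ℓ : AlmostConformallySymplectic E M) (ℓ' : AlmostConformallySymplectic E M') (f : M → M') :
    Prop :=
  ∀ x, (ℓ.line x : Set (TwoCovector E x)) =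
    (fun τ : TwoCovector E (f x) =>
      τ.compContinuousLinearMap (mfderiv 𝓘(ℝ, E) 𝓘(ℝ, E) f x)) '' ℓ'.line (f x)

end CSpStructures

universe u v v' w w'

open Bundle Set Topology Module
open scoped Manifold ContDiff TensorProduct

set_option linter.unusedSectionVars false

/-! ### Alternating maps of degree two and three. -/

section AlternatingConstructions

variable {V : Type*} [AddCommGroup V] [Module ℝ V] {W : Type*} [AddCommGroup W] [Module ℝ W]

/-! Linear algebra. Lower the value of T ∈ Λ²V* ⊗ V with b and take the cyclic sum, a three-form.
For T = ∂Φ the six terms combine to (c ∘ Φ) ∧ b, where c is the infinitesimal scaling factor on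
csp(V) (`cyclicSum_spencer`). Conversely, a T with vanishing cyclic sum is ∂Φ for an explicit
sp(V)-valued Φ (`mem_range_spencer_of_cyclicSum_eq_zero`), and multiples of the identity realise
every λ ∧ b. So im ∂ is the preimage of V* ∧ b. Since λ ∧ b contracts to (n - 2)λ
(`contract_wedge`), Λ³V* = (V* ∧ b) ⊕ Λ³₀V*, and the tracefree part of the cyclic sum identifies the
cokernel. If ∂Φ = 0, then (c ∘ Φ) ∧ b = 0, so Φ has values in sp(V) and b(Φ(x)y, z) is totally
symmetric; this is S³V. All maps are built from b, hence Sp(V)-equivariant.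

Equivalence of structures. A point of P over x is a coframe TₓM → V, and b pulled back along it
changes by a factor when the coframe is moved by CSp(V). A morphism over f must send u to the u'
over f(x) whose coframe composed with Tf is that of u; such a u' is unique, and it exists exactly
when Tf respects the lines, because comparison with an arbitrary coframe at f(x) then gives an
element of CSp(V) (`exists_isLift`). To construct P from ℓ one needs smooth local coframes that pull
b back to a generator. They come from the linear normal form of symplectic spaces, made smooth by
the inverse function theorem for A ↦ A*b (`exists_smooth_normal_form`). Their transition functions
lie in CSp(V), and glueing gives P.

Intrinsic torsion. Let τ be b pulled back along a local section of P, and D an induced connection.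
Then ∇τ = m ⊗ τ, and dτ equals m ∧ τ plus the cyclic sum of the torsion lowered with τ
(`extDeriv_eq_of_isTwoFormDerivAt`). Hence the torsion lies in im ∂ iff dτ = l ∧ τ for some l
(`torsionAt_mem_spencerImage_iff`). A closed generator clearly gives this. Conversely, l is smooth
as the unique solution of a linear equation, 0 = ddτ = dl ∧ τ, and for n > 4 wedging two-forms with
τ is injective (`eq_zero_of_wedge_two_eq_zero`), so l = df locally and exp(-f)τ is closed. That some
induced connection exists, so that vanishing of the torsion carries information, is shown by glueing
flat connections with a partition of unity (`exists_induces`).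

Torsion-free connections. For a closed generator τ₀ one has ∇τ₀ = m ⊗ τ₀ and 0 = dτ₀ = m ∧ τ₀, so m
= 0. Every section is locally fτ₀ with ∇(fτ₀) = df ⊗ τ₀ and d(fτ₀) = df ∧ τ₀. Flatness is ddf = 0,
and the two expressions vanish together because wedging one-forms with τ₀ is injective. -/

theorem eq_zero_of_eq_neg {a : W} (h : a = -a) : a = 0 := by
  have h2 : (2 : ℝ) • a = 0 := by
    rw [two_smul]
    nth_rewrite 1 [h]
    exact neg_add_cancel a
  exact (smul_eq_zero.1 h2).resolve_left two_ne_zero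

/-- An alternating map of degree two from a skew symmetric function which is linear in the first
variable. -/
def altTwo (f : V → V → W) (hadd : ∀ x x' y, f (x + x') y = f x y + f x' y)
    (hsmul : ∀ (c : ℝ) x y, f (c • x) y = c • f x y) (hswap : ∀ x y, f x y = -f y x) :
    V [⋀^Fin 2]→ₗ[ℝ] W where
  toFun v := f (v 0) (v 1)
  map_update_add' v i x y := by
    fin_cases i
    · simp [hadd]
    · simp only [Fin.mk_one, Function.update_self, ne_eq, zero_ne_one, not_false_eq_true,
        Function.update_of_ne]
      rw [hswap, hadd, hswap x, hswap y]; abel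
  map_update_smul' v i c x := by
    fin_cases i
    · simp [hsmul]
    · simp only [Fin.mk_one, Function.update_self, ne_eq, zero_ne_one, not_false_eq_true,
        Function.update_of_ne]
      rw [hswap, hsmul, ← smul_neg, ← hswap]
  map_eq_zero_of_eq' v i j h hij := by
    have key : ∀ x, f x x = 0 := fun x => eq_zero_of_eq_neg (hswap x x)
    fin_cases i <;> fin_cases j <;> first | exact absurd rfl hij | (simp at h; simp [h, key])

/-- An alternating map of degree three from a totally skew symmetric function which is linear in the
first variable. -/
def altThree (f : V → V → V → W) (hadd : ∀ x x' y z, f (x + x') y z = f x y z + f x' y z)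
    (hsmul : ∀ (c : ℝ) x y z, f (c • x) y z = c • f x y z) (hswap : ∀ x y z, f x y z = -f y x z)
    (hswap' : ∀ x y z, f x y z = -f x z y) :
    V [⋀^Fin 3]→ₗ[ℝ] W where
  toFun v := f (v 0) (v 1) (v 2)
  map_update_add' := @fun inst v i x y => by
    -- The field quantifies over the decidability instance; replacing it by the canonical one lets
    -- `simp` evaluate `Function.update`.
    obtain rfl := Subsingleton.elim inst (instDecidableEqFin 3)
    have h1 : ∀ a x y z, f a (x + y) z = f a x z + f a y z := fun a x y z => by
      rw [hswap, hadd, hswap a x, hswap a y]; abel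
    have h2 : ∀ a c x y, f a c (x + y) = f a c x + f a c y := fun a c x y => by
      rw [hswap', h1, hswap' a c x, hswap' a c y]; abel
    fin_cases i
    · simp [hadd]
    · simp [h1]
    · simp [h2]
  map_update_smul' := @fun inst v i c x => by
    obtain rfl := Subsingleton.elim inst (instDecidableEqFin 3)
    have h1 : ∀ a x z, f a (c • x) z = c • f a x z := fun a x z => by
      rw [hswap, hsmul, hswap a x, smul_neg]
    have h2 : ∀ a z x, f a z (c • x) = c • f a z x := fun a z x => by
      rw [hswap', h1, hswap' a z x, smul_neg]
    fin_cases i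
    · simp [hsmul]
    · simp [h1]
    · simp [h2]
  map_eq_zero_of_eq' v i j h hij := by
    have key : ∀ x y, f x x y = 0 := fun x y => eq_zero_of_eq_neg (hswap x x y)
    have key' : ∀ x y, f y x x = 0 := fun x y => eq_zero_of_eq_neg (hswap' y x x)
    have key'' : ∀ x y, f x y x = 0 := fun x y => by rw [hswap', key, neg_zero]
    fin_cases i <;> fin_cases j <;> first | exact absurd rfl hij | (simp at h; simp [h, key, key', key''])

@[simp] theorem altThree_apply (f : V → V → V → W) (h₁ h₂ h₃ h₄) (v : Fin 3 → V) :
    altThree f h₁ h₂ h₃ h₄ v = f (v 0) (v 1) (v 2) := rfl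

theorem altTwo_ext {S T : V [⋀^Fin 2]→ₗ[ℝ] W} (h : ∀ x y, S ![x, y] = T ![x, y]) : S = T := by
  ext v
  have hv : v = ![v 0, v 1] := by funext i; fin_cases i <;> rfl
  rw [hv]
  exact h _ _

theorem altThree_ext {S T : V [⋀^Fin 3]→ₗ[ℝ] W} (h : ∀ x y z, S ![x, y, z] = T ![x, y, z]) :
    S = T := by
  ext v
  have hv : v = ![v 0, v 1, v 2] := by funext i; fin_cases i <;> rfl
  rw [hv]
  exact h _ _ _

theorem altTwo_swap (T : V [⋀^Fin 2]→ₗ[ℝ] W) (x y : V) : T ![x, y] = -T ![y, x] := by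
  rw [← T.map_swap ![y, x] (i := 0) (j := 1) (by decide)]
  congr 1
  funext i
  fin_cases i <;> rfl

theorem altThree_swap (T : V [⋀^Fin 3]→ₗ[ℝ] W) (x y z : V) : T ![x, y, z] = -T ![y, x, z] := by
  rw [← T.map_swap ![y, x, z] (i := 0) (j := 1) (by decide)]
  congr 1
  funext i
  fin_cases i <;> rfl

theorem altThree_swap' (T : V [⋀^Fin 3]→ₗ[ℝ] W) (x y z : V) : T ![x, y, z] = -T ![x, z, y] := by
  rw [← T.map_swap ![x, z, y] (i := 1) (j := 2) (by decide)]
  congr 1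
  funext i
  fin_cases i <;> rfl

theorem altTwo_add_left (T : V [⋀^Fin 2]→ₗ[ℝ] W) (x x' y : V) :
    T ![x + x', y] = T ![x, y] + T ![x', y] := by
  have h := T.map_update_add ![x, y] 0 x x'
  have e : ∀ z, Function.update ![x, y] 0 z = ![z, y] := fun z => by
    funext i; fin_cases i <;> rfl
  simpa only [e] using h

theorem altTwo_smul_left (T : V [⋀^Fin 2]→ₗ[ℝ] W) (c : ℝ) (x y : V) :
    T ![c • x, y] = c • T ![x, y] := by
  have h := T.map_update_smul ![x, y] 0 c x
  have e : ∀ z, Function.update ![x, y] 0 z = ![z, y] := fun z => by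
    funext i; fin_cases i <;> rfl
  simpa only [e] using h

end AlternatingConstructions

/-! ### The cyclic sum and the wedge product with the symplectic form. -/

namespace SymplecticForm

variable {V : Type*} [NormedAddCommGroup V] [NormedSpace ℝ V] (b : SymplecticForm V)

theorem swap (v w : V) : b v w = -b w v := altTwo_swap b.form.toAlternatingMap v w

theorem neg_left (v w : V) : b (-v) w = -b v w := by
  rw [← neg_one_smul ℝ v, b.smul_left, neg_one_mul]

theorem neg_right (v w : V) : b v (-w) = -b v w := by
  rw [← neg_one_smul ℝ w, b.smul_right, neg_one_mul]

theorem eq_of_forall_left {x y : V} (h : ∀ w, b x w = b y w) : x = y :=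
  sub_eq_zero.1 (b.nondegenerate _ fun w => (b.sub_left x y w).trans (sub_eq_zero.2 (h w)))

/-- The map `Λ²V* ⊗ V → Λ³V*` which sends `T` to the cyclic sum of `b(T(x, y), z)`. -/
def cyclicSum : (V [⋀^Fin 2]→ₗ[ℝ] V) →ₗ[ℝ] (V [⋀^Fin 3]→ₗ[ℝ] ℝ) where
  toFun T := altThree (fun x y z => b (T ![x, y]) z + b (T ![y, z]) x + b (T ![z, x]) y)
    (fun x x' y z => by
      rw [altTwo_swap T z (x + x'), altTwo_swap T z x, altTwo_swap T z x']
      simp only [altTwo_add_left, b.add_left, b.add_right, b.neg_left]; ring)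
    (fun c x y z => by
      rw [altTwo_swap T z (c • x), altTwo_swap T z x]
      simp only [altTwo_smul_left, b.smul_left, b.smul_right, b.neg_left, smul_eq_mul]; ring)
    (fun x y z => by
      rw [altTwo_swap T y x, altTwo_swap T x z, altTwo_swap T z y]; simp only [b.neg_left]; ring)
    (fun x y z => by
      rw [altTwo_swap T x z, altTwo_swap T z y, altTwo_swap T y x]; simp only [b.neg_left]; ring)
  map_add' S T := altThree_ext fun x y z => by
    simp [b.add_left]; ring
  map_smul' c T := altThree_ext fun x y z => by
    simp [b.smul_left]; ring

theorem cyclicSum_apply (T : V [⋀^Fin 2]→ₗ[ℝ] V) (x y z : V) :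
    b.cyclicSum T ![x, y, z] = b (T ![x, y]) z + b (T ![y, z]) x + b (T ![z, x]) y := rfl

/-- The exterior product `λ ↦ λ ∧ b`. -/
def wedge : Module.Dual ℝ V →ₗ[ℝ] (V [⋀^Fin 3]→ₗ[ℝ] ℝ) where
  toFun l := altThree (fun x y z => l x * b y z + l y * b z x + l z * b x y)
    (fun x x' y z => by simp only [map_add, b.add_left, b.add_right]; ring)
    (fun c x y z => by simp only [map_smul, b.smul_left, b.smul_right, smul_eq_mul]; ring)
    (fun x y z => by rw [b.swap y x, b.swap x z, b.swap z y]; ring)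
    (fun x y z => by rw [b.swap y x, b.swap x z, b.swap z y]; ring)
  map_add' S T := altThree_ext fun x y z => by simp; ring
  map_smul' c T := altThree_ext fun x y z => by simp; ring

theorem wedge_apply (l : Module.Dual ℝ V) (x y z : V) :
    b.wedge l ![x, y, z] = l x * b y z + l y * b z x + l z * b x y := rfl

/-! ### The image of the Spencer differential of csp(V). -/

section Csp

variable [FiniteDimensional ℝ V] [Nontrivial V]

/-- The character of `csp(V)`: the infinitesimal factor by which an element rescales `b`. -/
theorem exists_cspScale : ∃ c : b.csp →ₗ[ℝ] ℝ, ∀ (X : b.csp) v w,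
    b ((X : V →L[ℝ] V) v) w + b v ((X : V →L[ℝ] V) w) = c X * b v w := by
  obtain ⟨p, hp⟩ := b.exists_pair
  -- Evaluating on a pair with b(p₁, p₂) = 1 gives a formula for the factor which is visibly linear
  -- in X.
  refine ⟨{ toFun := fun X => b ((X : V →L[ℝ] V) p.1) p.2 + b p.1 ((X : V →L[ℝ] V) p.2)
            map_add' := fun X Y => ?_
            map_smul' := fun c X => ?_ }, fun X v w => ?_⟩
  · simp only [Submodule.coe_add, _root_.add_apply, b.add_left, b.add_right]; ring
  · simp only [Submodule.coe_smul, _root_.smul_apply, b.smul_left, b.smul_right, RingHom.id_apply,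
      smul_eq_mul]; ring
  · obtain ⟨c, hc⟩ := X.2
    simp only [LinearMap.coe_mk, AddHom.coe_mk]
    rw [hc, hc, hp, mul_one]

/-- The infinitesimal scaling factor of an element of `csp(V)`. -/
noncomputable def cspScale : b.csp →ₗ[ℝ] ℝ := b.exists_cspScale.choose

theorem cspScale_spec (X : b.csp) (v w : V) :
    b ((X : V →L[ℝ] V) v) w + b v ((X : V →L[ℝ] V) w) = b.cspScale X * b v w :=
  b.exists_cspScale.choose_spec X v w

/-- Group the six terms by the argument of Φ. Those with Φ(x) are b(Φ(x)y, z) and -b(Φ(x)z, y) =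
b(y, Φ(x)z), and their sum is the scaling factor of Φ(x) times b(y, z). -/
theorem cyclicSum_spencer (Φ : V →ₗ[ℝ] b.csp) :
    b.cyclicSum (spencer b.csp Φ) = b.wedge (b.cspScale ∘ₗ Φ) := by
  refine altThree_ext fun x y z => ?_
  rw [cyclicSum_apply, wedge_apply]
  have h1 := b.cspScale_spec (Φ x) y z
  have h2 := b.cspScale_spec (Φ y) z x
  have h3 := b.cspScale_spec (Φ z) x y
  have e : ∀ x y, spencer b.csp Φ ![x, y] = (Φ x : V →L[ℝ] V) y - (Φ y : V →L[ℝ] V) x :=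
    fun x y => rfl
  simp only [e, b.sub_left, LinearMap.comp_apply, ← h1, ← h2, ← h3]
  rw [b.swap y, b.swap z ((Φ y : V →L[ℝ] V) x), b.swap x ((Φ z : V →L[ℝ] V) y)]
  ring

/-- An element of `V* ⊗ sp(V)` from a trilinear form which is symmetric in the last two
variables. -/
noncomputable def ofTrilinear (C : V →ₗ[ℝ] V →ₗ[ℝ] V →ₗ[ℝ] ℝ) (h : ∀ x y z, C x y z = C x z y) :
    V →ₗ[ℝ] b.csp where
  -- The witness 0 is the scaling factor: symmetry of C x says that the endomorphism lies in sp(V).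
  toFun x := ⟨LinearMap.toContinuousLinearMap (b.flat.symm.toLinearMap ∘ₗ C x), 0, fun v w => by
    rw [b.swap v]
    simp only [LinearMap.coe_toContinuousLinearMap', LinearMap.comp_apply, LinearEquiv.coe_coe]
    rw [b.flat_symm_apply, b.flat_symm_apply, h]
    ring⟩
  map_add' x y := by ext; simp
  map_smul' c x := by ext; simp

theorem ofTrilinear_apply (C : V →ₗ[ℝ] V →ₗ[ℝ] V →ₗ[ℝ] ℝ) (h : ∀ x y z, C x y z = C x z y)
    (x y z : V) : b ((b.ofTrilinear C h x : V →L[ℝ] V) y) z = C x y z :=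
  b.flat_symm_apply _ z

/-- Write t(x, y, z) = b(T(x, y), z). Then C(x, y, z) = (t(x, y, z) - t(z, x, y))/3 is symmetric in
y and z, hence defines an sp(V)-valued map. Its skew part in x and y is (2t(x, y, z) - t(y, z, x) -
t(z, x, y))/3, which is t(x, y, z) as soon as the cyclic sum vanishes. -/
theorem mem_range_spencer_of_cyclicSum_eq_zero {T : V [⋀^Fin 2]→ₗ[ℝ] V}
    (hT : b.cyclicSum T = 0) : T ∈ LinearMap.range (spencer b.csp) := by
  have h0 : ∀ x y z, b (T ![x, y]) z + b (T ![y, z]) x + b (T ![z, x]) y = 0 := fun x y z =>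
    congrArg (fun α : V [⋀^Fin 3]→ₗ[ℝ] ℝ => α ![x, y, z]) hT
  have hs := altTwo_swap T
  have ha : ∀ x y y', T ![x, y + y'] = T ![x, y] + T ![x, y'] := fun x y y' => by
    rw [hs, altTwo_add_left, hs x y, hs x y']; abel
  have hm : ∀ (c : ℝ) x y, T ![x, c • y] = c • T ![x, y] := fun c x y => by
    rw [hs, altTwo_smul_left, hs x y, smul_neg]
  let C : V →ₗ[ℝ] V →ₗ[ℝ] V →ₗ[ℝ] ℝ :=
    LinearMap.mk₂ ℝ (fun x y =>
      (3⁻¹ : ℝ) • (b.bilin (T ![x, y]) - b.bilin.flip y ∘ₗ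
        { toFun := fun z => T ![z, x]
          map_add' := fun z z' => altTwo_add_left T z z' x
          map_smul' := fun c z => altTwo_smul_left T c z x }))
      (fun x x' y => by
        ext z
        simp only [altTwo_add_left, ha, map_add, LinearMap.smul_apply, LinearMap.sub_apply,
          LinearMap.add_apply, LinearMap.comp_apply, LinearMap.coe_mk, AddHom.coe_mk, smul_eq_mul]
        ring)
      (fun c x y => by
        ext z
        simp only [altTwo_smul_left, hm, map_smul, LinearMap.smul_apply, LinearMap.sub_apply,
          LinearMap.comp_apply, LinearMap.coe_mk, AddHom.coe_mk, smul_eq_mul]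
        ring)
      (fun x y y' => by
        ext z
        simp only [ha, map_add, LinearMap.smul_apply, LinearMap.sub_apply,
          LinearMap.add_apply, LinearMap.comp_apply, LinearMap.coe_mk, AddHom.coe_mk, smul_eq_mul]
        ring)
      (fun c x y => by
        ext z
        simp only [hm, map_smul, LinearMap.smul_apply, LinearMap.sub_apply,
          LinearMap.comp_apply, LinearMap.coe_mk, AddHom.coe_mk, smul_eq_mul]
        ring)
  have hC : ∀ x y z, C x y z = 3⁻¹ * (b (T ![x, y]) z - b (T ![z, x]) y) := fun x y z => rfl
  have hsym : ∀ x y z, C x y z = C x z y := fun x y z => by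
    rw [hC, hC, hs z x, hs y x, b.neg_left, b.neg_left]; ring
  refine ⟨b.ofTrilinear C hsym, altTwo_ext fun x y => b.eq_of_forall_left fun z => ?_⟩
  change b ((b.ofTrilinear C hsym x : V →L[ℝ] V) y - (b.ofTrilinear C hsym y : V →L[ℝ] V) x) z = _
  rw [b.sub_left, ofTrilinear_apply, ofTrilinear_apply, hC, hC]
  have := h0 x y z
  rw [hs y x, hs z y, b.neg_left, b.neg_left]
  linear_combination (-1 / 3 : ℝ) * this

/-- The endomorphism associated to `λ ∧ b` and `v`. -/
theorem raise_wedge (l : Module.Dual ℝ V) (v : V) :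
    b.raise (b.wedge l) v = l v • LinearMap.id - l.smulRight v
      + (b.bilin v).smulRight (b.flat.symm l) := by
  ext x
  refine b.eq_of_forall_left fun y => ?_
  rw [raise_spec, wedge_apply]
  simp only [LinearMap.add_apply, LinearMap.sub_apply, LinearMap.smul_apply, LinearMap.id_apply,
    LinearMap.smulRight_apply, b.add_left, b.sub_left, b.smul_left, b.flat_symm_apply, bilin_apply]
  rw [b.swap y v]
  ring

/-- The three summands in `raise_wedge` have traces n l(v), l(v) and b(v, w) = -l(v), where w is the
vector with b(w, ·) = l. -/
theorem contract_wedge (l : Module.Dual ℝ V) :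
    b.contract (b.wedge l) = ((finrank ℝ V : ℝ) - 2) • l := by
  ext v
  change LinearMap.trace ℝ V (b.raise (b.wedge l) v) = _
  rw [raise_wedge, map_add, map_sub, map_smul, LinearMap.trace_id, LinearMap.trace_smulRight,
    LinearMap.trace_smulRight, bilin_apply, b.swap, flat_symm_apply]
  simp only [smul_eq_mul, LinearMap.smul_apply]
  ring

/-- The contraction recovers the one-form up to the factor n - 2, which is non-zero. -/
theorem wedge_injective (hV : 3 ≤ finrank ℝ V) : Function.Injective b.wedge := by
  intro l l' h
  have h' := congrArg b.contract h
  rw [contract_wedge, contract_wedge] at h'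
  have : (3 : ℝ) ≤ finrank ℝ V := by exact_mod_cast hV
  exact smul_right_injective _ (by linarith : ((finrank ℝ V : ℝ) - 2) ≠ 0) h'

-- Raise the last argument of α by b. Cyclic permutations of three letters are even, so each of the
-- three terms of the cyclic sum reproduces α.
omit [Nontrivial V] in
theorem exists_cyclicSum_eq (α : V [⋀^Fin 3]→ₗ[ℝ] ℝ) : ∃ T, b.cyclicSum T = (3 : ℝ) • α ∧
    ∀ x y z, b (T ![x, y]) z = α ![x, y, z] := by
  let T : V [⋀^Fin 2]→ₗ[ℝ] V := altTwo (fun x y => b.flat.symm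
      { toFun := fun z => α ![x, y, z]
        map_add' := fun z z' => by
          have h := α.map_update_add ![x, y, z] 2 z z'
          simpa only [update_three] using h
        map_smul' := fun c z => by
          have h := α.map_update_smul ![x, y, z] 2 c z
          simpa only [update_three, RingHom.id_apply] using h })
    (fun x x' y => by
      rw [← map_add]; congr 1; ext z
      have h := α.map_update_add ![x, y, z] 0 x x'
      simp only [update_three] at h
      exact h)
    (fun c x y => by
      rw [← map_smul]; congr 1; ext z
      have h := α.map_update_smul ![x, y, z] 0 c x
      simp only [update_three] at h
      exact h)
    (fun x y => by
      rw [← map_neg]; congr 1; ext z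
      exact altThree_swap α x y z)
  have hT : ∀ x y z, b (T ![x, y]) z = α ![x, y, z] := fun x y z => b.flat_symm_apply _ z
  refine ⟨T, altThree_ext fun x y z => ?_, hT⟩
  rw [cyclicSum_apply, hT, hT, hT, AlternatingMap.smul_apply, smul_eq_mul]
  rw [altThree_swap' α y z x, altThree_swap α y x z, altThree_swap α z x y, altThree_swap' α x z y]
  ring

/-- The image of the Spencer differential of `csp(V)`. -/
theorem mem_range_spencer_iff (T : V [⋀^Fin 2]→ₗ[ℝ] V) :
    T ∈ LinearMap.range (spencer b.csp) ↔ ∃ l, b.cyclicSum T = b.wedge l := by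
  constructor
  · rintro ⟨Φ, rfl⟩
    exact ⟨_, b.cyclicSum_spencer Φ⟩
  · rintro ⟨l, hl⟩
    -- The identity has scaling factor 2, so (l/2) ⊗ id has scaling factor l. Subtracting its image
    -- from T leaves a tensor with vanishing cyclic sum.
    let e : b.csp := ⟨(1 : V →L[ℝ] V), 2, fun v w => by
      simp only [one_apply_eq_self]; ring⟩
    have he : b.cspScale e = 2 := by
      obtain ⟨p, hp⟩ := b.exists_pair
      have := b.cspScale_spec e p.1 p.2
      simp only [e, one_apply_eq_self, hp] at this
      linarith
    let Φ : V →ₗ[ℝ] b.csp := ((2⁻¹ : ℝ) • l).smulRight e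
    have h := b.cyclicSum_spencer Φ
    have hΦ : b.cspScale ∘ₗ Φ = l := by
      ext v
      simp [Φ, he]; ring
    rw [hΦ] at h
    have h0 : b.cyclicSum (T - spencer b.csp Φ) = 0 := by rw [map_sub, hl, h, sub_self]
    have := Submodule.add_mem _ (b.mem_range_spencer_of_cyclicSum_eq_zero h0)
      (LinearMap.mem_range_self (spencer b.csp) Φ)
    rwa [sub_add_cancel] at this

/-- For n = 4 both Λ³V* and V* have dimension four, and the contraction is onto since it sends (λ/2)
∧ b to λ. -/
theorem contract_injective (hV : finrank ℝ V = 4) : Function.Injective b.contract := by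
  have hfin : finrank ℝ (V [⋀^Fin 3]→ₗ[ℝ] ℝ) = 4 := by
    rw [(exteriorPower.alternatingMapLinearEquiv (R := ℝ) (n := 3) (M := V) (N := ℝ)).finrank_eq]
    change finrank ℝ (Module.Dual ℝ _) = 4
    rw [Subspace.dual_finrank_eq, exteriorPower.finrank_eq, hV]
    rfl
  have : FiniteDimensional ℝ (V [⋀^Fin 3]→ₗ[ℝ] ℝ) := .of_finrank_pos (by omega)
  rw [LinearMap.injective_iff_surjective_of_finrank_eq_finrank
    (by rw [hfin, Subspace.dual_finrank_eq, hV])]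
  intro l
  refine ⟨b.wedge ((2⁻¹ : ℝ) • l), ?_⟩
  rw [contract_wedge, hV, smul_smul]
  norm_num

/-- In dimension four every three-form is λ ∧ b with λ half its contraction, so the description of
the image imposes no condition. -/
theorem spencer_surjective (hV : finrank ℝ V = 4) : Function.Surjective (spencer b.csp) := by
  intro T
  refine (b.mem_range_spencer_iff T).2 ⟨(2⁻¹ : ℝ) • b.contract (b.cyclicSum T),
    b.contract_injective hV ?_⟩
  rw [contract_wedge, hV, smul_smul]
  norm_num

end Csp

end SymplecticForm

open Bundle Set Topology Module
open scoped Manifold ContDiff TensorProduct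

set_option linter.unusedSectionVars false

namespace SymplecticForm

variable {V : Type*} [NormedAddCommGroup V] [NormedSpace ℝ V] (b : SymplecticForm V)

/-! ### Symmetric trilinear forms, S³V and the first prolongation. -/

section SymCube

/-- The symmetrization of the multilinear forms `∏ b(vᵢ, ·)`, as a function of the `vᵢ`. -/
noncomputable def symmetrize :
    MultilinearMap ℝ (fun _ : Fin 3 => V) (MultilinearMap ℝ (fun _ : Fin 3 => V) ℝ) :=
  ∑ σ : Equiv.Perm (Fin 3), MultilinearMap.domDomCongr σ
    ((LinearMap.applyₗ (MultilinearMap.mkPiAlgebra ℝ (Fin 3) ℝ)).compMultilinearMap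
      ((MultilinearMap.compLinearMapMultilinear (R := ℝ) (M₁ := fun _ : Fin 3 => V)
        (M₁' := fun _ : Fin 3 => ℝ) (M₂ := ℝ)).compLinearMap fun _ => b.bilin))

theorem symmetrize_apply (v x : Fin 3 → V) :
    b.symmetrize v x = ∑ σ : Equiv.Perm (Fin 3), ∏ i, b (v (σ i)) (x i) := by
  simp [symmetrize, _root_.sum_apply]

/-- The map from `S³V` to trilinear forms on `V` induced by `b`. -/
noncomputable def symToForm : Sym[ℝ]^3 V →ₗ[ℝ] MultilinearMap ℝ (fun _ : Fin 3 => V) ℝ where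
  __ := AddCon.lift (addConGen (SymmetricPower.Rel ℝ (Fin 3) V))
    (PiTensorProduct.lift b.symmetrize).toAddMonoidHom
    (AddCon.addConGen_le.2 fun x y h => by
      induction h with
      | perm e v =>
        rw [AddCon.ker_rel]
        simp only [LinearMap.toAddMonoidHom_coe, PiTensorProduct.lift.tprod]
        ext x
        rw [symmetrize_apply, symmetrize_apply]
        exact (Fintype.sum_equiv (Equiv.mulLeft e) _ _ fun σ => rfl).symm)
  map_smul' c x := by
    induction x using AddCon.induction_on with
    | H x => exact (PiTensorProduct.lift b.symmetrize).map_smul c x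

theorem symToForm_tprod (v x : Fin 3 → V) :
    b.symToForm (SymmetricPower.tprod ℝ v) x =
      ∑ σ : Equiv.Perm (Fin 3), ∏ i, b (v (σ i)) (x i) := by
  change PiTensorProduct.lift b.symmetrize (PiTensorProduct.tprod ℝ v) x = _
  rw [PiTensorProduct.lift.tprod, symmetrize_apply]

theorem symToForm_perm (s : Sym[ℝ]^3 V) (x : Fin 3 → V) (e : Equiv.Perm (Fin 3)) :
    b.symToForm s (x ∘ e) = b.symToForm s x := by
  have hs : s ∈ Submodule.span ℝ (Set.range (SymmetricPower.tprod ℝ (ι := Fin 3) (M := V))) := by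
    rw [SymmetricPower.span_tprod_eq_top]; trivial
  induction hs using Submodule.span_induction with
  | mem s h =>
    obtain ⟨v, rfl⟩ := h
    rw [symToForm_tprod, symToForm_tprod]
    refine Fintype.sum_equiv (Equiv.mulRight e⁻¹) _ _ fun σ => ?_
    refine Fintype.prod_equiv e _ _ fun i => ?_
    simp
  | zero => simp
  | add s t _ _ hs ht => simp [hs, ht]
  | smul c s _ hs => simp [hs]

variable [FiniteDimensional ℝ V] [Nontrivial V]

/-- The f i represent the coordinates of the basis e with respect to b, with a sign because they sit
in the second slot. Pairing the second expansion with b(w, ·) reduces it to the first one. -/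
theorem exists_dual_bases : ∃ e f : Fin (finrank ℝ V) → V,
    (∀ v, ∑ i, b v (f i) • e i = v) ∧ ∀ v, ∑ i, b (e i) v • f i = v := by
  let e := finBasis ℝ V
  have h1 : ∀ i v, b v (-b.flat.symm (e.coord i)) = e.coord i v := fun i v => by
    rw [b.neg_right, ← b.swap, flat_symm_apply]
  have h2 : ∀ v, ∑ i, b v (-b.flat.symm (e.coord i)) • e i = v := fun v => by
    simp only [h1]
    exact e.sum_repr v
  refine ⟨e, fun i => -b.flat.symm (e.coord i), h2, fun v => b.eq_of_forall_left fun w => ?_⟩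
  have key : ∀ w, b w (∑ i, b (e i) v • -b.flat.symm (e.coord i)) = b w v := fun w => by
    change b.bilin w _ = _
    rw [map_sum]
    simp only [map_smul, bilin_apply, h1, smul_eq_mul]
    conv_rhs => rw [← e.sum_repr w]
    change _ = b.bilin.flip v _
    rw [map_sum]
    refine Finset.sum_congr rfl fun i _ => ?_
    simp [mul_comm]
  rw [b.swap, key, ← b.swap]

/-- Evaluate a form on the f's and use the values as coefficients of products of the e's. Each of
the six permutations in the symmetrization gives back the original element, as the order of factors
does not matter in S³V; hence the composite is multiplication by 6. -/
theorem symToForm_injective : Function.Injective b.symToForm := by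
  obtain ⟨e, f, h1, -⟩ := b.exists_dual_bases
  let G : MultilinearMap ℝ (fun _ : Fin 3 => V) ℝ →ₗ[ℝ] Sym[ℝ]^3 V :=
    { toFun := fun m => ∑ r : Fin 3 → Fin (finrank ℝ V),
        m (fun a => f (r a)) • SymmetricPower.tprod ℝ fun a => e (r a)
      map_add' := fun m m' => by simp [add_smul, Finset.sum_add_distrib]
      map_smul' := fun c m => by simp [Finset.smul_sum, smul_smul] }
  have h : G ∘ₗ b.symToForm = (6 : ℝ) • LinearMap.id := by
    refine symCube_hom_ext fun v => ?_
    have h3 : ∀ σ : Equiv.Perm (Fin 3), ∑ r : Fin 3 → Fin (finrank ℝ V),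
        (∏ i, b (v (σ i)) (f (r i))) • SymmetricPower.tprod ℝ (fun a => e (r a)) =
        SymmetricPower.tprod ℝ v := fun σ => by
      rw [← SymmetricPower.tprod_equiv σ v]
      conv_rhs => enter [2, i]; rw [← h1 (v (σ i))]
      rw [MultilinearMap.map_sum]
      exact Finset.sum_congr rfl fun r _ => (MultilinearMap.map_smul_univ _ _ _).symm
    change ∑ r : Fin 3 → Fin (finrank ℝ V), b.symToForm (SymmetricPower.tprod ℝ v)
      (fun a => f (r a)) • SymmetricPower.tprod ℝ (fun a => e (r a)) = _
    simp only [symToForm_tprod, Finset.sum_smul]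
    rw [Finset.sum_comm]
    simp only [h3, Finset.sum_const, Finset.card_univ, Fintype.card_perm, Fintype.card_fin]
    simp [← Nat.cast_smul_eq_nsmul ℝ, Nat.factorial]
  intro s t hst
  have h' : ∀ s, G (b.symToForm s) = (6 : ℝ) • s := fun s => LinearMap.congr_fun h s
  have h6 : (6 : ℝ) • s = (6 : ℝ) • t := by rw [← h', ← h', hst]
  exact smul_right_injective _ (by norm_num : (6 : ℝ) ≠ 0) h6

/-- The same reconstruction, divided by 6: for symmetric m each of the six permutations contributes
m x. -/
theorem exists_symToForm_eq (m : MultilinearMap ℝ (fun _ : Fin 3 => V) ℝ)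
    (hm : ∀ (x : Fin 3 → V) (e : Equiv.Perm (Fin 3)), m (x ∘ e) = m x) :
    ∃ s, b.symToForm s = m := by
  obtain ⟨e, f, -, h2⟩ := b.exists_dual_bases
  refine ⟨(6⁻¹ : ℝ) • ∑ r : Fin 3 → Fin (finrank ℝ V),
    m (fun a => f (r a)) • SymmetricPower.tprod ℝ fun a => e (r a), ?_⟩
  ext x
  have h3 : ∀ σ : Equiv.Perm (Fin 3), ∑ r : Fin 3 → Fin (finrank ℝ V),
      m (fun a => f (r a)) * ∏ i, b (e (r (σ i))) (x i) = m x := fun σ => by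
    have h4 : m x = ∑ r : Fin 3 → Fin (finrank ℝ V),
        m (fun a => f (r a)) * ∏ i, b (e (r i)) (x i) := by
      conv_lhs => enter [2, i]; rw [← h2 (x i)]
      rw [MultilinearMap.map_sum]
      exact Finset.sum_congr rfl fun r _ => by
        rw [MultilinearMap.map_smul_univ, smul_eq_mul, mul_comm]
    rw [h4]
    refine Fintype.sum_equiv (Equiv.arrowCongr σ.symm (Equiv.refl _)) _ _ fun r => ?_
    have := hm (fun a => f (r a)) σ
    rw [← this]
    rfl
  simp only [map_smul, map_sum, _root_.smul_apply, _root_.sum_apply,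
    symToForm_tprod, smul_eq_mul, Finset.mul_sum]
  simp only [← Finset.mul_sum]
  rw [Finset.mul_sum, ← Finset.mul_sum]
  have h5 : ∑ r : Fin 3 → Fin (finrank ℝ V), m (fun a => f (r a)) *
      ∑ σ : Equiv.Perm (Fin 3), ∏ i, b (e (r (σ i))) (x i) = 6 * m x := by
    simp only [Finset.mul_sum]
    rw [Finset.sum_comm]
    simp only [h3, Finset.sum_const, Finset.card_univ, Fintype.card_perm, Fintype.card_fin]
    simp [Nat.factorial]
  rw [h5]
  ring

/-- A trilinear form as an iterated linear map. -/
def curryThree (m : MultilinearMap ℝ (fun _ : Fin 3 => V) ℝ) : V →ₗ[ℝ] V →ₗ[ℝ] V →ₗ[ℝ] ℝ :=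
  have h0 : ∀ x y z w : V, Function.update ![x, y, z] 0 w = ![w, y, z] := fun x y z w =>
    (update_three x y z w).1
  have h1 : ∀ x y z w : V, Function.update ![x, y, z] 1 w = ![x, w, z] := fun x y z w =>
    (update_three x y z w).2.1
  have h2 : ∀ x y z w : V, Function.update ![x, y, z] 2 w = ![x, y, w] := fun x y z w =>
    (update_three x y z w).2.2
  LinearMap.mk₂ ℝ (fun x y =>
    { toFun := fun z => m ![x, y, z]
      map_add' := fun z z' => by simpa only [h2] using m.map_update_add ![x, y, z] 2 z z'
      map_smul' := fun c z => by
        simpa only [h2, RingHom.id_apply] using m.map_update_smul ![x, y, z] 2 c z })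
    (fun x x' y => by
      ext z
      have h := m.map_update_add ![x, y, z] 0 x x'
      simp only [h0] at h
      exact h)
    (fun c x y => by
      ext z
      have h := m.map_update_smul ![x, y, z] 0 c x
      simp only [h0] at h
      exact h)
    (fun x y y' => by
      ext z
      have h := m.map_update_add ![x, y, z] 1 y y'
      simp only [h1] at h
      exact h)
    (fun c x y => by
      ext z
      have h := m.map_update_smul ![x, y, z] 1 c y
      simp only [h1] at h
      exact h)

theorem curryThree_apply (m : MultilinearMap ℝ (fun _ : Fin 3 => V) ℝ) (x y z : V) :
    curryThree m x y z = m ![x, y, z] := rfl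

theorem curry_symToForm_symm (s : Sym[ℝ]^3 V) (x y z : V) :
    curryThree (b.symToForm s) x y z = curryThree (b.symToForm s) x z y := by
  rw [curryThree_apply, curryThree_apply, ← b.symToForm_perm s _ (Equiv.swap 1 2)]
  congr 1
  funext i
  fin_cases i <;> rfl

theorem curry_symToForm_symm' (s : Sym[ℝ]^3 V) (x y z : V) :
    curryThree (b.symToForm s) x y z = curryThree (b.symToForm s) y x z := by
  rw [curryThree_apply, curryThree_apply, ← b.symToForm_perm s _ (Equiv.swap 0 1)]
  congr 1
  funext i
  fin_cases i <;> rfl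

theorem prolongation_ext {Φ Ψ : prolongation b.csp}
    (h : ∀ x y z, b ((Φ.1 x : V →L[ℝ] V) y) z = b ((Ψ.1 x : V →L[ℝ] V) y) z) : Φ = Ψ := by
  ext x y
  exact b.eq_of_forall_left fun z => h x y z

theorem ofTrilinear_symToForm_apply (s : Sym[ℝ]^3 V) (x y z : V) :
    b ((b.ofTrilinear (curryThree (b.symToForm s)) (b.curry_symToForm_symm s) x : V →L[ℝ] V) y) z =
      b.symToForm s ![x, y, z] :=
  b.ofTrilinear_apply (curryThree (b.symToForm s)) (b.curry_symToForm_symm s) x y z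

theorem spencer_ofTrilinear_symToForm (s : Sym[ℝ]^3 V) :
    spencer b.csp (b.ofTrilinear (curryThree (b.symToForm s)) (b.curry_symToForm_symm s)) = 0 :=
  altTwo_ext fun x y => b.eq_of_forall_left fun z => by
    change b ((b.ofTrilinear (curryThree (b.symToForm s)) (b.curry_symToForm_symm s) x :
        V →L[ℝ] V) y -
      (b.ofTrilinear (curryThree (b.symToForm s)) (b.curry_symToForm_symm s) y :
        V →L[ℝ] V) x) z = b 0 z
    rw [b.sub_left, ofTrilinear_symToForm_apply, ofTrilinear_symToForm_apply,
      ← curryThree_apply, curry_symToForm_symm', curryThree_apply, sub_self, b.zero_left]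

/-- The isomorphism `S³V ≅ csp(V)⁽¹⁾` as a linear map. -/
noncomputable def symToProlongation : Sym[ℝ]^3 V →ₗ[ℝ] prolongation b.csp where
  toFun s := ⟨b.ofTrilinear (curryThree (b.symToForm s)) (b.curry_symToForm_symm s),
    b.spencer_ofTrilinear_symToForm s⟩
  map_add' s t := b.prolongation_ext fun x y z => by
    refine (b.ofTrilinear_symToForm_apply (s + t) x y z).trans ?_
    refine Eq.trans ?_ (b.add_left _ _ z).symm
    refine Eq.trans ?_ (congrArg₂ (· + ·) (b.ofTrilinear_symToForm_apply s x y z)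
      (b.ofTrilinear_symToForm_apply t x y z)).symm
    rw [map_add]
    rfl
  map_smul' c s := b.prolongation_ext fun x y z => by
    refine (b.ofTrilinear_symToForm_apply (c • s) x y z).trans ?_
    refine Eq.trans ?_ (b.smul_left _ _ z).symm
    refine Eq.trans ?_ (congrArg (c * ·) (b.ofTrilinear_symToForm_apply s x y z)).symm
    rw [map_smul]
    rfl

theorem symToProlongation_spec (s : Sym[ℝ]^3 V) (x y z : V) :
    b (((b.symToProlongation s).1 x : V →L[ℝ] V) y) z = b.symToForm s ![x, y, z] :=
  b.ofTrilinear_symToForm_apply s x y z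

/-- If ∂Φ = 0, the scaling factor of Φ wedges with b to zero and hence vanishes, so Φ has values in
sp(V). Thus b(Φ(x)y, z) is symmetric in y and z, while ∂Φ = 0 makes it symmetric in x and y. A
totally symmetric form comes from S³V. -/
theorem symToProlongation_bijective (hV : 3 ≤ finrank ℝ V) :
    Function.Bijective b.symToProlongation := by
  constructor
  · intro s t h
    refine b.symToForm_injective (MultilinearMap.ext fun x => ?_)
    have hx : x = ![x 0, x 1, x 2] := by funext i; fin_cases i <;> rfl
    rw [hx, ← symToProlongation_spec, h, symToProlongation_spec]
  · intro Φ
    have hΦ : spencer b.csp Φ.1 = 0 := Φ.2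
    have h0 : b.cspScale ∘ₗ Φ.1 = 0 := by
      refine b.wedge_injective hV ?_
      rw [← cyclicSum_spencer, hΦ, map_zero, map_zero]
    have h1 : ∀ x y z, b ((Φ.1 x : V →L[ℝ] V) y) z = b ((Φ.1 x : V →L[ℝ] V) z) y := by
      intro x y z
      have h := b.cspScale_spec (Φ.1 x) y z
      have h2 : b.cspScale (Φ.1 x) = 0 := LinearMap.congr_fun h0 x
      rw [h2, zero_mul, b.swap y] at h
      linarith
    have h2 : ∀ x y, (Φ.1 x : V →L[ℝ] V) y = (Φ.1 y : V →L[ℝ] V) x := by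
      intro x y
      exact sub_eq_zero.1 (congrArg (fun T : V [⋀^Fin 2]→ₗ[ℝ] V => T ![x, y]) hΦ)
    let m : MultilinearMap ℝ (fun _ : Fin 3 => V) ℝ :=
      { toFun := fun x => b ((Φ.1 (x 0) : V →L[ℝ] V) (x 1)) (x 2)
        map_update_add' := @fun inst v i x y => by
          obtain rfl := Subsingleton.elim inst (instDecidableEqFin 3)
          fin_cases i <;> simp [b.add_left, b.add_right]
        map_update_smul' := @fun inst v i c x => by
          obtain rfl := Subsingleton.elim inst (instDecidableEqFin 3)
          fin_cases i <;> simp [b.smul_left, b.smul_right] }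
    have hm : ∀ (x : Fin 3 → V) (e : Equiv.Perm (Fin 3)), m (x ∘ e) = m x := by
      intro x e
      induction e using Equiv.Perm.swap_induction_on generalizing x with
      | one => rfl
      | swap_mul e i j hij ih =>
        -- Transpositions suffice: (0 1) is `h2`, (1 2) is `h1`, and (0 2) is composed of these.
        have key : ∀ (y : Fin 3 → V) (i j : Fin 3), m (y ∘ Equiv.swap i j) = m y := by
          intro y i j
          change b ((Φ.1 (y (Equiv.swap i j 0)) : V →L[ℝ] V) (y (Equiv.swap i j 1)))
            (y (Equiv.swap i j 2)) = b ((Φ.1 (y 0) : V →L[ℝ] V) (y 1)) (y 2)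
          have e01 : Equiv.swap (0 : Fin 3) 1 2 = 2 := by decide
          have e02 : Equiv.swap (0 : Fin 3) 2 1 = 1 := by decide
          have e12 : Equiv.swap (1 : Fin 3) 2 0 = 0 := by decide
          have p01 : b ((Φ.1 (y 1) : V →L[ℝ] V) (y 0)) (y 2) =
            b ((Φ.1 (y 0) : V →L[ℝ] V) (y 1)) (y 2) := by rw [h2]
          have p12 : b ((Φ.1 (y 0) : V →L[ℝ] V) (y 2)) (y 1) =
            b ((Φ.1 (y 0) : V →L[ℝ] V) (y 1)) (y 2) := by rw [h1]
          have p02 : b ((Φ.1 (y 2) : V →L[ℝ] V) (y 1)) (y 0) =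
            b ((Φ.1 (y 0) : V →L[ℝ] V) (y 1)) (y 2) := by rw [h1, h2, p12]
          fin_cases i <;> fin_cases j <;>
            simp only [Fin.zero_eta, Fin.mk_one, Fin.reduceFinMk, Equiv.swap_self,
              Equiv.refl_apply, Equiv.swap_apply_left, Equiv.swap_apply_right, e01, e02, e12,
              Equiv.swap_comm (1 : Fin 3) 0, Equiv.swap_comm (2 : Fin 3) 0,
              Equiv.swap_comm (2 : Fin 3) 1, p01, p12, p02]
        exact (ih (x ∘ Equiv.swap i j)).trans (key x i j)
    obtain ⟨s, hs⟩ := b.exists_symToForm_eq m hm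
    refine ⟨s, b.prolongation_ext fun x y z => ?_⟩
    rw [symToProlongation_spec, hs]
    rfl

/-- Invariance of b moves g from the vectors vᵢ to the arguments, where it appears as g⁻¹; checking
this on products is enough. -/
theorem symToForm_equivariant (g : b.Sp) (s : Sym[ℝ]^3 V) (x : Fin 3 → V) :
    b.symToForm (b.symCubeRep g s) x = b.symToForm s fun i => (g⁻¹).1.val (x i) := by
  have hv : ∀ v, g.1.val ((g⁻¹).1.val v) = v := fun v => by
    rw [← mul_apply_eq_comp]
    exact DFunLike.congr_fun g.1.mul_inv v
  have hg : ∀ v w, b (g.1.val v) (g.1.val w) = b v w := g.2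
  have hs : s ∈ Submodule.span ℝ (Set.range (SymmetricPower.tprod ℝ (ι := Fin 3) (M := V))) := by
    rw [SymmetricPower.span_tprod_eq_top]; trivial
  induction hs using Submodule.span_induction with
  | mem s h =>
    obtain ⟨v, rfl⟩ := h
    change b.symToForm (symCubeMap (b.stdRep g) _) x = _
    rw [symCubeMap_tprod, symToForm_tprod, symToForm_tprod]
    refine Finset.sum_congr rfl fun σ _ => Finset.prod_congr rfl fun i _ => ?_
    rw [← hg (v (σ i)), hv]
    rfl
  | zero => simp
  | add s t _ _ hs ht => simp [hs, ht]
  | smul c s _ hs => simp [hs]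

theorem nonempty_prolongationRep_equiv (hV : 3 ≤ finrank ℝ V) :
    Nonempty (b.prolongationRep.Equiv b.symCubeRep) := by
  refine ⟨(Representation.Equiv.mk
    (LinearEquiv.ofBijective b.symToProlongation (b.symToProlongation_bijective hV))
    fun g => LinearMap.ext fun s => b.prolongation_ext fun x y z => ?_).symm⟩
  have hv : ∀ v, g.1.val ((g⁻¹).1.val v) = v := fun v => by
    rw [← mul_apply_eq_comp]
    exact DFunLike.congr_fun g.1.mul_inv v
  have hg : ∀ v w, b (g.1.val v) (g.1.val w) = b v w := g.2
  change b (((b.symToProlongation (b.symCubeRep g s)).1 x : V →L[ℝ] V) y) z =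
    b (g.1.val (((b.symToProlongation s).1 ((g⁻¹).1.val x) : V →L[ℝ] V) ((g⁻¹).1.val y))) z
  have h := hg (((b.symToProlongation s).1 ((g⁻¹).1.val x) : V →L[ℝ] V) ((g⁻¹).1.val y))
    ((g⁻¹).1.val z)
  rw [hv] at h
  rw [symToProlongation_spec, symToForm_equivariant, h, symToProlongation_spec]
  congr 1
  funext i
  fin_cases i <;> rfl

end SymCube

/-! ### The cokernel of the Spencer differential and tracefree three-forms. -/

section Torsion

variable [FiniteDimensional ℝ V] [Nontrivial V]

theorem cyclicSum_altRep (g : b.Sp) (T : V [⋀^Fin 2]→ₗ[ℝ] V) :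
    b.cyclicSum (b.altRep b.stdRep 2 g T) =
      b.altRep (Representation.trivial ℝ b.Sp ℝ) 3 g (b.cyclicSum T) := by
  have hv : ∀ v, g.1.val ((g⁻¹).1.val v) = v := fun v => by
    rw [← mul_apply_eq_comp]
    exact DFunLike.congr_fun g.1.mul_inv v
  have hg : ∀ v w, b (g.1.val v) (g.1.val w) = b v w := g.2
  refine altThree_ext fun x y z => ?_
  have h : ∀ x y z, b (b.altRep b.stdRep 2 g T ![x, y]) z =
      b (T ![(g⁻¹).1.val x, (g⁻¹).1.val y]) ((g⁻¹).1.val z) := fun x y z => by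
    refine Eq.trans ?_ (hg _ _)
    rw [hv]
    change b (g.1.val (T _)) z = b (g.1.val (T _)) z
    congr 3
    funext i
    fin_cases i <;> rfl
  rw [cyclicSum_apply, h, h, h]
  rfl

theorem altRep_wedge (g : b.Sp) (l : Module.Dual ℝ V) :
    b.altRep (Representation.trivial ℝ b.Sp ℝ) 3 g (b.wedge l) =
      b.wedge (l ∘ₗ b.stdRep g⁻¹) := by
  have hg : ∀ v w, b ((g⁻¹).1.val v) ((g⁻¹).1.val w) = b v w := (g⁻¹).2
  refine altThree_ext fun x y z => ?_
  rw [wedge_apply, ← hg y z, ← hg z x, ← hg x y]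
  rfl

/-- The map `Λ²V* ⊗ V → Λ³₀V*` which computes the tracefree part of the cyclic sum. -/
noncomputable def traceFreeCyclicSum (hV : 3 ≤ finrank ℝ V) :
    (V [⋀^Fin 2]→ₗ[ℝ] V) →ₗ[ℝ] b.traceFree :=
  ((LinearMap.id - ((finrank ℝ V : ℝ) - 2)⁻¹ • b.wedge ∘ₗ b.contract) ∘ₗ b.cyclicSum).codRestrict
    b.traceFree fun T => by
      have : (3 : ℝ) ≤ finrank ℝ V := by exact_mod_cast hV
      have h0 : ((finrank ℝ V : ℝ) - 2) ≠ 0 := by linarith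
      change b.contract (b.cyclicSum T -
        ((finrank ℝ V : ℝ) - 2)⁻¹ • b.wedge (b.contract (b.cyclicSum T))) = 0
      rw [map_sub, map_smul, contract_wedge, smul_smul, inv_mul_cancel₀ h0, one_smul, sub_self]

theorem traceFreeCyclicSum_coe (hV : 3 ≤ finrank ℝ V) (T : V [⋀^Fin 2]→ₗ[ℝ] V) :
    (b.traceFreeCyclicSum hV T : V [⋀^Fin 3]→ₗ[ℝ] ℝ) = b.cyclicSum T -
      b.wedge (((finrank ℝ V : ℝ) - 2)⁻¹ • b.contract (b.cyclicSum T)) := by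
  rw [map_smul]; rfl

/-- V* ∧ b meets Λ³₀V* only in zero, because contraction acts on V* ∧ b as the non-zero factor n -
2. Tracefree forms may therefore be compared modulo V* ∧ b, which spares any computation of
contractions below. -/
theorem traceFree_eq_of_sub_eq_wedge (hV : 3 ≤ finrank ℝ V) {α η : V [⋀^Fin 3]→ₗ[ℝ] ℝ}
    (hα : α ∈ b.traceFree) (hη : η ∈ b.traceFree) {l : Module.Dual ℝ V} (h : α - η = b.wedge l) :
    α = η := by
  have : (3 : ℝ) ≤ finrank ℝ V := by exact_mod_cast hV
  have h0 : ((finrank ℝ V : ℝ) - 2) ≠ 0 := by linarith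
  have h1 : b.contract (α - η) = 0 := b.traceFree.sub_mem hα hη
  rw [h, contract_wedge] at h1
  rw [(smul_eq_zero.1 h1).resolve_left h0, map_zero] at h
  exact sub_eq_zero.1 h

/-- The tracefree part vanishes iff the cyclic sum lies in V* ∧ b, which is the description of im ∂.
-/
theorem ker_traceFreeCyclicSum (hV : 3 ≤ finrank ℝ V) :
    LinearMap.ker (b.traceFreeCyclicSum hV) = LinearMap.range (spencer b.csp) := by
  ext T
  rw [mem_range_spencer_iff, LinearMap.mem_ker, ← Subtype.coe_inj, traceFreeCyclicSum_coe]
  constructor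
  · intro h
    exact ⟨_, sub_eq_zero.1 h⟩
  · rintro ⟨l, hl⟩
    have h := traceFreeCyclicSum_coe b hV T
    rw [← h]
    refine b.traceFree_eq_of_sub_eq_wedge hV (b.traceFreeCyclicSum hV T).2 b.traceFree.zero_mem
      (l := l - ((finrank ℝ V : ℝ) - 2)⁻¹ • b.contract (b.cyclicSum T)) ?_
    rw [h, map_sub, ← hl]
    exact sub_zero _

/-- For tracefree α the tensor T with b(T(x, y), z) = α(x, y, z) has cyclic sum 3α, and there is no
trace to remove. -/
theorem traceFreeCyclicSum_surjective (hV : 3 ≤ finrank ℝ V) :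
    Function.Surjective (b.traceFreeCyclicSum hV) := by
  rintro ⟨α, hα⟩
  obtain ⟨T, hT, -⟩ := b.exists_cyclicSum_eq α
  refine ⟨(3⁻¹ : ℝ) • T, Subtype.ext ?_⟩
  have hα' : b.contract α = 0 := hα
  rw [traceFreeCyclicSum_coe, map_smul, hT, smul_smul]
  norm_num [hα']

/-- Both sides are tracefree. They agree modulo V* ∧ b, since the cyclic sum is equivariant and
Sp(V) preserves V* ∧ b; so they are equal, without recourse to equivariance of the contraction. -/
theorem traceFreeCyclicSum_altRep (hV : 3 ≤ finrank ℝ V) (g : b.Sp) (T : V [⋀^Fin 2]→ₗ[ℝ] V) :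
    b.traceFreeCyclicSum hV (b.altRep b.stdRep 2 g T) =
      b.traceFreeRep g (b.traceFreeCyclicSum hV T) := by
  refine Subtype.ext (b.traceFree_eq_of_sub_eq_wedge hV (Subtype.prop _) (Subtype.prop _)
    (l := -(((finrank ℝ V : ℝ) - 2)⁻¹ • b.contract (b.cyclicSum (b.altRep b.stdRep 2 g T))) +
      (((finrank ℝ V : ℝ) - 2)⁻¹ • b.contract (b.cyclicSum T)) ∘ₗ b.stdRep g⁻¹) ?_)
  have h : (b.traceFreeRep g (b.traceFreeCyclicSum hV T) : V [⋀^Fin 3]→ₗ[ℝ] ℝ) =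
    b.altRep (Representation.trivial ℝ b.Sp ℝ) 3 g
      (b.traceFreeCyclicSum hV T : V [⋀^Fin 3]→ₗ[ℝ] ℝ) := rfl
  rw [h, traceFreeCyclicSum_coe, traceFreeCyclicSum_coe, map_sub, altRep_wedge, cyclicSum_altRep,
    map_add, map_neg]
  abel

/-- The submodule is only assumed equal to the kernel, so the first isomorphism theorem can be
applied to the quotient by im ∂ without rewriting inside a quotient type. -/
theorem exists_quotient_equiv {R M N : Type*} [Ring R] [AddCommGroup M] [AddCommGroup N]
    [Module R M] [Module R N] (f : M →ₗ[R] N) (hf : Function.Surjective f) {p : Submodule R M}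
    (hp : LinearMap.ker f = p) : ∃ e : (M ⧸ p) ≃ₗ[R] N, ∀ x, e (p.mkQ x) = f x := by
  subst hp
  exact ⟨f.quotKerEquivOfSurjective hf, fun x => f.quotKerEquivOfSurjective_apply_mk hf x⟩

theorem nonempty_torsionRep_equiv (hV : 3 ≤ finrank ℝ V) :
    Nonempty (b.torsionRep.Equiv b.traceFreeRep) := by
  obtain ⟨e, he⟩ := exists_quotient_equiv (R := ℝ) (M := V [⋀^Fin 2]→ₗ[ℝ] V) (N := b.traceFree)
    (b.traceFreeCyclicSum hV) (b.traceFreeCyclicSum_surjective hV)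
    (p := LinearMap.range (spencer b.csp)) (b.ker_traceFreeCyclicSum hV)
  have h : ∀ g T, b.torsionRep g ((LinearMap.range (spencer b.csp)).mkQ T) =
    (LinearMap.range (spencer b.csp)).mkQ (b.altRep b.stdRep 2 g T) := fun g T => rfl
  refine ⟨Representation.Equiv.mk e fun g => LinearMap.ext fun q => ?_⟩
  obtain ⟨T, rfl⟩ := Submodule.mkQ_surjective _ q
  exact (congrArg e (h g T)).trans ((he _).trans ((b.traceFreeCyclicSum_altRep hV g T).trans
    (congrArg (b.traceFreeRep g) (he T).symm)))

end Torsion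

/-! ### The Lie algebra of CSp(V). -/

section LieAlgebra

variable [FiniteDimensional ℝ V] [Nontrivial V]

/-- Subtracting half the scaling factor times the identity leaves an element of sp(V). The factor 2
is chosen to match the derivative of the inverse Cayley map. -/
theorem mem_csp_iff (X : V →L[ℝ] V) :
    X ∈ b.csp ↔ ∃ (t : ℝ) (Y : b.sp), X = t • 1 + (2 : ℝ) • (Y : V →L[ℝ] V) := by
  constructor
  · rintro ⟨c, hc⟩
    refine ⟨c / 2, ⟨(2⁻¹ : ℝ) • (X - (c / 2) • 1), fun v w => ?_⟩, ?_⟩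
    · have := hc v w
      simp only [_root_.smul_apply, _root_.sub_apply, one_apply_eq_self, b.smul_left,
        b.smul_right, b.sub_left, b.sub_right]
      linear_combination (2⁻¹ : ℝ) * this
    · rw [smul_smul]
      norm_num
  · rintro ⟨t, Y, rfl⟩
    refine ⟨2 * t, fun v w => ?_⟩
    have := Y.2 v w
    simp only [_root_.smul_apply, _root_.add_apply, one_apply_eq_self, b.smul_left,
        b.smul_right, b.add_left, b.add_right]
    linear_combination 2 * this

-- For t(1 + X)(1 - X)⁻¹ at t = 1, X = 0, each of the two factors containing X contributes X, whence
-- the coefficient 2.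
set_option synthInstance.maxHeartbeats 200000 in
theorem hasFDerivAt_cayleyInv : HasFDerivAt b.cayleyInv
    ((ContinuousLinearMap.fst ℝ ℝ b.sp).smulRight (1 : V →L[ℝ] V) +
      (2 : ℝ) • (b.sp.subtypeL ∘L ContinuousLinearMap.snd ℝ ℝ b.sp)) ((1, 0) : ℝ × b.sp) := by
  have h2 : HasFDerivAt (fun y : ℝ × b.sp => (y.2 : V →L[ℝ] V))
      (b.sp.subtypeL ∘L ContinuousLinearMap.snd ℝ ℝ b.sp) ((1, 0) : ℝ × b.sp) :=
    (b.sp.subtypeL ∘L ContinuousLinearMap.snd ℝ ℝ b.sp).hasFDerivAt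
  have h3 := hasFDerivAt_ringInverse (𝕜 := ℝ) (1 : (V →L[ℝ] V)ˣ)
  have e : ((1 : (V →L[ℝ] V)ˣ) : V →L[ℝ] V) = 1 - (((1, 0) : ℝ × b.sp).2 : V →L[ℝ] V) := by simp
  rw [e] at h3
  have h4 := HasFDerivAt.comp (g := Ring.inverse) (f := fun y : ℝ × b.sp => 1 - (y.2 : V →L[ℝ] V))
    ((1, 0) : ℝ × b.sp) h3 (h2.const_sub 1)
  have hi : Ring.inverse (1 - (((1, 0) : ℝ × b.sp).2 : V →L[ℝ] V)) = 1 := by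
    rw [← e]; exact Ring.inverse_one _
  have h6 : HasFDerivAt (fun y : ℝ × b.sp => (1 + (y.2 : V →L[ℝ] V)) *
      Ring.inverse (1 - (y.2 : V →L[ℝ] V)))
      ((2 : ℝ) • (b.sp.subtypeL ∘L ContinuousLinearMap.snd ℝ ℝ b.sp)) ((1, 0) : ℝ × b.sp) := by
    refine ((h2.const_add 1).mul' h4).congr_fderiv (ContinuousLinearMap.ext fun y => ?_)
    change (1 + (0 : V →L[ℝ] V)) * -(1 * -(y.2 : V →L[ℝ] V) * 1) +
      (y.2 : V →L[ℝ] V) * Ring.inverse (1 - (((1, 0) : ℝ × b.sp).2 : V →L[ℝ] V)) =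
      (2 : ℝ) • (y.2 : V →L[ℝ] V)
    rw [hi, two_smul]
    simp only [add_zero, one_mul, mul_one, neg_neg]
  have h7 : HasFDerivAt (fun y : ℝ × b.sp => y.1 • (1 : V →L[ℝ] V))
      ((ContinuousLinearMap.fst ℝ ℝ b.sp).smulRight (1 : V →L[ℝ] V)) ((1, 0) : ℝ × b.sp) :=
    ((ContinuousLinearMap.fst ℝ ℝ b.sp).smulRight (1 : V →L[ℝ] V)).hasFDerivAt
  have h8 : b.cayleyInv = fun y : ℝ × b.sp => (y.1 • (1 : V →L[ℝ] V)) *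
      ((1 + (y.2 : V →L[ℝ] V)) * Ring.inverse (1 - (y.2 : V →L[ℝ] V))) := by
    funext y
    rw [smul_mul_assoc, one_mul]
    rfl
  rw [h8]
  have h9 := HasFDerivAt.fun_mul' (𝕜 := ℝ) (E := ℝ × b.sp) (𝔸 := V →L[ℝ] V)
    (a := fun y : ℝ × b.sp => y.1 • (1 : V →L[ℝ] V))
    (b := fun y : ℝ × b.sp => (1 + (y.2 : V →L[ℝ] V)) * Ring.inverse (1 - (y.2 : V →L[ℝ] V)))
    (b' := (2 : ℝ) • (b.sp.subtypeL ∘L ContinuousLinearMap.snd ℝ ℝ b.sp))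
    (x := ((1, 0) : ℝ × b.sp)) h7 h6
  refine h9.congr_fderiv (ContinuousLinearMap.ext fun y => ?_)
  change ((1 : ℝ) • (1 : V →L[ℝ] V)) * ((2 : ℝ) • (y.2 : V →L[ℝ] V)) +
    (y.1 • (1 : V →L[ℝ] V)) * ((1 + ((0 : b.sp) : V →L[ℝ] V)) *
      Ring.inverse (1 - (((1, 0) : ℝ × b.sp).2 : V →L[ℝ] V))) =
    y.1 • (1 : V →L[ℝ] V) + (2 : ℝ) • (y.2 : V →L[ℝ] V)
  rw [hi, Submodule.coe_zero, add_zero, mul_one, mul_one, one_smul, one_mul, add_comm]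

set_option synthInstance.maxHeartbeats 200000 in
theorem chart_one : CSp.chart (1 : b.CSp) 1 = ((1, 0) : ℝ × b.sp) := by
  change b.cayley ((1 : b.CSp)⁻¹ * 1).1.val = _
  have h : b.scale (1 : V →L[ℝ] V) = 1 := b.scale_eq fun v w => by simp
  rw [inv_one, one_mul]
  change b.cayley 1 = _
  refine Prod.ext ?_ ?_
  · change √(b.scale (1 : V →L[ℝ] V)) = 1
    rw [h, Real.sqrt_one]
  · change b.exists_proj.choose ((1 - √(b.scale (1 : V →L[ℝ] V)) • (1 : V →L[ℝ] V)) * _) = 0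
    rw [h, Real.sqrt_one, one_smul, sub_self, zero_mul]
    exact map_zero _

/-- In the Cayley chart at the identity the inclusion of the group is the inverse Cayley map, with
derivative (t, Y) ↦ t + 2Y there; the range of this map is csp(V). -/
theorem lieAlg_CSp : lieAlg (ℝ × b.sp) b.CSp.subtype = b.csp := by
  have hd : mvfderiv 𝓘(ℝ, ℝ × b.sp) (fun g : b.CSp => ((b.CSp.subtype g).val : V →L[ℝ] V)) 1 =
      ((ContinuousLinearMap.fst ℝ ℝ b.sp).smulRight (1 : V →L[ℝ] V) +
      (2 : ℝ) • (b.sp.subtypeL ∘L ContinuousLinearMap.snd ℝ ℝ b.sp) :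
        (ℝ × b.sp) →L[ℝ] (V →L[ℝ] V)) := by
    have h1 : MDifferentiableAt 𝓘(ℝ, ℝ × b.sp) 𝓘(ℝ, V →L[ℝ] V)
        (fun g : b.CSp => (g.1.val : V →L[ℝ] V)) 1 :=
      (CSp.contMDiff_val 1).mdifferentiableAt (by simp)
    have h2 : HasFDerivAt (writtenInExtChartAt 𝓘(ℝ, ℝ × b.sp) 𝓘(ℝ, V →L[ℝ] V) (1 : b.CSp)
        (fun g : b.CSp => (g.1.val : V →L[ℝ] V)))
        ((ContinuousLinearMap.fst ℝ ℝ b.sp).smulRight (1 : V →L[ℝ] V) +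
          (2 : ℝ) • (b.sp.subtypeL ∘L ContinuousLinearMap.snd ℝ ℝ b.sp))
        (extChartAt 𝓘(ℝ, ℝ × b.sp) (1 : b.CSp) 1) := by
      have e : extChartAt 𝓘(ℝ, ℝ × b.sp) (1 : b.CSp) 1 = ((1, 0) : ℝ × b.sp) := b.chart_one
      rw [e]
      refine b.hasFDerivAt_cayleyInv.congr_of_eventuallyEq ?_
      have hmem : ((1, 0) : ℝ × b.sp) ∈ b.cayleyTarget := by
        rw [← b.chart_one]; exact (CSp.chart (1 : b.CSp)).map_source (CSp.mem_chart_source 1)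
      filter_upwards [b.isOpen_cayleyTarget.mem_nhds hmem] with y hy
      exact (CSp.val_chart_symm (1 : b.CSp) hy).trans (one_mul _)
    have h3 : HasMFDerivAt 𝓘(ℝ, ℝ × b.sp) 𝓘(ℝ, V →L[ℝ] V)
        (fun g : b.CSp => (g.1.val : V →L[ℝ] V)) 1 _ :=
      ⟨h1.continuousAt, h2.hasFDerivWithinAt⟩
    exact h3.mfderiv
  ext X
  rw [mem_csp_iff, lieAlg, hd]
  constructor
  · rintro ⟨⟨t, Y⟩, rfl⟩
    exact ⟨t, Y, rfl⟩
  · rintro ⟨t, Y, rfl⟩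
    exact ⟨(t, Y), rfl⟩

end LieAlgebra

end SymplecticForm

/-! ### Functions and vector fields in charts. -/

section Coordinates

variable {E : Type*} [NormedAddCommGroup E] [NormedSpace ℝ E]
  {M : Type*} [TopologicalSpace M] [ChartedSpace E M]

/-- The derivative of the preferred chart at `x` in the point `y`. -/
noncomputable def chartDeriv (x y : M) : TangentSpace 𝓘(ℝ, E) y →L[ℝ] E :=
  mfderiv 𝓘(ℝ, E) 𝓘(ℝ, E) (extChartAt 𝓘(ℝ, E) x) y

/-- The derivative of the inverse of the preferred chart at `x` in the point `z`. -/
noncomputable def chartSymmDeriv (x : M) (z : E) :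
    E →L[ℝ] TangentSpace 𝓘(ℝ, E) ((extChartAt 𝓘(ℝ, E) x).symm z) :=
  mfderiv 𝓘(ℝ, E) 𝓘(ℝ, E) (extChartAt 𝓘(ℝ, E) x).symm z

/-- The coordinate expression of a vector field in the preferred chart at `x`. -/
noncomputable def vecInChart (X : Π y : M, TangentSpace 𝓘(ℝ, E) y) (x : M) (z : E) : E :=
  chartDeriv x ((extChartAt 𝓘(ℝ, E) x).symm z) (X ((extChartAt 𝓘(ℝ, E) x).symm z))

theorem extChartAt_target_mem_nhds_of_mem {x : M} {z : E} (hz : z ∈ (extChartAt 𝓘(ℝ, E) x).target) :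
    (extChartAt 𝓘(ℝ, E) x).target ∈ 𝓝 z :=
  (isOpen_extChartAt_target x).mem_nhds hz

variable [IsManifold 𝓘(ℝ, E) ∞ M]

instance : IsManifold 𝓘(ℝ, E) 1 M := IsManifold.of_le (n := ∞) (by simp)

theorem mdifferentiableAt_extChartAt_symm {x : M} {z : E}
    (hz : z ∈ (extChartAt 𝓘(ℝ, E) x).target) :
    MDifferentiableAt 𝓘(ℝ, E) 𝓘(ℝ, E) (extChartAt 𝓘(ℝ, E) x).symm z := by
  have h := mdifferentiableWithinAt_extChartAt_symm (I := 𝓘(ℝ, E)) hz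
  rwa [modelWithCornersSelf_coe, Set.range_id, mdifferentiableWithinAt_univ] at h

theorem contMDiffAt_extChartAt_symm {x : M} {z : E}
    (hz : z ∈ (extChartAt 𝓘(ℝ, E) x).target) :
    ContMDiffAt 𝓘(ℝ, E) 𝓘(ℝ, E) ∞ (extChartAt 𝓘(ℝ, E) x).symm z :=
  (contMDiffOn_extChartAt_symm x).contMDiffAt (extChartAt_target_mem_nhds_of_mem hz)

theorem chartDeriv_symmDeriv {x : M} {z : E} (hz : z ∈ (extChartAt 𝓘(ℝ, E) x).target) (w : E) :
    chartDeriv x ((extChartAt 𝓘(ℝ, E) x).symm z) (chartSymmDeriv x z w) = w := by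
  have h := mfderiv_extChartAt_comp_mfderivWithin_extChartAt_symm (I := 𝓘(ℝ, E)) hz
  rw [modelWithCornersSelf_coe, Set.range_id, mfderivWithin_univ] at h
  exact DFunLike.congr_fun h w

theorem chartSymmDeriv_deriv {x : M} {z : E} (hz : z ∈ (extChartAt 𝓘(ℝ, E) x).target)
    (v : TangentSpace 𝓘(ℝ, E) ((extChartAt 𝓘(ℝ, E) x).symm z)) :
    chartSymmDeriv x z (chartDeriv x ((extChartAt 𝓘(ℝ, E) x).symm z) v) = v := by
  have h := mfderivWithin_extChartAt_symm_comp_mfderiv_extChartAt (I := 𝓘(ℝ, E)) hz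
  rw [modelWithCornersSelf_coe, Set.range_id, mfderivWithin_univ] at h
  exact DFunLike.congr_fun h v

/-- The tangent space at x is the model space E as seen in the preferred chart at x, so this chart
has derivative the identity at x. Pointwise computations at x can hence be done in E without
correction terms. -/
theorem chartDeriv_self (x : M) (v : TangentSpace 𝓘(ℝ, E) x) : chartDeriv x x v = v := by
  have h := mfderiv_extChartAt_self (I := 𝓘(ℝ, E)) (x := x)
  exact DFunLike.congr_fun h v

theorem chartSymmDeriv_self (x : M) (w : E) :
    (chartSymmDeriv x (extChartAt 𝓘(ℝ, E) x x) w : E) = w := by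
  have h := mfderivWithin_range_extChartAt_symm (I := 𝓘(ℝ, E)) (x := x)
  rw [modelWithCornersSelf_coe, Set.range_id, mfderivWithin_univ] at h
  exact DFunLike.congr_fun h w

theorem chartSymmDeriv_vecInChart (X : Π y : M, TangentSpace 𝓘(ℝ, E) y) {x : M} {z : E}
    (hz : z ∈ (extChartAt 𝓘(ℝ, E) x).target) :
    chartSymmDeriv x z (vecInChart X x z) = X ((extChartAt 𝓘(ℝ, E) x).symm z) :=
  chartSymmDeriv_deriv hz _

theorem vecInChart_self (X : Π y : M, TangentSpace 𝓘(ℝ, E) y) (x : M) :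
    vecInChart X x (extChartAt 𝓘(ℝ, E) x x) = X x := by
  unfold vecInChart
  rw [extChartAt_to_inv]
  exact chartDeriv_self x (X x)

/-- A function which near `x` is the chart at `x` composed with `g` is differentiable (smooth) if
and only if `g` is. -/
theorem mdifferentiableAt_iff_comp_symm {F : Type*} [NormedAddCommGroup F] [NormedSpace ℝ F]
    {f : M → F} {x y : M} (hy : y ∈ (extChartAt 𝓘(ℝ, E) x).source) :
    MDifferentiableAt 𝓘(ℝ, E) 𝓘(ℝ, F) f y ↔
      DifferentiableAt ℝ (f ∘ (extChartAt 𝓘(ℝ, E) x).symm) (extChartAt 𝓘(ℝ, E) x y) := by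
  have hz := (extChartAt 𝓘(ℝ, E) x).map_source hy
  rw [← mdifferentiableAt_iff_differentiableAt]
  constructor
  · intro h
    have h' := mdifferentiableAt_extChartAt_symm hz
    rw [← (extChartAt 𝓘(ℝ, E) x).left_inv hy] at h
    exact h.comp _ h'
  · intro h
    have h' := mdifferentiableAt_extChartAt (I := 𝓘(ℝ, E)) (by rwa [extChartAt_source] at hy)
    refine (MDifferentiableAt.comp y h h').congr_of_eventuallyEq ?_
    filter_upwards [(isOpen_extChartAt_source x).mem_nhds hy] with y' hy'
    exact (congrArg f ((extChartAt 𝓘(ℝ, E) x).left_inv hy')).symm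

theorem contMDiffAt_iff_comp_symm {F : Type*} [NormedAddCommGroup F] [NormedSpace ℝ F]
    {f : M → F} {x y : M} (hy : y ∈ (extChartAt 𝓘(ℝ, E) x).source) :
    ContMDiffAt 𝓘(ℝ, E) 𝓘(ℝ, F) ∞ f y ↔
      ContDiffAt ℝ ∞ (f ∘ (extChartAt 𝓘(ℝ, E) x).symm) (extChartAt 𝓘(ℝ, E) x y) := by
  have hz := (extChartAt 𝓘(ℝ, E) x).map_source hy
  rw [← contMDiffAt_iff_contDiffAt]
  constructor
  · intro h
    have h' := contMDiffAt_extChartAt_symm hz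
    rw [← (extChartAt 𝓘(ℝ, E) x).left_inv hy] at h
    exact h.comp _ h'
  · intro h
    have h' := contMDiffAt_extChartAt' (I := 𝓘(ℝ, E)) (n := ∞) (by rwa [extChartAt_source] at hy)
    refine (ContMDiffAt.comp y h h').congr_of_eventuallyEq ?_
    filter_upwards [(isOpen_extChartAt_source x).mem_nhds hy] with y' hy'
    exact (congrArg f ((extChartAt 𝓘(ℝ, E) x).left_inv hy')).symm

theorem mvfderiv_eq_fderiv_comp_symm {F : Type*} [NormedAddCommGroup F] [NormedSpace ℝ F]
    {f : M → F} {x y : M} (hy : y ∈ (extChartAt 𝓘(ℝ, E) x).source)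
    (hf : DifferentiableAt ℝ (f ∘ (extChartAt 𝓘(ℝ, E) x).symm) (extChartAt 𝓘(ℝ, E) x y))
    (v : TangentSpace 𝓘(ℝ, E) y) :
    mvfderiv 𝓘(ℝ, E) f y v =
      fderiv ℝ (f ∘ (extChartAt 𝓘(ℝ, E) x).symm) (extChartAt 𝓘(ℝ, E) x y) (chartDeriv x y v) := by
  have h' := mdifferentiableAt_extChartAt (I := 𝓘(ℝ, E)) (x := x) (y := y)
    (by rwa [extChartAt_source] at hy)
  have he : f =ᶠ[𝓝 y] (f ∘ (extChartAt 𝓘(ℝ, E) x).symm) ∘ extChartAt 𝓘(ℝ, E) x := by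
    filter_upwards [(isOpen_extChartAt_source x).mem_nhds hy] with y' hy'
    exact (congrArg f ((extChartAt 𝓘(ℝ, E) x).left_inv hy')).symm
  have h1 : mfderiv 𝓘(ℝ, E) 𝓘(ℝ, F) f y = _ :=
    he.mfderiv_eq.trans (mfderiv_comp y hf.mdifferentiableAt h')
  rw [mfderiv_eq_fderiv] at h1
  exact DFunLike.congr_fun h1 v

theorem mvfderiv_eq_fderiv_self {F : Type*} [NormedAddCommGroup F] [NormedSpace ℝ F]
    {f : M → F} {x : M}
    (hf : DifferentiableAt ℝ (f ∘ (extChartAt 𝓘(ℝ, E) x).symm) (extChartAt 𝓘(ℝ, E) x x))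
    (v : TangentSpace 𝓘(ℝ, E) x) :
    mvfderiv 𝓘(ℝ, E) f x v =
      fderiv ℝ (f ∘ (extChartAt 𝓘(ℝ, E) x).symm) (extChartAt 𝓘(ℝ, E) x x) v := by
  rw [mvfderiv_eq_fderiv_comp_symm (mem_extChartAt_source x) hf, chartDeriv_self]

theorem trivializationAt_tangent_snd (X : Π y : M, TangentSpace 𝓘(ℝ, E) y) {x y : M}
    (hy : y ∈ (chartAt E x).source) :
    (trivializationAt E (TangentSpace 𝓘(ℝ, E)) x ⟨y, X y⟩).2 = chartDeriv x y (X y) := by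
  have h := TangentBundle.continuousLinearMapAt_trivializationAt (I := 𝓘(ℝ, E)) hy
  have h2 := congrFun (Trivialization.continuousLinearMapAt_apply ℝ
    (trivializationAt E (TangentSpace 𝓘(ℝ, E)) x) y) (X y)
  rw [h] at h2
  refine Eq.trans ?_ h2.symm
  rw [Trivialization.coe_linearMapAt_of_mem]
  simpa using hy

theorem differentiableAt_vecInChart {X : Π y : M, TangentSpace 𝓘(ℝ, E) y} {x : M}
    (hX : MDifferentiableAt 𝓘(ℝ, E) 𝓘(ℝ, E).tangent
      (fun y => (⟨y, X y⟩ : TangentBundle 𝓘(ℝ, E) M)) x) :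
    DifferentiableAt ℝ (vecInChart X x) (extChartAt 𝓘(ℝ, E) x x) := by
  have h := (mdifferentiableAt_section (IB := 𝓘(ℝ, E)) (F := E) X).1 hX
  have h' : MDifferentiableAt 𝓘(ℝ, E) 𝓘(ℝ, E) (fun y => chartDeriv x y (X y)) x := by
    refine h.congr_of_eventuallyEq ?_
    filter_upwards [(chartAt E x).open_source.mem_nhds (mem_chart_source E x)] with y hy
    exact (trivializationAt_tangent_snd X hy).symm
  exact (mdifferentiableAt_iff_comp_symm (mem_extChartAt_source x)).1 h'

theorem contDiffAt_vecInChart {X : Π y : M, TangentSpace 𝓘(ℝ, E) y} {x : M}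
    (hX : ContMDiffAt 𝓘(ℝ, E) 𝓘(ℝ, E).tangent ∞
      (fun y => (⟨y, X y⟩ : TangentBundle 𝓘(ℝ, E) M)) x) :
    ContDiffAt ℝ ∞ (vecInChart X x) (extChartAt 𝓘(ℝ, E) x x) := by
  have h := (contMDiffAt_section (IB := 𝓘(ℝ, E)) (F := E) x).1 hX
  have h' : ContMDiffAt 𝓘(ℝ, E) 𝓘(ℝ, E) ∞ (fun y => chartDeriv x y (X y)) x := by
    refine h.congr_of_eventuallyEq ?_
    filter_upwards [(chartAt E x).open_source.mem_nhds (mem_chart_source E x)] with y hy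
    exact (trivializationAt_tangent_snd X hy).symm
  exact (contMDiffAt_iff_comp_symm (mem_extChartAt_source x)).1 h'

theorem lieBracketWithin_univ_eq_of_eventuallyEq {V W V' W' : E → E} {z : E}
    (hV : V =ᶠ[𝓝 z] V') (hW : W =ᶠ[𝓝 z] W') :
    VectorField.lieBracketWithin ℝ V W univ z = fderiv ℝ W' z (V' z) - fderiv ℝ V' z (W' z) := by
  rw [VectorField.lieBracketWithin_univ, hV.lieBracket_vectorField_eq hW, VectorField.lieBracket_eq]

/-- The bracket is the chart bracket transported back by the derivative of the chart, which is the
identity at its own centre. -/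
theorem mlieBracket_eq_fderiv (X Y : Π y : M, TangentSpace 𝓘(ℝ, E) y) (x : M) :
    VectorField.mlieBracket 𝓘(ℝ, E) X Y x =
      (fderiv ℝ (vecInChart Y x) (extChartAt 𝓘(ℝ, E) x x) (X x) -
        fderiv ℝ (vecInChart X x) (extChartAt 𝓘(ℝ, E) x x) (Y x) : E) := by
  have key : ∀ X : Π y : M, TangentSpace 𝓘(ℝ, E) y,
      VectorField.mpullbackWithin 𝓘(ℝ, E) 𝓘(ℝ, E) (extChartAt 𝓘(ℝ, E) x).symm X univ
        =ᶠ[𝓝 (extChartAt 𝓘(ℝ, E) x x)] vecInChart X x := by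
    intro X
    filter_upwards [extChartAt_target_mem_nhds x] with z hz
    rw [VectorField.mpullbackWithin_apply, mfderivWithin_univ]
    have hi : (mfderiv 𝓘(ℝ, E) 𝓘(ℝ, E) (extChartAt 𝓘(ℝ, E) x).symm z).inverse =
        chartDeriv x ((extChartAt 𝓘(ℝ, E) x).symm z) :=
      ContinuousLinearMap.inverse_eq (ContinuousLinearMap.ext fun w => chartSymmDeriv_deriv hz w)
        (ContinuousLinearMap.ext fun w => chartDeriv_symmDeriv hz w)
    rw [hi]
    rfl
  have hinv : ∀ w : E, ((mfderiv 𝓘(ℝ, E) 𝓘(ℝ, E) (extChartAt 𝓘(ℝ, E) x) x).inverse w : E) = w := by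
    have h : (mfderiv 𝓘(ℝ, E) 𝓘(ℝ, E) (extChartAt 𝓘(ℝ, E) x) x).inverse =
        ContinuousLinearMap.id ℝ E :=
      ContinuousLinearMap.inverse_eq (ContinuousLinearMap.ext fun w => chartDeriv_self x w)
        (ContinuousLinearMap.ext fun w => chartDeriv_self x w)
    exact fun w => DFunLike.congr_fun h w
  rw [← VectorField.mlieBracketWithin_univ, VectorField.mlieBracketWithin_apply,
    modelWithCornersSelf_coe, Set.range_id, Set.preimage_univ, Set.univ_inter]
  refine (hinv _).trans ((lieBracketWithin_univ_eq_of_eventuallyEq (key X) (key Y)).trans ?_)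
  rw [vecInChart_self X x, vecInChart_self Y x]

end Coordinates

/-! ### Alternating two-forms on a vector space and their calculus. -/

section FlatTwoForms

variable {E : Type*} [NormedAddCommGroup E] [NormedSpace ℝ E]

theorem contAlt_ext {F : Type*} [AddCommGroup F] [Module ℝ F] [TopologicalSpace F]
    {σ τ : F [⋀^Fin 2]→L[ℝ] ℝ} (h : ∀ x y, σ ![x, y] = τ ![x, y]) : σ = τ :=
  ContinuousAlternatingMap.ext fun v => by
    have hv : v = ![v 0, v 1] := by funext i; fin_cases i <;> rfl
    rw [hv]
    exact h _ _

theorem contAlt_swap {F : Type*} [AddCommGroup F] [Module ℝ F] [TopologicalSpace F]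
    (σ : F [⋀^Fin 2]→L[ℝ] ℝ) (x y : F) : σ ![x, y] = -σ ![y, x] :=
  altTwo_swap σ.toAlternatingMap x y

theorem contAlt_comp {F G : Type*} [AddCommGroup F] [Module ℝ F] [TopologicalSpace F]
    [AddCommGroup G] [Module ℝ G] [TopologicalSpace G]
    (σ : F [⋀^Fin 2]→L[ℝ] ℝ) (A : G →L[ℝ] F) (x y : G) :
    σ.compContinuousLinearMap A ![x, y] = σ ![A x, A y] := by
  rw [ContinuousAlternatingMap.compContinuousLinearMap_apply]
  congr 1
  funext i
  fin_cases i <;> rfl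

theorem contAlt_comp_three {F G : Type*} [AddCommGroup F] [Module ℝ F] [TopologicalSpace F]
    [AddCommGroup G] [Module ℝ G] [TopologicalSpace G]
    (σ : F [⋀^Fin 3]→L[ℝ] ℝ) (A : G →L[ℝ] F) (x y z : G) :
    σ.compContinuousLinearMap A ![x, y, z] = σ ![A x, A y, A z] := by
  rw [ContinuousAlternatingMap.compContinuousLinearMap_apply]
  congr 1
  funext i
  fin_cases i <;> rfl

variable [FiniteDimensional ℝ E]

/-- A skew symmetric bilinear map on a finite dimensional space as a continuous alternating map. -/
noncomputable def contAltTwo (f : E → E → ℝ) (hadd : ∀ x x' y, f (x + x') y = f x y + f x' y)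
    (hsmul : ∀ (c : ℝ) x y, f (c • x) y = c • f x y) (hswap : ∀ x y, f x y = -f y x) :
    E [⋀^Fin 2]→L[ℝ] ℝ :=
  { altTwo f hadd hsmul hswap with
    cont := by
      let B : E →ₗ[ℝ] E →ₗ[ℝ] ℝ := LinearMap.mk₂ ℝ f hadd hsmul
        (fun x y y' => by rw [hswap, hadd, hswap y, hswap y']; abel)
        (fun c x y => by rw [hswap, hsmul, hswap y, smul_neg, neg_neg])
      let L : E →ₗ[ℝ] (E →L[ℝ] ℝ) :=
        (LinearMap.toContinuousLinearMap (𝕜 := ℝ) (E := E) (F' := ℝ)).toLinearMap ∘ₗ B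
      have hL : Continuous L := L.continuous_of_finiteDimensional
      exact (hL.comp (continuous_apply (0 : Fin 2))).clm_apply (continuous_apply (1 : Fin 2)) }

theorem contAlt_add_left (σ : E [⋀^Fin 2]→L[ℝ] ℝ) (x x' y : E) :
    σ ![x + x', y] = σ ![x, y] + σ ![x', y] := altTwo_add_left σ.toAlternatingMap x x' y

theorem contAlt_smul_left (σ : E [⋀^Fin 2]→L[ℝ] ℝ) (c : ℝ) (x y : E) :
    σ ![c • x, y] = c * σ ![x, y] := altTwo_smul_left σ.toAlternatingMap c x y

theorem contAlt_add_right (σ : E [⋀^Fin 2]→L[ℝ] ℝ) (x y y' : E) :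
    σ ![x, y + y'] = σ ![x, y] + σ ![x, y'] := by
  rw [contAlt_swap, contAlt_add_left, contAlt_swap σ y, contAlt_swap σ y']; ring

theorem contAlt_smul_right (σ : E [⋀^Fin 2]→L[ℝ] ℝ) (c : ℝ) (x y : E) :
    σ ![x, c • y] = c * σ ![x, y] := by
  rw [contAlt_swap, contAlt_smul_left, contAlt_swap σ y]; ring

/-- An alternating form as a bilinear map. -/
def contAltBilin (σ : E [⋀^Fin 2]→L[ℝ] ℝ) : E →ₗ[ℝ] E →ₗ[ℝ] ℝ :=
  LinearMap.mk₂ ℝ (fun x y => σ ![x, y]) (contAlt_add_left σ) (contAlt_smul_left σ)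
    (contAlt_add_right σ) (contAlt_smul_right σ)

theorem contAlt_sum (σ : E [⋀^Fin 2]→L[ℝ] ℝ) (x y : E) :
    σ ![x, y] = ∑ i, ∑ j, (finBasis ℝ E).repr x i * ((finBasis ℝ E).repr y j *
      σ ![finBasis ℝ E i, finBasis ℝ E j]) := by
  have h := LinearMap.sum_repr_mul_repr_mul (B := contAltBilin σ) (finBasis ℝ E) (finBasis ℝ E) x y
  refine h.symm.trans ?_
  rw [Finsupp.sum_fintype _ _ (by simp)]
  refine Finset.sum_congr rfl fun i _ => ?_
  rw [Finsupp.sum_fintype _ _ (by simp)]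
  rfl

/-- The coefficients of an alternating form. -/
noncomputable def contAltCoeff :
    (E [⋀^Fin 2]→L[ℝ] ℝ) →ₗ[ℝ] (Fin (finrank ℝ E) → Fin (finrank ℝ E) → ℝ) where
  toFun σ i j := σ ![finBasis ℝ E i, finBasis ℝ E j]
  map_add' _ _ := rfl
  map_smul' _ _ := rfl

theorem contAltCoeff_injective : Function.Injective (contAltCoeff (E := E)) := fun σ τ h =>
  contAlt_ext fun x y => by
    rw [contAlt_sum σ, contAlt_sum τ]
    have h' : ∀ i j, σ ![finBasis ℝ E i, finBasis ℝ E j] = τ ![finBasis ℝ E i, finBasis ℝ E j] :=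
      fun i j => congrFun (congrFun h i) j
    simp only [h']

instance : FiniteDimensional ℝ (E [⋀^Fin 2]→L[ℝ] ℝ) :=
  FiniteDimensional.of_injective (contAltCoeff (E := E)) contAltCoeff_injective

variable {D : Type*} [NormedAddCommGroup D] [NormedSpace ℝ D]
  {F : Type*} [NormedAddCommGroup F] [NormedSpace ℝ F]

/-- The coefficient map is linear and injective, so a linear left inverse turns smooth coefficients
into a smooth form. -/
theorem contDiffAt_alt_of_apply {n : WithTop ℕ∞} {f : D → E [⋀^Fin 2]→L[ℝ] ℝ} {z : D}
    (h : ∀ x y, ContDiffAt ℝ n (fun z => f z ![x, y]) z) : ContDiffAt ℝ n f z := by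
  obtain ⟨g, hg⟩ := LinearMap.exists_leftInverse_of_injective (contAltCoeff (E := E))
    (LinearMap.ker_eq_bot.2 contAltCoeff_injective)
  have h1 : ContDiffAt ℝ n (fun z => contAltCoeff (f z)) z :=
    contDiffAt_pi.2 fun i => contDiffAt_pi.2 fun j => h _ _
  have h2 := (LinearMap.toContinuousLinearMap g).contDiff.contDiffAt.comp z h1
  refine h2.congr_of_eventuallyEq (Filter.Eventually.of_forall fun z => ?_)
  exact (LinearMap.congr_fun hg (f z)).symm

theorem ContDiffAt.contAlt_apply {n : WithTop ℕ∞} {f : D → E [⋀^Fin 2]→L[ℝ] ℝ} {u v : D → E} {z : D}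
    (hf : ContDiffAt ℝ n f z) (hu : ContDiffAt ℝ n u z) (hv : ContDiffAt ℝ n v z) :
    ContDiffAt ℝ n (fun z => f z ![u z, v z]) z := by
  have hr : ∀ (u : D → E) (_ : ContDiffAt ℝ n u z) i,
      ContDiffAt ℝ n (fun z => (finBasis ℝ E).repr (u z) i) z := fun u hu i =>
    (LinearMap.toContinuousLinearMap ((finBasis ℝ E).coord i)).contDiff.contDiffAt.comp z hu
  have hc : ∀ i j, ContDiffAt ℝ n (fun z => f z ![finBasis ℝ E i, finBasis ℝ E j]) z := fun i j =>
    (ContinuousAlternatingMap.apply ℝ E ℝ ![finBasis ℝ E i, finBasis ℝ E j]).contDiff.contDiffAt.comp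
      z hf
  simp only [fun z => contAlt_sum (f z) (u z) (v z)]
  exact ContDiffAt.sum fun i _ => ContDiffAt.sum fun j _ =>
    (hr u hu i).mul ((hr v hv j).mul (hc i j))

theorem ContDiffAt.contAlt_comp {G : Type*} [NormedAddCommGroup G] [NormedSpace ℝ G]
    [FiniteDimensional ℝ G]
    {n : WithTop ℕ∞} {f : D → E [⋀^Fin 2]→L[ℝ] ℝ} {A : D → G →L[ℝ] E} {z : D}
    (hf : ContDiffAt ℝ n f z) (hA : ContDiffAt ℝ n A z) :
    ContDiffAt ℝ n (fun z => (f z).compContinuousLinearMap (A z)) z :=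
  contDiffAt_alt_of_apply fun x y => by
    simp only [_root_.contAlt_comp]
    exact hf.contAlt_apply (hA.clm_apply contDiffAt_const) (hA.clm_apply contDiffAt_const)

theorem hasFDerivAt_contAlt_apply {f : D → E [⋀^Fin 2]→L[ℝ] ℝ} {u v : D → E} {z : D}
    (hf : DifferentiableAt ℝ f z) (hu : DifferentiableAt ℝ u z) (hv : DifferentiableAt ℝ v z) :
    DifferentiableAt ℝ (fun z => f z ![u z, v z]) z ∧ ∀ w,
      fderiv ℝ (fun z => f z ![u z, v z]) z w =
        fderiv ℝ f z w ![u z, v z] + f z ![fderiv ℝ u z w, v z] + f z ![u z, fderiv ℝ v z w] := by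
  have hg : ∀ i, DifferentiableAt ℝ ((![u, v] : Fin 2 → D → E) i) z := fun i => by
    fin_cases i <;> assumption
  have he : ∀ z, (fun i => (![u, v] : Fin 2 → D → E) i z) = ![u z, v z] := fun z => by
    funext i; fin_cases i <;> rfl
  have h1 := hf.continuousAlternatingMap_apply hg
  have h2 := fun w => fderiv_continuousAlternatingMap_apply_apply hf hg w
  simp only [he, Fin.sum_univ_two, SymplecticForm.update_zero, SymplecticForm.update_one] at h1 h2
  refine ⟨h1, fun w => ?_⟩
  rw [h2 w, add_assoc]
  rfl

theorem extDeriv_two_apply {f : E → E [⋀^Fin 2]→L[ℝ] ℝ} {z : E} (hf : DifferentiableAt ℝ f z)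
    (x y w : E) : _root_.extDeriv f z ![x, y, w] =
      fderiv ℝ f z x ![y, w] - fderiv ℝ f z y ![x, w] + fderiv ℝ f z w ![x, y] := by
  rw [_root_.extDeriv_apply hf, Fin.sum_univ_three]
  have h0 : (0 : Fin 3).removeNth ![x, y, w] = ![y, w] := by funext i; fin_cases i <;> rfl
  have h1 : (1 : Fin 3).removeNth ![x, y, w] = ![x, w] := by funext i; fin_cases i <;> rfl
  have h2 : (2 : Fin 3).removeNth ![x, y, w] = ![x, y] := by funext i; fin_cases i <;> rfl
  rw [h0, h1, h2, fderiv_continuousAlternatingMap_apply_const_apply hf,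
    fderiv_continuousAlternatingMap_apply_const_apply hf,
    fderiv_continuousAlternatingMap_apply_const_apply hf]
  simp
  ring

theorem contAlt_three_ext {F : Type*} [AddCommGroup F] [Module ℝ F] [TopologicalSpace F]
    {σ τ : F [⋀^Fin 3]→L[ℝ] ℝ} (h : ∀ x y z, σ ![x, y, z] = τ ![x, y, z]) : σ = τ :=
  ContinuousAlternatingMap.ext fun v => by
    have hv : v = ![v 0, v 1, v 2] := by funext i; fin_cases i <;> rfl
    rw [hv]
    exact h _ _ _

end FlatTwoForms

/-! ### Two-forms on manifolds in charts. -/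

section TwoFormsInCharts

variable {E : Type*} [NormedAddCommGroup E] [NormedSpace ℝ E]
  {M : Type*} [TopologicalSpace M] [ChartedSpace E M] [IsManifold 𝓘(ℝ, E) ∞ M]

namespace TwoForm

variable (τ : TwoForm E M)

theorem inChart_apply (x : M) (z v w : E) :
    τ.inChart x z ![v, w] =
      τ ((extChartAt 𝓘(ℝ, E) x).symm z) ![chartSymmDeriv x z v, chartSymmDeriv x z w] :=
  contAlt_comp (τ ((extChartAt 𝓘(ℝ, E) x).symm z)) (chartSymmDeriv x z) v w

theorem inChart_vecInChart (X Y : Π y : M, TangentSpace 𝓘(ℝ, E) y) {x : M} {z : E}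
    (hz : z ∈ (extChartAt 𝓘(ℝ, E) x).target) :
    τ.inChart x z ![vecInChart X x z, vecInChart Y x z] =
      τ ((extChartAt 𝓘(ℝ, E) x).symm z) ![X ((extChartAt 𝓘(ℝ, E) x).symm z),
        Y ((extChartAt 𝓘(ℝ, E) x).symm z)] := by
  rw [inChart_apply, chartSymmDeriv_vecInChart X hz, chartSymmDeriv_vecInChart Y hz]

theorem inChart_chartDeriv {x m : M} (hm : m ∈ (extChartAt 𝓘(ℝ, E) x).source)
    (v w : TangentSpace 𝓘(ℝ, E) m) :
    τ.inChart x (extChartAt 𝓘(ℝ, E) x m) ![chartDeriv x m v, chartDeriv x m w] = τ m ![v, w] := by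
  obtain ⟨z, hz, rfl⟩ : ∃ z ∈ (extChartAt 𝓘(ℝ, E) x).target, (extChartAt 𝓘(ℝ, E) x).symm z = m :=
    ⟨_, (extChartAt 𝓘(ℝ, E) x).map_source hm, (extChartAt 𝓘(ℝ, E) x).left_inv hm⟩
  rw [(extChartAt 𝓘(ℝ, E) x).right_inv hz, inChart_apply, chartSymmDeriv_deriv hz,
    chartSymmDeriv_deriv hz]

theorem inChart_self (x : M) (v w : TangentSpace 𝓘(ℝ, E) x) :
    τ.inChart x (extChartAt 𝓘(ℝ, E) x x) ![v, w] = τ x ![v, w] := by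
  have h := τ.inChart_chartDeriv (mem_extChartAt_source (I := 𝓘(ℝ, E)) x) v w
  rw [chartDeriv_self, chartDeriv_self] at h
  exact h

/-- The change of coordinates between the preferred charts at `x'` and `x`. -/
noncomputable def _root_.coordChange (x x' : M) (z : E) : E :=
  extChartAt 𝓘(ℝ, E) x ((extChartAt 𝓘(ℝ, E) x').symm z)

theorem _root_.contDiffAt_coordChange {x x' : M} {z : E}
    (hz : z ∈ (extChartAt 𝓘(ℝ, E) x').target)
    (hz' : (extChartAt 𝓘(ℝ, E) x').symm z ∈ (extChartAt 𝓘(ℝ, E) x).source) :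
    ContDiffAt ℝ ∞ (coordChange x x') z := by
  rw [← contMDiffAt_iff_contDiffAt]
  exact ContMDiffAt.comp z (contMDiffAt_extChartAt' (by rwa [extChartAt_source] at hz'))
    (contMDiffAt_extChartAt_symm hz)

theorem _root_.fderiv_coordChange {x x' : M} {z : E}
    (hz : z ∈ (extChartAt 𝓘(ℝ, E) x').target)
    (hz' : (extChartAt 𝓘(ℝ, E) x').symm z ∈ (extChartAt 𝓘(ℝ, E) x).source) (v : E) :
    fderiv ℝ (coordChange x x') z v =
      chartDeriv x ((extChartAt 𝓘(ℝ, E) x').symm z) (chartSymmDeriv x' z v) := by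
  rw [← mfderiv_eq_fderiv]
  exact DFunLike.congr_fun (mfderiv_comp z
    (mdifferentiableAt_extChartAt (by rwa [extChartAt_source] at hz'))
    (mdifferentiableAt_extChartAt_symm hz)) v

theorem inChart_coordChange {x x' m : M} (hm : m ∈ (extChartAt 𝓘(ℝ, E) x).source)
    (hm' : m ∈ (extChartAt 𝓘(ℝ, E) x').source) :
    τ.inChart x' =ᶠ[𝓝 (extChartAt 𝓘(ℝ, E) x' m)] fun z =>
      (τ.inChart x (coordChange x x' z)).compContinuousLinearMap
        (fderiv ℝ (coordChange x x') z) := by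
  have ht := extChartAt_target_mem_nhds_of_mem ((extChartAt 𝓘(ℝ, E) x').map_source hm')
  have hc : ContinuousAt (extChartAt 𝓘(ℝ, E) x').symm (extChartAt 𝓘(ℝ, E) x' m) :=
    continuousAt_extChartAt_symm' hm'
  have hs : ∀ᶠ z in 𝓝 (extChartAt 𝓘(ℝ, E) x' m),
      (extChartAt 𝓘(ℝ, E) x').symm z ∈ (extChartAt 𝓘(ℝ, E) x).source := by
    refine hc.eventually ((isOpen_extChartAt_source x).mem_nhds ?_)
    rwa [(extChartAt 𝓘(ℝ, E) x').left_inv hm']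
  filter_upwards [ht, hs] with z hz hz'
  refine contAlt_ext fun v w => ?_
  rw [contAlt_comp, fderiv_coordChange hz hz', fderiv_coordChange hz hz', inChart_apply]
  exact (τ.inChart_chartDeriv hz' _ _).symm

variable [FiniteDimensional ℝ E]

theorem contDiffAt_inChart_of_contDiffAt {x x' m : M}
    (hm : m ∈ (extChartAt 𝓘(ℝ, E) x).source) (hm' : m ∈ (extChartAt 𝓘(ℝ, E) x').source)
    (h : ContDiffAt ℝ ∞ (τ.inChart x) (extChartAt 𝓘(ℝ, E) x m)) :
    ContDiffAt ℝ ∞ (τ.inChart x') (extChartAt 𝓘(ℝ, E) x' m) := by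
  refine ContDiffAt.congr_of_eventuallyEq ?_ (τ.inChart_coordChange hm hm')
  have hz := (extChartAt 𝓘(ℝ, E) x').map_source hm'
  have hz' : (extChartAt 𝓘(ℝ, E) x').symm (extChartAt 𝓘(ℝ, E) x' m) ∈
      (extChartAt 𝓘(ℝ, E) x).source := by rwa [(extChartAt 𝓘(ℝ, E) x').left_inv hm']
  have hc := contDiffAt_coordChange hz hz'
  have he : coordChange x x' (extChartAt 𝓘(ℝ, E) x' m) = extChartAt 𝓘(ℝ, E) x m := by
    unfold coordChange
    rw [(extChartAt 𝓘(ℝ, E) x').left_inv hm']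
  rw [← he] at h
  exact ContDiffAt.contAlt_comp (ContDiffAt.comp (g := τ.inChart x) (f := coordChange x x') _ h hc)
    (hc.fderiv_right (m := ∞) le_rfl)

/-- The trivialization of Λ²T*M centred at x precomposes a form with the derivative of the inverse
chart, so the trivialized section is the coordinate expression. -/
theorem contMDiffAt_iff_inChart (x : M) :
    ContMDiffAt 𝓘(ℝ, E) (𝓘(ℝ, E).prod 𝓘(ℝ, E [⋀^Fin 2]→L[ℝ] ℝ)) ∞
      (fun x => (⟨x, τ x⟩ : TotalSpace (E [⋀^Fin 2]→L[ℝ] ℝ)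
        (fun x : M => TangentSpace 𝓘(ℝ, E) x [⋀^Fin 2]→L[ℝ] Bundle.Trivial M ℝ x))) x ↔
      ContDiffAt ℝ ∞ (τ.inChart x) (extChartAt 𝓘(ℝ, E) x x) := by
  have h := contMDiffAt_section (IB := 𝓘(ℝ, E)) (n := ∞) (F := E [⋀^Fin 2]→L[ℝ] ℝ)
    (E := fun x : M => TangentSpace 𝓘(ℝ, E) x [⋀^Fin 2]→L[ℝ] Bundle.Trivial M ℝ x) (s := τ) x
  refine h.trans ((contMDiffAt_iff_comp_symm (mem_extChartAt_source x)).trans ?_)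
  have key : ∀ᶠ z in 𝓝 (extChartAt 𝓘(ℝ, E) x x), ((fun y : M => (trivializationAt
      (E [⋀^Fin 2]→L[ℝ] ℝ) (fun x : M => TangentSpace 𝓘(ℝ, E) x [⋀^Fin 2]→L[ℝ] Bundle.Trivial M ℝ x)
      x ⟨y, τ y⟩).2) ∘ (extChartAt 𝓘(ℝ, E) x).symm) z = τ.inChart x z := ?_
  · exact ⟨fun h => h.congr_of_eventuallyEq (key.mono fun _ h => h.symm),
      fun h => h.congr_of_eventuallyEq key⟩
  filter_upwards [extChartAt_target_mem_nhds x] with z hz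
  have hs : (extChartAt 𝓘(ℝ, E) x).symm z ∈ (chartAt E x).source := by
    rw [← extChartAt_source 𝓘(ℝ, E)]; exact (extChartAt 𝓘(ℝ, E) x).map_target hz
  have hl := TangentBundle.symmL_trivializationAt (I := 𝓘(ℝ, E)) hs
  rw [modelWithCornersSelf_coe, Set.range_id, mfderivWithin_univ,
    (extChartAt 𝓘(ℝ, E) x).right_inv hz] at hl
  refine ContinuousAlternatingMap.ext fun v => ?_
  change (trivializationAt ℝ (Bundle.Trivial M ℝ) x).continuousLinearMapAt ℝ
    ((extChartAt 𝓘(ℝ, E) x).symm z) ((τ ((extChartAt 𝓘(ℝ, E) x).symm z))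
      ((trivializationAt E (TangentSpace 𝓘(ℝ, E)) x).symmL ℝ ((extChartAt 𝓘(ℝ, E) x).symm z) ∘ v)) =
    τ ((extChartAt 𝓘(ℝ, E) x).symm z)
      (mfderiv 𝓘(ℝ, E) 𝓘(ℝ, E) (extChartAt 𝓘(ℝ, E) x).symm z ∘ v)
  rw [hl]
  exact DFunLike.congr_fun (Bundle.Trivial.continuousLinearMapAt_trivialization ℝ M ℝ _) _

theorem smoothOn_iff {U : Set M} (hU : IsOpen U) :
    τ.SmoothOn U ↔ ∀ x ∈ U, ContDiffAt ℝ ∞ (τ.inChart x) (extChartAt 𝓘(ℝ, E) x x) := by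
  refine ⟨fun h x hx => (τ.contMDiffAt_iff_inChart x).1 ((h x hx).contMDiffAt (hU.mem_nhds hx)),
    fun h x hx => ((τ.contMDiffAt_iff_inChart x).2 (h x hx)).contMDiffWithinAt⟩

theorem SmoothOn.contDiffAt {τ : TwoForm E M} {U : Set M} (hU : IsOpen U) (h : τ.SmoothOn U)
    {x m : M} (hm : m ∈ U) (hx : m ∈ (extChartAt 𝓘(ℝ, E) x).source) :
    ContDiffAt ℝ ∞ (τ.inChart x) (extChartAt 𝓘(ℝ, E) x m) :=
  τ.contDiffAt_inChart_of_contDiffAt (mem_extChartAt_source m) hx ((τ.smoothOn_iff hU).1 h m hm)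

theorem smoothOn_of_contDiffAt {U : Set M} (hU : IsOpen U) {x : M}
    (hUx : U ⊆ (extChartAt 𝓘(ℝ, E) x).source)
    (h : ∀ m ∈ U, ContDiffAt ℝ ∞ (τ.inChart x) (extChartAt 𝓘(ℝ, E) x m)) : τ.SmoothOn U :=
  (τ.smoothOn_iff hU).2 fun m hm =>
    τ.contDiffAt_inChart_of_contDiffAt (hUx hm) (mem_extChartAt_source m) (h m hm)

theorem extDeriv_self_apply (x : M) (u v w : TangentSpace 𝓘(ℝ, E) x) :
    τ.extDeriv x ![u, v, w] =
      _root_.extDeriv (τ.inChart x) (extChartAt 𝓘(ℝ, E) x x) ![u, v, w] := by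
  refine (contAlt_comp_three (_root_.extDeriv (τ.inChart x) (extChartAt 𝓘(ℝ, E) x x))
    (chartDeriv x x) u v w).trans ?_
  rw [chartDeriv_self, chartDeriv_self, chartDeriv_self]

/-- `TwoForm.extDeriv` uses at each point the chart preferred there. Naturality of d under
coordinate changes allows one fixed chart to be used on its whole domain, as is needed for
differential identities on open sets. -/
theorem extDeriv_eq_inChart {x m : M} (hm : m ∈ (extChartAt 𝓘(ℝ, E) x).source)
    (h : DifferentiableAt ℝ (τ.inChart x) (extChartAt 𝓘(ℝ, E) x m))
    (u v w : TangentSpace 𝓘(ℝ, E) m) :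
    τ.extDeriv m ![u, v, w] = _root_.extDeriv (τ.inChart x) (extChartAt 𝓘(ℝ, E) x m)
      ![chartDeriv x m u, chartDeriv x m v, chartDeriv x m w] := by
  have hz := mem_extChartAt_target (I := 𝓘(ℝ, E)) m
  have hz' : (extChartAt 𝓘(ℝ, E) m).symm (extChartAt 𝓘(ℝ, E) m m) ∈
      (extChartAt 𝓘(ℝ, E) x).source := by rwa [extChartAt_to_inv]
  have he : coordChange x m (extChartAt 𝓘(ℝ, E) m m) = extChartAt 𝓘(ℝ, E) x m := by
    unfold coordChange
    rw [extChartAt_to_inv]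
  have hd : ∀ v : TangentSpace 𝓘(ℝ, E) m,
      fderiv ℝ (coordChange x m) (extChartAt 𝓘(ℝ, E) m m) v = chartDeriv x m v := by
    intro v
    refine (fderiv_coordChange hz hz' v).trans ?_
    have h1 := chartSymmDeriv_self (E := E) m v
    -- The inverse chart returns m only up to a proof of equality; the tangent vector is transported
    -- by stating the claim for an arbitrary equal point.
    have h2 : ∀ (m' : M) (_ : m' = m) (v' : TangentSpace 𝓘(ℝ, E) m'), (v' : E) = v →
      chartDeriv x m' v' = chartDeriv x m v := by rintro m' rfl v' rfl; rfl
    exact h2 _ (extChartAt_to_inv m) _ h1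
  have h2 : minSmoothness ℝ 2 ≤ ∞ := by
    rw [minSmoothness_of_isRCLikeNormedField]
    exact WithTop.coe_le_coe.2 (le_top : (2 : ℕ∞) ≤ ⊤)
  refine (τ.extDeriv_self_apply m u v w).trans ?_
  rw [(τ.inChart_coordChange hm (mem_extChartAt_source m)).extDeriv_eq,
    extDeriv_pullback (by rwa [he]) (contDiffAt_coordChange hz hz') h2]
  refine (contAlt_comp_three (F := E) (G := E) (_root_.extDeriv (τ.inChart x)
    (coordChange x m (extChartAt 𝓘(ℝ, E) m m))) (fderiv ℝ (coordChange x m) _) u v w).trans ?_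
  rw [he]
  refine congrArg _ ?_
  funext i
  fin_cases i
  exacts [hd u, hd v, hd w]

end TwoForm

end TwoFormsInCharts

/-! ### Christoffel symbols and the induced connection on two-forms. -/

section Christoffel

variable {E : Type*} [NormedAddCommGroup E] [NormedSpace ℝ E]
  {M : Type*} [TopologicalSpace M] [ChartedSpace E M] [IsManifold 𝓘(ℝ, E) ∞ M]

theorem exists_vectorField (x : M) (v : TangentSpace 𝓘(ℝ, E) x) :
    ∃ X : Π y : M, TangentSpace 𝓘(ℝ, E) y, MDifferentiableAt 𝓘(ℝ, E) 𝓘(ℝ, E).tangent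
      (fun y => (⟨y, X y⟩ : TangentBundle 𝓘(ℝ, E) M)) x ∧ X x = v :=
  ⟨FiberBundle.extend E v, FiberBundle.mdifferentiableAt_extend .., by simp⟩

variable [FiniteDimensional ℝ E]

namespace TwoForm

theorem mvfderiv_apply_vectorField {τ : TwoForm E M} {x : M}
    (hτ : DifferentiableAt ℝ (τ.inChart x) (extChartAt 𝓘(ℝ, E) x x))
    {X Y : Π y : M, TangentSpace 𝓘(ℝ, E) y}
    (hX : MDifferentiableAt 𝓘(ℝ, E) 𝓘(ℝ, E).tangent
      (fun y => (⟨y, X y⟩ : TangentBundle 𝓘(ℝ, E) M)) x)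
    (hY : MDifferentiableAt 𝓘(ℝ, E) 𝓘(ℝ, E).tangent
      (fun y => (⟨y, Y y⟩ : TangentBundle 𝓘(ℝ, E) M)) x) (v : E) :
    mvfderiv 𝓘(ℝ, E) (fun y => τ y ![X y, Y y]) x v =
      fderiv ℝ (τ.inChart x) (extChartAt 𝓘(ℝ, E) x x) v
        ![vecInChart X x (extChartAt 𝓘(ℝ, E) x x), vecInChart Y x (extChartAt 𝓘(ℝ, E) x x)] +
      τ.inChart x (extChartAt 𝓘(ℝ, E) x x)
        ![fderiv ℝ (vecInChart X x) (extChartAt 𝓘(ℝ, E) x x) v,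
          vecInChart Y x (extChartAt 𝓘(ℝ, E) x x)] +
      τ.inChart x (extChartAt 𝓘(ℝ, E) x x)
        ![vecInChart X x (extChartAt 𝓘(ℝ, E) x x),
          fderiv ℝ (vecInChart Y x) (extChartAt 𝓘(ℝ, E) x x) v] := by
  obtain ⟨h1, h2⟩ := hasFDerivAt_contAlt_apply hτ (differentiableAt_vecInChart hX)
    (differentiableAt_vecInChart hY)
  have he : (fun y => τ y ![X y, Y y]) ∘ (extChartAt 𝓘(ℝ, E) x).symm
      =ᶠ[𝓝 (extChartAt 𝓘(ℝ, E) x x)]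
      fun z => τ.inChart x z ![vecInChart X x z, vecInChart Y x z] := by
    filter_upwards [extChartAt_target_mem_nhds x] with z hz
    exact (τ.inChart_vecInChart X Y hz).symm
  refine (mvfderiv_eq_fderiv_self (h1.congr_of_eventuallyEq he) v).trans ?_
  rw [he.fderiv_eq, h2]

end TwoForm

namespace LinearConnection

variable (D : LinearConnection E M)

/-- The covariant derivative of a vector field in a point, in the preferred chart at this point. -/
def coordDeriv (X : Π y : M, TangentSpace 𝓘(ℝ, E) y) (x : M) : E →L[ℝ] E := D X x

/-- The bilinear map `Γ` consists of the Christoffel symbols of `D` in the point `x`, in the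
preferred chart at `x`. -/
def IsChristoffelAt (x : M) (Γ : E →ₗ[ℝ] E →ₗ[ℝ] E) : Prop :=
  ∀ X : Π y : M, TangentSpace 𝓘(ℝ, E) y, MDifferentiableAt 𝓘(ℝ, E) 𝓘(ℝ, E).tangent
      (fun y => (⟨y, X y⟩ : TangentBundle 𝓘(ℝ, E) M)) x → ∀ v : E,
    D.coordDeriv X x v = fderiv ℝ (vecInChart X x) (extChartAt 𝓘(ℝ, E) x x) v +
      Γ (vecInChart X x (extChartAt 𝓘(ℝ, E) x x)) v

theorem vecInChart_add (X Y : Π y : M, TangentSpace 𝓘(ℝ, E) y) (x : M) :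
    vecInChart (X + Y) x = vecInChart X x + vecInChart Y x := by
  funext z
  exact map_add (chartDeriv x ((extChartAt 𝓘(ℝ, E) x).symm z)) _ _

theorem vecInChart_smul (f : M → ℝ) (X : Π y : M, TangentSpace 𝓘(ℝ, E) y) (x : M) :
    vecInChart (f • X) x = (f ∘ (extChartAt 𝓘(ℝ, E) x).symm) • vecInChart X x := by
  funext z
  exact map_smul (chartDeriv x ((extChartAt 𝓘(ℝ, E) x).symm z)) _ _

/-- The Leibniz terms cancel in the difference of the covariant and the coordinate derivative. The
difference is thus tensorial and depends on the vector field only through its value at x. -/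
theorem exists_isChristoffelAt (x : M) : ∃ Γ, D.IsChristoffelAt x Γ := by
  let e := extChartAt 𝓘(ℝ, E) x
  let Φ : (Π y : M, TangentSpace 𝓘(ℝ, E) y) → (E →L[ℝ] E) := fun X =>
    D.coordDeriv X x - fderiv ℝ (vecInChart X x) (e x)
  have hΦ : TensorialAt 𝓘(ℝ, E) E Φ x := by
    constructor
    · intro f X hf hX
      have hd := differentiableAt_vecInChart hX
      have hf' := (mdifferentiableAt_iff_comp_symm (mem_extChartAt_source x)).1 hf
      refine ContinuousLinearMap.ext fun v => ?_
      have h5 : vecInChart X x (e x) = X x := vecInChart_self X x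
      have h1 : D.coordDeriv (f • X) x v = f x • D.coordDeriv X x v +
          (mvfderiv 𝓘(ℝ, E) f x v) • vecInChart X x (e x) := by
        rw [h5]
        exact DFunLike.congr_fun (D.isCovariantDerivativeOn.leibniz hX hf) v
      have h2 : fderiv ℝ (vecInChart (f • X) x) (e x) v = f x • fderiv ℝ (vecInChart X x) (e x) v +
          (mvfderiv 𝓘(ℝ, E) f x v) • vecInChart X x (e x) := by
        have h3 : mvfderiv 𝓘(ℝ, E) f x v = fderiv ℝ (f ∘ e.symm) (e x) v :=
          mvfderiv_eq_fderiv_self hf' v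
        have h4 : (f ∘ e.symm) (e x) = f x := congrArg f (extChartAt_to_inv x)
        have h6 := DFunLike.congr_fun (fderiv_smul hf' hd) v
        rw [h3, vecInChart_smul, ← h4]
        exact h6
      change D.coordDeriv (f • X) x v - fderiv ℝ (vecInChart (f • X) x) (e x) v =
        f x • (D.coordDeriv X x v - fderiv ℝ (vecInChart X x) (e x) v)
      rw [h1, h2, smul_sub]
      abel
    · intro X Y hX hY
      refine ContinuousLinearMap.ext fun v => ?_
      have h1 : D.coordDeriv (X + Y) x v = D.coordDeriv X x v + D.coordDeriv Y x v :=
        DFunLike.congr_fun (D.isCovariantDerivativeOn.add hX hY) v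
      have h2 : fderiv ℝ (vecInChart (X + Y) x) (e x) v = fderiv ℝ (vecInChart X x) (e x) v +
          fderiv ℝ (vecInChart Y x) (e x) v := by
        rw [vecInChart_add]
        exact DFunLike.congr_fun (fderiv_add (differentiableAt_vecInChart hX)
          (differentiableAt_vecInChart hY)) v
      change D.coordDeriv (X + Y) x v - fderiv ℝ (vecInChart (X + Y) x) (e x) v =
        (D.coordDeriv X x v - fderiv ℝ (vecInChart X x) (e x) v) +
        (D.coordDeriv Y x v - fderiv ℝ (vecInChart Y x) (e x) v)
      rw [h1, h2]
      abel
  let L : E →L[ℝ] (E →L[ℝ] E) := TensorialAt.mkHom Φ x hΦ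
  refine ⟨(ContinuousLinearMap.coeLM ℝ) ∘ₗ L.toLinearMap, fun X hX v => ?_⟩
  have h : L (vecInChart X x (e x)) = Φ X := by
    rw [show vecInChart X x (e x) = X x from vecInChart_self X x]
    exact TensorialAt.mkHom_apply hΦ hX
  change _ = _ + L (vecInChart X x (e x)) v
  rw [h]
  exact (add_sub_cancel (fderiv ℝ (vecInChart X x) (e x) v) (D.coordDeriv X x v)).symm

/-- The torsion in a point, in the preferred chart at this point. -/
noncomputable def coordTorsion (x : M) (v w : E) : E := CovariantDerivative.torsion D x v w

variable {D}

/-- The bracket cancels the coordinate derivatives in ∇_v Y - ∇_w X. The second slot of Γ is the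
direction of differentiation, whence the order of the terms. -/
theorem torsion_eq_of_isChristoffelAt {x : M} {Γ : E →ₗ[ℝ] E →ₗ[ℝ] E} (hΓ : D.IsChristoffelAt x Γ)
    (v w : E) : D.coordTorsion x v w = Γ w v - Γ v w := by
  obtain ⟨X, hX, hXv⟩ := exists_vectorField x v
  obtain ⟨Y, hY, hYw⟩ := exists_vectorField x w
  have hXv' : vecInChart X x (extChartAt 𝓘(ℝ, E) x x) = v := (vecInChart_self X x).trans hXv
  have hYw' : vecInChart Y x (extChartAt 𝓘(ℝ, E) x x) = w := (vecInChart_self Y x).trans hYw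
  have h := CovariantDerivative.torsion_apply D hX hY
  rw [mlieBracket_eq_fderiv, hXv, hYw] at h
  refine h.trans ?_
  change D.coordDeriv Y x v - D.coordDeriv X x w -
    (fderiv ℝ (vecInChart Y x) (extChartAt 𝓘(ℝ, E) x x) v -
      fderiv ℝ (vecInChart X x) (extChartAt 𝓘(ℝ, E) x x) w) = _
  rw [hΓ Y hY v, hΓ X hX w, hXv', hYw']
  abel

/-- By the product rule, the coordinate derivatives of the vector fields cancel those inside ∇X and
∇Y. What remains depends only on the values at x, so the defining property becomes an explicit
formula for β. -/
theorem isTwoFormDerivAt_iff {x : M} {Γ : E →ₗ[ℝ] E →ₗ[ℝ] E} (hΓ : D.IsChristoffelAt x Γ)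
    {τ : TwoForm E M} (hτ : DifferentiableAt ℝ (τ.inChart x) (extChartAt 𝓘(ℝ, E) x x)) (v : E)
    (β : E [⋀^Fin 2]→L[ℝ] ℝ) :
    D.IsTwoFormDerivAt τ x v β ↔ ∀ X Y : E, β ![X, Y] =
      fderiv ℝ (τ.inChart x) (extChartAt 𝓘(ℝ, E) x x) v ![X, Y] -
      τ.inChart x (extChartAt 𝓘(ℝ, E) x x) ![Γ X v, Y] -
      τ.inChart x (extChartAt 𝓘(ℝ, E) x x) ![X, Γ Y v] := by
  have key : ∀ X Y : Π y : M, TangentSpace 𝓘(ℝ, E) y,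
      MDifferentiableAt 𝓘(ℝ, E) 𝓘(ℝ, E).tangent
        (fun y => (⟨y, X y⟩ : TangentBundle 𝓘(ℝ, E) M)) x →
      MDifferentiableAt 𝓘(ℝ, E) 𝓘(ℝ, E).tangent
        (fun y => (⟨y, Y y⟩ : TangentBundle 𝓘(ℝ, E) M)) x → ∀ v' w' : E,
      vecInChart X x (extChartAt 𝓘(ℝ, E) x x) = v' → vecInChart Y x (extChartAt 𝓘(ℝ, E) x x) = w' →
      mvfderiv 𝓘(ℝ, E) (fun y => τ y ![X y, Y y]) x v
        - τ x ![D X x v, Y x] - τ x ![X x, D Y x v] =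
      fderiv ℝ (τ.inChart x) (extChartAt 𝓘(ℝ, E) x x) v ![v', w'] -
      τ.inChart x (extChartAt 𝓘(ℝ, E) x x) ![Γ v' v, w'] -
      τ.inChart x (extChartAt 𝓘(ℝ, E) x x) ![v', Γ w' v] := by
    rintro X Y hX hY v' w' rfl rfl
    have h1 := TwoForm.mvfderiv_apply_vectorField hτ hX hY v
    have h2 : τ x ![D X x v, Y x] = τ.inChart x (extChartAt 𝓘(ℝ, E) x x)
        ![D.coordDeriv X x v, vecInChart Y x (extChartAt 𝓘(ℝ, E) x x)] := by
      rw [vecInChart_self]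
      exact (τ.inChart_self x (D X x v) (Y x)).symm
    have h3 : τ x ![X x, D Y x v] = τ.inChart x (extChartAt 𝓘(ℝ, E) x x)
        ![vecInChart X x (extChartAt 𝓘(ℝ, E) x x), D.coordDeriv Y x v] := by
      rw [vecInChart_self]
      exact (τ.inChart_self x (X x) (D Y x v)).symm
    rw [h1, h2, h3, hΓ X hX v, hΓ Y hY v, contAlt_add_left, contAlt_add_right]
    ring
  constructor
  · intro h v' w'
    obtain ⟨X, hX, hXv⟩ := exists_vectorField x v'
    obtain ⟨Y, hY, hYw⟩ := exists_vectorField x w'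
    have h' := (h X Y hX hY).trans (key X Y hX hY v' w' ((vecInChart_self X x).trans hXv)
      ((vecInChart_self Y x).trans hYw))
    rw [hXv, hYw] at h'
    exact h'
  · intro h X Y hX hY
    exact (h (X x) (Y x)).trans (key X Y hX hY _ _ (vecInChart_self X x) (vecInChart_self Y x)).symm

theorem exists_isTwoFormDerivAt {x : M}
    {τ : TwoForm E M} (hτ : DifferentiableAt ℝ (τ.inChart x) (extChartAt 𝓘(ℝ, E) x x)) (v : E) :
    ∃ β, D.IsTwoFormDerivAt τ x v β := by
  obtain ⟨Γ, hΓ⟩ := D.exists_isChristoffelAt x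
  set σ := fderiv ℝ (τ.inChart x) (extChartAt 𝓘(ℝ, E) x x) v
  set η := τ.inChart x (extChartAt 𝓘(ℝ, E) x x)
  refine ⟨contAltTwo (E := E) (fun X Y => σ ![X, Y] - η ![Γ X v, Y] - η ![X, Γ Y v]) ?_ ?_ ?_,
    (isTwoFormDerivAt_iff hΓ hτ v _).2 fun X Y => rfl⟩
  · intro X X' Y
    simp only [map_add, LinearMap.add_apply, contAlt_add_left]
    ring
  · intro c X Y
    simp only [map_smul, LinearMap.smul_apply, contAlt_smul_left, smul_eq_mul]
    ring
  · intro X Y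
    rw [contAlt_swap σ, contAlt_swap η, contAlt_swap η X]
    ring

theorem IsTwoFormDerivAt.unique {x : M} {τ : TwoForm E M} {v : TangentSpace 𝓘(ℝ, E) x}
    {β β' : TwoCovector E x} (h : D.IsTwoFormDerivAt τ x v β) (h' : D.IsTwoFormDerivAt τ x v β') :
    β = β' := contAlt_ext fun v w => by
  obtain ⟨X, hX, rfl⟩ := exists_vectorField x v
  obtain ⟨Y, hY, rfl⟩ := exists_vectorField x w
  rw [h X Y hX hY, h' X Y hX hY]

theorem IsTwoFormDerivAt.twoFormDeriv_eq {x : M} {τ : TwoForm E M} {v : TangentSpace 𝓘(ℝ, E) x}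
    {β : TwoCovector E x} (h : D.IsTwoFormDerivAt τ x v β) : D.twoFormDeriv τ x v = β := by
  have h' : ∃ β, D.IsTwoFormDerivAt τ x v β := ⟨β, h⟩
  rw [twoFormDeriv, dif_pos h']
  exact h'.choose_spec.unique h

theorem isTwoFormDerivAt_twoFormDeriv {x : M} {τ : TwoForm E M}
    (hτ : DifferentiableAt ℝ (τ.inChart x) (extChartAt 𝓘(ℝ, E) x x)) (v : E) :
    D.IsTwoFormDerivAt τ x v (D.twoFormDeriv τ x v) := by
  obtain ⟨β, h⟩ := exists_isTwoFormDerivAt (D := D) hτ v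
  rwa [h.twoFormDeriv_eq]

/-- The exterior derivative in terms of the covariant derivative and the torsion. -/
theorem extDeriv_eq_of_isTwoFormDerivAt {x : M}
    {τ : TwoForm E M} (hτ : DifferentiableAt ℝ (τ.inChart x) (extChartAt 𝓘(ℝ, E) x x))
    {β : E → E [⋀^Fin 2]→L[ℝ] ℝ} (hβ : ∀ v, D.IsTwoFormDerivAt τ x v (β v)) (X Y Z : E) :
    τ.extDeriv x ![X, Y, Z] = β X ![Y, Z] - β Y ![X, Z] + β Z ![X, Y] +
      τ.inChart x (extChartAt 𝓘(ℝ, E) x x) ![D.coordTorsion x X Y, Z] -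
      τ.inChart x (extChartAt 𝓘(ℝ, E) x x) ![D.coordTorsion x X Z, Y] +
      τ.inChart x (extChartAt 𝓘(ℝ, E) x x) ![D.coordTorsion x Y Z, X] := by
  obtain ⟨Γ, hΓ⟩ := D.exists_isChristoffelAt x
  have hβ' := fun v => (isTwoFormDerivAt_iff hΓ hτ v _).1 (hβ v)
  have hT : ∀ v w : E, D.coordTorsion x v w = Γ w v + (-1 : ℝ) • Γ v w :=
    fun v w => (torsion_eq_of_isChristoffelAt hΓ v w).trans (by module)
  refine (τ.extDeriv_self_apply x X Y Z).trans ?_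
  -- Alternating the formula for β gives dτ and six terms in Γ, which pair up to the three torsion
  -- terms.
  rw [extDeriv_two_apply hτ, hβ', hβ', hβ', hT, hT, hT]
  set η := τ.inChart x (extChartAt 𝓘(ℝ, E) x x)
  simp only [contAlt_add_left, contAlt_smul_left]
  rw [contAlt_swap η Y, contAlt_swap η X, contAlt_swap η X]
  ring

end LinearConnection

end Christoffel

/-! ### Locality and multiplication of two-forms by functions. -/

section TwoFormCalculus

variable {E : Type*} [NormedAddCommGroup E] [NormedSpace ℝ E]
  {M : Type*} [TopologicalSpace M] [ChartedSpace E M]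

theorem mvfderiv_apply_congr {F : Type*} [NormedAddCommGroup F] [NormedSpace ℝ F]
    {f g : M → F} {x : M} (h : f =ᶠ[𝓝 x] g) (v : TangentSpace 𝓘(ℝ, E) x) :
    mvfderiv 𝓘(ℝ, E) f x v = mvfderiv 𝓘(ℝ, E) g x v :=
  DFunLike.congr_fun h.mfderiv_eq v

variable [IsManifold 𝓘(ℝ, E) ∞ M]

namespace TwoForm

theorem inChart_congr {τ τ' : TwoForm E M} {x y : M} (hy : y ∈ (extChartAt 𝓘(ℝ, E) x).source)
    (h : ∀ᶠ m in 𝓝 y, τ m = τ' m) :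
    τ.inChart x =ᶠ[𝓝 (extChartAt 𝓘(ℝ, E) x y)] τ'.inChart x := by
  have hc : ContinuousAt (extChartAt 𝓘(ℝ, E) x).symm (extChartAt 𝓘(ℝ, E) x y) :=
    continuousAt_extChartAt_symm' hy
  have h' : ∀ᶠ m in 𝓝 ((extChartAt 𝓘(ℝ, E) x).symm (extChartAt 𝓘(ℝ, E) x y)), τ m = τ' m := by
    rwa [(extChartAt 𝓘(ℝ, E) x).left_inv hy]
  filter_upwards [hc.eventually h'] with z hz
  unfold inChart
  rw [hz]

theorem inChart_smul (f : M → ℝ) (τ : TwoForm E M) (x : M) :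
    inChart (fun y => f y • τ y) x =
      fun z => (f ∘ (extChartAt 𝓘(ℝ, E) x).symm) z • τ.inChart x z := by
  funext z
  exact contAlt_ext fun v w => rfl

variable [FiniteDimensional ℝ E]

theorem mdifferentiableAt_apply_vectorField {τ : TwoForm E M} {x : M}
    (hτ : DifferentiableAt ℝ (τ.inChart x) (extChartAt 𝓘(ℝ, E) x x))
    {X Y : Π y : M, TangentSpace 𝓘(ℝ, E) y}
    (hX : MDifferentiableAt 𝓘(ℝ, E) 𝓘(ℝ, E).tangent
      (fun y => (⟨y, X y⟩ : TangentBundle 𝓘(ℝ, E) M)) x)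
    (hY : MDifferentiableAt 𝓘(ℝ, E) 𝓘(ℝ, E).tangent
      (fun y => (⟨y, Y y⟩ : TangentBundle 𝓘(ℝ, E) M)) x) :
    MDifferentiableAt 𝓘(ℝ, E) 𝓘(ℝ, ℝ) (fun y => τ y ![X y, Y y]) x := by
  refine (mdifferentiableAt_iff_comp_symm (mem_extChartAt_source x)).2 ?_
  refine (hasFDerivAt_contAlt_apply hτ (differentiableAt_vecInChart hX)
    (differentiableAt_vecInChart hY)).1.congr_of_eventuallyEq ?_
  filter_upwards [extChartAt_target_mem_nhds x] with z hz
  exact (τ.inChart_vecInChart X Y hz).symm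

theorem exists_ne_zero {F : Type*} [AddCommGroup F] [Module ℝ F] [TopologicalSpace F]
    {σ : F [⋀^Fin 2]→L[ℝ] ℝ} (h : σ ≠ 0) : ∃ v w, σ ![v, w] ≠ 0 := by
  by_contra! h'
  exact h (contAlt_ext h')

/-- Take two vectors on which τ₀ does not vanish at x and extend them constantly in the chart. The
factor is the quotient of the values of τ and τ₀ on them, smooth where the denominator is non-zero.
-/
theorem exists_smooth_ratio {τ τ₀ : TwoForm E M} {U : Set M} (hU : IsOpen U) (hτ : τ.SmoothOn U)
    (hτ₀ : τ₀.SmoothOn U) {x : M} (hx : x ∈ U) (h₀ : τ₀ x ≠ 0)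
    (hs : ∀ y ∈ U, τ y ∈ Submodule.span ℝ {τ₀ y}) :
    ∃ U' ⊆ U, IsOpen U' ∧ x ∈ U' ∧ ∃ f : M → ℝ,
      (∀ y ∈ U', ContMDiffAt 𝓘(ℝ, E) 𝓘(ℝ, ℝ) ∞ f y) ∧ ∀ y ∈ U', τ y = f y • τ₀ y ∧ τ₀ y ≠ 0 := by
  set e := extChartAt 𝓘(ℝ, E) x
  obtain ⟨v, w, hvw⟩ : ∃ v w : E, τ₀.inChart x (e x) ![v, w] ≠ 0 := by
    obtain ⟨v, w, h⟩ := exists_ne_zero h₀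
    refine ⟨v, w, ?_⟩
    rw [τ₀.inChart_self x v w]
    exact h
  let g : TwoForm E M → M → ℝ := fun τ m => τ.inChart x (e m) ![v, w]
  have hg : ∀ τ : TwoForm E M, τ.SmoothOn U → ∀ m ∈ U ∩ e.source,
      ContMDiffAt 𝓘(ℝ, E) 𝓘(ℝ, ℝ) ∞ (g τ) m := by
    intro τ hτ m hm
    have h1 : ContDiffAt ℝ ∞ (fun z => τ.inChart x z ![v, w]) (e m) :=
      (SmoothOn.contDiffAt hU hτ hm.1 hm.2).contAlt_apply contDiffAt_const contDiffAt_const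
    exact h1.contMDiffAt.comp m (contMDiffAt_extChartAt' (by
      have := hm.2; rwa [extChartAt_source] at this))
  have ho : IsOpen (U ∩ e.source) := hU.inter (isOpen_extChartAt_source x)
  refine ⟨U ∩ e.source ∩ g τ₀ ⁻¹' {0}ᶜ, fun y hy => hy.1.1, ?_,
    ⟨⟨hx, mem_extChartAt_source x⟩, hvw⟩, fun m => g τ m / g τ₀ m, ?_, ?_⟩
  · exact ContinuousOn.isOpen_inter_preimage
      (fun m hm => (hg τ₀ hτ₀ m hm).continuousAt.continuousWithinAt) ho isOpen_compl_singleton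
  · intro y hy
    exact (hg τ hτ y hy.1).div₀ (hg τ₀ hτ₀ y hy.1) hy.2
  · intro y hy
    have hy0 : g τ₀ y ≠ 0 := hy.2
    obtain ⟨c, hc⟩ := Submodule.mem_span_singleton.1 (hs y hy.1.1)
    have h1 : ∀ m, m = y → τ m = c • τ₀ m := by rintro m rfl; exact hc.symm
    have h2 : τ (e.symm (e y)) = c • τ₀ (e.symm (e y)) := h1 _ (e.left_inv hy.1.2)
    have h3 : g τ y = c * g τ₀ y := by
      change τ.inChart x (e y) ![v, w] = c * τ₀.inChart x (e y) ![v, w]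
      rw [inChart_apply, inChart_apply, h2]
      rfl
    refine ⟨?_, fun h => hy0 ?_⟩
    · change τ y = (g τ y / g τ₀ y) • τ₀ y
      rw [h3, mul_div_cancel_right₀ _ hy0, hc]
    · have h4 : ∀ m, m = y → τ₀ m = 0 := by rintro m rfl; exact h
      change τ₀.inChart x (e y) ![v, w] = 0
      rw [inChart_apply, h4 _ (e.left_inv hy.1.2)]
      rfl

theorem extDeriv_congr {τ τ' : TwoForm E M} {x : M} (h : ∀ᶠ m in 𝓝 x, τ m = τ' m) :
    τ.extDeriv x = τ'.extDeriv x := by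
  unfold extDeriv
  rw [(inChart_congr (mem_extChartAt_source x) h).extDeriv_eq]

theorem extDeriv_smul {f : M → ℝ} {τ : TwoForm E M} {x : M}
    (hf : MDifferentiableAt 𝓘(ℝ, E) 𝓘(ℝ, ℝ) f x)
    (hτ : DifferentiableAt ℝ (τ.inChart x) (extChartAt 𝓘(ℝ, E) x x))
    (X Y Z : TangentSpace 𝓘(ℝ, E) x) :
    extDeriv (fun y => f y • τ y) x ![X, Y, Z] = f x * τ.extDeriv x ![X, Y, Z] +
      (mvfderiv 𝓘(ℝ, E) f x X * τ x ![Y, Z] - mvfderiv 𝓘(ℝ, E) f x Y * τ x ![X, Z] +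
        mvfderiv 𝓘(ℝ, E) f x Z * τ x ![X, Y]) := by
  have hf' := (mdifferentiableAt_iff_comp_symm (mem_extChartAt_source x)).1 hf
  have h1 := (extDeriv_self_apply (fun y => f y • τ y) x X Y Z)
  have h2 := τ.extDeriv_self_apply x X Y Z
  rw [h1, h2, ← τ.inChart_self x Y Z, ← τ.inChart_self x X Z, ← τ.inChart_self x X Y]
  have hd : ∀ v : E, mvfderiv 𝓘(ℝ, E) f x v =
      fderiv ℝ (f ∘ (extChartAt 𝓘(ℝ, E) x).symm) (extChartAt 𝓘(ℝ, E) x x) v :=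
    fun v => mvfderiv_eq_fderiv_self hf' v
  have hs : DifferentiableAt ℝ (fun z => (f ∘ (extChartAt 𝓘(ℝ, E) x).symm) z • τ.inChart x z)
    (extChartAt 𝓘(ℝ, E) x x) := hf'.smul hτ
  have h3 : ∀ v a b : E, fderiv ℝ (fun z => (f ∘ (extChartAt 𝓘(ℝ, E) x).symm) z • τ.inChart x z)
      (extChartAt 𝓘(ℝ, E) x x) v ![a, b] =
      f x * fderiv ℝ (τ.inChart x) (extChartAt 𝓘(ℝ, E) x x) v ![a, b] +
      mvfderiv 𝓘(ℝ, E) f x v * τ.inChart x (extChartAt 𝓘(ℝ, E) x x) ![a, b] := by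
    intro v a b
    have h4 := DFunLike.congr_fun (fderiv_smul hf' hτ) v
    have h5 : (f ∘ (extChartAt 𝓘(ℝ, E) x).symm) (extChartAt 𝓘(ℝ, E) x x) = f x :=
      congrArg f (extChartAt_to_inv x)
    rw [hd, ← h5]
    exact DFunLike.congr_fun h4 ![a, b]
  rw [inChart_smul]
  refine (extDeriv_two_apply hs X Y Z).trans ?_
  refine Eq.trans ?_ (congrArg (fun t => f x * t + _) (extDeriv_two_apply hτ X Y Z)).symm
  rw [h3 X Y Z, h3 Y X Z, h3 Z X Y]
  ring

end TwoForm

namespace LinearConnection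

variable [FiniteDimensional ℝ E] {D : LinearConnection E M}

theorem IsTwoFormDerivAt.congr {x : M} {τ τ' : TwoForm E M} {v : TangentSpace 𝓘(ℝ, E) x}
    {β : TwoCovector E x} (h : D.IsTwoFormDerivAt τ x v β) (hτ : ∀ᶠ m in 𝓝 x, τ m = τ' m) :
    D.IsTwoFormDerivAt τ' x v β := by
  intro X Y hX hY
  rw [h X Y hX hY, hτ.self_of_nhds,
    mvfderiv_apply_congr (f := fun y => τ y ![X y, Y y]) (g := fun y => τ' y ![X y, Y y])
      (hτ.mono fun m hm => by simp only [hm])]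

theorem IsTwoFormDerivAt.smul {x : M} {τ : TwoForm E M} {v : TangentSpace 𝓘(ℝ, E) x}
    {β : TwoCovector E x} (h : D.IsTwoFormDerivAt τ x v β)
    (hτ : DifferentiableAt ℝ (τ.inChart x) (extChartAt 𝓘(ℝ, E) x x)) {f : M → ℝ}
    (hf : MDifferentiableAt 𝓘(ℝ, E) 𝓘(ℝ, ℝ) f x) :
    D.IsTwoFormDerivAt (fun y => f y • τ y) x v (mvfderiv 𝓘(ℝ, E) f x v • τ x + f x • β) := by
  intro X Y hX hY
  have h1 := DFunLike.congr_fun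
    (mvfderiv_mul hf (TwoForm.mdifferentiableAt_apply_vectorField hτ hX hY)) v
  have h2 := h X Y hX hY
  have h3 : mvfderiv 𝓘(ℝ, E) (fun y => (f y • τ y) ![X y, Y y]) x v =
      f x * mvfderiv 𝓘(ℝ, E) (fun y => τ y ![X y, Y y]) x v +
        τ x ![X x, Y x] * mvfderiv 𝓘(ℝ, E) f x v := h1
  rw [h3]
  change mvfderiv 𝓘(ℝ, E) f x v * τ x ![X x, Y x] + f x * β ![X x, Y x] =
    _ - f x * τ x ![D X x v, Y x] - f x * τ x ![X x, D Y x v]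
  rw [h2]
  ring

end LinearConnection

end TwoFormCalculus

/-! ### Compatible torsion-free connections: flatness and parallel sections. -/

section CompatibleConnections

variable {E : Type*} [NormedAddCommGroup E] [NormedSpace ℝ E]
  {M : Type*} [TopologicalSpace M] [ChartedSpace E M] [IsManifold 𝓘(ℝ, E) ∞ M]

variable [FiniteDimensional ℝ E]

namespace TwoForm

theorem SmoothOn.differentiableAt {τ : TwoForm E M} {U : Set M} (hU : IsOpen U) (h : τ.SmoothOn U)
    {x : M} (hx : x ∈ U) : DifferentiableAt ℝ (τ.inChart x) (extChartAt 𝓘(ℝ, E) x x) :=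
  (SmoothOn.contDiffAt hU h hx (mem_extChartAt_source x)).differentiableAt (by simp)

theorem SmoothOn.mono {τ : TwoForm E M} {U U' : Set M} (h : τ.SmoothOn U) (hU : U' ⊆ U) :
    τ.SmoothOn U' := ContMDiffOn.mono h hU

/-- The symplectic form on the tangent space given by a non-degenerate two-form. -/
noncomputable def symplecticAt (τ : TwoForm E M) (x : M)
    (h : ∀ v : TangentSpace 𝓘(ℝ, E) x, (∀ w : TangentSpace 𝓘(ℝ, E) x, τ x ![v, w] = 0) → v = 0) :
    SymplecticForm E where
  form := τ.inChart x (extChartAt 𝓘(ℝ, E) x x)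
  nondegenerate v hv := h v fun w => (τ.inChart_self x v w).symm.trans (hv w)

/-- If the wedge product of a one-form with a non-degenerate two-form vanishes, then so does the
one-form. -/
theorem eq_zero_of_wedge_eq_zero (hE : 3 ≤ finrank ℝ E) [Nontrivial E] (τ : TwoForm E M) {x : M}
    (h : ∀ v : TangentSpace 𝓘(ℝ, E) x, (∀ w : TangentSpace 𝓘(ℝ, E) x, τ x ![v, w] = 0) → v = 0)
    (l : E →ₗ[ℝ] ℝ)
    (hl : ∀ X Y Z : E, l X * τ.inChart x (extChartAt 𝓘(ℝ, E) x x) ![Y, Z] -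
      l Y * τ.inChart x (extChartAt 𝓘(ℝ, E) x x) ![X, Z] +
      l Z * τ.inChart x (extChartAt 𝓘(ℝ, E) x x) ![X, Y] = 0) : l = 0 := by
  refine (τ.symplecticAt x h).wedge_injective hE (altThree_ext fun X Y Z => ?_)
  rw [SymplecticForm.wedge_apply, map_zero]
  refine Eq.trans ?_ (hl X Y Z)
  rw [contAlt_swap _ X Z]
  change l X * τ.inChart x _ ![Y, Z] + l Y * τ.inChart x _ ![Z, X] +
    l Z * τ.inChart x _ ![X, Y] = _
  ring

end TwoForm

namespace AlmostConformallySymplectic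

variable {ℓ : AlmostConformallySymplectic E M}

theorem line_eq_span {x : M} {σ : TwoCovector E x} (hσ : σ ∈ ℓ.line x) (h : σ ≠ 0) :
    ℓ.line x = Submodule.span ℝ {σ} := by
  obtain ⟨U, -, hx, τ, -, hτ⟩ := ℓ.smooth x
  obtain ⟨-, hl⟩ := hτ x hx
  rw [hl] at hσ ⊢
  obtain ⟨c, rfl⟩ := Submodule.mem_span_singleton.1 hσ
  exact (Submodule.span_singleton_smul_eq (IsUnit.mk0 c fun hc => h (by rw [hc, zero_smul])) _).symm

theorem exists_generator_of_ne_zero {τ : TwoForm E M} {U : Set M} (hU : IsOpen U)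
    (hτ : ℓ.IsSectionOn τ U) {x : M} (hx : x ∈ U) (h0 : τ x ≠ 0) :
    ∃ U' ⊆ U, IsOpen U' ∧ x ∈ U' ∧ ∀ y ∈ U', τ y ≠ 0 ∧ ℓ.line y = Submodule.span ℝ {τ y} := by
  obtain ⟨W, hW, hxW, σ, hσ, hl⟩ := ℓ.smooth x
  obtain ⟨U', hU', ho, hxU', f, hf, hfσ⟩ := TwoForm.exists_smooth_ratio (hU.inter hW)
    (hτ.1.mono inter_subset_left) (hσ.mono inter_subset_right) ⟨hx, hxW⟩ (hl x hxW).1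
    (fun y hy => (hl y hy.2).2 ▸ hτ.2 y hy.1)
  have hfx : f x ≠ 0 := fun h => h0 (by rw [(hfσ x hxU').1, h, zero_smul])
  refine ⟨U' ∩ f ⁻¹' {0}ᶜ, fun y hy => (hU' hy.1).1, ContinuousOn.isOpen_inter_preimage
    (fun m hm => (hf m hm).continuousAt.continuousWithinAt) ho isOpen_compl_singleton,
    ⟨hxU', hfx⟩, fun y hy => ?_⟩
  have hy0 : τ y ≠ 0 := by
    rw [(hfσ y hy.1).1]
    exact smul_ne_zero hy.2 (hfσ y hy.1).2
  exact ⟨hy0, line_eq_span (hτ.2 y (hU' hy.1).1) hy0⟩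

theorem IsConformallySymplectic.exists_closed (h : ℓ.IsConformallySymplectic) (x : M) :
    ∃ U : Set M, IsOpen U ∧ x ∈ U ∧ ∃ τ : TwoForm E M, τ.SmoothOn U ∧
      ∀ y ∈ U, τ y ≠ 0 ∧ ℓ.line y = Submodule.span ℝ {τ y} ∧ τ.extDeriv y = 0 := by
  obtain ⟨U, hU, hx, τ, hτ, hc, h0⟩ := h x
  obtain ⟨U', hU', ho, hxU', hl⟩ := exists_generator_of_ne_zero hU hτ hx h0
  exact ⟨U', ho, hxU', τ, hτ.1.mono hU', fun y hy => ⟨(hl y hy).1, (hl y hy).2, hc y (hU' hy)⟩⟩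

/-- A section of the line bundle is locally a multiple of a closed generator. -/
theorem IsConformallySymplectic.exists_eq_smul_closed (h : ℓ.IsConformallySymplectic)
    {τ : TwoForm E M} {U : Set M} (hU : IsOpen U) (hτ : ℓ.IsSectionOn τ U) {x : M} (hx : x ∈ U) :
    ∃ W ⊆ U, IsOpen W ∧ x ∈ W ∧ ∃ (τ₀ : TwoForm E M) (f : M → ℝ), τ₀.SmoothOn W ∧
      ∀ y ∈ W, τ₀ y ≠ 0 ∧ ℓ.line y = Submodule.span ℝ {τ₀ y} ∧ τ₀.extDeriv y = 0 ∧
        ContMDiffAt 𝓘(ℝ, E) 𝓘(ℝ, ℝ) ∞ f y ∧ τ y = f y • τ₀ y := by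
  obtain ⟨W, hW, hxW, σ, hσ, hl⟩ := h.exists_closed x
  obtain ⟨U', hU', ho, hxU', f, hf, hfσ⟩ := TwoForm.exists_smooth_ratio (hU.inter hW)
    (hτ.1.mono inter_subset_left) (hσ.mono inter_subset_right) ⟨hx, hxW⟩ (hl x hxW).1
    (fun y hy => (hl y hy.2).2.1 ▸ hτ.2 y hy.1)
  exact ⟨U', fun y hy => (hU' hy).1, ho, hxU', σ, f, hσ.mono fun y hy => (hU' hy).2, fun y hy =>
    ⟨(hl y (hU' hy).2).1, (hl y (hU' hy).2).2.1, (hl y (hU' hy).2).2.2, hf y hy, (hfσ y hy).1⟩⟩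

end AlmostConformallySymplectic

namespace LinearConnection

variable {D : LinearConnection E M} {ℓ : AlmostConformallySymplectic E M}

theorem IsTwoFormDerivAt.add {x : M} {τ : TwoForm E M} {v v' : TangentSpace 𝓘(ℝ, E) x}
    {β β' : TwoCovector E x} (h : D.IsTwoFormDerivAt τ x v β) (h' : D.IsTwoFormDerivAt τ x v' β') :
    D.IsTwoFormDerivAt τ x (v + v') (β + β') := by
  intro X Y hX hY
  have h1 := altTwo_add_left (τ x).toAlternatingMap (D X x v) (D X x v') (Y x)
  have h2 := altTwo_add_left (τ x).toAlternatingMap (D Y x v) (D Y x v') (X x)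
  have hs := fun a b => contAlt_swap (τ x) a b
  rw [map_add, map_add, map_add, hs (X x)]
  change β ![X x, Y x] + β' ![X x, Y x] = _ - (τ x).toAlternatingMap _ - -(τ x).toAlternatingMap _
  rw [h1, h2, h X Y hX hY, h' X Y hX hY, hs (X x), hs (X x)]
  change _ = _ - (τ x ![_, _] + τ x ![_, _]) - -(τ x ![_, _] + τ x ![_, _])
  ring

theorem IsTwoFormDerivAt.const_smul {x : M} {τ : TwoForm E M} {v : TangentSpace 𝓘(ℝ, E) x}
    {β : TwoCovector E x} (h : D.IsTwoFormDerivAt τ x v β) (c : ℝ) :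
    D.IsTwoFormDerivAt τ x (c • v) (c • β) := by
  intro X Y hX hY
  have h1 := altTwo_smul_left (τ x).toAlternatingMap c (D X x v) (Y x)
  have h2 := altTwo_smul_left (τ x).toAlternatingMap c (D Y x v) (X x)
  have hs := fun a b => contAlt_swap (τ x) a b
  rw [map_smul, map_smul, map_smul, hs (X x)]
  change c * β ![X x, Y x] = _ - (τ x).toAlternatingMap _ - -(τ x).toAlternatingMap _
  rw [h1, h2, h X Y hX hY, hs (X x)]
  change _ = _ - c • (τ x ![_, _]) - -(c • (τ x ![_, _]))
  simp only [smul_eq_mul]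
  ring

/-- If the derivatives of a two-form are multiples of the form, then the factor is linear. -/
theorem exists_linear_of_mem_span {x : M} {τ : TwoForm E M}
    (hτ : DifferentiableAt ℝ (τ.inChart x) (extChartAt 𝓘(ℝ, E) x x)) (h0 : τ x ≠ 0)
    (h : ∀ v : TangentSpace 𝓘(ℝ, E) x, D.twoFormDeriv τ x v ∈ Submodule.span ℝ {τ x}) :
    ∃ l : E →ₗ[ℝ] ℝ, ∀ v : TangentSpace 𝓘(ℝ, E) x, D.IsTwoFormDerivAt τ x v (l v • τ x) := by
  have h1 : ∀ v : E, ∃ a : ℝ, D.IsTwoFormDerivAt τ x v (a • τ x) := fun v => by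
    obtain ⟨a, ha⟩ := Submodule.mem_span_singleton.1 (h v)
    exact ⟨a, ha ▸ isTwoFormDerivAt_twoFormDeriv hτ v⟩
  choose l hl using h1
  have hinj : ∀ a c : ℝ, a • τ x = c • τ x → a = c := fun a c h => smul_left_injective ℝ h0 h
  refine ⟨⟨⟨l, fun v w => hinj _ _ ?_⟩, fun c v => hinj _ _ ?_⟩, hl⟩
  · rw [add_smul]
    exact (hl (v + w)).unique ((hl v).add (hl w))
  · rw [RingHom.id_apply, smul_eq_mul, mul_smul]
    exact (hl (c • v)).unique ((hl v).const_smul c)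

/-- Compatibility gives ∇τ = l ⊗ τ at x. Without torsion dτ = l ∧ τ, so closedness of τ forces l ∧ τ
= 0, and l = 0 by non-degeneracy. -/
theorem IsCompatible.isTwoFormDerivAt_closed (hE : 3 ≤ finrank ℝ E) [Nontrivial E]
    (hD : D.IsCompatible ℓ) (hT : ∀ x, CovariantDerivative.torsion D x = 0)
    {τ : TwoForm E M} {U : Set M} (hU : IsOpen U) (hτ : τ.SmoothOn U)
    (hl : ∀ y ∈ U, τ y ≠ 0 ∧ ℓ.line y = Submodule.span ℝ {τ y}) {x : M} (hx : x ∈ U)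
    (hc : τ.extDeriv x = 0) (v : TangentSpace 𝓘(ℝ, E) x) : D.IsTwoFormDerivAt τ x v 0 := by
  have hd := TwoForm.SmoothOn.differentiableAt hU hτ hx
  have hs : ℓ.IsSectionOn τ U := ⟨hτ, fun y hy => by
    rw [(hl y hy).2]; exact Submodule.mem_span_singleton_self _⟩
  obtain ⟨l, hlin⟩ := exists_linear_of_mem_span hd (hl x hx).1 fun v =>
    (hl x hx).2 ▸ hD U τ hU hs x hx v
  have hl0 : l = 0 := by
    refine τ.eq_zero_of_wedge_eq_zero hE (ℓ.nondegenerate x (τ x) (hs.2 x hx) (hl x hx).1) l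
      fun X Y Z => ?_
    have hT' : ∀ v w : E, D.coordTorsion x v w = 0 := fun v w => by
      unfold coordTorsion
      rw [hT x]
      rfl
    have hz : ∀ w : E, τ.inChart x (extChartAt 𝓘(ℝ, E) x x) ![0, w] = 0 := fun w => by
      have := contAlt_smul_left (τ.inChart x (extChartAt 𝓘(ℝ, E) x x)) 0 0 w
      rwa [zero_smul, zero_mul] at this
    have hex := extDeriv_eq_of_isTwoFormDerivAt hd hlin X Y Z
    rw [hT', hT', hT', hz, hz, hz, hc] at hex
    have he : ∀ a v w : E, (l a • τ x) ![v, w] =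
        l a * τ.inChart x (extChartAt 𝓘(ℝ, E) x x) ![v, w] := fun a v w =>
      congrArg (l a * ·) (τ.inChart_self x v w).symm
    have hex' : (0 : ℝ) = (l X • τ x) ![Y, Z] - (l Y • τ x) ![X, Z] + (l Z • τ x) ![X, Y] + 0 - 0 + 0 :=
      hex
    have e1 := he X Y Z
    have e2 := he Y X Z
    have e3 := he Z X Y
    linarith
  have hz : ∀ a : ℝ, a = 0 → D.IsTwoFormDerivAt τ x v (a • τ x) → D.IsTwoFormDerivAt τ x v 0 := by
    rintro _ rfl h
    rwa [zero_smul] at h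
  exact hz _ (LinearMap.congr_fun hl0 v) (hlin v)

theorem twoFormDeriv_smul_of_parallel {τ τ₀ : TwoForm E M} {W : Set M} (hW : IsOpen W)
    (hτ₀ : τ₀.SmoothOn W) {f : M → ℝ} (hf : ∀ y ∈ W, ContMDiffAt 𝓘(ℝ, E) 𝓘(ℝ, ℝ) ∞ f y)
    (hτ : ∀ y ∈ W, τ y = f y • τ₀ y) {y : M} (hy : y ∈ W) {v : TangentSpace 𝓘(ℝ, E) y}
    (hp : D.IsTwoFormDerivAt τ₀ y v 0) :
    D.twoFormDeriv τ y v = mvfderiv 𝓘(ℝ, E) f y v • τ₀ y := by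
  have h := (hp.smul (TwoForm.SmoothOn.differentiableAt hW hτ₀ hy)
    ((hf y hy).mdifferentiableAt (by simp))).congr (τ' := τ) (by
      filter_upwards [hW.mem_nhds hy] with m hm
      exact (hτ m hm).symm)
  rw [smul_zero, add_zero] at h
  exact h.twoFormDeriv_eq

/-- The exterior derivative of a function is closed. -/
theorem mvfderiv_mvfderiv_sub {f : M → ℝ} {x : M} {W : Set M} (hW : IsOpen W) (hx : x ∈ W)
    (hf : ∀ y ∈ W, ContMDiffAt 𝓘(ℝ, E) 𝓘(ℝ, ℝ) ∞ f y) {X Y : Π y : M, TangentSpace 𝓘(ℝ, E) y}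
    (hX : ContMDiffAt 𝓘(ℝ, E) 𝓘(ℝ, E).tangent ∞ (fun y => (⟨y, X y⟩ : TangentBundle 𝓘(ℝ, E) M)) x)
    (hY : ContMDiffAt 𝓘(ℝ, E) 𝓘(ℝ, E).tangent ∞ (fun y => (⟨y, Y y⟩ : TangentBundle 𝓘(ℝ, E) M)) x) :
    (MDifferentiableAt 𝓘(ℝ, E) 𝓘(ℝ, ℝ) (fun y => mvfderiv 𝓘(ℝ, E) f y (Y y)) x ∧
      MDifferentiableAt 𝓘(ℝ, E) 𝓘(ℝ, ℝ) (fun y => mvfderiv 𝓘(ℝ, E) f y (X y)) x) ∧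
    mvfderiv 𝓘(ℝ, E) (fun y => mvfderiv 𝓘(ℝ, E) f y (Y y)) x (X x) -
      mvfderiv 𝓘(ℝ, E) (fun y => mvfderiv 𝓘(ℝ, E) f y (X y)) x (Y x) -
      mvfderiv 𝓘(ℝ, E) f x (VectorField.mlieBracket 𝓘(ℝ, E) X Y x) = 0 := by
  set e := extChartAt 𝓘(ℝ, E) x
  set g : E → ℝ := f ∘ e.symm
  have hsrc := mem_extChartAt_source (I := 𝓘(ℝ, E)) x
  have hg : ContDiffAt ℝ ∞ g (e x) := (contMDiffAt_iff_comp_symm hsrc).1 (hf x hx)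
  have hg2 : ContDiffAt ℝ 2 g (e x) := hg.of_le (WithTop.coe_le_coe.2 (le_top : (2 : ℕ∞) ≤ ⊤))
  have hdg : DifferentiableAt ℝ (fderiv ℝ g) (e x) :=
    (hg.fderiv_right (m := ∞) le_rfl).differentiableAt (by simp)
  have key : ∀ Z : Π y : M, TangentSpace 𝓘(ℝ, E) y,
      (fun y => mvfderiv 𝓘(ℝ, E) f y (Z y)) ∘ e.symm =ᶠ[𝓝 (e x)]
        fun z => fderiv ℝ g z (vecInChart Z x z) := by
    intro Z
    have hc : ContinuousAt e.symm (e x) := continuousAt_extChartAt_symm x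
    have hw : ∀ᶠ z in 𝓝 (e x), e.symm z ∈ W := hc.eventually (hW.mem_nhds (by
      rw [show e.symm (e x) = x from extChartAt_to_inv x]; exact hx))
    filter_upwards [extChartAt_target_mem_nhds x, hw] with z hz hzW
    have h1 := (contMDiffAt_iff_comp_symm (e.map_target hz)).1 (hf _ hzW)
    refine (mvfderiv_eq_fderiv_comp_symm (e.map_target hz) (h1.differentiableAt (by simp))
      (Z (e.symm z))).trans ?_
    rw [show extChartAt 𝓘(ℝ, E) x (e.symm z) = z from e.right_inv hz]
    rfl
  have hdiff : ∀ Z : Π y : M, TangentSpace 𝓘(ℝ, E) y,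
      ContMDiffAt 𝓘(ℝ, E) 𝓘(ℝ, E).tangent ∞ (fun y => (⟨y, Z y⟩ : TangentBundle 𝓘(ℝ, E) M)) x →
      DifferentiableAt ℝ ((fun y => mvfderiv 𝓘(ℝ, E) f y (Z y)) ∘ e.symm) (e x) ∧
      ∀ v : E, mvfderiv 𝓘(ℝ, E) (fun y => mvfderiv 𝓘(ℝ, E) f y (Z y)) x v =
        fderiv ℝ (fderiv ℝ g) (e x) v (vecInChart Z x (e x)) +
          fderiv ℝ g (e x) (fderiv ℝ (vecInChart Z x) (e x) v) := by
    intro Z hZ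
    have hZ' := (contDiffAt_vecInChart hZ).differentiableAt (by simp)
    have h1 := hdg.hasFDerivAt.clm_apply hZ'.hasFDerivAt
    have h2 := h1.differentiableAt.congr_of_eventuallyEq (key Z)
    refine ⟨h2, fun v => (mvfderiv_eq_fderiv_self h2 v).trans ?_⟩
    rw [(key Z).fderiv_eq, h1.fderiv]
    exact add_comm _ _
  refine ⟨⟨(mdifferentiableAt_iff_comp_symm hsrc).2 (hdiff Y hY).1,
    (mdifferentiableAt_iff_comp_symm hsrc).2 (hdiff X hX).1⟩, ?_⟩
  have hX' : X x = vecInChart X x (e x) := (vecInChart_self X x).symm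
  have hY' : Y x = vecInChart Y x (e x) := (vecInChart_self Y x).symm
  have hb := mlieBracket_eq_fderiv X Y x
  have hb' := mvfderiv_eq_fderiv_self (f := f) (hg.differentiableAt (by simp))
    (VectorField.mlieBracket 𝓘(ℝ, E) X Y x)
  have hsym : IsSymmSndFDerivAt ℝ g (e x) :=
    hg2.isSymmSndFDerivAt (by rw [minSmoothness_of_isRCLikeNormedField])
  have e1 := (hdiff Y hY).2 (vecInChart X x (e x))
  have e2 := (hdiff X hX).2 (vecInChart Y x (e x))
  rw [hb', hb, hX', hY']
  -- The second derivatives of f cancel by symmetry, and the first-order terms left over form df of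
  -- the bracket.
  refine (congrArg₂ (fun s t => s - t - fderiv ℝ g (e x) (fderiv ℝ (vecInChart Y x) (e x)
    (vecInChart X x (e x)) - fderiv ℝ (vecInChart X x) (e x) (vecInChart Y x (e x)))) e1 e2).trans ?_
  rw [hsym.eq, map_sub]
  ring

/-- A closed local generator τ₀ is parallel, so a section fτ₀ has derivative df ⊗ τ₀ and its
curvature is the vanishing ddf times τ₀. -/
theorem isFlatOn_of_isCompatible (hE : 3 ≤ finrank ℝ E) [Nontrivial E]
    (hℓ : ℓ.IsConformallySymplectic) (hD : D.IsCompatible ℓ)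
    (hT : ∀ x, CovariantDerivative.torsion D x = 0) : D.IsFlatOn ℓ := by
  intro U τ X Y hU hτ hX hY x hx
  obtain ⟨W, hWU, hW, hxW, τ₀, f, hτ₀, h⟩ := hℓ.exists_eq_smul_closed hU hτ hx
  have hp : ∀ y ∈ W, ∀ v, D.IsTwoFormDerivAt τ₀ y v 0 := fun y hy v =>
    hD.isTwoFormDerivAt_closed hE hT hW hτ₀ (fun y hy => ⟨(h y hy).1, (h y hy).2.1⟩) hy
      (h y hy).2.2.1 v
  have hf : ∀ y ∈ W, ContMDiffAt 𝓘(ℝ, E) 𝓘(ℝ, ℝ) ∞ f y := fun y hy => (h y hy).2.2.2.1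
  have h1 : ∀ y ∈ W, ∀ v, D.twoFormDeriv τ y v = mvfderiv 𝓘(ℝ, E) f y v • τ₀ y := fun y hy v =>
    twoFormDeriv_smul_of_parallel hW hτ₀ hf (fun y hy => (h y hy).2.2.2.2) hy (hp y hy v)
  obtain ⟨⟨hdY, hdX⟩, hsub⟩ := mvfderiv_mvfderiv_sub hW hxW hf (hX.contMDiffAt (hU.mem_nhds hx))
    (hY.contMDiffAt (hU.mem_nhds hx))
  have hd := TwoForm.SmoothOn.differentiableAt hW hτ₀ hxW
  have h2 : ∀ (Z : Π y : M, TangentSpace 𝓘(ℝ, E) y) (v : TangentSpace 𝓘(ℝ, E) x),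
      MDifferentiableAt 𝓘(ℝ, E) 𝓘(ℝ, ℝ) (fun y => mvfderiv 𝓘(ℝ, E) f y (Z y)) x →
      D.twoFormDeriv (fun y => D.twoFormDeriv τ y (Z y)) x v =
        mvfderiv 𝓘(ℝ, E) (fun y => mvfderiv 𝓘(ℝ, E) f y (Z y)) x v • τ₀ x := by
    intro Z v hZ
    have h3 := ((hp x hxW v).smul hd hZ).congr (τ' := fun y => D.twoFormDeriv τ y (Z y)) (by
      filter_upwards [hW.mem_nhds hxW] with m hm
      exact (h1 m hm _).symm)
    rw [smul_zero, add_zero] at h3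
    exact h3.twoFormDeriv_eq
  rw [h2 Y _ hdY, h2 X _ hdX, h1 x hxW]
  have key : ∀ (r s t : ℝ) (σ : TwoCovector E x), r - s - t = 0 → r • σ - s • σ - t • σ = 0 := by
    intro r s t σ hrst
    refine contAlt_ext fun v w => ?_
    change r * σ ![v, w] - s * σ ![v, w] - t * σ ![v, w] = 0
    rw [← sub_mul, ← sub_mul, hrst, zero_mul]
  exact key _ _ _ _ hsub

/-- With a closed, hence parallel, generator τ₀, the covariant derivative of fτ₀ is df ⊗ τ₀ and the
exterior derivative is df ∧ τ₀. Each vanishes at a point iff df does, since wedging one-forms with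
τ₀ is injective. -/
theorem isParallelOn_iff_of_isCompatible (hE : 3 ≤ finrank ℝ E) [Nontrivial E]
    (hℓ : ℓ.IsConformallySymplectic) (hD : D.IsCompatible ℓ)
    (hT : ∀ x, CovariantDerivative.torsion D x = 0) {U : Set M} {τ : TwoForm E M} (hU : IsOpen U)
    (hτ : ℓ.IsSectionOn τ U) : D.IsParallelOn τ U ↔ ∀ x ∈ U, τ.extDeriv x = 0 := by
  refine forall₂_congr fun x hx => ?_
  obtain ⟨W, hWU, hW, hxW, τ₀, f, hτ₀, h⟩ := hℓ.exists_eq_smul_closed hU hτ hx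
  obtain ⟨h0, hl, hc, hf, -⟩ := h x hxW
  have h1 : ∀ v, D.twoFormDeriv τ x v = mvfderiv 𝓘(ℝ, E) f x v • τ₀ x := fun v =>
    twoFormDeriv_smul_of_parallel hW hτ₀ (fun y hy => (h y hy).2.2.2.1)
      (fun y hy => (h y hy).2.2.2.2) hxW
      (hD.isTwoFormDerivAt_closed hE hT hW hτ₀ (fun y hy => ⟨(h y hy).1, (h y hy).2.1⟩) hxW hc v)
  have hd := TwoForm.SmoothOn.differentiableAt hW hτ₀ hxW
  have h2 : ∀ A B C : TangentSpace 𝓘(ℝ, E) x, τ.extDeriv x ![A, B, C] =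
      mvfderiv 𝓘(ℝ, E) f x A * τ₀ x ![B, C] - mvfderiv 𝓘(ℝ, E) f x B * τ₀ x ![A, C] +
        mvfderiv 𝓘(ℝ, E) f x C * τ₀ x ![A, B] := by
    intro A B C
    have h3 : τ.extDeriv x = TwoForm.extDeriv (fun y => f y • τ₀ y) x :=
      TwoForm.extDeriv_congr (by
        filter_upwards [hW.mem_nhds hxW] with m hm
        exact (h m hm).2.2.2.2)
    rw [h3, TwoForm.extDeriv_smul (hf.mdifferentiableAt (by simp)) hd, hc]
    change f x * 0 + _ = _
    rw [mul_zero, zero_add]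
  constructor
  · intro hp
    have h4 : ∀ v, mvfderiv 𝓘(ℝ, E) f x v = 0 := fun v =>
      (smul_eq_zero.1 ((h1 v).symm.trans (hp v))).resolve_right h0
    refine contAlt_three_ext fun A B C => ?_
    rw [h2, h4, h4, h4]
    simp
  · intro hcl v
    have h4 : (mvfderiv 𝓘(ℝ, E) f x : E →L[ℝ] ℝ).toLinearMap = 0 := by
      refine τ₀.eq_zero_of_wedge_eq_zero hE (ℓ.nondegenerate x (τ₀ x)
        (hl ▸ Submodule.mem_span_singleton_self _) h0) _ fun A B C => ?_
      have h5 := h2 A B C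
      rw [hcl] at h5
      rw [← τ₀.inChart_self x B C, ← τ₀.inChart_self x A C, ← τ₀.inChart_self x A B] at h5
      exact h5.symm
    rw [h1]
    have h5 : mvfderiv 𝓘(ℝ, E) f x v = 0 := LinearMap.congr_fun h4 v
    rw [h5, zero_smul]

end LinearConnection

end CompatibleConnections

/-! ### Normal forms of symplectic vector spaces. -/

section Darboux

section HyperbolicPair

variable {W : Type*} [AddCommGroup W] [Module ℝ W] (B : W →ₗ[ℝ] W →ₗ[ℝ] ℝ)

theorem exists_hyperbolic_pair (hB : ∀ x, (∀ y, B x y = 0) → x = 0) [Nontrivial W] :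
    ∃ p q, B p q = 1 := by
  obtain ⟨p, hp⟩ := exists_ne (0 : W)
  obtain ⟨q, hq⟩ : ∃ q, B p q ≠ 0 := by
    by_contra! h
    exact hp (hB p h)
  exact ⟨p, (B p q)⁻¹ • q, by rw [map_smul, smul_eq_mul, inv_mul_cancel₀ hq]⟩

/-- The orthogonal complement of a pair of vectors. -/
def pairComplement (p q : W) : Submodule ℝ W :=
  LinearMap.ker ((B.flip p).prod (B.flip q))

variable {B}

theorem mem_pairComplement {p q x : W} : x ∈ pairComplement B p q ↔ B x p = 0 ∧ B x q = 0 := by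
  simp [pairComplement, LinearMap.mem_ker]

theorem self_eq_zero_of_skew (hs : ∀ x y, B x y = -B y x) (x : W) : B x x = 0 :=
  eq_zero_of_eq_neg (hs x x)

/-- The projection to the orthogonal complement of a hyperbolic pair. -/
def pairProj (hs : ∀ x y, B x y = -B y x) {p q : W} (hpq : B p q = 1) :
    W →ₗ[ℝ] pairComplement B p q :=
  LinearMap.codRestrict _ (LinearMap.id - (B.flip q).smulRight p + (B.flip p).smulRight q)
    fun x => by
      have hqp : B q p = -1 := by rw [hs, hpq]
      rw [mem_pairComplement]
      constructor <;>
      simp [hpq, hqp, self_eq_zero_of_skew hs]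

theorem pairProj_add (hs : ∀ x y, B x y = -B y x) {p q : W} (hpq : B p q = 1) (x : W) :
    x = B x q • p - B x p • q + pairProj hs hpq x := by
  simp [pairProj]

theorem finrank_pairComplement [FiniteDimensional ℝ W] (hs : ∀ x y, B x y = -B y x) {p q : W}
    (hpq : B p q = 1) : finrank ℝ (pairComplement B p q) + 2 = finrank ℝ W := by
  have hqp : B q p = -1 := by rw [hs, hpq]
  have h := LinearMap.finrank_range_add_finrank_ker ((B.flip p).prod (B.flip q))
  have hr : LinearMap.range ((B.flip p).prod (B.flip q)) = ⊤ := by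
    rw [LinearMap.range_eq_top]
    rintro ⟨a, c⟩
    refine ⟨c • p - a • q, ?_⟩
    simp [hpq, hqp, self_eq_zero_of_skew hs]
  rw [hr, finrank_top] at h
  simp only [finrank_prod, finrank_self] at h
  unfold pairComplement
  omega

theorem pairComplement_nondegenerate (hs : ∀ x y, B x y = -B y x)
    (hB : ∀ x, (∀ y, B x y = 0) → x = 0) {p q : W} (hpq : B p q = 1)
    (x : pairComplement B p q) (hx : ∀ y : pairComplement B p q, B x y = 0) : x = 0 := by
  refine Subtype.ext (hB x fun y => ?_)
  obtain ⟨h1, h2⟩ := mem_pairComplement.1 x.2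
  rw [pairProj_add hs hpq y, map_add, map_sub, map_smul, map_smul, h1, h2, hx]
  simp

end HyperbolicPair

/-- Split off a pair with B(p, q) = 1 on each side; the complements are again non-degenerate, with
dimension smaller by two. Only an isometric linear map is asked for, as injectivity is then
automatic, and n merely bounds the dimension for the induction. -/
theorem exists_isometry_of_finrank_le (n : ℕ) : ∀ {W W' : Type*} [AddCommGroup W] [Module ℝ W]
    [FiniteDimensional ℝ W] [AddCommGroup W'] [Module ℝ W'] [FiniteDimensional ℝ W']
    (B : W →ₗ[ℝ] W →ₗ[ℝ] ℝ) (B' : W' →ₗ[ℝ] W' →ₗ[ℝ] ℝ), (∀ x y, B x y = -B y x) →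
    (∀ x y, B' x y = -B' y x) → (∀ x, (∀ y, B x y = 0) → x = 0) →
    (∀ x, (∀ y, B' x y = 0) → x = 0) → finrank ℝ W ≤ finrank ℝ W' → finrank ℝ W ≤ n →
    ∃ e : W →ₗ[ℝ] W', ∀ x y, B' (e x) (e y) = B x y := by
  induction n with
  | zero =>
    intro W W' _ _ _ _ _ _ B B' _ _ _ _ _ h0
    have : Subsingleton W := finrank_zero_iff.1 (Nat.le_zero.1 h0)
    refine ⟨0, fun x y => ?_⟩
    rw [Subsingleton.elim x 0]
    simp
  | succ n ih =>
    intro W W' _ _ _ _ _ _ B B' hs hs' hB hB' hle hn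
    rcases subsingleton_or_nontrivial W with hW | hW
    · refine ⟨0, fun x y => ?_⟩
      rw [Subsingleton.elim x 0]
      simp
    have hW' : Nontrivial W' := nontrivial_of_finrank_pos (finrank_pos.trans_le hle)
    obtain ⟨p, q, hpq⟩ := exists_hyperbolic_pair B hB
    obtain ⟨p', q', hpq'⟩ := exists_hyperbolic_pair B' hB'
    have h1 := finrank_pairComplement hs hpq
    have h2 := finrank_pairComplement hs' hpq'
    have hqp' : B' q' p' = -1 := by rw [hs', hpq']
    obtain ⟨e, he⟩ := ih (B.domRestrict₁₂ (pairComplement B p q) (pairComplement B p q))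
      (B'.domRestrict₁₂ (pairComplement B' p' q') (pairComplement B' p' q'))
      (fun x y => hs x y) (fun x y => hs' x y) (pairComplement_nondegenerate hs hB hpq)
      (pairComplement_nondegenerate hs' hB' hpq') (by omega) (by omega)
    have he' : ∀ x y, B' (e x) (e y) = B x y := he
    -- This map sends p to p', q to q' and acts as `e` on the complement.
    refine ⟨(B.flip q).smulRight p' - (B.flip p).smulRight q' +
      (pairComplement B' p' q').subtype ∘ₗ e ∘ₗ pairProj hs hpq, fun x y => ?_⟩
    have hqp : B q p = -1 := by rw [hs, hpq]
    obtain ⟨a1, a2⟩ := mem_pairComplement.1 (pairProj hs hpq x).2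
    obtain ⟨b1, b2⟩ := mem_pairComplement.1 (pairProj hs hpq y).2
    obtain ⟨c1, c2⟩ := mem_pairComplement.1 (e (pairProj hs hpq x)).2
    obtain ⟨d1, d2⟩ := mem_pairComplement.1 (e (pairProj hs hpq y)).2
    have hxy : B x y = B (B x q • p - B x p • q + pairProj hs hpq x)
        (B y q • p - B y p • q + pairProj hs hpq y) := by
      rw [← pairProj_add, ← pairProj_add]
    have b1' := (hs p _).trans (neg_eq_zero.2 b1)
    have b2' := (hs q _).trans (neg_eq_zero.2 b2)
    have d1' := (hs' p' _).trans (neg_eq_zero.2 d1)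
    have d2' := (hs' q' _).trans (neg_eq_zero.2 d2)
    rw [hxy]
    simp only [LinearMap.add_apply, LinearMap.sub_apply, LinearMap.smulRight_apply,
      LinearMap.flip_apply, LinearMap.comp_apply, Submodule.subtype_apply, map_add, map_sub,
      map_smul, LinearMap.smul_apply, hpq, hqp, hpq', hqp', self_eq_zero_of_skew hs,
      self_eq_zero_of_skew hs', a1, a2, c1, c2, b1', b2', d1', d2', he', smul_eq_mul]

namespace SymplecticForm

variable {V W : Type*} [NormedAddCommGroup V] [NormedSpace ℝ V] [FiniteDimensional ℝ V]
  [NormedAddCommGroup W] [NormedSpace ℝ W] [FiniteDimensional ℝ W]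

/-- Symplectic vector spaces of the same dimension are isomorphic. -/
theorem exists_equiv (b : SymplecticForm V) (c : SymplecticForm W)
    (h : finrank ℝ W = finrank ℝ V) :
    ∃ e : W ≃L[ℝ] V, ∀ x y, b (e x) (e y) = c x y := by
  obtain ⟨e, he⟩ := exists_isometry_of_finrank_le (finrank ℝ W) c.bilin b.bilin c.swap b.swap
    c.nondegenerate b.nondegenerate h.le le_rfl
  have he' : ∀ x y, b (e x) (e y) = c x y := he
  have hinj : Function.Injective e := by
    rw [injective_iff_map_eq_zero]
    intro x hx
    refine c.nondegenerate x fun y => ?_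
    exact (he' x y).symm.trans (by rw [hx, b.zero_left])
  exact ⟨(LinearEquiv.ofInjectiveOfFinrankEq e hinj h).toContinuousLinearEquiv, he'⟩

/-- For an alternating form `σ`, the endomorphism `A` with `2 c(A x, y) = σ(x, y)`. -/
noncomputable def halfRaise (c : SymplecticForm W) : (W [⋀^Fin 2]→L[ℝ] ℝ) →ₗ[ℝ] (W →L[ℝ] W) where
  toFun σ := LinearMap.toContinuousLinearMap
    (c.flat.symm.toLinearMap ∘ₗ ((2⁻¹ : ℝ) • contAltBilin σ))
  map_add' σ τ := ContinuousLinearMap.ext fun x => c.eq_of_forall fun y => by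
    refine (c.flat_symm_apply _ y).trans (Eq.trans ?_ (c.add_left _ _ y).symm)
    refine Eq.trans ?_ (congrArg₂ (· + ·) (c.flat_symm_apply _ y) (c.flat_symm_apply _ y)).symm
    change (2⁻¹ : ℝ) * (σ ![x, y] + τ ![x, y]) = 2⁻¹ * σ ![x, y] + 2⁻¹ * τ ![x, y]
    ring
  map_smul' r σ := ContinuousLinearMap.ext fun x => c.eq_of_forall fun y => by
    refine (c.flat_symm_apply _ y).trans (Eq.trans ?_ (c.smul_left r _ y).symm)
    refine Eq.trans ?_ (congrArg (r * ·) (c.flat_symm_apply _ y)).symm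
    change (2⁻¹ : ℝ) * (r * σ ![x, y]) = r * (2⁻¹ * σ ![x, y])
    ring

theorem halfRaise_spec (c : SymplecticForm W) (σ : W [⋀^Fin 2]→L[ℝ] ℝ) (x y : W) :
    c (c.halfRaise σ x) y = 2⁻¹ * σ ![x, y] := c.flat_symm_apply _ y

/-- Near a symplectic form, all two-forms are pulled back from it along smoothly depending
endomorphisms. -/
theorem exists_smooth_normal_form (c : SymplecticForm W) :
    ∃ A : (W [⋀^Fin 2]→L[ℝ] ℝ) → (W →L[ℝ] W), ContDiffAt ℝ ω A c.form ∧
      ∀ᶠ σ in 𝓝 c.form, c.form.compContinuousLinearMap (A σ) = σ := by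
  let K : (W [⋀^Fin 2]→L[ℝ] ℝ) →L[ℝ] (W →L[ℝ] W) :=
    ⟨c.halfRaise, c.halfRaise.continuous_of_finiteDimensional⟩
  -- K is a right inverse of the derivative at the identity of A ↦ A*c, because c(Kσ x, y) + c(x, Kσ
  -- y) = σ(x, y). So F has derivative the identity at 0, and the required endomorphism is 1 + K
  -- applied to the local inverse of F.
  let F : (W [⋀^Fin 2]→L[ℝ] ℝ) → (W [⋀^Fin 2]→L[ℝ] ℝ) := fun σ =>
    c.form.compContinuousLinearMap (1 + K σ)
  have hF0 : F 0 = c.form := by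
    refine contAlt_ext fun x y => ?_
    rw [contAlt_comp, map_zero, add_zero]
    rfl
  have hg : ContDiff ℝ ω fun σ => (1 : W →L[ℝ] W) + K σ := contDiff_const.add K.contDiff
  have hF : ContDiffAt ℝ ω F 0 := ContDiffAt.contAlt_comp contDiffAt_const hg.contDiffAt
  have hd : HasFDerivAt F ((ContinuousLinearEquiv.refl ℝ (W [⋀^Fin 2]→L[ℝ] ℝ) :
      (W [⋀^Fin 2]→L[ℝ] ℝ) ≃L[ℝ] (W [⋀^Fin 2]→L[ℝ] ℝ)) :
      (W [⋀^Fin 2]→L[ℝ] ℝ) →L[ℝ] (W [⋀^Fin 2]→L[ℝ] ℝ)) 0 := by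
    have h1 := (hF.differentiableAt (by simp)).hasFDerivAt
    refine h1.congr_fderiv (ContinuousLinearMap.ext fun σ => contAlt_ext fun x y => ?_)
    have hK : HasFDerivAt (fun σ => (1 : W →L[ℝ] W) + K σ) K 0 := K.hasFDerivAt.const_add 1
    have hx : ∀ x : W, HasFDerivAt (fun σ => ((1 : W →L[ℝ] W) + K σ) x)
        ((ContinuousLinearMap.apply ℝ W x) ∘L K) 0 := fun x =>
      (ContinuousLinearMap.apply ℝ W x).hasFDerivAt.comp 0 hK
    have h2 := (hasFDerivAt_contAlt_apply (f := fun _ => c.form) (differentiableAt_const _)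
      (hx x).differentiableAt (hx y).differentiableAt).2 σ
    have h3 := fderiv_continuousAlternatingMap_apply_const_apply
      (hF.differentiableAt (by simp)) ![x, y] σ
    rw [(hx x).fderiv, (hx y).fderiv] at h2
    have h4 : (fun σ => F σ ![x, y]) =
        fun σ => c.form ![((1 : W →L[ℝ] W) + K σ) x, ((1 : W →L[ℝ] W) + K σ) y] := by
      funext σ
      exact contAlt_comp _ _ _ _
    rw [h4, h2] at h3
    rw [← h3]
    have h5 := c.halfRaise_spec σ x y
    have h6 := c.halfRaise_spec σ y x
    rw [c.swap, contAlt_swap] at h6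
    simp only [fderiv_fun_const, map_zero, add_zero]
    change (0 : ℝ) + c (c.halfRaise σ x) y + c x (c.halfRaise σ y) = σ ![x, y]
    linarith
  have hn : (ω : WithTop ℕ∞) ≠ 0 := by simp
  refine ⟨fun σ => 1 + K (hF.localInverse hd hn σ), ?_, ?_⟩
  · have h := hF.to_localInverse hd hn
    rw [hF0] at h
    exact hg.contDiffAt.comp _ h
  · have h := (hF.hasStrictFDerivAt' hd hn).eventually_right_inverse
    rwa [hF0] at h

end SymplecticForm

end Darboux

/-! ### Smoothness of vector-valued one-forms. -/

section OneForms

variable {EN HN N : Type*} [NormedAddCommGroup EN] [NormedSpace ℝ EN] [TopologicalSpace HN]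
  {I : ModelWithCorners ℝ EN HN} [TopologicalSpace N] [ChartedSpace HN N] [IsManifold I ∞ N]
  {EN' HN' N' : Type*} [NormedAddCommGroup EN'] [NormedSpace ℝ EN'] [TopologicalSpace HN']
  {J : ModelWithCorners ℝ EN' HN'} [TopologicalSpace N'] [ChartedSpace HN' N'] [IsManifold J ∞ N']
  {F : Type*} [NormedAddCommGroup F] [NormedSpace ℝ F]
  {F' : Type*} [NormedAddCommGroup F'] [NormedSpace ℝ F']

variable (I) in
/-- Smoothness in a point of a one-form with values in a vector space. -/
def OneFormSmoothAt (θ : Π u : N, TangentSpace I u →L[ℝ] F) (u : N) : Prop :=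
  ContMDiffAt I (I.prod 𝓘(ℝ, EN →L[ℝ] F)) ∞
    (fun u => (⟨u, θ u⟩ : TotalSpace (EN →L[ℝ] F)
      (fun u : N => TangentSpace I u →L[ℝ] Bundle.Trivial N F u))) u

variable (I) in
/-- A one-form in the trivialization of the tangent bundle centred at `u₀`. -/
noncomputable def oneFormInTrivialization (θ : Π u : N, TangentSpace I u →L[ℝ] F) (u₀ u : N) :
    EN →L[ℝ] F :=
  (θ u) ∘L (trivializationAt EN (TangentSpace I) u₀).symmL ℝ u

instance : IsManifold I 1 N := IsManifold.of_le (n := ∞) (by simp)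

/-- The target bundle is trivial, so only the tangent bundle has to be trivialized; smoothness
becomes that of a map into a fixed space of linear maps. -/
theorem oneFormSmoothAt_iff {θ : Π u : N, TangentSpace I u →L[ℝ] F} {u : N} :
    OneFormSmoothAt I θ u ↔ ContMDiffAt I 𝓘(ℝ, EN →L[ℝ] F) ∞ (oneFormInTrivialization I θ u) u := by
  unfold OneFormSmoothAt
  rw [contMDiffAt_hom_bundle]
  have key : (fun x => ContinuousLinearMap.inCoordinates EN (TangentSpace I) F (Trivial N F)
      u x u x (θ x)) = oneFormInTrivialization I θ u := by
    funext x
    refine ContinuousLinearMap.ext fun w => ?_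
    exact DFunLike.congr_fun (Bundle.Trivial.continuousLinearMapAt_trivialization ℝ N F x) _
  exact ⟨fun h => key ▸ h.2, fun h => ⟨contMDiffAt_id, by rw [← key] at h; exact h⟩⟩

theorem OneFormSmoothAt.clm_comp {θ : Π u : N, TangentSpace I u →L[ℝ] F} {u : N}
    {c : N → F →L[ℝ] F'} (hc : ContMDiffAt I 𝓘(ℝ, F →L[ℝ] F') ∞ c u)
    (hθ : OneFormSmoothAt I θ u) : OneFormSmoothAt I (fun u => (c u) ∘L (θ u)) u := by
  rw [oneFormSmoothAt_iff] at hθ ⊢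
  exact hc.clm_comp hθ

theorem OneFormSmoothAt.pullback {θ : Π u : N, TangentSpace I u →L[ℝ] F} {ψ : N' → N} {x : N'}
    (hθ : OneFormSmoothAt I θ (ψ x)) (hψ : ContMDiffAt J I ∞ ψ x) :
    OneFormSmoothAt J (fun y => (θ (ψ y)) ∘L (mfderiv J I ψ y)) x := by
  rw [oneFormSmoothAt_iff] at hθ ⊢
  have h1 := ContMDiffAt.mfderiv_const hψ (m := ∞) le_rfl
  have h2 : ContMDiffAt J 𝓘(ℝ, EN →L[ℝ] F) ∞
    (fun y => oneFormInTrivialization I θ (ψ x) (ψ y)) x := ContMDiffAt.comp x hθ hψ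
  refine (h2.clm_comp h1).congr_of_eventuallyEq ?_
  have hb : (trivializationAt EN (TangentSpace I) (ψ x)).baseSet ∈ 𝓝 (ψ x) :=
    (trivializationAt EN (TangentSpace I) (ψ x)).open_baseSet.mem_nhds
      (mem_baseSet_trivializationAt EN (TangentSpace I) (ψ x))
  filter_upwards [hψ.continuousAt hb] with y hy
  refine ContinuousLinearMap.ext fun w => ?_
  exact congrArg (θ (ψ y)) ((trivializationAt EN (TangentSpace I) (ψ x)).symmL_continuousLinearMapAt hy _).symm

theorem oneFormSmoothAt_vectorSpace_iff {θ : EN → EN →L[ℝ] F} {z : EN} :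
    OneFormSmoothAt 𝓘(ℝ, EN) (fun z => (θ z : TangentSpace 𝓘(ℝ, EN) z →L[ℝ] F)) z ↔
      ContDiffAt ℝ ∞ θ z := by
  refine oneFormSmoothAt_iff.trans ?_
  have : oneFormInTrivialization 𝓘(ℝ, EN) (fun z => (θ z : TangentSpace 𝓘(ℝ, EN) z →L[ℝ] F)) z
      = θ := by
    funext y
    refine ContinuousLinearMap.ext fun w => ?_
    refine congrArg (θ y) ?_
    exact DFunLike.congr_fun (TangentBundle.symmL_model_space (𝕜 := ℝ) z y) w
  rw [this, contMDiffAt_iff_contDiffAt]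

theorem OneFormSmoothAt.mfderiv_self {ψ : N → F} {x : N} (hψ : ContMDiffAt I 𝓘(ℝ, F) ∞ ψ x) :
    OneFormSmoothAt I (fun y => mfderiv I 𝓘(ℝ, F) ψ y) x := by
  refine OneFormSmoothAt.pullback (θ := fun _ => ContinuousLinearMap.id ℝ F) ?_ hψ
  exact oneFormSmoothAt_vectorSpace_iff.2 contDiffAt_const

end OneForms

/-! ### Local sections and coframes of first order structures. -/

namespace FirstOrderStructure

variable {𝔤 : Type*} [NormedAddCommGroup 𝔤] [NormedSpace ℝ 𝔤]
  {G : Type*} [Group G] [TopologicalSpace G] [ChartedSpace 𝔤 G]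
  {V : Type*} [NormedAddCommGroup V] [NormedSpace ℝ V]
  {ρ : G →* (V →L[ℝ] V)ˣ}
  {E : Type*} [NormedAddCommGroup E] [NormedSpace ℝ E]
  {M : Type*} [TopologicalSpace M] [ChartedSpace E M]

/-- A local smooth section `σ` over `U`, together with the function `h` describing points over `U`
relative to this section. -/
structure IsLocalSection (P : FirstOrderStructure 𝔤 ρ E M) (U : Set M) (σ : M → P.Total)
    (h : P.Total → G) : Prop where
  isOpen : IsOpen U
  proj_section : ∀ y ∈ U, P.proj (σ y) = y
  act_coord : ∀ u, P.proj u ∈ U → P.act (σ (P.proj u)) (h u) = u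
  coord_act : ∀ y ∈ U, ∀ g, h (P.act (σ y) g) = g
  smooth_act : ContMDiffOn (𝓘(ℝ, E).prod 𝓘(ℝ, 𝔤)) (𝓘(ℝ, E).prod 𝓘(ℝ, 𝔤)) ∞
    (fun p : M × G => P.act (σ p.1) p.2) (U ×ˢ univ)
  smooth_coord : ∀ u, P.proj u ∈ U → ContMDiffAt (𝓘(ℝ, E).prod 𝓘(ℝ, 𝔤)) 𝓘(ℝ, 𝔤) ∞ h u
  smooth_proj : ∀ u, P.proj u ∈ U → ContMDiffAt (𝓘(ℝ, E).prod 𝓘(ℝ, 𝔤)) 𝓘(ℝ, E) ∞ P.proj u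

variable (P : FirstOrderStructure 𝔤 ρ E M)

/-- For a trivialization φ the section is φ⁻¹(y, 1) and the relative position is the group component
of φ; equivariance identifies φ⁻¹(y, g) with the section translated by g. -/
theorem exists_localSection (x : M) : ∃ U σ h, x ∈ U ∧ P.IsLocalSection U σ h := by
  obtain ⟨U, φ, hU, hx, hs, ht, h1, h2, h3⟩ := P.locally_trivial x
  have hmem : ∀ y ∈ U, ∀ g, (y, g) ∈ φ.target := fun y hy g => by rw [ht]; exact ⟨hy, trivial⟩
  have hproj : ∀ y ∈ U, ∀ g, P.proj (φ.symm (y, g)) = y := fun y hy g => by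
    have h := (h3 _ (φ.map_target (hmem y hy g))).1
    rw [φ.right_inv (hmem y hy g)] at h
    exact h.symm
  have hact : ∀ y ∈ U, ∀ g, P.act (φ.symm (y, 1)) g = φ.symm (y, g) := fun y hy g => by
    have h := (h3 _ (φ.map_target (hmem y hy 1))).2 g
    rw [φ.right_inv (hmem y hy 1), hproj y hy, one_mul] at h
    rw [← h, φ.left_inv]
    rw [hs, mem_preimage, P.proj_act, hproj y hy]
    exact hy
  have hsrc : ∀ u, P.proj u ∈ U → u ∈ φ.source := fun u hu => by rw [hs]; exact hu
  have hφ : ∀ u, P.proj u ∈ U →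
      ContMDiffAt (𝓘(ℝ, E).prod 𝓘(ℝ, 𝔤)) (𝓘(ℝ, E).prod 𝓘(ℝ, 𝔤)) ∞ φ u := fun u hu =>
    h1.contMDiffAt (φ.open_source.mem_nhds (hsrc u hu))
  refine ⟨U, fun y => φ.symm (y, 1), fun u => (φ u).2, hx, hU, fun y hy => hproj y hy 1,
    fun u hu => ?_, fun y hy g => ?_, ?_, fun u hu => ?_, fun u hu => ?_⟩
  · rw [hact _ hu]
    have h := φ.left_inv (hsrc u hu)
    rwa [show φ u = (P.proj u, (φ u).2) from Prod.ext (h3 u (hsrc u hu)).1 rfl] at h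
  · rw [hact y hy, φ.right_inv (hmem y hy g)]
  · rw [← ht]
    refine h2.congr fun p hp => ?_
    rw [ht] at hp
    exact hact p.1 hp.1 p.2
  · exact contMDiffAt_snd.comp u (hφ u hu)
  · refine (contMDiffAt_fst.comp u (hφ u hu)).congr_of_eventuallyEq ?_
    filter_upwards [φ.open_source.mem_nhds (hsrc u hu)] with v hv
    exact (h3 v hv).1.symm

theorem contMDiff_proj : ContMDiff (𝓘(ℝ, E).prod 𝓘(ℝ, 𝔤)) 𝓘(ℝ, E) ∞ P.proj := fun u => by
  obtain ⟨U, σ, h, hx, hl⟩ := P.exists_localSection (P.proj u)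
  exact hl.smooth_proj u hx

theorem surjective_proj : Function.Surjective P.proj := fun x => by
  obtain ⟨U, σ, h, hx, hl⟩ := P.exists_localSection x
  exact ⟨σ x, hl.proj_section x hx⟩

theorem exists_act_eq {u u' : P.Total} (h : P.proj u = P.proj u') : ∃ g, P.act u g = u' := by
  obtain ⟨U, σ, k, hx, hl⟩ := P.exists_localSection (P.proj u)
  have h1 := hl.act_coord u hx
  have h2 := hl.act_coord u' (h ▸ hx)
  refine ⟨(k u)⁻¹ * k u', ?_⟩
  rw [← h] at h2
  nth_rewrite 1 [← h1]
  rw [← P.act_mul, mul_inv_cancel_left, h2]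

variable {P} in
theorem IsLocalSection.contMDiffAt_act {U : Set M} {σ : M → P.Total} {h : P.Total → G}
    (hl : P.IsLocalSection U σ h) {y : M} (hy : y ∈ U) (g : G) :
    ContMDiffAt (𝓘(ℝ, E).prod 𝓘(ℝ, 𝔤)) (𝓘(ℝ, E).prod 𝓘(ℝ, 𝔤)) ∞
      (fun p : M × G => P.act (σ p.1) p.2) (y, g) :=
  hl.smooth_act.contMDiffAt ((hl.isOpen.prod isOpen_univ).mem_nhds ⟨hy, trivial⟩)

variable {P} in
theorem IsLocalSection.contMDiffAt {U : Set M} {σ : M → P.Total} {h : P.Total → G}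
    (hl : P.IsLocalSection U σ h) {y : M} (hy : y ∈ U) :
    ContMDiffAt 𝓘(ℝ, E) (𝓘(ℝ, E).prod 𝓘(ℝ, 𝔤)) ∞ σ y := by
  have h1 : ContMDiffAt 𝓘(ℝ, E) (𝓘(ℝ, E).prod 𝓘(ℝ, 𝔤)) ∞ (fun y : M => (y, (1 : G))) y :=
    contMDiffAt_id.prodMk contMDiffAt_const
  exact (ContMDiffAt.comp y (hl.contMDiffAt_act hy 1) h1).congr_of_eventuallyEq
    (Filter.Eventually.of_forall fun y => (P.act_one _).symm)

/-- Smoothness of the action is no axiom of the structure. It follows from the trivializations, in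
which the action is right multiplication of the group component. -/
theorem contMDiff_act [LieGroup 𝓘(ℝ, 𝔤) ∞ G] (g : G) :
    ContMDiff (𝓘(ℝ, E).prod 𝓘(ℝ, 𝔤)) (𝓘(ℝ, E).prod 𝓘(ℝ, 𝔤)) ∞ (fun u => P.act u g) := fun u => by
  obtain ⟨U, σ, h, hx, hl⟩ := P.exists_localSection (P.proj u)
  have h1 : ContMDiffAt (𝓘(ℝ, E).prod 𝓘(ℝ, 𝔤)) 𝓘(ℝ, 𝔤) ∞ (fun u => h u * g) u :=
    (hl.smooth_coord u hx).mul contMDiffAt_const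
  refine (ContMDiffAt.comp u (hl.contMDiffAt_act hx (h u * g))
    ((P.contMDiff_proj u).prodMk h1)).congr_of_eventuallyEq ?_
  filter_upwards [P.contMDiff_proj.continuous.continuousAt (hl.isOpen.mem_nhds hx)] with v hv
  change _ = P.act _ _
  rw [P.act_mul, hl.act_coord v hv]

theorem dproj_dact [LieGroup 𝓘(ℝ, 𝔤) ∞ G] (u : P.Total) (g : G)
    (ξ : TangentSpace (𝓘(ℝ, E).prod 𝓘(ℝ, 𝔤)) u) :
    (P.dproj (P.act u g) (P.dact u g ξ) : E) = P.dproj u ξ := by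
  have h := mfderiv_comp u (P.mdifferentiableAt_proj (P.act u g))
    ((P.contMDiff_act g u).mdifferentiableAt (by simp))
  have hc : P.proj ∘ (fun u => P.act u g) = P.proj := funext fun u => P.proj_act u g
  rw [hc] at h
  exact (DFunLike.congr_fun h ξ).symm

variable [FiniteDimensional ℝ E] [FiniteDimensional ℝ V]

/-- The isomorphism from the tangent space to `V` given by a point in a first order structure, with
the tangent space identified with the model space. -/
noncomputable def coframe (u : P.Total) : E ≃L[ℝ] V := P.frame u

theorem coframe_dproj (u : P.Total) (ξ : TangentSpace (𝓘(ℝ, E).prod 𝓘(ℝ, 𝔤)) u) :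
    P.coframe u (P.dproj u ξ) = P.θ u ξ := P.frame_dproj u ξ

/-- Translation along the fibres does not change the projection to TM, so equivariance of the
soldering form passes to the coframes. -/
theorem coframe_act [LieGroup 𝓘(ℝ, 𝔤) ∞ G] (u : P.Total) (g : G) (v : E) :
    P.coframe (P.act u g) v = (ρ g)⁻¹.val (P.coframe u v) := by
  obtain ⟨ξ, rfl⟩ := P.surjective_dproj u v
  have h1 : P.coframe (P.act u g) (P.dproj u ξ) = P.θ (P.act u g) (P.dact u g ξ) :=
    (congrArg (P.coframe (P.act u g)) (P.dproj_dact u g ξ)).symm.trans (P.coframe_dproj _ _)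
  rw [P.equivariant_θ, ← P.coframe_dproj] at h1
  exact h1

variable {P} in
theorem IsLocalSection.dproj_mfderiv {U : Set M} {σ : M → P.Total} {h : P.Total → G}
    (hl : P.IsLocalSection U σ h) {y : M} (hy : y ∈ U) (v : TangentSpace 𝓘(ℝ, E) y) :
    (P.dproj (σ y) (mfderiv 𝓘(ℝ, E) (𝓘(ℝ, E).prod 𝓘(ℝ, 𝔤)) σ y v) : E) = v := by
  have h1 := mfderiv_comp y (P.mdifferentiableAt_proj (σ y))
    ((hl.contMDiffAt hy).mdifferentiableAt (by simp))
  have hc : P.proj ∘ σ =ᶠ[𝓝 y] id := by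
    filter_upwards [hl.isOpen.mem_nhds hy] with z hz
    exact hl.proj_section z hz
  rw [hc.mfderiv_eq, mfderiv_id] at h1
  exact (DFunLike.congr_fun h1 v).symm

variable [IsManifold 𝓘(ℝ, E) ∞ M]

variable {P} in
theorem IsLocalSection.oneFormSmoothAt_coframe {U : Set M} {σ : M → P.Total}
    {h : P.Total → G}
    (hl : P.IsLocalSection U σ h) {y : M} (hy : y ∈ U) :
    OneFormSmoothAt 𝓘(ℝ, E) (fun y => ((P.coframe (σ y) : E ≃L[ℝ] V) : E →L[ℝ] V)) y := by
  have h1 : OneFormSmoothAt (𝓘(ℝ, E).prod 𝓘(ℝ, 𝔤)) P.θ (σ y) := P.smooth_θ (σ y)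
  refine (h1.pullback (hl.contMDiffAt hy)).congr_of_eventuallyEq ?_
  filter_upwards [hl.isOpen.mem_nhds hy] with z hz
  congr 1
  refine ContinuousLinearMap.ext fun v => ?_
  have h2 := P.coframe_dproj (σ z) (mfderiv 𝓘(ℝ, E) (𝓘(ℝ, E).prod 𝓘(ℝ, 𝔤)) σ z v)
  exact (congrArg (P.coframe (σ z)) (hl.dproj_mfderiv hz v)).symm.trans h2

/-- A coframe in the preferred chart at `x`. -/
noncomputable def coframeInChart (σ : M → P.Total) (x : M) (z : E) : E →L[ℝ] V :=
  ((P.coframe (σ ((extChartAt 𝓘(ℝ, E) x).symm z)) : E ≃L[ℝ] V) : E →L[ℝ] V) ∘L chartSymmDeriv x z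

variable {P} in
theorem IsLocalSection.contDiffAt_coframeInChart {U : Set M} {σ : M → P.Total} {h : P.Total → G}
    (hl : P.IsLocalSection U σ h) {x : M} {z : E} (hz : z ∈ (extChartAt 𝓘(ℝ, E) x).target)
    (hzU : (extChartAt 𝓘(ℝ, E) x).symm z ∈ U) :
    ContDiffAt ℝ ∞ (P.coframeInChart σ x) z := by
  rw [← oneFormSmoothAt_vectorSpace_iff]
  exact (hl.oneFormSmoothAt_coframe hzU).pullback (contMDiffAt_extChartAt_symm hz)

end FirstOrderStructure

/-! ### The line bundle determined by a CSp(V)-structure. -/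

section CSpStructureLine

variable {V : Type*} [NormedAddCommGroup V] [NormedSpace ℝ V] [FiniteDimensional ℝ V]
  [Nontrivial V] {b : SymplecticForm V}

namespace SymplecticForm

theorem exists_scale (g : b.CSp) :
    ∃ c : ℝ, c ≠ 0 ∧ ∀ v w, b (g.1.val v) (g.1.val w) = c * b v w := by
  obtain ⟨c, hc⟩ := g.2
  refine ⟨c, ?_, hc⟩
  rintro rfl
  obtain ⟨p, hp⟩ := b.exists_pair
  have hv : ∀ v, g.1.val (g.1⁻¹.val v) = v := fun v => by
    rw [← mul_apply_eq_comp, g.1.mul_inv]; rfl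
  have := hc (g.1⁻¹.val p.1) (g.1⁻¹.val p.2)
  rw [hv, hv, hp, zero_mul] at this
  exact one_ne_zero this

variable {F : Type*} [NormedAddCommGroup F] [NormedSpace ℝ F]

theorem pullback_apply (A : F →L[ℝ] V) (v w : F) :
    b.form.compContinuousLinearMap A ![v, w] = b (A v) (A w) := contAlt_comp _ _ _ _

theorem pullback_nondegenerate (A : F ≃L[ℝ] V) {v : F}
    (h : ∀ w, b.form.compContinuousLinearMap (A : F →L[ℝ] V) ![v, w] = 0) : v = 0 := by
  have h1 : A v = 0 := b.nondegenerate _ fun w => by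
    have := h (A.symm w)
    rw [pullback_apply] at this
    have h2 : b (A v) w = 0 := by simpa using this
    exact h2
  exact A.map_eq_zero_iff.1 h1

theorem pullback_ne_zero (A : F ≃L[ℝ] V) :
    b.form.compContinuousLinearMap (A : F →L[ℝ] V) ≠ 0 := fun h => by
  obtain ⟨v, hv⟩ := exists_ne (0 : V)
  have h1 : A.symm v = 0 := b.pullback_nondegenerate A fun w => by rw [h]; rfl
  exact hv (A.symm.map_eq_zero_iff.1 h1)

end SymplecticForm

open SymplecticForm

variable {E : Type*} [NormedAddCommGroup E] [NormedSpace ℝ E] [FiniteDimensional ℝ E]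
  {M : Type*} [TopologicalSpace M] [ChartedSpace E M]

namespace CSpStructure

variable (P : CSpStructure b E M)

/-- The pullback of `b` along the coframe given by a point of the structure. -/
noncomputable def twoCovector (u : P.Total) : E [⋀^Fin 2]→L[ℝ] ℝ :=
  b.form.compContinuousLinearMap (P.coframe u : E →L[ℝ] V)

theorem twoCovector_apply (u : P.Total) (v w : E) :
    P.twoCovector u ![v, w] = b (P.coframe u v) (P.coframe u w) := pullback_apply _ _ _

theorem twoCovector_ne_zero (u : P.Total) : P.twoCovector u ≠ 0 := pullback_ne_zero _

theorem twoCovector_nondegenerate (u : P.Total) {v : E} (h : ∀ w, P.twoCovector u ![v, w] = 0) :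
    v = 0 := pullback_nondegenerate _ h

theorem exists_twoCovector_act (u : P.Total) (g : b.CSp) :
    ∃ c : ℝ, c ≠ 0 ∧ P.twoCovector (P.act u g) = c • P.twoCovector u := by
  obtain ⟨c, h0, hc⟩ := exists_scale g⁻¹
  refine ⟨c, h0, contAlt_ext fun v w => ?_⟩
  rw [twoCovector_apply, P.coframe_act, P.coframe_act]
  exact (hc _ _).trans (congrArg (c * ·) (P.twoCovector_apply u v w).symm)

theorem span_twoCovector_eq {u u' : P.Total} (h : P.proj u = P.proj u') :
    Submodule.span ℝ {P.twoCovector u} = Submodule.span ℝ {P.twoCovector u'} := by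
  obtain ⟨g, rfl⟩ := P.exists_act_eq h
  obtain ⟨c, h0, hc⟩ := P.exists_twoCovector_act u g
  rw [hc, Submodule.span_singleton_smul_eq (IsUnit.mk0 c h0)]

variable [IsManifold 𝓘(ℝ, E) ∞ M]

/-- The pullback of `b` along the coframe given by a section. -/
noncomputable def sectionForm (σ : M → P.Total) : TwoForm E M := fun y => P.twoCovector (σ y)

theorem inChart_sectionForm (σ : M → P.Total) (x : M) (z : E) :
    (P.sectionForm σ).inChart x z = b.form.compContinuousLinearMap (P.coframeInChart σ x z) :=
  contAlt_ext fun v w => by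
    rw [TwoForm.inChart_apply, pullback_apply]
    exact P.twoCovector_apply _ _ _

variable {P} in
theorem smoothOn_sectionForm {U : Set M} {σ : M → P.Total} {h : P.Total → b.CSp}
    (hl : P.IsLocalSection U σ h) : (P.sectionForm σ).SmoothOn U := by
  refine (TwoForm.smoothOn_iff _ hl.isOpen).2 fun x hx => ?_
  have h1 : (P.sectionForm σ).inChart x = fun z =>
    b.form.compContinuousLinearMap (P.coframeInChart σ x z) := funext (P.inChart_sectionForm σ x)
  rw [h1]
  refine ContDiffAt.contAlt_comp contDiffAt_const
    (hl.contDiffAt_coframeInChart (mem_extChartAt_target x) ?_)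
  rwa [extChartAt_to_inv]

/-- The almost conformally symplectic structure determined by a first order structure. -/
noncomputable def toAlmostConformallySymplectic : AlmostConformallySymplectic E M where
  -- Any point over x spans the same line. The chosen one need not depend smoothly on x, so
  -- smoothness is checked on local sections.
  line x := Submodule.span ℝ {P.twoCovector (Function.surjInv P.surjective_proj x)}
  smooth x := by
    obtain ⟨U, σ, h, hx, hl⟩ := P.exists_localSection x
    refine ⟨U, hl.isOpen, hx, P.sectionForm σ, smoothOn_sectionForm hl, fun y hy =>
      ⟨P.twoCovector_ne_zero (σ y), P.span_twoCovector_eq ?_⟩⟩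
    exact (Function.surjInv_eq P.surjective_proj y).trans (hl.proj_section y hy).symm
  nondegenerate x τ hτ h0 v hv := by
    obtain ⟨c, rfl⟩ := Submodule.mem_span_singleton.1 hτ
    have hc : c ≠ 0 := by
      rintro rfl
      exact h0 (zero_smul _ _)
    exact P.twoCovector_nondegenerate _ fun w => (mul_eq_zero.1 (hv w)).resolve_left hc

theorem determines_iff {ℓ : AlmostConformallySymplectic E M} :
    P.Determines ℓ ↔ ∀ u, ℓ.line (P.proj u) = Submodule.span ℝ {P.twoCovector u} := Iff.rfl

theorem existsUnique_determines : ∃! ℓ : AlmostConformallySymplectic E M, P.Determines ℓ := by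
  have h : P.Determines P.toAlmostConformallySymplectic :=
    P.determines_iff.2 fun u => P.span_twoCovector_eq (Function.surjInv_eq _ _)
  refine ⟨_, h, fun ℓ hℓ => ?_⟩
  refine AlmostConformallySymplectic.ext (funext fun x => ?_)
  obtain ⟨u, rfl⟩ := P.surjective_proj x
  exact (hℓ u).trans (h u).symm

end CSpStructure

end CSpStructureLine

/-- In a trivialization of the tangent bundle both forms become smooth maps into spaces of linear
maps, and inversion is smooth at isomorphisms; the trivialization cancels in the composite. This is
how comparison maps between coframes are seen to be smooth. -/
theorem OneFormSmoothAt.contMDiffAt_comp_symm {EN HN N : Type*} [NormedAddCommGroup EN]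
    [NormedSpace ℝ EN] [CompleteSpace EN] [TopologicalSpace HN]
    {I : ModelWithCorners ℝ EN HN} [TopologicalSpace N] [ChartedSpace HN N] [IsManifold I ∞ N]
    {F : Type*} [NormedAddCommGroup F] [NormedSpace ℝ F]
    {F' : Type*} [NormedAddCommGroup F'] [NormedSpace ℝ F']
    {α : Π u : N, TangentSpace I u →L[ℝ] F} {β : Π u : N, TangentSpace I u ≃L[ℝ] F'} {u : N}
    (hα : OneFormSmoothAt I α u)
    (hβ : OneFormSmoothAt I (fun u => (β u : TangentSpace I u →L[ℝ] F')) u) :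
    ContMDiffAt I 𝓘(ℝ, F' →L[ℝ] F) ∞
      (fun u => (α u) ∘L ((β u).symm : F' →L[ℝ] TangentSpace I u)) u := by
  rw [oneFormSmoothAt_iff] at hα hβ
  set t := trivializationAt EN (TangentSpace I) u with ht
  have hu : u ∈ t.baseSet := mem_baseSet_trivializationAt EN (TangentSpace I) u
  have key : ∀ y, y ∈ t.baseSet → ∃ e : EN ≃L[ℝ] TangentSpace I y,
      (e : EN →L[ℝ] TangentSpace I y) = t.symmL ℝ y := fun y hy =>
    ⟨(t.continuousLinearEquivAt ℝ y hy).symm, DFunLike.coe_injective (t.symm_continuousLinearEquivAt_eq hy)⟩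
  have hβ' : ∀ y, ∀ e : EN ≃L[ℝ] TangentSpace I y,
      (e : EN →L[ℝ] TangentSpace I y) = t.symmL ℝ y →
      oneFormInTrivialization I (fun u => (β u : TangentSpace I u →L[ℝ] F')) u y =
        ((e.trans (β y) : EN ≃L[ℝ] F') : EN →L[ℝ] F') := fun y e he => by
    refine ContinuousLinearMap.ext fun w => ?_
    exact congrArg (β y) (DFunLike.congr_fun he w).symm
  obtain ⟨e, he⟩ := key u hu
  have h1 : ContMDiffAt 𝓘(ℝ, EN →L[ℝ] F') 𝓘(ℝ, F' →L[ℝ] EN) ∞ ContinuousLinearMap.inverse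
      (oneFormInTrivialization I (fun u => (β u : TangentSpace I u →L[ℝ] F')) u u) := by
    rw [hβ' u e he]
    exact (contDiffAt_map_inverse _).contMDiffAt
  have h2 := hα.clm_comp (ContMDiffAt.comp u h1 hβ)
  refine h2.congr_of_eventuallyEq ?_
  filter_upwards [t.open_baseSet.mem_nhds hu] with y hy
  obtain ⟨e, he⟩ := key y hy
  refine ContinuousLinearMap.ext fun w => ?_
  simp only [Function.comp_apply]
  rw [hβ' y e he, ContinuousLinearMap.inverse_equiv]
  change α y ((β y).symm w) = α y (t.symmL ℝ y (e.symm ((β y).symm w)))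
  rw [← he]
  exact congrArg (α y) (e.apply_symm_apply _).symm

/-! ### Morphisms and pullbacks of line bundles. -/

section Morphisms

variable {V : Type*} [NormedAddCommGroup V] [NormedSpace ℝ V] [FiniteDimensional ℝ V]
  [Nontrivial V] {b : SymplecticForm V}
  {E : Type*} [NormedAddCommGroup E] [NormedSpace ℝ E] [FiniteDimensional ℝ E]
  {M : Type*} [TopologicalSpace M] [ChartedSpace E M]
  {M' : Type*} [TopologicalSpace M'] [ChartedSpace E M']

open SymplecticForm

namespace CSpStructure


variable (P : CSpStructure.{w} b E M) (P' : CSpStructure.{w'} b E M')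

/-- The derivative of a map between manifolds, as an endomorphism of the model space. -/
noncomputable def mapDeriv (f : M → M') (x : M) : E →L[ℝ] E := mfderiv 𝓘(ℝ, E) 𝓘(ℝ, E) f x

/-- The point `u'` over `f x` is compatible with `u` over `x`. -/
def IsLift (f : M → M') (u : P.Total) (u' : P'.Total) : Prop :=
  P'.proj u' = f (P.proj u) ∧
    ∀ v : E, P'.coframe u' (mapDeriv f (P.proj u) v) = P.coframe u v

variable {P P'}

/-- Two lifts differ by some g. Their coframes composed with Tf both equal the coframe of u, which
is onto V, so g⁻¹ fixes all of V. -/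
theorem IsLift.unique {f : M → M'} {u : P.Total} {u' u'' : P'.Total} (h : IsLift P P' f u u')
    (h' : IsLift P P' f u u'') : u' = u'' := by
  obtain ⟨g, rfl⟩ := P'.exists_act_eq (h.1.trans h'.1.symm)
  have hg : g = 1 := by
    rw [← inv_eq_one]
    refine Subtype.ext (Units.ext (ContinuousLinearMap.ext fun v => ?_))
    obtain ⟨v, rfl⟩ := (P.coframe u).surjective v
    have h1 := h'.2 v
    rw [P'.coframe_act, h.2] at h1
    exact h1
  rw [hg, P'.act_one]

theorem IsLift.act {f : M → M'} {u : P.Total} {u' : P'.Total} (h : IsLift P P' f u u')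
    (g : b.CSp) : IsLift P P' f (P.act u g) (P'.act u' g) := by
  refine ⟨by rw [P'.proj_act, P.proj_act, h.1], fun v => ?_⟩
  rw [P'.coframe_act, P.coframe_act, P.proj_act, h.2]

theorem dproj_mfderiv {f : M → M'} {F : P.Total → P'.Total} {u : P.Total}
    (hf : MDifferentiableAt 𝓘(ℝ, E) 𝓘(ℝ, E) f (P.proj u))
    (hF : MDifferentiableAt (𝓘(ℝ, E).prod 𝓘(ℝ, ℝ × b.sp)) (𝓘(ℝ, E).prod 𝓘(ℝ, ℝ × b.sp)) F u)
    (h : ∀ u, P'.proj (F u) = f (P.proj u))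
    (ξ : TangentSpace (𝓘(ℝ, E).prod 𝓘(ℝ, ℝ × b.sp)) u) :
    (P'.dproj (F u) (mfderiv (𝓘(ℝ, E).prod 𝓘(ℝ, ℝ × b.sp)) (𝓘(ℝ, E).prod 𝓘(ℝ, ℝ × b.sp)) F u ξ) : E)
      = mapDeriv (E := E) f (P.proj u) (P.dproj u ξ) := by
  have h1 := mfderiv_comp u (P'.mdifferentiableAt_proj (F u)) hF
  have h2 := mfderiv_comp u hf (P.mdifferentiableAt_proj u)
  have hc : P'.proj ∘ F = f ∘ P.proj := funext h
  rw [hc, h2] at h1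
  exact (DFunLike.congr_fun h1 ξ).symm

/-- The soldering forms are the coframes composed with the projections to the tangent spaces. As F
covers f, compatibility with the soldering forms is the equation for the coframes, and F is
determined by f. -/
theorem isLift_of_isMorphism {f : M → M'} (hf : ContMDiff 𝓘(ℝ, E) 𝓘(ℝ, E) ∞ f)
    {F : P.Total → P'.Total} (hF : P.IsMorphism P' f F) (u : P.Total) : IsLift P P' f u (F u) := by
  refine ⟨hF.proj_map u, fun v => ?_⟩
  obtain ⟨ξ, hξ⟩ := P.surjective_dproj u v
  have h1 : P.coframe u v = P.θ u ξ :=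
    (congrArg (P.coframe u) hξ).symm.trans (P.coframe_dproj u ξ)
  have h2 := dproj_mfderiv (hf.mdifferentiableAt (by simp))
    (hF.smooth.mdifferentiableAt (x := u) (by simp)) hF.proj_map ξ
  have h3 := congrArg (P'.coframe (F u)) (h2.trans (congrArg (mapDeriv (E := E) f (P.proj u)) hξ))
  exact h3.symm.trans ((P'.coframe_dproj (F u) _).trans ((hF.pullback_θ u ξ).trans h1.symm))

theorem isMorphism_unique {f : M → M'} (hf : ContMDiff 𝓘(ℝ, E) 𝓘(ℝ, E) ∞ f)
    {F F' : P.Total → P'.Total} (hF : P.IsMorphism P' f F) (hF' : P.IsMorphism P' f F') : F = F' :=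
  funext fun u => (isLift_of_isMorphism hf hF u).unique (isLift_of_isMorphism hf hF' u)

variable [IsManifold 𝓘(ℝ, E) ∞ M] [IsManifold 𝓘(ℝ, E) ∞ M']

theorem Determines.line_eq {ℓ : AlmostConformallySymplectic E M} (h : P.Determines ℓ) {u : P.Total}
    {x : M} (hu : P.proj u = x) :
    ℓ.line x = Submodule.span ℝ {(P.twoCovector u : TwoCovector E x)} := by
  subst hu
  exact h u

theorem image_span_comp {F : Type*} [NormedAddCommGroup F] [NormedSpace ℝ F]
    {F' : Type*} [NormedAddCommGroup F'] [NormedSpace ℝ F'] (A : F →L[ℝ] F')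
    (σ : F' [⋀^Fin 2]→L[ℝ] ℝ) :
    ((Submodule.span ℝ {σ.compContinuousLinearMap A} : Submodule ℝ _) : Set (F [⋀^Fin 2]→L[ℝ] ℝ)) =
      (fun τ : F' [⋀^Fin 2]→L[ℝ] ℝ => τ.compContinuousLinearMap A) ''
        (Submodule.span ℝ {σ} : Submodule ℝ (F' [⋀^Fin 2]→L[ℝ] ℝ)) := by
  have key : ∀ c : ℝ, (c • σ).compContinuousLinearMap A = c • σ.compContinuousLinearMap A :=
    fun c => contAlt_ext fun v w => rfl
  ext τ
  constructor
  · intro hτ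
    obtain ⟨c, rfl⟩ := Submodule.mem_span_singleton.1 hτ
    exact ⟨_, Submodule.mem_span_singleton.2 ⟨c, rfl⟩, key c⟩
  · rintro ⟨σ, hσ, rfl⟩
    obtain ⟨c, rfl⟩ := Submodule.mem_span_singleton.1 hσ
    exact Submodule.mem_span_singleton.2 ⟨c, (key c).symm⟩

theorem IsLift.image_eq {ℓ : AlmostConformallySymplectic E M}
    {ℓ' : AlmostConformallySymplectic E M'} (h : P.Determines ℓ) (h' : P'.Determines ℓ') {f : M → M'}
    {u : P.Total} {u' : P'.Total} (hu : IsLift P P' f u u') :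
    (ℓ.line (P.proj u) : Set (TwoCovector E (P.proj u))) =
    (fun τ : TwoCovector E (f (P.proj u)) =>
      τ.compContinuousLinearMap (mfderiv 𝓘(ℝ, E) 𝓘(ℝ, E) f (P.proj u))) ''
        ℓ'.line (f (P.proj u)) := by
  have key : (P'.twoCovector u').compContinuousLinearMap (mapDeriv f (P.proj u)) =
      P.twoCovector u := contAlt_ext fun v w => by
    rw [contAlt_comp, twoCovector_apply, hu.2, hu.2, twoCovector_apply]
  rw [h.line_eq rfl, h'.line_eq hu.1]
  have h1 := image_span_comp (mapDeriv f (P.proj u)) (P'.twoCovector u')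
  rw [key] at h1
  exact h1

/-- Start with any u' over the image point and let A be the coframe of u' after Tf after the inverse
coframe of u. Preservation of the lines means that A rescales b, by a non-zero factor because the
form of u is not zero. So A is an element of CSp(V), and translating u' by it gives the lift. -/
theorem exists_isLift {ℓ : AlmostConformallySymplectic E M}
    {ℓ' : AlmostConformallySymplectic E M'} (h : P.Determines ℓ) (h' : P'.Determines ℓ') {f : M → M'}
    (hf : ℓ.IsPullback ℓ' f) (u : P.Total) : ∃ u', IsLift P P' f u u' := by
  obtain ⟨u', hu'⟩ := P'.surjective_proj (f (P.proj u))
  obtain ⟨c, hc⟩ : ∃ c : ℝ, ∀ v w : E, P.twoCovector u ![v, w] = c * b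
      (P'.coframe u' (mapDeriv f (P.proj u) v)) (P'.coframe u' (mapDeriv f (P.proj u) w)) := by
    have h1 : (P.twoCovector u : TwoCovector E (P.proj u)) ∈
        (ℓ.line (P.proj u) : Set (TwoCovector E (P.proj u))) := by
      rw [h.line_eq rfl]
      exact Submodule.mem_span_singleton_self (P.twoCovector u)
    rw [hf (P.proj u), h'.line_eq hu'] at h1
    have h2 := (image_span_comp (mapDeriv f (P.proj u)) (P'.twoCovector u')).symm.subset h1
    obtain ⟨c, h3⟩ := Submodule.mem_span_singleton.1 h2
    refine ⟨c, fun v w => ?_⟩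
    rw [← h3, ← twoCovector_apply, ← contAlt_comp]
    rfl
  have hc0 : c ≠ 0 := by
    rintro rfl
    refine P.twoCovector_ne_zero u (contAlt_ext fun v w => ?_)
    rw [hc, zero_mul]
    rfl
  let A : V →L[ℝ] V := (P'.coframe u' : E →L[ℝ] V) ∘L mapDeriv f (P.proj u) ∘L
    ((P.coframe u).symm : V →L[ℝ] E)
  have hA : ∀ v w, b (A v) (A w) = c⁻¹ * b v w := fun v w => by
    have h1 := hc ((P.coframe u).symm v) ((P.coframe u).symm w)
    rw [twoCovector_apply, (P.coframe u).apply_symm_apply, (P.coframe u).apply_symm_apply] at h1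
    rw [h1, inv_mul_cancel_left₀ hc0]
    rfl
  have hinj : Function.Injective A := by
    rw [injective_iff_map_eq_zero]
    intro v hv
    refine b.nondegenerate v fun w => ?_
    have h1 := hA v w
    rw [hv, b.zero_left] at h1
    exact (mul_eq_zero.1 h1.symm).resolve_left (inv_ne_zero hc0)
  have hunit : IsUnit A := by
    rw [ContinuousLinearMap.isUnit_iff_bijective]
    exact ⟨hinj, (LinearMap.injective_iff_surjective (f := A.toLinearMap)).1 hinj⟩
  obtain ⟨a, ha⟩ := hunit
  refine ⟨P'.act u' ⟨a, c⁻¹, by rw [ha]; exact hA⟩, by rw [P'.proj_act, hu'], fun v => ?_⟩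
  rw [P'.coframe_act]
  change a⁻¹.val _ = _
  have h1 : P'.coframe u' (mapDeriv f (P.proj u) v) = a.val (P.coframe u v) := by
    rw [ha]
    change _ = P'.coframe u' (mapDeriv f (P.proj u) ((P.coframe u).symm (P.coframe u v)))
    rw [(P.coframe u).symm_apply_apply]
  rw [h1, ← mul_apply_eq_comp, a.inv_mul]
  rfl

/-- By equivariance F is determined by the function a comparing the images of the section σ with the
section σ'. This a is the coframe of σ' after Tf after the inverse coframe of σ, hence smooth, and F
is the translate of σ' by the product of a and the coordinate h. -/
theorem contMDiff_of_isLift {f : M → M'} (hf : ContMDiff 𝓘(ℝ, E) 𝓘(ℝ, E) ∞ f)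
    {F : P.Total → P'.Total} (hF : ∀ u, IsLift P P' f u (F u)) :
    ContMDiff (𝓘(ℝ, E).prod 𝓘(ℝ, ℝ × b.sp)) (𝓘(ℝ, E).prod 𝓘(ℝ, ℝ × b.sp)) ∞ F := by
  intro u
  obtain ⟨U, σ, h, hx, hl⟩ := P.exists_localSection (P.proj u)
  obtain ⟨U', σ', h', hx', hl'⟩ := P'.exists_localSection (f (P.proj u))
  have ha : ∀ y, ∃ g : b.CSp, y ∈ U → f y ∈ U' → P'.act (σ' (f y)) g = F (σ y) := fun y => by
    by_cases hy : y ∈ U ∧ f y ∈ U'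
    · obtain ⟨g, hg⟩ := P'.exists_act_eq (u := σ' (f y)) (u' := F (σ y))
        (by rw [(hF _).1, hl'.proj_section _ hy.2, hl.proj_section _ hy.1])
      exact ⟨g, fun _ _ => hg⟩
    -- Away from the domains of the two sections the value of a plays no role.
    · exact ⟨1, fun h1 h2 => (hy ⟨h1, h2⟩).elim⟩
  choose a ha using ha
  have hU : ∀ᶠ y in 𝓝 (P.proj u), y ∈ U ∧ f y ∈ U' :=
    Filter.Eventually.and (hl.isOpen.mem_nhds hx)
      (hf.continuous.continuousAt (hl'.isOpen.mem_nhds hx'))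
  have hsm : ContMDiffAt 𝓘(ℝ, E) 𝓘(ℝ, ℝ × b.sp) ∞ a (P.proj u) := by
    rw [CSp.contMDiffAt_iff]
    have h1 := ((hl'.oneFormSmoothAt_coframe hx').pullback (hf (P.proj u))).contMDiffAt_comp_symm
      (β := fun y => P.coframe (σ y)) (hl.oneFormSmoothAt_coframe hx)
    refine h1.congr_of_eventuallyEq ?_
    filter_upwards [hU] with y hy
    refine ContinuousLinearMap.ext fun v => ?_
    have h2 := (hF (σ y)).2 ((P.coframe (σ y)).symm v)
    rw [← ha y hy.1 hy.2, P'.coframe_act, (P.coframe (σ y)).apply_symm_apply,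
      hl.proj_section y hy.1] at h2
    change (a y).1.val v = P'.coframe (σ' (f y)) (mapDeriv f y ((P.coframe (σ y)).symm v))
    have h3 := congrArg (a y).1.val h2
    rw [← h3]
    change ((a y).1.val * (a y).1⁻¹.val) _ = _
    rw [(a y).1.mul_inv]
    rfl
  have h1 : ContMDiffAt (𝓘(ℝ, E).prod 𝓘(ℝ, ℝ × b.sp)) (𝓘(ℝ, E).prod 𝓘(ℝ, ℝ × b.sp)) ∞
      (fun u => (f (P.proj u), a (P.proj u) * h u)) u :=
    (ContMDiffAt.comp u (hf (P.proj u)) (P.contMDiff_proj u)).prodMk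
      ((ContMDiffAt.comp u hsm (P.contMDiff_proj u)).mul (hl.smooth_coord u hx))
  refine (ContMDiffAt.comp u (hl'.contMDiffAt_act hx' _) h1).congr_of_eventuallyEq ?_
  filter_upwards [P.contMDiff_proj.continuous.continuousAt hU] with v hv
  have h2 := (hF (σ (P.proj v))).act (h v)
  rw [hl.act_coord v hv.1, ← ha _ hv.1 hv.2, ← P'.act_mul] at h2
  exact (hF v).unique h2

theorem isPullback_iff_exists_isMorphism {ℓ : AlmostConformallySymplectic E M}
    {ℓ' : AlmostConformallySymplectic E M'} (h : P.Determines ℓ) (h' : P'.Determines ℓ') {f : M → M'}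
    (hf : ContMDiff 𝓘(ℝ, E) 𝓘(ℝ, E) ∞ f) :
    ℓ.IsPullback ℓ' f ↔ ∃ F : P.Total → P'.Total, P.IsMorphism P' f F := by
  constructor
  · intro hp
    choose F hF using exists_isLift h h' hp
    have hs := contMDiff_of_isLift hf hF
    refine ⟨F, hs, fun u => (hF u).1, fun u g => (hF _).unique ((hF u).act g), fun u ξ => ?_⟩
    have h1 := dproj_mfderiv (hf.mdifferentiableAt (by simp))
      (hs.mdifferentiableAt (x := u) (by simp)) (fun u => (hF u).1) ξ
    exact (P'.coframe_dproj (F u) _).symm.trans ((congrArg (P'.coframe (F u)) h1).trans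
      (((hF u).2 _).trans (P.coframe_dproj u ξ)))
  · rintro ⟨F, hF⟩ x
    obtain ⟨u, rfl⟩ := P.surjective_proj x
    exact (isLift_of_isMorphism hf hF u).image_eq h h'

end CSpStructure

end Morphisms

/-! ### Smooth local coframes adapted to a two-form. -/

section SmoothCoframes

variable {V : Type*} [NormedAddCommGroup V] [NormedSpace ℝ V] [FiniteDimensional ℝ V]
  [Nontrivial V] (b : SymplecticForm V)
  {E : Type*} [NormedAddCommGroup E] [NormedSpace ℝ E] [FiniteDimensional ℝ E]
  {M : Type*} [TopologicalSpace M] [ChartedSpace E M] [IsManifold 𝓘(ℝ, E) ∞ M]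

open SymplecticForm

/-- A linear isomorphism B identifies τ at x with b. In the chart, the nearby values of τ are
pullbacks of its value at x by endomorphisms C depending smoothly on them. The composite of B, C and
the chart derivative pulls b back to τ, and non-degeneracy makes it invertible. -/
theorem TwoForm.exists_smooth_coframe (hEV : finrank ℝ E = finrank ℝ V) {τ : TwoForm E M} {W : Set M}
    (hW : IsOpen W) (hτ : τ.SmoothOn W) (hn : ∀ y ∈ W, ∀ v : TangentSpace 𝓘(ℝ, E) y,
      (∀ w : TangentSpace 𝓘(ℝ, E) y, τ y ![v, w] = 0) → v = 0) {x : M} (hx : x ∈ W) :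
    ∃ U ⊆ W, IsOpen U ∧ x ∈ U ∧ ∃ A : M → (E ≃L[ℝ] V),
      (∀ y ∈ U, OneFormSmoothAt 𝓘(ℝ, E) (fun y => ((A y : E ≃L[ℝ] V) : E →L[ℝ] V)) y) ∧
      ∀ y ∈ U, b.form.compContinuousLinearMap (A y : E →L[ℝ] V) = τ y := by
  have : Nontrivial E := finrank_pos_iff (R := ℝ).1 (hEV ▸ finrank_pos)
  let c := τ.symplecticAt x (hn x hx)
  obtain ⟨B, hB⟩ := b.exists_equiv c hEV
  obtain ⟨C, hC, hCp⟩ := c.exists_smooth_normal_form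
  let f : M → E [⋀^Fin 2]→L[ℝ] ℝ := fun y => τ.inChart x (extChartAt 𝓘(ℝ, E) x y)
  have hf : ∀ y ∈ W, y ∈ (extChartAt 𝓘(ℝ, E) x).source →
      ContMDiffAt 𝓘(ℝ, E) 𝓘(ℝ, E [⋀^Fin 2]→L[ℝ] ℝ) ∞ f y := fun y hy hys =>
    ContMDiffAt.comp (f := extChartAt 𝓘(ℝ, E) x) y (hτ.contDiffAt hW hy hys).contMDiffAt
      (contMDiffAt_extChartAt' (by rwa [← extChartAt_source 𝓘(ℝ, E)]))
  have hxs := mem_extChartAt_source (I := 𝓘(ℝ, E)) x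
  -- Regularity of class ω at a point persists nearby, which fails for `ContDiffAt ℝ ∞`; for this
  -- reason the normal form is used in class ω.
  have hev : ∀ᶠ y in 𝓝 x, ContDiffAt ℝ ω C (f y) ∧ c.form.compContinuousLinearMap (C (f y)) = f y :=
    (hf x hx hxs).continuousAt.eventually ((hC.eventually (by simp)).and hCp)
  obtain ⟨U, hU, hUo, hxU⟩ := mem_nhds_iff.1 (Filter.inter_mem hev (Filter.inter_mem
    (hW.mem_nhds hx) ((isOpen_extChartAt_source x).mem_nhds hxs)))
  let A' : M → E →L[ℝ] V := fun y => ((B : E →L[ℝ] V) ∘L C (f y)) ∘L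
    (chartDeriv x y : TangentSpace 𝓘(ℝ, E) y →L[ℝ] E)
  have hA' : ∀ y ∈ U, b.form.compContinuousLinearMap (A' y) = τ y := fun y hy => by
    refine contAlt_ext fun v w => ?_
    rw [pullback_apply]
    refine (hB _ _).trans ?_
    have h1 := c.pullback_apply (C (f y)) (chartDeriv x y v) (chartDeriv x y w)
    rw [(hU hy).1.2] at h1
    exact h1.symm.trans (τ.inChart_chartDeriv (hU hy).2.2 v w)
  have hex : ∀ y, ∃ A : E ≃L[ℝ] V, y ∈ U → (A : E →L[ℝ] V) = A' y := fun y => by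
    by_cases hy : y ∈ U
    · have hinj : Function.Injective (A' y).toLinearMap := by
        rw [injective_iff_map_eq_zero]
        intro v hv
        refine hn y (hU hy).2.1 v fun w => ?_
        rw [← hA' y hy]
        refine (b.pullback_apply (A' y) v w).trans ?_
        rw [show A' y v = 0 from hv, b.zero_left]
      exact ⟨(LinearEquiv.ofInjectiveOfFinrankEq _ hinj hEV).toContinuousLinearEquiv,
        fun _ => rfl⟩
    · exact ⟨B, fun h => (hy h).elim⟩
  choose A hA using hex
  refine ⟨U, fun y hy => (hU hy).2.1, hUo, hxU, A, fun y hy => ?_, fun y hy => by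
    rw [hA y hy, hA' y hy]⟩
  have h1 : ContMDiffAt 𝓘(ℝ, E) 𝓘(ℝ, E →L[ℝ] V) ∞ (fun y => (B : E →L[ℝ] V) ∘L C (f y)) y :=
    contMDiffAt_const.clm_comp (ContMDiffAt.comp y ((hU hy).1.1.of_le le_top).contMDiffAt
      (hf y (hU hy).2.1 (hU hy).2.2))
  have h2 : OneFormSmoothAt 𝓘(ℝ, E)
      (fun y => mfderiv 𝓘(ℝ, E) 𝓘(ℝ, E) (extChartAt 𝓘(ℝ, E) x) y) y :=
    OneFormSmoothAt.mfderiv_self (contMDiffAt_extChartAt' (by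
      have := (hU hy).2.2
      rwa [← extChartAt_source 𝓘(ℝ, E)]))
  refine (h2.clm_comp h1).congr_of_eventuallyEq ?_
  filter_upwards [hUo.mem_nhds hy] with z hz
  rw [hA z hz]
  rfl

namespace AlmostConformallySymplectic

theorem exists_smooth_coframe (hEV : finrank ℝ E = finrank ℝ V)
    (ℓ : AlmostConformallySymplectic E M) (x : M) :
    ∃ U : Set M, IsOpen U ∧ x ∈ U ∧ ∃ A : M → (E ≃L[ℝ] V),
      (∀ y ∈ U, OneFormSmoothAt 𝓘(ℝ, E) (fun y => ((A y : E ≃L[ℝ] V) : E →L[ℝ] V)) y) ∧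
      ∀ y ∈ U, ℓ.line y =
        Submodule.span ℝ {(b.form.compContinuousLinearMap (A y : E →L[ℝ] V) : TwoCovector E y)} := by
  obtain ⟨W, hW, hx, τ, hτ, hl⟩ := ℓ.smooth x
  obtain ⟨U, hUW, hU, hxU, A, hA, hAτ⟩ := TwoForm.exists_smooth_coframe b hEV hW hτ (fun y hy =>
    ℓ.nondegenerate y (τ y) (by
      rw [(hl y hy).2]
      exact Submodule.mem_span_singleton_self _) (hl y hy).1) hx
  refine ⟨U, hU, hxU, A, hA, fun y hy => ?_⟩
  rw [(hl y (hUW hy)).2]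
  exact congrArg (fun σ : E [⋀^Fin 2]→L[ℝ] ℝ => Submodule.span ℝ {σ}) (hAτ y hy).symm

end AlmostConformallySymplectic

end SmoothCoframes

/-! ### Glueing local coframes to a principal bundle. -/

section CoframeAtlas

variable {V : Type*} [NormedAddCommGroup V] [NormedSpace ℝ V] [FiniteDimensional ℝ V]
  [Nontrivial V] (b : SymplecticForm V)
  (E : Type*) [NormedAddCommGroup E] [NormedSpace ℝ E] [FiniteDimensional ℝ E]
  (M : Type*) [TopologicalSpace M] [ChartedSpace E M] [IsManifold 𝓘(ℝ, E) ∞ M]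

open SymplecticForm

/-- A family of smooth local coframes, one around each point, any two of which are related by
conformally symplectic transformations. -/
structure CoframeAtlas where
  domain : M → Set M
  isOpen_domain : ∀ i, IsOpen (domain i)
  mem_domain : ∀ i, i ∈ domain i
  coframe : M → M → (E ≃L[ℝ] V)
  smooth : ∀ i, ∀ y ∈ domain i,
    OneFormSmoothAt 𝓘(ℝ, E) (fun y => ((coframe i y : E ≃L[ℝ] V) : E →L[ℝ] V)) y
  trans : M → M → M → b.CSp
  trans_apply : ∀ i j, ∀ y ∈ domain i ∩ domain j, ∀ v : E,
    (trans i j y).1.val (coframe i y v) = coframe j y v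

namespace CoframeAtlas

variable {b E M} (𝒜 : CoframeAtlas b E M)

/-- A coframe is onto V, so its relation to another coframe determines the transition element. The
cocycle identities follow from this uniqueness. -/
theorem trans_eq {i j y : M} (hy : y ∈ 𝒜.domain i ∩ 𝒜.domain j) {g : b.CSp}
    (h : ∀ v, g.1.val (𝒜.coframe i y v) = 𝒜.coframe j y v) : 𝒜.trans i j y = g := by
  refine Subtype.ext (Units.ext (ContinuousLinearMap.ext fun v => ?_))
  obtain ⟨v, rfl⟩ := (𝒜.coframe i y).surjective v
  rw [𝒜.trans_apply i j y hy, h]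

theorem trans_self {i y : M} (hy : y ∈ 𝒜.domain i) : 𝒜.trans i i y = 1 :=
  𝒜.trans_eq ⟨hy, hy⟩ fun _ => rfl

theorem trans_mul {i j k y : M} (hi : y ∈ 𝒜.domain i) (hj : y ∈ 𝒜.domain j) (hk : y ∈ 𝒜.domain k) :
    𝒜.trans j k y * 𝒜.trans i j y = 𝒜.trans i k y :=
  (𝒜.trans_eq ⟨hi, hk⟩ fun v => by
    change (𝒜.trans j k y).1.val ((𝒜.trans i j y).1.val _) = _
    rw [𝒜.trans_apply i j y ⟨hi, hj⟩, 𝒜.trans_apply j k y ⟨hj, hk⟩]).symm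

theorem contMDiffAt_trans {i j y : M} (hi : y ∈ 𝒜.domain i) (hj : y ∈ 𝒜.domain j) :
    ContMDiffAt 𝓘(ℝ, E) 𝓘(ℝ, ℝ × b.sp) ∞ (𝒜.trans i j) y := by
  rw [CSp.contMDiffAt_iff]
  refine ((𝒜.smooth j y hj).contMDiffAt_comp_symm (β := fun y => 𝒜.coframe i y)
    (𝒜.smooth i y hi)).congr_of_eventuallyEq ?_
  filter_upwards [((𝒜.isOpen_domain i).inter (𝒜.isOpen_domain j)).mem_nhds ⟨hi, hj⟩] with z hz
  refine ContinuousLinearMap.ext fun v => ?_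
  obtain ⟨v, rfl⟩ := (𝒜.coframe i z).surjective v
  refine (𝒜.trans_apply i j z hz v).trans (congrArg (𝒜.coframe j z) ?_)
  exact ((𝒜.coframe i z).symm_apply_apply v).symm

theorem contMDiffOn_trans_mul (i j : M) :
    ContMDiffOn (𝓘(ℝ, E).prod 𝓘(ℝ, ℝ × b.sp)) (𝓘(ℝ, E).prod 𝓘(ℝ, ℝ × b.sp)) ∞
      (fun p : M × b.CSp => (p.1, 𝒜.trans i j p.1 * p.2))
      ((𝒜.domain i ∩ 𝒜.domain j) ×ˢ univ) := by
  intro p hp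
  refine (contMDiffAt_fst.prodMk (ContMDiffAt.mul ?_ contMDiffAt_snd)).contMDiffWithinAt
  exact ContMDiffAt.comp p (𝒜.contMDiffAt_trans hp.1.1 hp.1.2) contMDiffAt_fst

/-- The principal bundle obtained by glueing the trivial bundles over the domains. -/
noncomputable def core : FiberBundleCore M M b.CSp where
  baseSet := 𝒜.domain
  isOpen_baseSet := 𝒜.isOpen_domain
  indexAt := id
  mem_baseSet_at := 𝒜.mem_domain
  coordChange i j y g := 𝒜.trans i j y * g
  coordChange_self i y hy g := by rw [𝒜.trans_self hy, one_mul]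
  continuousOn_coordChange i j := 
    continuous_snd.comp_continuousOn (𝒜.contMDiffOn_trans_mul i j).continuousOn
  coordChange_comp i j k y hy g := by rw [← mul_assoc, 𝒜.trans_mul hy.1.1 hy.1.2 hy.2]

/-- The total space. -/
abbrev Total : Type _ := 𝒜.core.TotalSpace

/-- The position of a point relative to the coframe centred at its base point. -/
def coord (u : 𝒜.Total) : b.CSp := u.snd

/-- The trivialization of the total space over a domain. -/
noncomputable def triv (i : M) : OpenPartialHomeomorph 𝒜.Total (M × b.CSp) :=
  (𝒜.core.localTriv i).toOpenPartialHomeomorph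

theorem triv_source (i : M) : (𝒜.triv i).source = (fun u : 𝒜.Total => u.proj) ⁻¹' 𝒜.domain i := rfl

theorem triv_target (i : M) : (𝒜.triv i).target = 𝒜.domain i ×ˢ univ := rfl

theorem triv_apply (i : M) (u : 𝒜.Total) :
    𝒜.triv i u = (u.proj, 𝒜.trans u.proj i u.proj * 𝒜.coord u) := rfl

theorem triv_symm_apply (i : M) (p : M × b.CSp) :
    (𝒜.triv i).symm p = ⟨p.1, (𝒜.trans i p.1 p.1 * p.2 : b.CSp)⟩ := rfl

theorem triv_symm_triv (i j : M) {p : M × b.CSp} (hi : p.1 ∈ 𝒜.domain i) (hj : p.1 ∈ 𝒜.domain j) :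
    𝒜.triv j ((𝒜.triv i).symm p) = (p.1, 𝒜.trans i j p.1 * p.2) := by
  rw [triv_symm_apply, triv_apply]
  change (p.1, 𝒜.trans p.1 j p.1 * (𝒜.trans i p.1 p.1 * p.2)) = _
  rw [← mul_assoc, 𝒜.trans_mul hi (𝒜.mem_domain _) hj]

/-- The groupoid of local diffeomorphisms of a manifold. -/
noncomputable def _root_.diffeoGroupoid {EN HN : Type*} [NormedAddCommGroup EN] [NormedSpace ℝ EN]
    [TopologicalSpace HN] (I : ModelWithCorners ℝ EN HN) (N : Type*) [TopologicalSpace N]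
    [ChartedSpace HN N] : StructureGroupoid N :=
  Pregroupoid.groupoid
    { property := fun f s => ContMDiffOn I I ∞ f s
      comp := fun hf hg _ _ _ =>
        hg.comp (hf.mono inter_subset_left) fun _ hx => hx.2
      id_mem := contMDiffOn_id
      locality := fun _ h => contMDiffOn_of_locally_contMDiffOn h
      congr := fun _ h hf => hf.congr h }

/-- The bundle trivializations are charts with values in M × CSp(V), whose changes (y, g) ↦ (y,
t(y)g) are smooth in both directions. Composing with the charts of M × CSp(V) yields the manifold
structure of the total space. -/
instance : HasGroupoid 𝒜.Total
    (diffeoGroupoid (𝓘(ℝ, E).prod 𝓘(ℝ, ℝ × b.sp)) (M × b.CSp)) where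
  compatible := by
    have key : ∀ i j, ContMDiffOn (𝓘(ℝ, E).prod 𝓘(ℝ, ℝ × b.sp)) (𝓘(ℝ, E).prod 𝓘(ℝ, ℝ × b.sp)) ∞
        ((𝒜.triv i).symm ≫ₕ 𝒜.triv j) ((𝒜.triv i).symm ≫ₕ 𝒜.triv j).source := fun i j => by
      have hs : ∀ p ∈ ((𝒜.triv i).symm ≫ₕ 𝒜.triv j).source,
          p ∈ (𝒜.domain i ∩ 𝒜.domain j) ×ˢ (univ : Set b.CSp) := fun p hp => by
        rw [OpenPartialHomeomorph.trans_source] at hp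
        exact ⟨⟨hp.1.1, hp.2⟩, trivial⟩
      refine ((𝒜.contMDiffOn_trans_mul i j).mono hs).congr fun p hp => ?_
      exact 𝒜.triv_symm_triv i j (hs p hp).1.1 (hs p hp).1.2
    rintro _ _ ⟨_, ⟨i, rfl⟩, rfl⟩ ⟨_, ⟨j, rfl⟩, rfl⟩
    refine mem_groupoid_of_pregroupoid.2 ⟨key i j, ?_⟩
    rw [OpenPartialHomeomorph.trans_symm_eq_symm_trans_symm]
    exact key j i

noncomputable instance : ChartedSpace (ModelProd E (ℝ × b.sp)) 𝒜.Total :=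
  ChartedSpace.comp (ModelProd E (ℝ × b.sp)) (M × b.CSp) 𝒜.Total

instance : IsManifold (𝓘(ℝ, E).prod 𝓘(ℝ, ℝ × b.sp)) ∞ 𝒜.Total :=
  { StructureGroupoid.HasGroupoid.comp
      (diffeoGroupoid (𝓘(ℝ, E).prod 𝓘(ℝ, ℝ × b.sp)) (M × b.CSp)) (fun e he => by
        rw [isLocalStructomorphOn_contDiffGroupoid_iff]
        exact mem_groupoid_of_pregroupoid.1 he) with }


theorem mem_triv_source {i : M} {u : 𝒜.Total} : u ∈ (𝒜.triv i).source ↔ u.proj ∈ 𝒜.domain i :=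
  Iff.rfl

theorem triv_proj_self (u : 𝒜.Total) : 𝒜.triv u.proj u = (u.proj, 𝒜.coord u) := by
  rw [triv_apply, 𝒜.trans_self (𝒜.mem_domain _), one_mul]

theorem chartAt_total (u : 𝒜.Total) : chartAt (ModelProd E (ℝ × b.sp)) u =
    (𝒜.triv u.proj) ≫ₕ chartAt (ModelProd E (ℝ × b.sp)) (u.proj, 𝒜.coord u) := by
  rw [← triv_proj_self]
  rfl

/-- The preferred chart at u is this trivialization followed by a chart of the product, so the
coordinate expression of the trivialization is the identity. The other trivializations differ from
it by smooth transitions. -/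
theorem contMDiffAt_triv_self (u : 𝒜.Total) :
    ContMDiffAt (𝓘(ℝ, E).prod 𝓘(ℝ, ℝ × b.sp)) (𝓘(ℝ, E).prod 𝓘(ℝ, ℝ × b.sp)) ∞
      (𝒜.triv u.proj) u := by
  rw [contMDiffAt_iff]
  refine ⟨(𝒜.triv u.proj).continuousAt (𝒜.mem_triv_source.2 (𝒜.mem_domain _)), ?_⟩
  refine ContDiffWithinAt.congr_of_eventuallyEq (f := id) contDiffWithinAt_id ?_ ?_
  · filter_upwards [extChartAt_target_mem_nhdsWithin (I := 𝓘(ℝ, E).prod 𝓘(ℝ, ℝ × b.sp)) u] with z hz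
    exact writtenInExtChartAt_chartAt_comp (I := 𝓘(ℝ, E).prod 𝓘(ℝ, ℝ × b.sp))
      (H' := M × b.CSp) u hz
  · exact writtenInExtChartAt_chartAt_comp (I := 𝓘(ℝ, E).prod 𝓘(ℝ, ℝ × b.sp))
      (H' := M × b.CSp) u (mem_extChartAt_target u)

theorem contMDiffAt_triv_symm_self (u : 𝒜.Total) :
    ContMDiffAt (𝓘(ℝ, E).prod 𝓘(ℝ, ℝ × b.sp)) (𝓘(ℝ, E).prod 𝓘(ℝ, ℝ × b.sp)) ∞
      (𝒜.triv u.proj).symm (u.proj, 𝒜.coord u) := by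
  have hc := mem_chart_source (ModelProd E (ℝ × b.sp)) (u.proj, 𝒜.coord u)
  have he := mem_chart_target (ModelProd E (ℝ × b.sp)) u
  have h1 : ContMDiffAt (𝓘(ℝ, E).prod 𝓘(ℝ, ℝ × b.sp)) (𝓘(ℝ, E).prod 𝓘(ℝ, ℝ × b.sp)) ∞
      (chartAt (ModelProd E (ℝ × b.sp)) (u.proj, 𝒜.coord u)) (u.proj, 𝒜.coord u) :=
    contMDiffOn_chart.contMDiffAt ((chartAt _ _).open_source.mem_nhds hc)
  have h2 : ContMDiffAt (𝓘(ℝ, E).prod 𝓘(ℝ, ℝ × b.sp)) (𝓘(ℝ, E).prod 𝓘(ℝ, ℝ × b.sp)) ∞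
      (chartAt (ModelProd E (ℝ × b.sp)) u).symm (chartAt (ModelProd E (ℝ × b.sp)) u u) :=
    contMDiffOn_chart_symm.contMDiffAt ((chartAt _ _).open_target.mem_nhds he)
  have h3 : chartAt (ModelProd E (ℝ × b.sp)) u u =
      chartAt (ModelProd E (ℝ × b.sp)) (u.proj, 𝒜.coord u) (u.proj, 𝒜.coord u) := by
    rw [chartAt_total, OpenPartialHomeomorph.trans_apply, triv_proj_self]
  rw [h3] at h2
  refine (ContMDiffAt.comp _ h2 h1).congr_of_eventuallyEq ?_
  filter_upwards [(chartAt (ModelProd E (ℝ × b.sp)) (u.proj, 𝒜.coord u)).open_source.mem_nhds hc]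
    with p hp
  rw [chartAt_total]
  exact congrArg (𝒜.triv u.proj).symm
    ((chartAt (ModelProd E (ℝ × b.sp)) (u.proj, 𝒜.coord u)).left_inv hp).symm

theorem contMDiffAt_triv {i : M} {u : 𝒜.Total} (hu : u.proj ∈ 𝒜.domain i) :
    ContMDiffAt (𝓘(ℝ, E).prod 𝓘(ℝ, ℝ × b.sp)) (𝓘(ℝ, E).prod 𝓘(ℝ, ℝ × b.sp)) ∞ (𝒜.triv i) u := by
  have hs : u ∈ (𝒜.triv u.proj).source := 𝒜.mem_triv_source.2 (𝒜.mem_domain _)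
  have h1 : ContMDiffAt (𝓘(ℝ, E).prod 𝓘(ℝ, ℝ × b.sp)) (𝓘(ℝ, E).prod 𝓘(ℝ, ℝ × b.sp)) ∞
      (fun p : M × b.CSp => (p.1, 𝒜.trans u.proj i p.1 * p.2)) (𝒜.triv u.proj u) :=
    (𝒜.contMDiffOn_trans_mul _ _).contMDiffAt ((((𝒜.isOpen_domain _).inter
      (𝒜.isOpen_domain _)).prod isOpen_univ).mem_nhds ⟨⟨𝒜.mem_domain _, hu⟩, trivial⟩)
  refine (ContMDiffAt.comp u h1 (𝒜.contMDiffAt_triv_self u)).congr_of_eventuallyEq ?_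
  filter_upwards [(𝒜.triv u.proj).open_source.mem_nhds hs,
    (𝒜.triv i).open_source.mem_nhds hu] with v hv hv'
  have h2 := 𝒜.triv_symm_triv u.proj i (p := 𝒜.triv u.proj v) hv hv'
  rw [(𝒜.triv u.proj).left_inv hv] at h2
  exact h2

theorem contMDiffAt_triv_symm {i : M} {p : M × b.CSp} (hp : p.1 ∈ 𝒜.domain i) :
    ContMDiffAt (𝓘(ℝ, E).prod 𝓘(ℝ, ℝ × b.sp)) (𝓘(ℝ, E).prod 𝓘(ℝ, ℝ × b.sp)) ∞
      (𝒜.triv i).symm p := by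
  set u := (𝒜.triv i).symm p with hu
  have h1 : ContMDiffAt (𝓘(ℝ, E).prod 𝓘(ℝ, ℝ × b.sp)) (𝓘(ℝ, E).prod 𝓘(ℝ, ℝ × b.sp)) ∞
      (fun q : M × b.CSp => (q.1, 𝒜.trans i p.1 q.1 * q.2)) p :=
    (𝒜.contMDiffOn_trans_mul _ _).contMDiffAt ((((𝒜.isOpen_domain _).inter
      (𝒜.isOpen_domain _)).prod isOpen_univ).mem_nhds ⟨⟨hp, 𝒜.mem_domain _⟩, trivial⟩)
  have h3 : ContMDiffAt (𝓘(ℝ, E).prod 𝓘(ℝ, ℝ × b.sp)) (𝓘(ℝ, E).prod 𝓘(ℝ, ℝ × b.sp)) ∞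
      (𝒜.triv p.1).symm (p.1, 𝒜.trans i p.1 p.1 * p.2) := 𝒜.contMDiffAt_triv_symm_self u
  refine (ContMDiffAt.comp p h3 h1).congr_of_eventuallyEq ?_
  filter_upwards [((𝒜.isOpen_domain i).prod isOpen_univ).mem_nhds
    (show p ∈ 𝒜.domain i ×ˢ univ from ⟨hp, trivial⟩), ((𝒜.isOpen_domain p.1).prod
    isOpen_univ).mem_nhds (show p ∈ 𝒜.domain p.1 ×ˢ univ from ⟨𝒜.mem_domain _, trivial⟩)]
    with q hq hq'
  have h4 := 𝒜.triv_symm_triv i p.1 (p := q) hq.1 hq'.1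
  change _ = (𝒜.triv p.1).symm (q.1, 𝒜.trans i p.1 q.1 * q.2)
  rw [← h4, (𝒜.triv p.1).left_inv]
  exact hq'.1

end CoframeAtlas

end CoframeAtlas

theorem OneFormSmoothAt.congr {EN HN N : Type*} [NormedAddCommGroup EN] [NormedSpace ℝ EN]
    [TopologicalSpace HN] {I : ModelWithCorners ℝ EN HN} [TopologicalSpace N] [ChartedSpace HN N]
    [IsManifold I ∞ N] {F : Type*} [NormedAddCommGroup F] [NormedSpace ℝ F]
    {θ θ' : Π u : N, TangentSpace I u →L[ℝ] F} {u : N} (h : OneFormSmoothAt I θ u)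
    (hθ : ∀ᶠ v in 𝓝 u, θ' v = θ v) : OneFormSmoothAt I θ' u := by
  refine ContMDiffAt.congr_of_eventuallyEq (f := fun u => (⟨u, θ u⟩ : TotalSpace (EN →L[ℝ] F)
      (fun u : N => TangentSpace I u →L[ℝ] Bundle.Trivial N F u))) h ?_
  filter_upwards [hθ] with v hv
  rw [hv]

/-! ### The first order structure of an almost conformally symplectic structure. -/

section CoframeAtlasStructure


variable {V : Type u} [NormedAddCommGroup V] [NormedSpace ℝ V] [FiniteDimensional ℝ V]
  [Nontrivial V] {b : SymplecticForm V}
  {E : Type*} [NormedAddCommGroup E] [NormedSpace ℝ E] [FiniteDimensional ℝ E]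
  {M : Type v} [TopologicalSpace M] [ChartedSpace E M] [IsManifold 𝓘(ℝ, E) ∞ M]

open SymplecticForm

namespace CoframeAtlas

variable (𝒜 : CoframeAtlas b E M)

/-- The projection of the total space. -/
def proj (u : 𝒜.Total) : M := TotalSpace.proj u

/-- The principal right action on the total space. -/
def act (u : 𝒜.Total) (g : b.CSp) : 𝒜.Total := ⟨𝒜.proj u, (𝒜.coord u * g : b.CSp)⟩

theorem triv_act (i : M) (u : 𝒜.Total) (g : b.CSp) :
    𝒜.triv i (𝒜.act u g) = ((𝒜.triv i u).1, (𝒜.triv i u).2 * g) :=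
  Prod.ext rfl (mul_assoc _ _ _).symm

theorem contMDiff_proj : ContMDiff (𝓘(ℝ, E).prod 𝓘(ℝ, ℝ × b.sp)) 𝓘(ℝ, E) ∞ 𝒜.proj := fun u =>
  contMDiffAt_fst.comp u (𝒜.contMDiffAt_triv_self u)

theorem contMDiff_act (g : b.CSp) :
    ContMDiff (𝓘(ℝ, E).prod 𝓘(ℝ, ℝ × b.sp)) (𝓘(ℝ, E).prod 𝓘(ℝ, ℝ × b.sp)) ∞
      (fun u => 𝒜.act u g) := fun u => by
  have h1 : ContMDiffAt (𝓘(ℝ, E).prod 𝓘(ℝ, ℝ × b.sp)) (𝓘(ℝ, E).prod 𝓘(ℝ, ℝ × b.sp)) ∞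
      (fun p : M × b.CSp => (p.1, p.2 * g)) (𝒜.triv (𝒜.proj u) u) :=
    contMDiffAt_fst.prodMk (contMDiffAt_snd.mul contMDiffAt_const)
  have h2 := ContMDiffAt.comp u h1 (𝒜.contMDiffAt_triv (𝒜.mem_domain (𝒜.proj u)))
  refine (ContMDiffAt.comp u (𝒜.contMDiffAt_triv_symm (i := 𝒜.proj u) (𝒜.mem_domain _))
    h2).congr_of_eventuallyEq ?_
  filter_upwards [(𝒜.triv (𝒜.proj u)).open_source.mem_nhds
    (𝒜.mem_triv_source.2 (𝒜.mem_domain _))] with v hv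
  change _ = (𝒜.triv (𝒜.proj u)).symm ((𝒜.triv (𝒜.proj u) v).1, (𝒜.triv (𝒜.proj u) v).2 * g)
  rw [← 𝒜.triv_act, (𝒜.triv (𝒜.proj u)).left_inv]
  exact hv

/-- The coframe corresponding to a point of the total space. -/
noncomputable def pointCoframe (u : 𝒜.Total) : E →L[ℝ] V :=
  (𝒜.coord u)⁻¹.1.val ∘L (𝒜.coframe (𝒜.proj u) (𝒜.proj u) : E →L[ℝ] V)

/-- The definition uses the coframe centred at the base point, which varies with u. Expressing it
through one fixed local coframe makes smoothness of the soldering form accessible. -/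
theorem pointCoframe_eq {i : M} {u : 𝒜.Total} (hu : 𝒜.proj u ∈ 𝒜.domain i) :
    𝒜.pointCoframe u = (𝒜.triv i u).2⁻¹.1.val ∘L (𝒜.coframe i (𝒜.proj u) : E →L[ℝ] V) := by
  refine ContinuousLinearMap.ext fun v => ?_
  have h := 𝒜.trans_apply _ i (𝒜.proj u) ⟨𝒜.mem_domain _, hu⟩ v
  have h2 : (𝒜.triv i u).2⁻¹ = (𝒜.coord u)⁻¹ * (𝒜.trans (𝒜.proj u) i (𝒜.proj u))⁻¹ :=
    mul_inv_rev _ _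
  rw [h2]
  change _ = (𝒜.coord u)⁻¹.1.val ((𝒜.trans (𝒜.proj u) i (𝒜.proj u))⁻¹.1.val
    (𝒜.coframe i (𝒜.proj u) v))
  rw [← h]
  refine congrArg (𝒜.coord u)⁻¹.1.val ?_
  exact (DFunLike.congr_fun (𝒜.trans (𝒜.proj u) i (𝒜.proj u)).1.inv_mul _).symm

theorem pointCoframe_injective (u : 𝒜.Total) : Function.Injective (𝒜.pointCoframe u) := by
  refine Function.Injective.comp (g := (𝒜.coord u)⁻¹.1.val) ?_ (𝒜.coframe _ _).injective
  exact Function.LeftInverse.injective (g := (𝒜.coord u).1.val) fun v =>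
    DFunLike.congr_fun (𝒜.coord u).1.mul_inv v

theorem pointCoframe_act (u : 𝒜.Total) (g : b.CSp) (v : E) :
    𝒜.pointCoframe (𝒜.act u g) v = g⁻¹.1.val (𝒜.pointCoframe u v) := by
  have h2 : (𝒜.coord (𝒜.act u g))⁻¹ = g⁻¹ * (𝒜.coord u)⁻¹ := mul_inv_rev _ _
  unfold pointCoframe
  rw [h2]
  rfl

/-- The first order structure obtained by glueing. -/
noncomputable def toStructure (hEV : finrank ℝ E = finrank ℝ V) : CSpStructure.{max u v} b E M where
  Total := 𝒜.Total
  proj := 𝒜.proj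
  act := 𝒜.act
  act_one u := by
    change (⟨_, (𝒜.coord u * 1 : b.CSp)⟩ : 𝒜.Total) = u
    rw [mul_one]
    rfl
  act_mul u g h := by
    change (⟨_, (𝒜.coord u * (g * h) : b.CSp)⟩ : 𝒜.Total) = ⟨_, (𝒜.coord u * g * h : b.CSp)⟩
    rw [mul_assoc]
    rfl
  proj_act _ _ := rfl
  locally_trivial x := ⟨𝒜.domain x, 𝒜.triv x, 𝒜.isOpen_domain x, 𝒜.mem_domain x, 𝒜.triv_source x,
    𝒜.triv_target x, fun u hu => (𝒜.contMDiffAt_triv hu).contMDiffWithinAt,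
    fun p hp => (𝒜.contMDiffAt_triv_symm hp.1).contMDiffWithinAt,
    fun u _ => ⟨rfl, fun g => 𝒜.triv_act x u g⟩⟩
  θ u := (𝒜.pointCoframe u) ∘L
    (mfderiv (𝓘(ℝ, E).prod 𝓘(ℝ, ℝ × b.sp)) 𝓘(ℝ, E) 𝒜.proj u :
      TangentSpace (𝓘(ℝ, E).prod 𝓘(ℝ, ℝ × b.sp)) u →L[ℝ] E)
  smooth_θ u := by
    have hu : 𝒜.proj u ∈ 𝒜.domain (𝒜.proj u) := 𝒜.mem_domain _
    have h1 := (𝒜.smooth _ _ hu).pullback (𝒜.contMDiff_proj u)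
    have h2 : ContMDiffAt (𝓘(ℝ, E).prod 𝓘(ℝ, ℝ × b.sp)) 𝓘(ℝ, V →L[ℝ] V) ∞
        (fun v => (𝒜.triv (𝒜.proj u) v).2⁻¹.1.val) u :=
      CSp.contMDiffAt_iff.1 (contMDiffAt_snd.comp u (𝒜.contMDiffAt_triv hu)).inv
    have h3 : OneFormSmoothAt (𝓘(ℝ, E).prod 𝓘(ℝ, ℝ × b.sp)) (fun u => (𝒜.pointCoframe u) ∘L
        (mfderiv (𝓘(ℝ, E).prod 𝓘(ℝ, ℝ × b.sp)) 𝓘(ℝ, E) 𝒜.proj u :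
          TangentSpace (𝓘(ℝ, E).prod 𝓘(ℝ, ℝ × b.sp)) u →L[ℝ] E)) u := by
      refine (h1.clm_comp h2).congr ?_
      filter_upwards [(𝒜.triv (𝒜.proj u)).open_source.mem_nhds (𝒜.mem_triv_source.2 hu)] with v hv
      rw [𝒜.pointCoframe_eq hv]
      rfl
    exact h3
  equivariant_θ u g ξ := by
    have h := mfderiv_comp u ((𝒜.contMDiff_proj (𝒜.act u g)).mdifferentiableAt (by simp))
      ((𝒜.contMDiff_act g u).mdifferentiableAt (by simp))
    have h1 := DFunLike.congr_fun h ξ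
    refine (congrArg (𝒜.pointCoframe (𝒜.act u g)) h1.symm).trans ?_
    exact 𝒜.pointCoframe_act u g _
  horizontal_θ u ξ := by
    constructor
    · intro h
      refine 𝒜.pointCoframe_injective u (h.trans (map_zero (𝒜.pointCoframe u)).symm)
    · intro h
      exact (congrArg (𝒜.pointCoframe u) h).trans (map_zero _)
  finrank_eq := hEV

theorem coframe_toStructure (hEV : finrank ℝ E = finrank ℝ V) (u : (𝒜.toStructure hEV).Total)
    (v : E) : (𝒜.toStructure hEV).coframe u v = 𝒜.pointCoframe u v := by
  obtain ⟨ξ, hξ⟩ := (𝒜.toStructure hEV).surjective_dproj u v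
  exact (congrArg _ hξ).symm.trans (((𝒜.toStructure hEV).coframe_dproj u ξ).trans
    (congrArg (𝒜.pointCoframe u) hξ))

theorem twoCovector_toStructure (hEV : finrank ℝ E = finrank ℝ V) (u : (𝒜.toStructure hEV).Total) :
    (𝒜.toStructure hEV).twoCovector u = b.form.compContinuousLinearMap (𝒜.pointCoframe u) :=
  contAlt_ext fun v w => by
    rw [CSpStructure.twoCovector_apply, coframe_toStructure, coframe_toStructure, pullback_apply]

theorem determines_toStructure (hEV : finrank ℝ E = finrank ℝ V)
    {ℓ : AlmostConformallySymplectic E M}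
    (h : ∀ x, ℓ.line x = Submodule.span ℝ
      {(b.form.compContinuousLinearMap (𝒜.coframe x x : E →L[ℝ] V) : TwoCovector E x)}) :
    (𝒜.toStructure hEV).Determines ℓ := by
  refine (CSpStructure.determines_iff _).2 fun u => (h (𝒜.proj u)).trans ?_
  obtain ⟨c, h0, hc⟩ := exists_scale (𝒜.coord u)⁻¹
  have h2 : (𝒜.toStructure hEV).twoCovector u =
      c • b.form.compContinuousLinearMap (𝒜.coframe (𝒜.proj u) (𝒜.proj u) : E →L[ℝ] V) := by
    rw [twoCovector_toStructure]
    refine contAlt_ext fun v w => ?_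
    rw [pullback_apply]
    refine (hc _ _).trans (congrArg (c * ·) ?_)
    exact (pullback_apply _ _ _).symm
  rw [h2]
  exact (Submodule.span_singleton_smul_eq (IsUnit.mk0 c h0) _).symm

end CoframeAtlas

theorem SymplecticForm.exists_trans {F : Type*} [NormedAddCommGroup F] [NormedSpace ℝ F]
    (A A' : F ≃L[ℝ] V)
    (h : Submodule.span ℝ {b.form.compContinuousLinearMap (A : F →L[ℝ] V)} =
      Submodule.span ℝ {b.form.compContinuousLinearMap (A' : F →L[ℝ] V)}) :
    ∃ g : b.CSp, ∀ v, g.1.val (A v) = A' v := by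
  have h1 : b.form.compContinuousLinearMap (A' : F →L[ℝ] V) ∈
      Submodule.span ℝ {b.form.compContinuousLinearMap (A : F →L[ℝ] V)} := by
    rw [h]
    exact Submodule.mem_span_singleton_self _
  obtain ⟨c, hc⟩ := Submodule.mem_span_singleton.1 h1
  let e : V ≃L[ℝ] V := A.symm.trans A'
  refine ⟨⟨⟨e, e.symm, ContinuousLinearMap.ext e.apply_symm_apply,
    ContinuousLinearMap.ext e.symm_apply_apply⟩, c, fun v w => ?_⟩, fun v => ?_⟩
  · have h2 := DFunLike.congr_fun hc ![A.symm v, A.symm w]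
    refine ((pullback_apply (A' : F →L[ℝ] V) _ _).symm.trans h2.symm).trans ?_
    refine congrArg (c * ·) ((pullback_apply (A : F →L[ℝ] V) _ _).trans ?_)
    exact congrArg₂ b (A.apply_symm_apply v) (A.apply_symm_apply w)
  · exact congrArg A' (A.symm_apply_apply v)

theorem CSpStructure.exists_determines (hEV : finrank ℝ E = finrank ℝ V)
    (ℓ : AlmostConformallySymplectic E M) :
    ∃ P : CSpStructure.{max u v} b E M, P.Determines ℓ := by
  choose U hU hx A hA hl using ℓ.exists_smooth_coframe b hEV
  have ht : ∀ i j y, ∃ g : b.CSp, y ∈ U i ∩ U j → ∀ v, g.1.val (A i y v) = A j y v :=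
    fun i j y => by
    by_cases hy : y ∈ U i ∩ U j
    · obtain ⟨g, hg⟩ := exists_trans (b := b) (A i y) (A j y) ((hl i y hy.1).symm.trans (hl j y hy.2))
      exact ⟨g, fun _ => hg⟩
    -- Transition elements matter only on the overlap of the two domains.
    · exact ⟨1, fun h => (hy h).elim⟩
  choose t ht using ht
  exact ⟨CoframeAtlas.toStructure ⟨U, hU, hx, A, hA, t, ht⟩ hEV,
    CoframeAtlas.determines_toStructure _ hEV fun x => hl x x (hx x)⟩

end CoframeAtlasStructure

/-! ### Derivatives of vector-valued functions on manifolds. -/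

section VectorValuedDerivative

variable {EN HN N : Type*} [NormedAddCommGroup EN] [NormedSpace ℝ EN] [TopologicalSpace HN]
  {I : ModelWithCorners ℝ EN HN} [TopologicalSpace N] [ChartedSpace HN N]
  {F : Type*} [NormedAddCommGroup F] [NormedSpace ℝ F]
  {F' : Type*} [NormedAddCommGroup F'] [NormedSpace ℝ F']

theorem mvfderiv_comp_vec {EN' HN' N' : Type*} [NormedAddCommGroup EN'] [NormedSpace ℝ EN']
    [TopologicalSpace HN'] {J : ModelWithCorners ℝ EN' HN'} [TopologicalSpace N']
    [ChartedSpace HN' N'] {g : N → F} {f : N' → N} (x : N')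
    (hg : MDifferentiableAt I 𝓘(ℝ, F) g (f x)) (hf : MDifferentiableAt J I f x)
    (v : TangentSpace J x) :
    mvfderiv J (g ∘ f) x v = mvfderiv I g (f x) (mfderiv J I f x v) :=
  mfderiv_comp_apply x hg hf v

theorem mvfderiv_clm_apply {c : N → F →L[ℝ] F'} {g : N → F} {x : N}
    (hc : MDifferentiableAt I 𝓘(ℝ, F →L[ℝ] F') c x) (hg : MDifferentiableAt I 𝓘(ℝ, F) g x)
    (v : TangentSpace I x) :
    mvfderiv I (fun y => c y (g y)) x v = mvfderiv I c x v (g x) + c x (mvfderiv I g x v) := by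
  let c' : EN →L[ℝ] F →L[ℝ] F' := mvfderiv I c x
  let g' : EN →L[ℝ] F := mvfderiv I g x
  let L : EN →L[ℝ] F' := (c x) ∘L g' + c'.flip (g x)
  have h : HasMFDerivAt I 𝓘(ℝ, F') (fun y => c y (g y)) x L := by
    refine ⟨(hc.clm_apply hg).continuousAt, ?_⟩
    have h3 := HasFDerivWithinAt.clm_apply hc.hasMFDerivAt.2 hg.hasMFDerivAt.2
    convert h3 using 1
    · simp
      rfl
  refine (DFunLike.congr_fun h.mfderiv v).trans ?_
  exact add_comm (c x (g' v)) (c' v (g x))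

theorem mdifferentiableAt_clm_apply {c : N → F →L[ℝ] F'} {g : N → F} {x : N}
    (hc : MDifferentiableAt I 𝓘(ℝ, F →L[ℝ] F') c x) (hg : MDifferentiableAt I 𝓘(ℝ, F) g x) :
    MDifferentiableAt I 𝓘(ℝ, F') (fun y => c y (g y)) x :=
  hc.clm_apply hg

theorem mvfderiv_const_clm_apply (L : F →L[ℝ] F') {g : N → F} {x : N}
    (hg : MDifferentiableAt I 𝓘(ℝ, F) g x) (v : TangentSpace I x) :
    mvfderiv I (fun y => L (g y)) x v = L (mvfderiv I g x v) := by
  rw [mvfderiv_clm_apply mdifferentiableAt_const hg, mvfderiv_const]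
  simp

theorem mvfderiv_congr_apply {f g : N → F} {x : N} (h : f =ᶠ[𝓝 x] g) (v : TangentSpace I x) :
    mvfderiv I f x v = mvfderiv I g x v := DFunLike.congr_fun h.mfderiv_eq v

/-- The derivative of a curve of inverses. -/
theorem mvfderiv_inverse {a k : N → F →L[ℝ] F} {x : N} (ha : MDifferentiableAt I 𝓘(ℝ, F →L[ℝ] F) a x)
    (hk : MDifferentiableAt I 𝓘(ℝ, F →L[ℝ] F) k x) (h1 : ∀ᶠ y in 𝓝 x, ∀ w, k y (a y w) = w)
    (h2 : ∀ w, a x (k x w) = w) (v : TangentSpace I x) (w : F) :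
    mvfderiv I k x v w = - k x (mvfderiv I a x v (k x w)) := by
  have h3 : ∀ w, mvfderiv I (fun y => k y (a y w)) x v = 0 := fun w => by
    rw [mvfderiv_congr_apply (g := fun _ => w) (h1.mono fun y hy => hy w), mvfderiv_const]
    rfl
  have h4 := h3 (k x w)
  have h5 : MDifferentiableAt I 𝓘(ℝ, F) (fun y => a y (k x w)) x :=
    mdifferentiableAt_clm_apply ha mdifferentiableAt_const
  rw [mvfderiv_clm_apply hk h5, mvfderiv_clm_apply ha mdifferentiableAt_const, mvfderiv_const, h2]
    at h4
  simp only [_root_.zero_apply, map_zero, add_zero] at h4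
  exact eq_neg_of_add_eq_zero_left h4

end VectorValuedDerivative

/-! ### The flat connection form of a local section. -/

section LocalConnection

variable {V : Type*} [NormedAddCommGroup V] [NormedSpace ℝ V] [FiniteDimensional ℝ V]
  [Nontrivial V] {b : SymplecticForm V}
  {E : Type*} [NormedAddCommGroup E] [NormedSpace ℝ E] [FiniteDimensional ℝ E]
  {M : Type*} [TopologicalSpace M] [ChartedSpace E M]

open SymplecticForm FirstOrderStructure

theorem SymplecticForm.val_inv_apply (g : b.CSp) (w : V) : g⁻¹.1.val (g.1.val w) = w :=
  DFunLike.congr_fun g.1.inv_mul w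

theorem SymplecticForm.val_apply_inv (g : b.CSp) (w : V) : g.1.val (g⁻¹.1.val w) = w :=
  DFunLike.congr_fun g.1.mul_inv w

namespace CSpStructure

variable (P : CSpStructure b E M)

/-- The pullback of the Maurer-Cartan form along a map to the structure group. -/
noncomputable def maurerCartan (h : P.Total → b.CSp) (u : P.Total) :
    TangentSpace (𝓘(ℝ, E).prod 𝓘(ℝ, ℝ × b.sp)) u →L[ℝ] (V →L[ℝ] V) :=
  (ContinuousLinearMap.compL ℝ V V V (h u)⁻¹.1.val) ∘L
    (mvfderiv (𝓘(ℝ, E).prod 𝓘(ℝ, ℝ × b.sp)) (fun u => (h u).1.val) u)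

theorem maurerCartan_apply (h : P.Total → b.CSp) (u : P.Total)
    (ξ : TangentSpace (𝓘(ℝ, E).prod 𝓘(ℝ, ℝ × b.sp)) u) :
    P.maurerCartan h u ξ = (h u)⁻¹.1.val *
      (mvfderiv (𝓘(ℝ, E).prod 𝓘(ℝ, ℝ × b.sp)) (fun u => (h u).1.val) u ξ) := rfl

variable {P}

section

variable {U : Set M} {σ : M → P.Total} {h : P.Total → b.CSp} (hl : P.IsLocalSection U σ h)
include hl

theorem coord_act_eq {u : P.Total} (hu : P.proj u ∈ U) (g : b.CSp) : h (P.act u g) = h u * g := by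
  have h1 := hl.act_coord u hu
  rw [← h1, ← P.act_mul, hl.coord_act _ hu, hl.coord_act _ hu]

theorem contMDiffAt_coord_val {u : P.Total} (hu : P.proj u ∈ U) :
    ContMDiffAt (𝓘(ℝ, E).prod 𝓘(ℝ, ℝ × b.sp)) 𝓘(ℝ, V →L[ℝ] V) ∞ (fun u => (h u).1.val) u :=
  CSp.contMDiffAt_iff.1 (hl.smooth_coord u hu)

theorem mdifferentiableAt_coord_val {u : P.Total} (hu : P.proj u ∈ U) :
    MDifferentiableAt (𝓘(ℝ, E).prod 𝓘(ℝ, ℝ × b.sp)) 𝓘(ℝ, V →L[ℝ] V) (fun u => (h u).1.val) u :=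
  (contMDiffAt_coord_val hl hu).mdifferentiableAt (by simp)

theorem eventually_mem {u : P.Total} (hu : P.proj u ∈ U) : ∀ᶠ v in 𝓝 u, P.proj v ∈ U :=
  P.contMDiff_proj.continuous.continuousAt (hl.isOpen.mem_nhds hu)

set_option synthInstance.maxHeartbeats 200000 in
theorem smooth_maurerCartan {u : P.Total} (hu : P.proj u ∈ U) :
    OneFormSmoothAt (𝓘(ℝ, E).prod 𝓘(ℝ, ℝ × b.sp)) (P.maurerCartan h) u := by
  have h1 : ContMDiffAt (𝓘(ℝ, E).prod 𝓘(ℝ, ℝ × b.sp)) 𝓘(ℝ, V →L[ℝ] V) ∞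
      (fun u => (h u)⁻¹.1.val) u := CSp.contMDiffAt_iff.1 (hl.smooth_coord u hu).inv
  have h2 : ContMDiffAt (𝓘(ℝ, E).prod 𝓘(ℝ, ℝ × b.sp)) 𝓘(ℝ, (V →L[ℝ] V) →L[ℝ] (V →L[ℝ] V)) ∞
      (fun u => ContinuousLinearMap.compL ℝ V V V (h u)⁻¹.1.val) u :=
    ContMDiffAt.comp u 
      (ContinuousLinearMap.compL ℝ V V V).contDiff.contDiffAt.contMDiffAt h1
  exact (OneFormSmoothAt.mfderiv_self (contMDiffAt_coord_val hl hu)).clm_comp h2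

/-- Replacing h by hg with constant g turns h⁻¹dh into g⁻¹(h⁻¹dh)g. -/
theorem maurerCartan_dact {u : P.Total} (hu : P.proj u ∈ U) (g : b.CSp)
    (ξ : TangentSpace (𝓘(ℝ, E).prod 𝓘(ℝ, ℝ × b.sp)) u) :
    P.maurerCartan h (P.act u g) (P.dact u g ξ) =
      g⁻¹.1.val * P.maurerCartan h u ξ * g.1.val := by
  have hu' : P.proj (P.act u g) ∈ U := by rwa [P.proj_act]
  have h1 := mvfderiv_comp_vec u (mdifferentiableAt_coord_val hl hu')
    ((P.contMDiff_act g u).mdifferentiableAt (by simp)) ξ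
  have h2 : mvfderiv (𝓘(ℝ, E).prod 𝓘(ℝ, ℝ × b.sp))
      ((fun u => (h u).1.val) ∘ fun u => P.act u g) u ξ =
      mvfderiv (𝓘(ℝ, E).prod 𝓘(ℝ, ℝ × b.sp)) (fun u => (h u).1.val) u ξ * g.1.val := by
    rw [mvfderiv_congr_apply (g := fun u =>
      (ContinuousLinearMap.compL ℝ V V V).flip g.1.val (h u).1.val)]
    · exact mvfderiv_const_clm_apply _ (mdifferentiableAt_coord_val hl hu) ξ
    · filter_upwards [eventually_mem hl hu] with v hv
      change (h (P.act v g)).1.val = _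
      rw [coord_act_eq hl hv]
      rfl
  rw [maurerCartan_apply, maurerCartan_apply, coord_act_eq hl hu, ← h1, h2, mul_inv_rev]
  exact (mul_assoc _ _ _).trans (mul_assoc _ _ _).symm

/-- Left translation by the fixed element h(u)⁻¹ gives a map to the group which takes the value 1 at
u, and whose derivative at u is h⁻¹dh. -/
theorem maurerCartan_mem_lieAlg {u : P.Total} (hu : P.proj u ∈ U)
    (ξ : TangentSpace (𝓘(ℝ, E).prod 𝓘(ℝ, ℝ × b.sp)) u) :
    P.maurerCartan h u ξ ∈ lieAlg (ℝ × b.sp) b.CSp.subtype := by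
  have h0 : ContMDiffAt (𝓘(ℝ, E).prod 𝓘(ℝ, ℝ × b.sp)) 𝓘(ℝ, ℝ × b.sp) ∞
      (fun v => (h u)⁻¹ * h v) u := contMDiffAt_const.mul (hl.smooth_coord u hu)
  have hψ : (fun v => (h u)⁻¹ * h v) u = 1 := inv_mul_cancel _
  have hval : ∀ g : b.CSp, MDifferentiableAt 𝓘(ℝ, ℝ × b.sp) 𝓘(ℝ, V →L[ℝ] V)
      (fun g : b.CSp => (g.1.val : V →L[ℝ] V)) g := fun g =>
    (CSp.contMDiff_val g).mdifferentiableAt (by simp)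
  have h1 := mvfderiv_comp_vec u (hval _) (h0.mdifferentiableAt (by simp)) ξ
  have h2 := mvfderiv_const_clm_apply (ContinuousLinearMap.compL ℝ V V V (h u)⁻¹.1.val)
    (mdifferentiableAt_coord_val hl hu) ξ
  -- The base point `(h u)⁻¹ * h u` is 1 only up to a proof, so membership is moved to the identity
  -- by way of arbitrary equal elements.
  have key : ∀ g g' : b.CSp, g = g' → ∀ A : TangentSpace 𝓘(ℝ, ℝ × b.sp) g,
      mvfderiv 𝓘(ℝ, ℝ × b.sp) (fun g : b.CSp => (g.1.val : V →L[ℝ] V)) g A ∈ LinearMap.range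
        (mvfderiv 𝓘(ℝ, ℝ × b.sp) (fun g : b.CSp => (g.1.val : V →L[ℝ] V)) g').toLinearMap := by
    rintro g _ rfl A
    exact ⟨A, rfl⟩
  have h3 := key _ _ hψ (mfderiv (𝓘(ℝ, E).prod 𝓘(ℝ, ℝ × b.sp)) 𝓘(ℝ, ℝ × b.sp)
    (fun v => (h u)⁻¹ * h v) u ξ)
  rw [← h1] at h3
  rw [maurerCartan_apply]
  exact Eq.subst (motive := fun X => X ∈ lieAlg (ℝ × b.sp) b.CSp.subtype) h2 h3

/-- Along the fibre through u the function h is left multiplication by h(u), which drops out of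
h⁻¹dh. -/
theorem maurerCartan_reproducing {u : P.Total} (hu : P.proj u ∈ U)
    (A : TangentSpace 𝓘(ℝ, ℝ × b.sp) (1 : b.CSp)) :
    P.maurerCartan h (P.act u 1) (mfderiv 𝓘(ℝ, ℝ × b.sp) (𝓘(ℝ, E).prod 𝓘(ℝ, ℝ × b.sp))
      (fun g => P.act u g) 1 A) =
    mvfderiv 𝓘(ℝ, ℝ × b.sp) (fun g : b.CSp => (g.1.val : V →L[ℝ] V)) 1 A := by
  have hu' : P.proj (P.act u 1) ∈ U := by rwa [P.proj_act]
  have h0 : ContMDiffAt 𝓘(ℝ, ℝ × b.sp) (𝓘(ℝ, E).prod 𝓘(ℝ, ℝ × b.sp)) ∞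
      (fun g => P.act u g) 1 := by
    have h1 : ContMDiffAt 𝓘(ℝ, ℝ × b.sp) (𝓘(ℝ, E).prod 𝓘(ℝ, ℝ × b.sp)) ∞
        (fun g : b.CSp => (P.proj u, h u * g)) 1 :=
      contMDiffAt_const.prodMk (contMDiffAt_const.mul contMDiffAt_id)
    refine (ContMDiffAt.comp (f := fun g : b.CSp => (P.proj u, h u * g)) (1 : b.CSp)
      (hl.contMDiffAt_act hu (h u * 1)) h1).congr_of_eventuallyEq
      (Filter.Eventually.of_forall fun g => ?_)
    change _ = P.act (σ (P.proj u)) (h u * g)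
    rw [P.act_mul, hl.act_coord u hu]
  have h1 := mvfderiv_comp_vec (1 : b.CSp) (mdifferentiableAt_coord_val hl hu')
    (h0.mdifferentiableAt (by simp)) A
  have h2 : mvfderiv 𝓘(ℝ, ℝ × b.sp) ((fun u => (h u).1.val) ∘ fun g => P.act u g) 1 A =
      (h u).1.val * mvfderiv 𝓘(ℝ, ℝ × b.sp) (fun g : b.CSp => (g.1.val : V →L[ℝ] V)) 1 A := by
    rw [mvfderiv_congr_apply (g := fun g : b.CSp =>
      ContinuousLinearMap.compL ℝ V V V (h u).1.val g.1.val)]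
    · exact mvfderiv_const_clm_apply _ ((CSp.contMDiff_val 1).mdifferentiableAt (by simp)) A
    · refine Filter.Eventually.of_forall fun g => ?_
      change (h (P.act u g)).1.val = _
      rw [coord_act_eq hl hu]
      rfl
  rw [maurerCartan_apply, coord_act_eq hl hu, ← h1, h2, mul_one]
  refine (mul_assoc _ _ _).symm.trans ?_
  have h3 : (h u)⁻¹.1.val * (h u).1.val = 1 := (h u).1.inv_mul
  rw [h3, one_mul]

end

end CSpStructure

end LocalConnection

/-! ### Sums of one-forms with function coefficients. -/

section OneFormSums

variable {EN HN N : Type*} [NormedAddCommGroup EN] [NormedSpace ℝ EN] [TopologicalSpace HN]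
  {I : ModelWithCorners ℝ EN HN} [TopologicalSpace N] [ChartedSpace HN N] [IsManifold I ∞ N]
  {F : Type*} [NormedAddCommGroup F] [NormedSpace ℝ F]

theorem OneFormSmoothAt.sum_smul {ι : Type*} {s : Finset ι} {c : ι → N → ℝ}
    {θ : ι → Π u : N, TangentSpace I u →L[ℝ] F} {u : N}
    (hc : ∀ i ∈ s, ContMDiffAt I 𝓘(ℝ, ℝ) ∞ (c i) u) (h : ∀ i ∈ s, OneFormSmoothAt I (θ i) u) :
    OneFormSmoothAt I (fun u => ∑ i ∈ s, c i u • θ i u) u := by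
  rw [oneFormSmoothAt_iff]
  have h1 : oneFormInTrivialization I (fun u => ∑ i ∈ s, c i u • θ i u) u =
      fun v => ∑ i ∈ s, c i v • oneFormInTrivialization I (θ i) u v := by
    funext v
    refine ContinuousLinearMap.ext fun w => ?_
    simp [oneFormInTrivialization]
  rw [h1]
  exact ContMDiffAt.sum fun i hi => (hc i hi).smul (oneFormSmoothAt_iff.1 (h i hi))

end OneFormSums

/-! ### The covariant derivative with a given parallel coframe. -/

section ConnectionExistence

variable {V : Type*} [NormedAddCommGroup V] [NormedSpace ℝ V] [FiniteDimensional ℝ V]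
  [Nontrivial V] {b : SymplecticForm V}
  {E : Type*} [NormedAddCommGroup E] [NormedSpace ℝ E] [FiniteDimensional ℝ E]
  {M : Type*} [TopologicalSpace M] [ChartedSpace E M] [IsManifold 𝓘(ℝ, E) ∞ M]

open SymplecticForm FirstOrderStructure

namespace CSpStructure

variable {P : CSpStructure b E M}

/-- The coordinates of a vector field with respect to the coframe given by a section. -/
noncomputable def components (σ : M → P.Total) (Y : Π y : M, TangentSpace 𝓘(ℝ, E) y) (y : M) : V :=
  P.coframe (σ y) (Y y)

/-- The derivative of a vector field for which the coframe given by a section is parallel. -/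
noncomputable def sectionDeriv (σ : M → P.Total) (Y : Π y : M, TangentSpace 𝓘(ℝ, E) y) (x : M) :
    TangentSpace 𝓘(ℝ, E) x →L[ℝ] E :=
  ((P.coframe (σ x)).symm : V →L[ℝ] E) ∘L mvfderiv 𝓘(ℝ, E) (components σ Y) x

section

variable {U : Set M} {σ : M → P.Total} {h : P.Total → b.CSp} (hl : P.IsLocalSection U σ h)
  {Y : Π y : M, TangentSpace 𝓘(ℝ, E) y}
include hl

theorem mdifferentiableAt_components {x : M} (hx : x ∈ U) (hY : MDifferentiableAt 𝓘(ℝ, E)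
    𝓘(ℝ, E).tangent (fun y => (⟨y, Y y⟩ : TangentBundle 𝓘(ℝ, E) M)) x) :
    MDifferentiableAt 𝓘(ℝ, E) 𝓘(ℝ, V) (components σ Y) x := by
  rw [mdifferentiableAt_iff_comp_symm (mem_extChartAt_source x)]
  have h1 : DifferentiableAt ℝ (fun z => P.coframeInChart σ x z (vecInChart Y x z))
      (extChartAt 𝓘(ℝ, E) x x) :=
    ((hl.contDiffAt_coframeInChart (mem_extChartAt_target x)
      (by rwa [extChartAt_to_inv])).differentiableAt (by simp)).clm_apply
      (differentiableAt_vecInChart hY)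
  refine h1.congr_of_eventuallyEq ?_
  filter_upwards [extChartAt_target_mem_nhds_of_mem (mem_extChartAt_target (I := 𝓘(ℝ, E)) x)]
    with z hz
  exact congrArg (P.coframe (σ ((extChartAt 𝓘(ℝ, E) x).symm z)))
    (chartSymmDeriv_vecInChart Y hz).symm

theorem coframe_eq {w : P.Total} (hw : P.proj w ∈ U) (v : E) :
    P.coframe w v = (h w)⁻¹.1.val (P.coframe (σ (P.proj w)) v) := by
  have h1 := P.coframe_act (σ (P.proj w)) (h w) v
  rw [hl.act_coord w hw] at h1
  exact h1

/-- The function attached to Y is h⁻¹ applied to the components of Y in the coframe. Its derivative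
contains the term from differentiating h⁻¹, namely -h⁻¹(dh)h⁻¹, which the Maurer-Cartan form
cancels. So the derivative making the coframe parallel is the one induced by h⁻¹dh. -/
theorem coframe_sectionDeriv {u : P.Total} (hu : P.proj u ∈ U)
    (ξ : TangentSpace (𝓘(ℝ, E).prod 𝓘(ℝ, ℝ × b.sp)) u) (hY : MDifferentiableAt 𝓘(ℝ, E)
    𝓘(ℝ, E).tangent (fun y => (⟨y, Y y⟩ : TangentBundle 𝓘(ℝ, E) M)) (P.proj u)) :
    P.coframe u (sectionDeriv σ Y (P.proj u) (P.dproj u ξ)) =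
      mvfderiv (𝓘(ℝ, E).prod 𝓘(ℝ, ℝ × b.sp)) (fun u => P.coframe u (Y (P.proj u))) u ξ +
        P.maurerCartan h u ξ (P.coframe u (Y (P.proj u))) := by
  have hk : ContMDiffAt (𝓘(ℝ, E).prod 𝓘(ℝ, ℝ × b.sp)) 𝓘(ℝ, V →L[ℝ] V) ∞
      (fun u => (h u)⁻¹.1.val) u := CSp.contMDiffAt_iff.1 (hl.smooth_coord u hu).inv
  have hc := mdifferentiableAt_components hl hu hY
  have hp := P.mdifferentiableAt_proj u
  have h1 : mvfderiv (𝓘(ℝ, E).prod 𝓘(ℝ, ℝ × b.sp)) (fun u => P.coframe u (Y (P.proj u))) u ξ =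
      mvfderiv (𝓘(ℝ, E).prod 𝓘(ℝ, ℝ × b.sp))
        (fun w => (h w)⁻¹.1.val ((components σ Y ∘ P.proj) w)) u ξ := by
    refine mvfderiv_congr_apply ?_ ξ
    filter_upwards [eventually_mem hl hu] with w hw
    exact coframe_eq hl hw _
  rw [h1, mvfderiv_clm_apply (hk.mdifferentiableAt (by simp)) (MDifferentiableAt.comp u hc hp),
    mvfderiv_comp_vec u hc hp, mvfderiv_inverse (mdifferentiableAt_coord_val hl hu)
    (hk.mdifferentiableAt (by simp)) (Filter.Eventually.of_forall fun y w => val_inv_apply _ w)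
    (fun w => val_apply_inv _ w)]
  have h2 : P.coframe (σ (P.proj u)) (sectionDeriv σ Y (P.proj u) (P.dproj u ξ)) =
      mvfderiv 𝓘(ℝ, E) (components σ Y) (P.proj u) (P.dproj u ξ) :=
    (P.coframe (σ (P.proj u))).apply_symm_apply _
  have h3 : P.coframe u (Y (P.proj u)) = (h u)⁻¹.1.val (components σ Y (P.proj u)) :=
    coframe_eq hl hu _
  have h4 : P.maurerCartan h u ξ (P.coframe u (Y (P.proj u))) =
      P.maurerCartan h u ξ ((h u)⁻¹.1.val (components σ Y (P.proj u))) :=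
    congrArg (P.maurerCartan h u ξ) h3
  refine (coframe_eq hl hu _).trans ((congrArg _ h2).trans ?_)
  refine Eq.trans ?_ (congrArg _ h4.symm)
  change _ = -((h u)⁻¹.1.val (mvfderiv (𝓘(ℝ, E).prod 𝓘(ℝ, ℝ × b.sp)) (fun u => (h u).1.val) u ξ
    ((h u)⁻¹.1.val (components σ Y (P.proj u))))) + _ +
    (h u)⁻¹.1.val (mvfderiv (𝓘(ℝ, E).prod 𝓘(ℝ, ℝ × b.sp)) (fun u => (h u).1.val) u ξ
    ((h u)⁻¹.1.val (components σ Y (P.proj u))))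
  abel

theorem sectionDeriv_add {x : M} (hx : x ∈ U) {Y' : Π y : M, TangentSpace 𝓘(ℝ, E) y}
    (hY : MDifferentiableAt 𝓘(ℝ, E) 𝓘(ℝ, E).tangent
      (fun y => (⟨y, Y y⟩ : TangentBundle 𝓘(ℝ, E) M)) x)
    (hY' : MDifferentiableAt 𝓘(ℝ, E) 𝓘(ℝ, E).tangent
      (fun y => (⟨y, Y' y⟩ : TangentBundle 𝓘(ℝ, E) M)) x) (v : TangentSpace 𝓘(ℝ, E) x) :
    sectionDeriv σ (Y + Y') x v = sectionDeriv σ Y x v + sectionDeriv σ Y' x v := by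
  have h1 : components σ (Y + Y') = components σ Y + components σ Y' :=
    funext fun y => (P.coframe (σ y)).map_add _ _
  have h2 : mvfderiv 𝓘(ℝ, E) (components σ (Y + Y')) x v =
      mvfderiv 𝓘(ℝ, E) (components σ Y) x v + mvfderiv 𝓘(ℝ, E) (components σ Y') x v := by
    rw [h1, mvfderiv_add (mdifferentiableAt_components hl hx hY)
      (mdifferentiableAt_components hl hx hY')]
    rfl
  exact (congrArg (P.coframe (σ x)).symm h2).trans (map_add _ _ _)

theorem sectionDeriv_smul {x : M} (hx : x ∈ U) {g : M → ℝ}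
    (hY : MDifferentiableAt 𝓘(ℝ, E) 𝓘(ℝ, E).tangent
      (fun y => (⟨y, Y y⟩ : TangentBundle 𝓘(ℝ, E) M)) x)
    (hg : MDifferentiableAt 𝓘(ℝ, E) 𝓘(ℝ, ℝ) g x) (v : TangentSpace 𝓘(ℝ, E) x) :
    sectionDeriv σ (g • Y) x v =
      g x • sectionDeriv σ Y x v + mvfderiv 𝓘(ℝ, E) g x v • (show E from Y x) := by
  have h1 : components σ (g • Y) = g • components σ Y :=
    funext fun y => (P.coframe (σ y)).map_smul _ _
  have h2 : mvfderiv 𝓘(ℝ, E) (components σ (g • Y)) x v =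
      g x • mvfderiv 𝓘(ℝ, E) (components σ Y) x v +
        mvfderiv 𝓘(ℝ, E) g x v • components σ Y x := by
    rw [h1, mvfderiv_smul hg (mdifferentiableAt_components hl hx hY)]
    rfl
  refine (congrArg (P.coframe (σ x)).symm h2).trans ?_
  rw [map_add, map_smul, map_smul]
  exact congrArg (fun w : E => g x • sectionDeriv σ Y x v + mvfderiv 𝓘(ℝ, E) g x v • w)
    ((P.coframe (σ x)).symm_apply_apply (Y x))

end

end CSpStructure

end ConnectionExistence

/-! ### Endomorphism-valued one-forms. -/

section EndValuedForms

variable {EN HN N : Type*} [NormedAddCommGroup EN] [NormedSpace ℝ EN] [TopologicalSpace HN]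
  {I : ModelWithCorners ℝ EN HN} [TopologicalSpace N] [ChartedSpace HN N] [IsManifold I ∞ N]
  {F : Type*} [NormedAddCommGroup F] [NormedSpace ℝ F]

/-- Smoothness of endomorphism valued one-forms, viewed as sections of the homomorphism bundle into
the bundle of endomorphisms of a trivial bundle. -/
theorem OneFormSmoothAt.contMDiffAt_hom {θ : Π u : N, TangentSpace I u →L[ℝ] (F →L[ℝ] F)} {u : N}
    (h : OneFormSmoothAt I θ u) :
    ContMDiffAt I (I.prod 𝓘(ℝ, EN →L[ℝ] (F →L[ℝ] F))) ∞
      (fun u => (⟨u, θ u⟩ : TotalSpace (EN →L[ℝ] (F →L[ℝ] F))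
        (fun u : N => TangentSpace I u →L[ℝ] (Bundle.Trivial N F u →L[ℝ] Bundle.Trivial N F u)))) u := by
  rw [contMDiffAt_hom_bundle]
  refine ⟨contMDiffAt_id, (oneFormSmoothAt_iff.1 h).congr_of_eventuallyEq ?_⟩
  filter_upwards [(trivializationAt EN (TangentSpace I) u).open_baseSet.mem_nhds
    (mem_baseSet_trivializationAt EN (TangentSpace I) u)] with w hw
  refine ContinuousLinearMap.ext fun v => ContinuousLinearMap.ext fun z => ?_
  refine (inCoordinates_apply_eq₂ (F₂ := F) (E₂ := Bundle.Trivial N F) (F₃ := F)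
    (E₃ := Bundle.Trivial N F) (x₀ := u) (x := w) (ϕ := θ w) hw trivial trivial).trans ?_
  refine Eq.trans ?_ (congrArg (fun t => θ w t z)
    ((trivializationAt EN (TangentSpace I) u).symmL_apply (R := ℝ) hw v).symm)
  simp

end EndValuedForms

/-! ### Existence of principal connections. -/

section GlobalConnection

variable {V : Type*} [NormedAddCommGroup V] [NormedSpace ℝ V] [FiniteDimensional ℝ V]
  [Nontrivial V] {b : SymplecticForm V}
  {E : Type*} [NormedAddCommGroup E] [NormedSpace ℝ E] [FiniteDimensional ℝ E]
  {M : Type*} [TopologicalSpace M] [ChartedSpace E M] [IsManifold 𝓘(ℝ, E) ∞ M]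

open SymplecticForm FirstOrderStructure

namespace CSpStructure

variable {P : CSpStructure b E M} {ι : Type*} (ρ : SmoothPartitionOfUnity ι 𝓘(ℝ, E) M)
  {U : ι → Set M} {σ : ι → M → P.Total} {h : ι → P.Total → b.CSp}

/-- The connection form obtained by glueing the flat ones given by local sections. -/
noncomputable def glueForm (h : ι → P.Total → b.CSp) (u : P.Total) :
    TangentSpace (𝓘(ℝ, E).prod 𝓘(ℝ, ℝ × b.sp)) u →L[ℝ] (V →L[ℝ] V) :=
  ∑ i ∈ ρ.finsupport (P.proj u), ρ i (P.proj u) • P.maurerCartan (h i) u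

/-- The covariant derivative obtained by glueing the flat ones given by local sections. -/
noncomputable def glueDeriv (σ : ι → M → P.Total) (Y : Π y : M, TangentSpace 𝓘(ℝ, E) y) (x : M) :
    TangentSpace 𝓘(ℝ, E) x →L[ℝ] E :=
  ∑ i ∈ ρ.finsupport x, ρ i x • sectionDeriv (σ i) Y x

theorem glueForm_apply (u : P.Total) (ξ : TangentSpace (𝓘(ℝ, E).prod 𝓘(ℝ, ℝ × b.sp)) u) :
    glueForm ρ h u ξ =
      ∑ i ∈ ρ.finsupport (P.proj u), ρ i (P.proj u) • P.maurerCartan (h i) u ξ :=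
  sum_apply _ _ _

theorem glueDeriv_apply (Y : Π y : M, TangentSpace 𝓘(ℝ, E) y) (x : M)
    (v : TangentSpace 𝓘(ℝ, E) x) :
    glueDeriv ρ σ Y x v = ∑ i ∈ ρ.finsupport x, ρ i x • sectionDeriv (σ i) Y x v :=
  sum_apply _ _ _

theorem mem_of_mem_finsupport (hρ : ρ.IsSubordinate U) {x : M} {i : ι} (hi : i ∈ ρ.finsupport x) :
    x ∈ U i :=
  hρ i (subset_tsupport _ (by simpa using hi))

variable (hρ : ρ.IsSubordinate U) (hl : ∀ i, P.IsLocalSection (U i) (σ i) (h i))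
include hρ hl

theorem smooth_glueForm (u : P.Total) :
    OneFormSmoothAt (𝓘(ℝ, E).prod 𝓘(ℝ, ℝ × b.sp)) (glueForm ρ h) u := by
  -- The index set of the sum varies with the point; near the base point of u it is contained in the
  -- fixed finite set `fintsupport`.
  have h1 : OneFormSmoothAt (𝓘(ℝ, E).prod 𝓘(ℝ, ℝ × b.sp)) (fun w =>
      ∑ i ∈ ρ.fintsupport (P.proj u), ρ i (P.proj w) • P.maurerCartan (h i) w) u := by
    refine OneFormSmoothAt.sum_smul (fun i _ => ?_) (fun i hi => ?_)
    · exact ((ρ i).contMDiff.contMDiffAt).comp u (P.contMDiff_proj u)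
    · exact smooth_maurerCartan (hl i) (hρ i ((ρ.mem_fintsupport_iff _ i).1 hi))
  refine h1.congr ?_
  filter_upwards [(P.contMDiff_proj u).continuousAt.eventually
    (ρ.eventually_finsupport_subset (P.proj u))] with w hw
  refine Finset.sum_subset hw fun i _ hi => ?_
  have h0 : ρ i (P.proj w) = 0 := by simpa using hi
  refine ContinuousLinearMap.ext fun ξ => ?_
  change ρ i (P.proj w) • P.maurerCartan (h i) w ξ = 0
  rw [h0, zero_smul]

theorem glueForm_mem_lieAlg (u : P.Total)
    (ξ : TangentSpace (𝓘(ℝ, E).prod 𝓘(ℝ, ℝ × b.sp)) u) :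
    glueForm ρ h u ξ ∈ lieAlg (ℝ × b.sp) b.CSp.subtype := by
  rw [glueForm_apply]
  exact Submodule.sum_mem _ fun i hi => Submodule.smul_mem _ _
    (maurerCartan_mem_lieAlg (hl i) (mem_of_mem_finsupport ρ hρ hi) ξ)

theorem glueForm_dact (u : P.Total) (g : b.CSp)
    (ξ : TangentSpace (𝓘(ℝ, E).prod 𝓘(ℝ, ℝ × b.sp)) u) :
    glueForm ρ h (P.act u g) (P.dact u g ξ) = g⁻¹.1.val * glueForm ρ h u ξ * g.1.val := by
  rw [glueForm_apply, glueForm_apply, Finset.mul_sum, Finset.sum_mul, P.proj_act]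
  refine Finset.sum_congr rfl fun i hi => ?_
  refine (congrArg (ρ i (P.proj u) • ·) (maurerCartan_dact (hl i)
    (mem_of_mem_finsupport ρ hρ hi) g ξ)).trans ?_
  change _ = g⁻¹.1.val * (ρ i (P.proj u) • P.maurerCartan (h i) u ξ) * g.1.val
  rw [mul_smul_comm, smul_mul_assoc]

theorem glueForm_reproducing (u : P.Total) (A : TangentSpace 𝓘(ℝ, ℝ × b.sp) (1 : b.CSp)) :
    glueForm ρ h (P.act u 1) (mfderiv 𝓘(ℝ, ℝ × b.sp) (𝓘(ℝ, E).prod 𝓘(ℝ, ℝ × b.sp))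
      (fun g => P.act u g) 1 A) =
    mvfderiv 𝓘(ℝ, ℝ × b.sp) (fun g : b.CSp => (g.1.val : V →L[ℝ] V)) 1 A := by
  refine (glueForm_apply ρ _ _).trans ?_
  rw [P.proj_act]
  refine (Finset.sum_congr rfl fun i hi => congrArg (ρ i (P.proj u) • ·)
    (maurerCartan_reproducing (hl i) (mem_of_mem_finsupport ρ hρ hi) A)).trans ?_
  rw [← Finset.sum_smul, ρ.sum_finsupport _ trivial, one_smul]

theorem glueDeriv_add {x : M} {Y Y' : Π y : M, TangentSpace 𝓘(ℝ, E) y}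
    (hY : MDifferentiableAt 𝓘(ℝ, E) 𝓘(ℝ, E).tangent
      (fun y => (⟨y, Y y⟩ : TangentBundle 𝓘(ℝ, E) M)) x)
    (hY' : MDifferentiableAt 𝓘(ℝ, E) 𝓘(ℝ, E).tangent
      (fun y => (⟨y, Y' y⟩ : TangentBundle 𝓘(ℝ, E) M)) x) (v : TangentSpace 𝓘(ℝ, E) x) :
    glueDeriv ρ σ (Y + Y') x v = glueDeriv ρ σ Y x v + glueDeriv ρ σ Y' x v := by
  rw [glueDeriv_apply, glueDeriv_apply, glueDeriv_apply, ← Finset.sum_add_distrib]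
  refine Finset.sum_congr rfl fun i hi => ?_
  rw [sectionDeriv_add (hl i) (mem_of_mem_finsupport ρ hρ hi) hY hY' v, smul_add]

theorem glueDeriv_smul {x : M} {Y : Π y : M, TangentSpace 𝓘(ℝ, E) y} {g : M → ℝ}
    (hY : MDifferentiableAt 𝓘(ℝ, E) 𝓘(ℝ, E).tangent
      (fun y => (⟨y, Y y⟩ : TangentBundle 𝓘(ℝ, E) M)) x)
    (hg : MDifferentiableAt 𝓘(ℝ, E) 𝓘(ℝ, ℝ) g x) (v : TangentSpace 𝓘(ℝ, E) x) :
    glueDeriv ρ σ (g • Y) x v =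
      g x • glueDeriv ρ σ Y x v + mvfderiv 𝓘(ℝ, E) g x v • (show E from Y x) := by
  rw [glueDeriv_apply, glueDeriv_apply, Finset.sum_congr rfl fun i hi => congrArg (ρ i x • ·)
    (sectionDeriv_smul (hl i) (mem_of_mem_finsupport ρ hρ hi) hY hg v)]
  simp only [smul_add, Finset.sum_add_distrib, ← Finset.sum_smul, ρ.sum_finsupport _ trivial,
    one_smul, Finset.smul_sum]
  congr 1
  exact Finset.sum_congr rfl fun i hi => smul_comm _ _ _

/-- The relation holds for each local section, and the derivative term, common to all of them,
occurs with total weight 1. -/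
theorem coframe_glueDeriv (u : P.Total) (ξ : TangentSpace (𝓘(ℝ, E).prod 𝓘(ℝ, ℝ × b.sp)) u)
    {Y : Π y : M, TangentSpace 𝓘(ℝ, E) y} (hY : MDifferentiableAt 𝓘(ℝ, E)
    𝓘(ℝ, E).tangent (fun y => (⟨y, Y y⟩ : TangentBundle 𝓘(ℝ, E) M)) (P.proj u)) :
    P.coframe u (glueDeriv ρ σ Y (P.proj u) (P.dproj u ξ)) =
      mvfderiv (𝓘(ℝ, E).prod 𝓘(ℝ, ℝ × b.sp)) (fun u => P.coframe u (Y (P.proj u))) u ξ +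
        glueForm ρ h u ξ (P.coframe u (Y (P.proj u))) := by
  have h2 : glueForm ρ h u ξ (P.coframe u (Y (P.proj u))) =
      ∑ i ∈ ρ.finsupport (P.proj u), ρ i (P.proj u) •
        P.maurerCartan (h i) u ξ (P.coframe u (Y (P.proj u))) := by
    rw [glueForm_apply]
    exact sum_apply _ _ _
  rw [h2, glueDeriv_apply, map_sum]
  rw [Finset.sum_congr rfl fun i hi => ((P.coframe u).map_smul _ _).trans
    (congrArg (ρ i (P.proj u) • ·)
      (coframe_sectionDeriv (hl i) (mem_of_mem_finsupport ρ hρ hi) ξ hY))]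
  simp only [smul_add, Finset.sum_add_distrib]
  rw [← Finset.sum_smul, ρ.sum_finsupport _ trivial, one_smul]

-- The axioms of connection forms and of covariant derivatives are preserved by combinations with
-- weights of sum 1, so the flat local ones glue; the same weights on both sides keep them related.
-- Vanishing of the intrinsic torsion is a statement about all induced connections and would be
-- vacuous if there were none.
omit hρ hl in
variable (P) in
theorem exists_induces [T2Space M] [SigmaCompactSpace M] :
    ∃ (γ : P.PrincipalConnection) (D : LinearConnection E M), γ.Induces D := by
  choose U σ h hxU hl using P.exists_localSection
  obtain ⟨ρ, hρ⟩ := SmoothPartitionOfUnity.exists_isSubordinate 𝓘(ℝ, E) isClosed_univ U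
    (fun i => (hl i).isOpen) (fun x _ => mem_iUnion_of_mem x (hxU x))
  refine ⟨⟨glueForm ρ h, fun u => (smooth_glueForm ρ hρ hl u).contMDiffAt_hom, glueForm_mem_lieAlg ρ hρ hl,
    glueForm_dact ρ hρ hl, glueForm_reproducing ρ hρ hl⟩,
    ⟨glueDeriv ρ σ, ⟨fun {Y Y' x} hY hY' _ => ?_, fun {Y g x} hY hg _ => ?_⟩⟩,
    fun u ξ Y hY => coframe_glueDeriv ρ hρ hl u ξ hY⟩
  · exact ContinuousLinearMap.ext fun v => glueDeriv_add ρ hρ hl hY hY' v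
  · exact ContinuousLinearMap.ext fun v => glueDeriv_smul ρ hρ hl hY hg v

end CSpStructure

end GlobalConnection

/-! ### The image of the Spencer differential on a tangent space. -/

section SpencerTransport

variable {V : Type*} [NormedAddCommGroup V] [NormedSpace ℝ V] [FiniteDimensional ℝ V]
  [Nontrivial V] (b : SymplecticForm V)

namespace SymplecticForm

/-- The condition that the cyclic sum lie in V* ∧ b, written on W in terms of b pulled back along A.
-/
theorem transport_mem_range_spencer_iff {W : Type*} [AddCommGroup W] [Module ℝ W]
    [TopologicalSpace W] (A : W ≃L[ℝ] V) (T : W [⋀^Fin 2]→ₗ[ℝ] W) :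
    FirstOrderStructure.transport A T ∈ LinearMap.range (spencer b.csp) ↔
      ∃ l : W →ₗ[ℝ] ℝ, ∀ X Y Z : W,
        b (A (T ![X, Y])) (A Z) - b (A (T ![X, Z])) (A Y) + b (A (T ![Y, Z])) (A X) =
          l X * b (A Y) (A Z) - l Y * b (A X) (A Z) + l Z * b (A X) (A Y) := by
  have key : ∀ X Y : W, FirstOrderStructure.transport A T ![A X, A Y] = A (T ![X, Y]) := by
    intro X Y
    change A (T fun i => A.symm (![A X, A Y] i)) = _
    congr 2
    funext i
    fin_cases i <;> simp
  have hT : ∀ X Y : W, T ![X, Y] = -T ![Y, X] := fun X Y => altTwo_swap T X Y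
  rw [mem_range_spencer_iff]
  constructor
  · rintro ⟨l, hl⟩
    refine ⟨l ∘ₗ A.toLinearMap, fun X Y Z => ?_⟩
    have h := DFunLike.congr_fun hl ![A X, A Y, A Z]
    rw [cyclicSum_apply, wedge_apply, key, key, key, hT Z X, map_neg, b.swap (A Z) (A X)] at h
    have h1 : b (-A (T ![X, Z])) (A Y) = -b (A (T ![X, Z])) (A Y) := by
      rw [← neg_one_smul ℝ (A (T ![X, Z])), b.smul_left]; ring
    rw [h1] at h
    simp only [LinearMap.comp_apply]
    change _ = l (A X) * _ - l (A Y) * _ + l (A Z) * _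
    linear_combination h
  · rintro ⟨l, hl⟩
    refine ⟨l ∘ₗ A.symm.toLinearMap, altThree_ext fun x y z => ?_⟩
    obtain ⟨X, rfl⟩ := A.surjective x
    obtain ⟨Y, rfl⟩ := A.surjective y
    obtain ⟨Z, rfl⟩ := A.surjective z
    have h := hl X Y Z
    rw [cyclicSum_apply, wedge_apply, key, key, key, hT Z X, map_neg, b.swap (A Z) (A X)]
    have h1 : b (-A (T ![X, Z])) (A Y) = -b (A (T ![X, Z])) (A Y) := by
      rw [← neg_one_smul ℝ (A (T ![X, Z])), b.smul_left]; ring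
    rw [h1]
    simp only [LinearMap.comp_apply]
    change _ = l (A.symm (A X)) * _ + l (A.symm (A Y)) * _ + l (A.symm (A Z)) * _
    rw [A.symm_apply_apply, A.symm_apply_apply, A.symm_apply_apply]
    linear_combination h

end SymplecticForm

end SpencerTransport

/-! ### Torsion of induced connections and the exterior derivative. -/

section InducedConnections

variable {V : Type*} [NormedAddCommGroup V] [NormedSpace ℝ V] [FiniteDimensional ℝ V]
  [Nontrivial V] {b : SymplecticForm V}
  {E : Type*} [NormedAddCommGroup E] [NormedSpace ℝ E] [FiniteDimensional ℝ E]
  {M : Type*} [TopologicalSpace M] [ChartedSpace E M] [IsManifold 𝓘(ℝ, E) ∞ M]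

open SymplecticForm FirstOrderStructure

namespace CSpStructure

variable {P : CSpStructure b E M} {γ : P.PrincipalConnection} {D : LinearConnection E M}
  {U : Set M} {σ : M → P.Total} {h : P.Total → b.CSp}

/-- In terms of a coframe given by a section, an induced connection differs from the flat one by
an element of the Lie algebra. -/
theorem exists_components_eq (hγ : γ.Induces D) (hl : P.IsLocalSection U σ h) {x : M} (hx : x ∈ U)
    (v : TangentSpace 𝓘(ℝ, E) x) : ∃ Φ : b.csp, ∀ Y : Π y : M, TangentSpace 𝓘(ℝ, E) y,
      MDifferentiableAt 𝓘(ℝ, E) 𝓘(ℝ, E).tangent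
        (fun y => (⟨y, Y y⟩ : TangentBundle 𝓘(ℝ, E) M)) x →
      P.coframe (σ x) (D Y x v) = mvfderiv 𝓘(ℝ, E) (components σ Y) x v +
        (Φ : V →L[ℝ] V) (components σ Y x) := by
  -- Writing x as the base point of u lets v be lifted to a tangent vector of the total space at u.
  obtain ⟨u, rfl, hu⟩ : ∃ u, P.proj u = x ∧ σ x = u := ⟨σ x, hl.proj_section x hx, rfl⟩
  obtain ⟨ξ, rfl⟩ := P.surjective_dproj u v
  have hmem : γ.form u ξ - P.maurerCartan h u ξ ∈ b.csp := by
    have h1 := γ.mem_lieAlg u ξ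
    have h2 := maurerCartan_mem_lieAlg hl hx ξ
    rw [lieAlg_CSp] at h1 h2
    exact sub_mem h1 h2
  refine ⟨⟨_, hmem⟩, fun Y hY => ?_⟩
  have h1 : P.coframe u (D Y (P.proj u) (P.dproj u ξ)) = _ := hγ u ξ Y hY
  have h2 := coframe_sectionDeriv hl hx ξ hY
  have h3 : P.coframe (σ (P.proj u)) (sectionDeriv σ Y (P.proj u) (P.dproj u ξ)) =
      mvfderiv 𝓘(ℝ, E) (components σ Y) (P.proj u) (P.dproj u ξ) :=
    (P.coframe (σ (P.proj u))).apply_symm_apply _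
  have h4 : components σ Y (P.proj u) = P.coframe u (Y (P.proj u)) := by
    unfold components
    rw [hu]
  rw [hu] at h3 ⊢
  refine h1.trans ?_
  rw [h4, ← h3, h2]
  change _ = _ + _ + (γ.form u ξ (P.coframe u (Y (P.proj u))) -
    P.maurerCartan h u ξ (P.coframe u (Y (P.proj u))))
  have h5 : ∀ a c d : V, a + c = a + d + (c - d) := fun a c d => by abel
  exact h5 _ _ _

theorem mvfderiv_eval {f g : M → V} {x : M} (hf : MDifferentiableAt 𝓘(ℝ, E) 𝓘(ℝ, V) f x)
    (hg : MDifferentiableAt 𝓘(ℝ, E) 𝓘(ℝ, V) g x) (v : TangentSpace 𝓘(ℝ, E) x) :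
    mvfderiv 𝓘(ℝ, E) (fun y => b (f y) (g y)) x v =
      b (mvfderiv 𝓘(ℝ, E) f x v) (g x) + b (f x) (mvfderiv 𝓘(ℝ, E) g x v) := by
  let B : V →L[ℝ] V →L[ℝ] ℝ := LinearMap.toContinuousLinearMap
    ((LinearMap.toContinuousLinearMap : (V →ₗ[ℝ] ℝ) ≃ₗ[ℝ] (V →L[ℝ] ℝ)).toLinearMap ∘ₗ b.bilin)
  have hB : MDifferentiableAt 𝓘(ℝ, E) 𝓘(ℝ, V →L[ℝ] ℝ) (fun y => B (f y)) x :=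
    mdifferentiableAt_clm_apply mdifferentiableAt_const hf
  refine (mvfderiv_clm_apply hB hg v).trans ?_
  rw [mvfderiv_const_clm_apply B hf]
  rfl

/-- In the coframe, D in the direction v is the derivative of the components plus an element Φ of
csp(V). The derivatives of the components cancel against those of b, and -(b(Φ·, ·) + b(·, Φ·)) is a
multiple of b. So induced connections preserve the line bundle. -/
theorem isTwoFormDerivAt_sectionForm (hγ : γ.Induces D) (hl : P.IsLocalSection U σ h) {x : M}
    (hx : x ∈ U) (v : TangentSpace 𝓘(ℝ, E) x) :
    ∃ a : ℝ, D.IsTwoFormDerivAt (P.sectionForm σ) x v (a • P.sectionForm σ x) := by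
  obtain ⟨Φ, hΦ⟩ := exists_components_eq hγ hl hx v
  refine ⟨-b.cspScale Φ, fun X Y hX hY => ?_⟩
  have h1 : (fun y => P.sectionForm σ y ![X y, Y y]) =
      fun y => b (components σ X y) (components σ Y y) :=
    funext fun y => P.twoCovector_apply _ _ _
  have h2 : ∀ v w : E, P.sectionForm σ x ![v, w] = b (P.coframe (σ x) v) (P.coframe (σ x) w) :=
    fun v w => P.twoCovector_apply _ _ _
  rw [h1, mvfderiv_eval (mdifferentiableAt_components hl hx hX)
    (mdifferentiableAt_components hl hx hY)]
  have h3 : P.sectionForm σ x ![D X x v, Y x] =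
      b (mvfderiv 𝓘(ℝ, E) (components σ X) x v + (Φ : V →L[ℝ] V) (components σ X x))
        (components σ Y x) := (h2 _ _).trans (congrArg (fun z => b z _) (hΦ X hX))
  have h4 : P.sectionForm σ x ![X x, D Y x v] = b (components σ X x)
      (mvfderiv 𝓘(ℝ, E) (components σ Y) x v + (Φ : V →L[ℝ] V) (components σ Y x)) :=
    (h2 _ _).trans (congrArg (fun z => b _ z) (hΦ Y hY))
  have h5 : P.sectionForm σ x ![X x, Y x] = b (components σ X x) (components σ Y x) := h2 _ _
  rw [h3, h4]
  change -b.cspScale Φ * P.sectionForm σ x ![X x, Y x] = _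
  rw [h5, b.add_left, b.add_right]
  linear_combination b.cspScale_spec Φ (components σ X x) (components σ Y x)

theorem twoCovector_torsion_iff {x : M} {u : P.Total} (hu : P.proj u = x) :
    transport (P.frameAt u hu) (D.torsionAt x) ∈
        LinearMap.range (spencer (lieAlg (ℝ × b.sp) b.CSp.subtype)) ↔
      ∃ l : E →ₗ[ℝ] ℝ, ∀ X Y Z : E,
        P.twoCovector u ![D.coordTorsion x X Y, Z] - P.twoCovector u ![D.coordTorsion x X Z, Y] +
          P.twoCovector u ![D.coordTorsion x Y Z, X] =
        l X * P.twoCovector u ![Y, Z] - l Y * P.twoCovector u ![X, Z] +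
          l Z * P.twoCovector u ![X, Y] := by
  subst hu
  rw [lieAlg_CSp]
  refine (b.transport_mem_range_spencer_iff _ _).trans (exists_congr fun l =>
    forall₃_congr fun X Y Z => ?_)
  have h1 : ∀ v w : E, b (P.coframe u v) (P.coframe u w) = P.twoCovector u ![v, w] :=
    fun v w => (P.twoCovector_apply u v w).symm
  exact Iff.of_eq (congrArg₂ (· = ·)
    (congrArg₂ (· + ·) (congrArg₂ (· - ·) (h1 _ _) (h1 _ _)) (h1 _ _))
    (congrArg₂ (· + ·) (congrArg₂ (· - ·) (congrArg (l X * ·) (h1 _ _))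
      (congrArg (l Y * ·) (h1 _ _))) (congrArg (l Z * ·) (h1 _ _))))

/-- Let τ be the form given by σ. As ∇τ = m ⊗ τ, the difference of dτ and m ∧ τ is the cyclic sum of
the torsion lowered with τ. The latter is l ∧ τ for some l iff dτ is of this type, with l replaced
by m + l. -/
theorem torsionAt_mem_spencerImage_iff (hγ : γ.Induces D) (hl : P.IsLocalSection U σ h) {x : M}
    (hx : x ∈ U) : D.torsionAt x ∈ P.spencerImage x ↔
      ∃ l : E →ₗ[ℝ] ℝ, ∀ X Y Z : E, (P.sectionForm σ).extDeriv x ![X, Y, Z] =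
        l X * P.twoCovector (σ x) ![Y, Z] - l Y * P.twoCovector (σ x) ![X, Z] +
          l Z * P.twoCovector (σ x) ![X, Y] := by
  have hd := TwoForm.SmoothOn.differentiableAt hl.isOpen (smoothOn_sectionForm hl) hx
  obtain ⟨m, hm⟩ := LinearConnection.exists_linear_of_mem_span (D := D) hd
    (P.twoCovector_ne_zero (σ x)) fun v => by
      obtain ⟨a, ha⟩ := isTwoFormDerivAt_sectionForm hγ hl hx v
      rw [ha.twoFormDeriv_eq]
      exact Submodule.smul_mem _ _ (Submodule.mem_span_singleton_self _)
  have hη : ∀ v w : E, (P.sectionForm σ).inChart x (extChartAt 𝓘(ℝ, E) x x) ![v, w] =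
      P.twoCovector (σ x) ![v, w] := fun v w => (P.sectionForm σ).inChart_self x v w
  have hσ : ∀ X Y Z : E, (P.sectionForm σ).extDeriv x ![X, Y, Z] =
      m X * P.twoCovector (σ x) ![Y, Z] - m Y * P.twoCovector (σ x) ![X, Z] +
        m Z * P.twoCovector (σ x) ![X, Y] +
      (P.twoCovector (σ x) ![D.coordTorsion x X Y, Z] -
        P.twoCovector (σ x) ![D.coordTorsion x X Z, Y] +
        P.twoCovector (σ x) ![D.coordTorsion x Y Z, X]) := fun X Y Z => by
    have h1 := LinearConnection.extDeriv_eq_of_isTwoFormDerivAt hd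
      (β := fun v => m v • P.twoCovector (σ x)) hm X Y Z
    rw [hη, hη, hη] at h1
    refine h1.trans ?_
    simp only [ContinuousAlternatingMap.smul_apply, smul_eq_mul]
    ring
  have hσx := hl.proj_section x hx
  have key : transport (P.frameAt (σ x) hσx) (D.torsionAt x) ∈
        LinearMap.range (spencer (lieAlg (ℝ × b.sp) b.CSp.subtype)) ↔
      ∃ l : E →ₗ[ℝ] ℝ, ∀ X Y Z : E, (P.sectionForm σ).extDeriv x ![X, Y, Z] =
        l X * P.twoCovector (σ x) ![Y, Z] - l Y * P.twoCovector (σ x) ![X, Z] +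
          l Z * P.twoCovector (σ x) ![X, Y] := by
    rw [twoCovector_torsion_iff]
    constructor
    · rintro ⟨l, hl⟩
      refine ⟨m + l, fun X Y Z => ?_⟩
      rw [hσ, hl]
      simp only [LinearMap.add_apply]
      ring
    · rintro ⟨l, hl⟩
      refine ⟨l - m, fun X Y Z => ?_⟩
      have h1 := (hσ X Y Z).symm.trans (hl X Y Z)
      simp only [LinearMap.sub_apply]
      linear_combination h1
  rw [← key]
  simp only [spencerImage, Submodule.mem_iInf, Submodule.mem_comap]
  refine ⟨fun hs => hs _ _, fun hs u hu => ?_⟩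
  -- Another point over x only rescales the two-covector, and the condition is homogeneous in it, so
  -- the same l serves.
  obtain ⟨g, rfl⟩ := P.exists_act_eq (hσx.trans hu.symm)
  obtain ⟨c, -, hc⟩ := P.exists_twoCovector_act (σ x) g
  rw [twoCovector_torsion_iff] at hs ⊢
  obtain ⟨l, hl⟩ := hs
  refine ⟨l, fun X Y Z => ?_⟩
  rw [hc]
  change c * _ - c * _ + c * _ = l X * (c * _) - l Y * (c * _) + l Z * (c * _)
  linear_combination c * hl X Y Z

end CSpStructure

end InducedConnections

/-! ### Wedging two-forms with the symplectic form. -/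

section LefschetzInjectivity

variable {V : Type*} [NormedAddCommGroup V] [NormedSpace ℝ V] [FiniteDimensional ℝ V]
  (b : SymplecticForm V)

namespace SymplecticForm

/-- In dimension greater than four, the common orthogonal space of two vectors is not isotropic. -/
theorem exists_pair_orthogonal (hV : 5 ≤ finrank ℝ V) (x y : V) :
    ∃ z w, b x z = 0 ∧ b y z = 0 ∧ b x w = 0 ∧ b y w = 0 ∧ b z w ≠ 0 := by
  by_contra! hc
  set K := LinearMap.ker ((b.bilin x).prod (b.bilin y)) with hK
  have hmem : ∀ z, z ∈ K ↔ b x z = 0 ∧ b y z = 0 := fun z => by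
    rw [hK, LinearMap.mem_ker, LinearMap.prod_apply]
    exact Prod.mk_eq_zero
  have h1 : _ + finrank ℝ K = _ :=
    LinearMap.finrank_range_add_finrank_ker ((b.bilin x).prod (b.bilin y))
  have h2 := Submodule.finrank_le (LinearMap.range ((b.bilin x).prod (b.bilin y)))
  rw [Module.finrank_prod, Module.finrank_self] at h2
  have h3 := Subspace.finrank_add_finrank_dualAnnihilator_eq K
  -- If K were isotropic, b would embed it into its annihilator, so 2 dim K ≤ n. But dim K ≥ n - 2,
  -- and together this forces n ≤ 4.
  let φ : K →ₗ[ℝ] K.dualAnnihilator := LinearMap.codRestrict _ (b.bilin ∘ₗ K.subtype) fun z => by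
    rw [Submodule.mem_dualAnnihilator]
    intro w hw
    have hz := (hmem z).1 z.2
    have hw' := (hmem w).1 hw
    exact hc z w hz.1 hz.2 hw'.1 hw'.2
  have hφ : Function.Injective φ := by
    rw [injective_iff_map_eq_zero]
    intro z hz
    refine Subtype.ext (b.nondegenerate _ fun w => ?_)
    exact LinearMap.congr_fun (congrArg Subtype.val hz) w
  have h4 := LinearMap.finrank_le_finrank_of_injective hφ
  omega

/-- Exterior multiplication by the symplectic form is injective on two-forms in dimension greater
than four. -/
theorem eq_zero_of_wedge_two_eq_zero (hV : 5 ≤ finrank ℝ V) (S : V →ₗ[ℝ] V →ₗ[ℝ] ℝ)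
    (hS : ∀ x y, S x y = -S y x)
    (h : ∀ x y z w, S x y * b z w - S x z * b y w + S x w * b y z + S y z * b x w -
      S y w * b x z + S z w * b x y = 0) (x y : V) : S x y = 0 := by
  -- For b(x, y) = 0 and z, w orthogonal to x and y, the only surviving term is S(x, y) b(z, w).
  have h1 : ∀ x y, b x y = 0 → S x y = 0 := fun x y hxy => by
    obtain ⟨z, w, hxz, hyz, hxw, hyw, hzw⟩ := b.exists_pair_orthogonal hV x y
    have := h x y z w
    rw [hxy, hxz, hyz, hxw, hyw] at this
    have h2 : S x y * b z w = 0 := by linear_combination this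
    exact (mul_eq_zero.1 h2).resolve_right hzw
  rcases eq_or_ne (b x y) 0 with hxy | hxy
  · exact h1 x y hxy
  -- Otherwise choose z, w orthogonal to x and y with b(z, w) = b(x, y). Then x + z is orthogonal to
  -- y - w, so the first case gives S(x, y) = S(z, w), and the hypothesis becomes 2 b(x, y) S(x, y)
  -- = 0.
  obtain ⟨z, w', hxz, hyz, hxw', hyw', hzw'⟩ := b.exists_pair_orthogonal hV x y
  obtain ⟨w, hxw, hyw, hzw⟩ : ∃ w, b x w = 0 ∧ b y w = 0 ∧ b z w = b x y := by
    refine ⟨(b x y / b z w') • w', ?_, ?_, ?_⟩ <;> rw [b.smul_right]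
    · rw [hxw', mul_zero]
    · rw [hyw', mul_zero]
    · field_simp
  have h2 : S (x + z) (y - w) = 0 := h1 _ _ (by
    have := contAlt_swap b.form z y
    change b z y = -b y z at this
    rw [b.add_left, b.sub_right, b.sub_right, hxw, this, hyz, hzw]
    ring)
  have h3 : S z y = 0 := by rw [hS, h1 y z hyz, neg_zero]
  simp only [map_add, map_sub, LinearMap.add_apply, h1 x w hxw, h3] at h2
  have h4 := h x y z w
  rw [hxz, hyz, hxw, hyw, hzw] at h4
  have h5 : (2 * b x y) * S x y = 0 := by linear_combination h4 + b x y * h2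
  exact (mul_eq_zero.1 h5).resolve_left (mul_ne_zero two_ne_zero hxy)

end SymplecticForm

end LefschetzInjectivity

/-! ### Linear equations depending smoothly on parameters. -/

section SmoothSolve

variable {D G F : Type*} [NormedAddCommGroup D] [NormedSpace ℝ D]
  [NormedAddCommGroup G] [NormedSpace ℝ G] [FiniteDimensional ℝ G]
  [NormedAddCommGroup F] [NormedSpace ℝ F] [FiniteDimensional ℝ F]

/-- The solution of an injective linear equation depends smoothly on parameters. -/
theorem exists_smooth_solution {Ω : Set D} (hΩ : IsOpen Ω) {W : D → G →L[ℝ] F} {y : D → F}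
    (hW : ∀ l, ContDiffOn ℝ ∞ (fun z => W z l) Ω) (hy : ∀ z ∈ Ω, ContDiffAt ℝ ∞ y z) {z₀ : D} (hz₀ : z₀ ∈ Ω)
    (hi : Function.Injective (W z₀)) : ∃ Ω' ⊆ Ω, IsOpen Ω' ∧ z₀ ∈ Ω' ∧ ∃ g : D → G,
      ∀ z ∈ Ω', ContDiffAt ℝ ∞ g z ∧ ∀ l, W z l = y z → l = g z := by
  have hW' : ∀ z ∈ Ω, ContDiffAt ℝ ∞ W z := fun z hz =>
    (contDiffOn_clm_apply.2 hW).contDiffAt (hΩ.mem_nhds hz)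
  have : CompleteSpace G := FiniteDimensional.complete ℝ G
  -- With L a left inverse at z₀, the endomorphism B z = L ∘ W z is the identity at z₀ and
  -- invertible nearby; any solution must be B⁻¹ L y.
  obtain ⟨L, hL⟩ := ContinuousLinearMap.HasLeftInverse.of_injective_of_finiteDimensional hi
  let B : D → G →L[ℝ] G := fun z => ContinuousLinearMap.compL ℝ G F G L (W z)
  have hB : ∀ z ∈ Ω, ContDiffAt ℝ ∞ B z := fun z hz =>
    (ContinuousLinearMap.compL ℝ G F G L).contDiff.contDiffAt.comp z (hW' z hz)
  have hBc : ContinuousOn B Ω := fun z hz => (hB z hz).continuousAt.continuousWithinAt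
  refine ⟨Ω ∩ B ⁻¹' {A | IsUnit A}, inter_subset_left, hBc.isOpen_inter_preimage hΩ Units.isOpen,
    ⟨hz₀, ?_⟩, fun z => Ring.inverse (B z) (L (y z)), fun z hz => ⟨?_, fun l hl => ?_⟩⟩
  · have : B z₀ = 1 := ContinuousLinearMap.ext hL
    change IsUnit (B z₀)
    rw [this]
    exact isUnit_one
  · obtain ⟨u, hu⟩ := hz.2
    have h1 : ContDiffAt ℝ ∞ (Ring.inverse : (G →L[ℝ] G) → _) (B z) :=
      hu ▸ contDiffAt_ringInverse ℝ u
    exact (h1.comp z (hB z hz.1)).clm_apply (L.contDiff.contDiffAt.comp z (hy z hz.1))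
  · have h1 := DFunLike.congr_fun (Ring.inverse_mul_cancel (B z) hz.2) l
    change l = Ring.inverse (B z) (L (y z))
    rw [← hl]
    exact h1.symm

end SmoothSolve

/-! ### Closing a non-degenerate two-form by a conformal factor. -/

section ConformalClosing

variable {E : Type*} [NormedAddCommGroup E] [NormedSpace ℝ E] [FiniteDimensional ℝ E]

theorem extDeriv_three_apply {f : E → E [⋀^Fin 3]→L[ℝ] ℝ} {z : E} (hf : DifferentiableAt ℝ f z)
    (x y w t : E) : _root_.extDeriv f z ![x, y, w, t] =
      fderiv ℝ (fun z => f z ![y, w, t]) z x - fderiv ℝ (fun z => f z ![x, w, t]) z y +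
        fderiv ℝ (fun z => f z ![x, y, t]) z w - fderiv ℝ (fun z => f z ![x, y, w]) z t := by
  rw [_root_.extDeriv_apply hf, Fin.sum_univ_four]
  have h0 : (0 : Fin 4).removeNth ![x, y, w, t] = ![y, w, t] := by funext i; fin_cases i <;> rfl
  have h1 : (1 : Fin 4).removeNth ![x, y, w, t] = ![x, w, t] := by funext i; fin_cases i <;> rfl
  have h2 : (2 : Fin 4).removeNth ![x, y, w, t] = ![x, y, t] := by funext i; fin_cases i <;> rfl
  have h3 : (3 : Fin 4).removeNth ![x, y, w, t] = ![x, y, w] := by funext i; fin_cases i <;> rfl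
  rw [h0, h1, h2, h3]
  simp
  ring

theorem differentiableAt_extDeriv {η : E → E [⋀^Fin 2]→L[ℝ] ℝ} {z : E} (hη : ContDiffAt ℝ ∞ η z) :
    DifferentiableAt ℝ (_root_.extDeriv η) z := by
  have h1 : DifferentiableAt ℝ (fderiv ℝ η) z :=
    (hη.fderiv_right (m := 1) (by norm_cast)).differentiableAt (by simp)
  exact (ContinuousAlternatingMap.alternatizeUncurryFinCLM ℝ E ℝ).differentiableAt.comp z h1

theorem contDiffAt_extDeriv_apply {η : E → E [⋀^Fin 2]→L[ℝ] ℝ} {Ω : Set E} (hΩ : IsOpen Ω)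
    (hη : ∀ z ∈ Ω, ContDiffAt ℝ ∞ η z) {z : E} (hz : z ∈ Ω) (x y w : E) :
    ContDiffAt ℝ ∞ (fun z => _root_.extDeriv η z ![x, y, w]) z := by
  have h1 : ∀ v u t, ContDiffAt ℝ ∞ (fun z => fderiv ℝ η z v ![u, t]) z := fun v u t =>
    (((hη z hz).fderiv_right (m := ∞) le_rfl).clm_apply contDiffAt_const).contAlt_apply
      contDiffAt_const contDiffAt_const
  refine (((h1 x y w).sub (h1 y x w)).add (h1 w x y)).congr_of_eventuallyEq ?_
  filter_upwards [hΩ.mem_nhds hz] with z hz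
  exact extDeriv_two_apply ((hη z hz).differentiableAt (by simp)) x y w

/-- The derivative of the values of the exterior product of a one-form and a two-form. -/
theorem fderiv_wedge_apply {η : E → E [⋀^Fin 2]→L[ℝ] ℝ} {l : E → E →L[ℝ] ℝ} {z : E}
    (hη : DifferentiableAt ℝ η z) (hl : DifferentiableAt ℝ l z) (x y w v : E) :
    fderiv ℝ (fun z => l z x * η z ![y, w] - l z y * η z ![x, w] + l z w * η z ![x, y]) z v =
      (fderiv ℝ l z v x * η z ![y, w] - fderiv ℝ l z v y * η z ![x, w] +
        fderiv ℝ l z v w * η z ![x, y]) +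
      (l z x * fderiv ℝ η z v ![y, w] - l z y * fderiv ℝ η z v ![x, w] +
        l z w * fderiv ℝ η z v ![x, y]) := by
  have h1 : ∀ x, HasFDerivAt (fun z => l z x) ((fderiv ℝ l z).flip x) z := fun x => by
    have := hl.hasFDerivAt.clm_apply (hasFDerivAt_const x z)
    simpa using this
  have h2 : ∀ x y, HasFDerivAt (fun z => η z ![x, y])
      ((ContinuousAlternatingMap.apply ℝ E ℝ ![x, y]) ∘L (fderiv ℝ η z)) z := fun x y =>
    (ContinuousAlternatingMap.apply ℝ E ℝ ![x, y]).hasFDerivAt.comp z hη.hasFDerivAt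
  have h3 := ((((h1 x).mul (h2 y w)).sub ((h1 y).mul (h2 x w))).add ((h1 w).mul (h2 x y))).fderiv
  refine (DFunLike.congr_fun h3 v).trans ?_
  simp
  ring

/-- A one-form `l` with `dη = l ∧ η` is closed if `η` is a non-degenerate two-form. -/
theorem fderiv_symm_of_extDeriv_eq_wedge (hE : 5 ≤ finrank ℝ E) {η : E → E [⋀^Fin 2]→L[ℝ] ℝ}
    {l : E → E →L[ℝ] ℝ} {z : E} (hη : ContDiffAt ℝ ∞ η z) (hl : DifferentiableAt ℝ l z)
    (h : ∀ᶠ z in 𝓝 z, ∀ x y w, _root_.extDeriv η z ![x, y, w] =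
      l z x * η z ![y, w] - l z y * η z ![x, w] + l z w * η z ![x, y])
    (h0 : ∀ v, (∀ w, η z ![v, w] = 0) → v = 0) (x y : E) :
    fderiv ℝ l z x y = fderiv ℝ l z y x := by
  have hη' := hη.differentiableAt (by simp)
  have h1 := extDeriv_extDeriv_apply hη (by
    rw [minSmoothness_of_isRCLikeNormedField]
    exact WithTop.coe_le_coe.2 le_top)
  let b : SymplecticForm E := ⟨η z, h0⟩
  have hb : ∀ v w, b v w = η z ![v, w] := fun v w => rfl
  let S : E →ₗ[ℝ] E →ₗ[ℝ] ℝ := LinearMap.mk₂ ℝ (fun v w => fderiv ℝ l z v w - fderiv ℝ l z w v)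
    (fun v v' w => by simp; ring) (fun c v w => by simp; ring) (fun v w w' => by simp; ring)
    (fun c v w => by simp; ring)
  have hS : ∀ v w, S v w = fderiv ℝ l z v w - fderiv ℝ l z w v := fun v w => rfl
  have hc : ∀ x y w, fderiv ℝ η z x ![y, w] - fderiv ℝ η z y ![x, w] + fderiv ℝ η z w ![x, y] =
      l z x * η z ![y, w] - l z y * η z ![x, w] + l z w * η z ![x, y] := fun x y w => by
    rw [← extDeriv_two_apply hη', h.self_of_nhds]
  have hd : ∀ x y w v, fderiv ℝ (fun z => _root_.extDeriv η z ![x, y, w]) z v =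
      (fderiv ℝ l z v x * η z ![y, w] - fderiv ℝ l z v y * η z ![x, w] +
        fderiv ℝ l z v w * η z ![x, y]) +
      (l z x * fderiv ℝ η z v ![y, w] - l z y * fderiv ℝ η z v ![x, w] +
        l z w * fderiv ℝ η z v ![x, y]) := fun x y w v => by
    rw [← fderiv_wedge_apply hη' hl, Filter.EventuallyEq.fderiv_eq (h.mono fun z hz => hz x y w)]
  refine sub_eq_zero.1 (b.eq_zero_of_wedge_two_eq_zero hE S (fun v w => by rw [hS, hS]; ring)
    (fun x y w t => ?_) x y)
  -- Substituting dη = l ∧ η into ddη = 0 gives dl ∧ η = l ∧ dη, and the right-hand side is l ∧ l ∧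
  -- η = 0 by `hc`. Here S is dl, which vanishes because wedging with η is injective on two-forms.
  have h2 := DFunLike.congr_fun h1 ![x, y, w, t]
  rw [extDeriv_three_apply (differentiableAt_extDeriv hη), hd, hd, hd, hd] at h2
  simp only [hS, hb]
  rw [show (0 : E [⋀^Fin (2 + 1 + 1)]→L[ℝ] ℝ) ![x, y, w, t] = 0 from rfl] at h2
  linear_combination h2 + l z x * hc y w t - l z y * hc x w t + l z w * hc x y t - l z t * hc x y w

/-- If a non-degenerate two-form `η` satisfies `dη = l ∧ η` for one-forms `l` at all points, then
it is locally conformal to a closed form. -/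
theorem exists_smul_closed (hE : 5 ≤ finrank ℝ E) {Ω : Set E} (hΩ : IsOpen Ω)
    {η : E → E [⋀^Fin 2]→L[ℝ] ℝ} (hη : ∀ z ∈ Ω, ContDiffAt ℝ ∞ η z)
    (h0 : ∀ z ∈ Ω, ∀ v, (∀ w, η z ![v, w] = 0) → v = 0)
    (h : ∀ z ∈ Ω, ∃ l : E →ₗ[ℝ] ℝ, ∀ x y w, _root_.extDeriv η z ![x, y, w] =
      l x * η z ![y, w] - l y * η z ![x, w] + l w * η z ![x, y]) {z₀ : E} (hz₀ : z₀ ∈ Ω) :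
    ∃ Ω' ⊆ Ω, IsOpen Ω' ∧ z₀ ∈ Ω' ∧ ∃ f : E → ℝ, ∀ z ∈ Ω', ContDiffAt ℝ ∞ f z ∧
      _root_.extDeriv (fun z => Real.exp (-f z) • η z) z = 0 := by
  have : Nontrivial E := Module.nontrivial_of_finrank_pos (R := ℝ) (by omega)
  let B := finBasis ℝ E
  -- In the basis B this is l ↦ l ∧ η at z. It is injective at z₀, so near z₀ the pointwise given
  -- one-forms agree with a smooth g.
  let W : E → (E →L[ℝ] ℝ) →L[ℝ] (Fin (finrank ℝ E) → Fin (finrank ℝ E) → Fin (finrank ℝ E) → ℝ) :=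
    fun z => LinearMap.toContinuousLinearMap
      { toFun := fun l i j k => l (B i) * η z ![B j, B k] - l (B j) * η z ![B i, B k] +
          l (B k) * η z ![B i, B j]
        map_add' := fun l l' => by
          funext i j k
          simp only [_root_.add_apply, Pi.add_apply]
          ring
        map_smul' := fun c l => by
          funext i j k
          simp only [_root_.smul_apply, Pi.smul_apply, smul_eq_mul, RingHom.id_apply]
          ring }
  have hη₂ : ∀ z ∈ Ω, ∀ x y, ContDiffAt ℝ ∞ (fun z => η z ![x, y]) z := fun z hz x y =>
    (hη z hz).contAlt_apply contDiffAt_const contDiffAt_const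
  have hW : ∀ l, ContDiffOn ℝ ∞ (fun z => W z l) Ω := fun l z hz => by
    refine ContDiffAt.contDiffWithinAt ?_
    refine contDiffAt_pi.2 fun i => contDiffAt_pi.2 fun j => contDiffAt_pi.2 fun k => ?_
    exact ((contDiffAt_const.mul (hη₂ z hz _ _)).sub (contDiffAt_const.mul (hη₂ z hz _ _))).add
      (contDiffAt_const.mul (hη₂ z hz _ _))
  have hy : ∀ z ∈ Ω, ContDiffAt ℝ ∞ (fun z i j k => _root_.extDeriv η z ![B i, B j, B k]) z :=
    fun z hz => contDiffAt_pi.2 fun i => contDiffAt_pi.2 fun j => contDiffAt_pi.2 fun k =>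
      contDiffAt_extDeriv_apply hΩ hη hz _ _ _
  have hi : Function.Injective (W z₀) := by
    let b : SymplecticForm E := ⟨η z₀, h0 z₀ hz₀⟩
    intro l l' hl
    have h1 : b.wedge (l : E →ₗ[ℝ] ℝ) = b.wedge (l' : E →ₗ[ℝ] ℝ) := by
      refine B.ext_alternating fun v _ => ?_
      have hv : (fun i => B (v i)) = ![B (v 0), B (v 1), B (v 2)] := by
        funext i; fin_cases i <;> rfl
      have h2 := congrFun (congrFun (congrFun hl (v 0)) (v 1)) (v 2)
      rw [hv, SymplecticForm.wedge_apply, SymplecticForm.wedge_apply,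
        b.swap (B (v 2)) (B (v 0))]
      change l (B (v 0)) * b (B (v 1)) (B (v 2)) - l (B (v 1)) * b (B (v 0)) (B (v 2)) +
        l (B (v 2)) * b (B (v 0)) (B (v 1)) = l' (B (v 0)) * b (B (v 1)) (B (v 2)) -
        l' (B (v 1)) * b (B (v 0)) (B (v 2)) + l' (B (v 2)) * b (B (v 0)) (B (v 1)) at h2
      simp only [ContinuousLinearMap.coe_coe]
      linear_combination h2
    exact ContinuousLinearMap.coe_injective (b.wedge_injective (by omega) h1)
  obtain ⟨Ω₁, hΩ₁, ho, hz₁, g, hg⟩ := exists_smooth_solution hΩ hW hy hz₀ hi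
  have hgη : ∀ z ∈ Ω₁, ∀ x y w, _root_.extDeriv η z ![x, y, w] =
      g z x * η z ![y, w] - g z y * η z ![x, w] + g z w * η z ![x, y] := fun z hz => by
    obtain ⟨l, hl⟩ := h z (hΩ₁ hz)
    have h1 : LinearMap.toContinuousLinearMap l = g z := (hg z hz).2 _ (by
      funext i j k
      exact (hl (B i) (B j) (B k)).symm)
    rw [← h1]
    exact hl
  obtain ⟨r, hr, hball⟩ := Metric.isOpen_iff.1 ho z₀ hz₁
  -- On a ball the closed form g has a primitive f, and d(exp(-f)η) = exp(-f)(dη - df ∧ η) = 0.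
  obtain ⟨f, hf⟩ : ∃ f : E → ℝ, ∀ z ∈ Metric.ball z₀ r, HasFDerivAt f (g z) z :=
    (convex_ball z₀ r).exists_forall_hasFDerivAt_of_fderiv_symmetric Metric.isOpen_ball
    (fun z hz => ((hg z (hball hz)).1.differentiableAt (by simp)).differentiableWithinAt)
    (fun z hz x y => fderiv_symm_of_extDeriv_eq_wedge hE (hη z (hΩ₁ (hball hz)))
      ((hg z (hball hz)).1.differentiableAt (by simp))
      (Filter.mem_of_superset (ho.mem_nhds (hball hz)) fun z hz => hgη z hz)
      (h0 z (hΩ₁ (hball hz))) x y)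
  have hfs : ContDiffOn ℝ ∞ f (Metric.ball z₀ r) :=
    (contDiffOn_infty_iff_fderiv_of_isOpen Metric.isOpen_ball).2
      ⟨fun z hz => (hf z hz).differentiableAt.differentiableWithinAt,
        ContDiffOn.congr (fun z hz => (hg z (hball hz)).1.contDiffWithinAt)
          fun z hz => (hf z hz).fderiv⟩
  refine ⟨Metric.ball z₀ r, hball.trans hΩ₁, Metric.isOpen_ball, Metric.mem_ball_self hr, f,
    fun z hz => ⟨hfs.contDiffAt (Metric.isOpen_ball.mem_nhds hz), ?_⟩⟩
  have hd := (hη z (hΩ₁ (hball hz))).differentiableAt (by simp)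
  have he : HasFDerivAt (fun z => Real.exp (-f z)) (Real.exp (-f z) • -g z) z := (hf z hz).neg.exp
  have h1 := he.smul hd.hasFDerivAt
  refine contAlt_three_ext fun x y w => ?_
  rw [extDeriv_two_apply (f := fun z => Real.exp (-f z) • η z) h1.differentiableAt]
  have h2 : ∀ v x y, fderiv ℝ (fun z => Real.exp (-f z) • η z) z v ![x, y] =
      Real.exp (-f z) * fderiv ℝ η z v ![x, y] - Real.exp (-f z) * g z v * η z ![x, y] := by
    intro v x y
    have h3 := DFunLike.congr_fun (DFunLike.congr_fun h1.fderiv v) ![x, y]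
    refine h3.trans ?_
    simp
    ring
  have h3 := hgη z (hball hz) x y w
  rw [extDeriv_two_apply hd] at h3
  rw [h2, h2, h2]
  refine Eq.trans ?_ (rfl : (0 : ℝ) = _)
  linear_combination Real.exp (-f z) * h3

end ConformalClosing

/-! ### Vanishing intrinsic torsion and conformally symplectic structures. -/

section IntrinsicTorsion

variable {E : Type*} [NormedAddCommGroup E] [NormedSpace ℝ E] [FiniteDimensional ℝ E]
  {M : Type*} [TopologicalSpace M] [ChartedSpace E M] [IsManifold 𝓘(ℝ, E) ∞ M]

/-- If a non-degenerate two-form `τ` satisfies `dτ = l ∧ τ` for one-forms `l` at all points, then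
it is locally conformal to a closed form. -/
theorem TwoForm.exists_smul_closed (hE : 5 ≤ finrank ℝ E) {τ : TwoForm E M} {U : Set M}
    (hU : IsOpen U) (hτ : τ.SmoothOn U)
    (h0 : ∀ y ∈ U, ∀ v : TangentSpace 𝓘(ℝ, E) y,
      (∀ w : TangentSpace 𝓘(ℝ, E) y, τ y ![v, w] = 0) → v = 0)
    (h : ∀ y ∈ U, ∃ l : TangentSpace 𝓘(ℝ, E) y →ₗ[ℝ] ℝ, ∀ X Y Z : TangentSpace 𝓘(ℝ, E) y,
      τ.extDeriv y ![X, Y, Z] = l X * τ y ![Y, Z] - l Y * τ y ![X, Z] + l Z * τ y ![X, Y])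
    {x : M} (hx : x ∈ U) :
    ∃ W ⊆ U, IsOpen W ∧ x ∈ W ∧ ∃ g : M → ℝ, (∀ y, g y ≠ 0) ∧
      TwoForm.SmoothOn (fun y => g y • τ y) W ∧
      ∀ y ∈ W, TwoForm.extDeriv (fun y => g y • τ y) y = 0 := by
  set e := extChartAt 𝓘(ℝ, E) x
  let Ω : Set E := e.target ∩ e.symm ⁻¹' U
  have hΩ : IsOpen Ω := (continuousOn_extChartAt_symm x).isOpen_inter_preimage
    (isOpen_extChartAt_target x) hU
  have hη : ∀ z ∈ Ω, ContDiffAt ℝ ∞ (τ.inChart x) z := fun z hz => by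
    have h1 := TwoForm.SmoothOn.contDiffAt hU hτ hz.2 (e.map_target hz.1)
    rwa [e.right_inv hz.1] at h1
  have hinv : ∀ z ∈ Ω, ∀ v : E, ∃ v' : TangentSpace 𝓘(ℝ, E) (e.symm z),
      chartDeriv x (e.symm z) v' = v := fun z hz v => ⟨_, chartDeriv_symmDeriv hz.1 v⟩
  have hval : ∀ z ∈ Ω, ∀ v w : TangentSpace 𝓘(ℝ, E) (e.symm z),
      τ.inChart x z ![chartDeriv x (e.symm z) v, chartDeriv x (e.symm z) w] =
        τ (e.symm z) ![v, w] := fun z hz v w => by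
    have h1 := τ.inChart_chartDeriv (e.map_target hz.1) v w
    rwa [e.right_inv hz.1] at h1
  have h0' : ∀ z ∈ Ω, ∀ v, (∀ w, τ.inChart x z ![v, w] = 0) → v = 0 := fun z hz v hv => by
    obtain ⟨v', rfl⟩ := hinv z hz v
    have h1 := h0 _ hz.2 v' fun w => (hval z hz v' w).symm.trans (hv _)
    rw [h1]
    exact map_zero _
  have h' : ∀ z ∈ Ω, ∃ l : E →ₗ[ℝ] ℝ, ∀ X Y Z, _root_.extDeriv (τ.inChart x) z ![X, Y, Z] =
      l X * τ.inChart x z ![Y, Z] - l Y * τ.inChart x z ![X, Z] +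
        l Z * τ.inChart x z ![X, Y] := fun z hz => by
    obtain ⟨l, hl⟩ := h _ hz.2
    refine ⟨l ∘ₗ (chartSymmDeriv x z).toLinearMap, fun X Y Z => ?_⟩
    obtain ⟨X', rfl⟩ := hinv z hz X
    obtain ⟨Y', rfl⟩ := hinv z hz Y
    obtain ⟨Z', rfl⟩ := hinv z hz Z
    have h1 := τ.extDeriv_eq_inChart (e.map_target hz.1)
      ((hη _ (by rwa [e.right_inv hz.1])).differentiableAt (by simp)) X' Y' Z'
    rw [e.right_inv hz.1, hl] at h1
    have h2 : ∀ v, (l ∘ₗ (chartSymmDeriv x z).toLinearMap) (chartDeriv x (e.symm z) v) = l v :=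
      fun v => congrArg l (chartSymmDeriv_deriv hz.1 v)
    rw [h2, h2, h2, hval z hz, hval z hz, hval z hz]
    exact h1.symm
  have hex : e x ∈ Ω := ⟨mem_extChartAt_target x, by
    change e.symm (e x) ∈ U
    rwa [e.left_inv (mem_extChartAt_source x)]⟩
  obtain ⟨Ω', hΩ', ho, hx', f, hf⟩ := _root_.exists_smul_closed hE hΩ hη h0' h' hex
  -- Outside the chart domain the values are arbitrary, but the exponential keeps them non-zero
  -- everywhere.
  let g : M → ℝ := fun y => Real.exp (-f (e y))
  have hg : ∀ y ∈ e.source, e y ∈ Ω' →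
      TwoForm.inChart (fun y => g y • τ y) x =ᶠ[𝓝 (e y)]
        fun z => Real.exp (-f z) • τ.inChart x z := fun y hy hy' => by
    filter_upwards [ho.mem_nhds hy'] with z hz
    rw [TwoForm.inChart_smul]
    change Real.exp (-f (e (e.symm z))) • _ = _
    rw [e.right_inv (hΩ' hz).1]
  have hs : ∀ y ∈ e.source, e y ∈ Ω' →
      ContDiffAt ℝ ∞ (TwoForm.inChart (fun y => g y • τ y) x) (e y) := fun y hy hy' =>
    ((((hf _ hy').1.neg).exp).smul (hη _ (hΩ' hy'))).congr_of_eventuallyEq (hg y hy hy')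
  have hW : IsOpen (e.source ∩ e ⁻¹' Ω') :=
    (continuousOn_extChartAt x).isOpen_inter_preimage (isOpen_extChartAt_source x) ho
  refine ⟨e.source ∩ e ⁻¹' Ω', fun y hy => ?_, hW, ⟨mem_extChartAt_source x, hx'⟩, g,
    fun y => Real.exp_ne_zero _, ?_, fun y hy => ?_⟩
  · have h1 : e.symm (e y) ∈ U := (hΩ' hy.2).2
    rwa [e.left_inv hy.1] at h1
  · exact TwoForm.smoothOn_of_contDiffAt _ hW inter_subset_left fun m hm => hs m hm.1 hm.2
  · refine contAlt_three_ext fun X Y Z => ?_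
    rw [TwoForm.extDeriv_eq_inChart _ hy.1 ((hs y hy.1 hy.2).differentiableAt (by simp)),
      (hg y hy.1 hy.2).extDeriv_eq, (hf _ hy.2).2]
    rfl

variable {V : Type*} [NormedAddCommGroup V] [NormedSpace ℝ V] [FiniteDimensional ℝ V]
  [Nontrivial V] {b : SymplecticForm V}

open SymplecticForm FirstOrderStructure

namespace CSpStructure

variable {P : CSpStructure b E M} {ℓ : AlmostConformallySymplectic E M}

theorem IsLocalSection.isSectionOn_sectionForm {U : Set M} {σ : M → P.Total}
    {h : P.Total → b.CSp} (hl : P.IsLocalSection U σ h) (hP : P.Determines ℓ) :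
    ℓ.IsSectionOn (P.sectionForm σ) U :=
  ⟨smoothOn_sectionForm hl, fun y hy => by
    rw [hP.line_eq (hl.proj_section y hy)]
    exact Submodule.mem_span_singleton_self (R := ℝ) (P.twoCovector (σ y))⟩

/-- The form of a local section is fτ₀ with τ₀ closed and f non-zero at x, so at x its exterior
derivative is (df/f) ∧ fτ₀. By the criterion in terms of dτ, the torsion of every induced connection
lies in the image of ∂. -/
theorem hasVanishingIntrinsicTorsion_of_isConformallySymplectic (hP : P.Determines ℓ)
    (hℓ : ℓ.IsConformallySymplectic) : P.HasVanishingIntrinsicTorsion := by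
  intro γ D hγ x
  obtain ⟨U, σ, h, hx, hl⟩ := P.exists_localSection x
  refine (Submodule.Quotient.mk_eq_zero _).2 ((torsionAt_mem_spencerImage_iff hγ hl hx).2 ?_)
  obtain ⟨W, hWU, hW, hxW, τ₀, f, hτ₀, hf⟩ := hℓ.exists_eq_smul_closed hl.isOpen
    (IsLocalSection.isSectionOn_sectionForm hl hP) hx
  obtain ⟨-, -, hc, hfx, hτ⟩ := hf x hxW
  have hf0 : f x ≠ 0 := fun h0 => P.twoCovector_ne_zero (σ x) (by
    have h1 : P.twoCovector (σ x) = f x • τ₀ x := hτ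
    rw [h1, h0]
    exact zero_smul ℝ (τ₀ x))
  have hd : (P.sectionForm σ).extDeriv x = TwoForm.extDeriv (fun y => f y • τ₀ y) x :=
    TwoForm.extDeriv_congr (Filter.mem_of_superset (hW.mem_nhds hxW) fun y hy => (hf y hy).2.2.2.2)
  have h2 : ∀ v w : E, P.twoCovector (σ x) ![v, w] = f x * τ₀ x ![v, w] := fun v w =>
    DFunLike.congr_fun hτ ![v, w]
  refine ⟨(f x)⁻¹ • (mvfderiv 𝓘(ℝ, E) f x).toLinearMap, fun X Y Z => ?_⟩
  rw [hd]
  refine (TwoForm.extDeriv_smul (hfx.mdifferentiableAt (by simp))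
    (TwoForm.SmoothOn.differentiableAt hW hτ₀ hxW) X Y Z).trans ?_
  rw [hc, h2, h2, h2]
  change f x * 0 + _ = ((f x)⁻¹ * mvfderiv 𝓘(ℝ, E) f x X) * _ -
    ((f x)⁻¹ * mvfderiv 𝓘(ℝ, E) f x Y) * _ + ((f x)⁻¹ * mvfderiv 𝓘(ℝ, E) f x Z) * _
  field_simp
  ring

/-- An induced connection exists, and its torsion lies in the image of ∂ at each point. So the form
τ of a local section satisfies dτ = l ∧ τ pointwise, and a conformal change makes it closed near x.
-/
theorem isConformallySymplectic_of_hasVanishingIntrinsicTorsion [T2Space M] [SigmaCompactSpace M]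
    (hE : 5 ≤ finrank ℝ E) (hP : P.Determines ℓ) (hv : P.HasVanishingIntrinsicTorsion) :
    ℓ.IsConformallySymplectic := by
  intro x
  obtain ⟨γ, D, hγ⟩ := P.exists_induces
  obtain ⟨U, σ, h, hx, hl⟩ := P.exists_localSection x
  obtain ⟨W, hWU, hW, hxW, g, hg, hs, hc⟩ := TwoForm.exists_smul_closed hE hl.isOpen
    (smoothOn_sectionForm hl) (fun y _ v hv => P.twoCovector_nondegenerate (σ y) hv)
    (fun y hy => (torsionAt_mem_spencerImage_iff hγ hl hy).1
      ((Submodule.Quotient.mk_eq_zero _).1 (hv γ D hγ y))) hx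
  refine ⟨W, hW, hxW, _, ⟨hs, fun y hy => Submodule.smul_mem _ _
    ((IsLocalSection.isSectionOn_sectionForm hl hP).2 y (hWU hy))⟩, hc, ?_⟩
  exact smul_ne_zero (hg x) (P.twoCovector_ne_zero (σ x))

end CSpStructure

end IntrinsicTorsion

theorem proposition2p3 {n : ℕ} (hn : 4 ≤ n)
    {V : Type u} [NormedAddCommGroup V] [NormedSpace ℝ V] [FiniteDimensional ℝ V] [Nontrivial V]
    (hV : finrank ℝ V = n) (b : SymplecticForm V)
    {M : Type v} [TopologicalSpace M] [T2Space M] [SecondCountableTopology M]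
    [ChartedSpace (EuclideanSpace ℝ (Fin n)) M] [IsManifold (𝓡 n) ∞ M]
    {M' : Type v'} [TopologicalSpace M'] [T2Space M'] [SecondCountableTopology M']
    [ChartedSpace (EuclideanSpace ℝ (Fin n)) M'] [IsManifold (𝓡 n) ∞ M'] :
    -- (1) first order `CSp(V)`-structures are equivalent to almost conformally symplectic structures
    ((∀ P : CSpStructure.{w} b (EuclideanSpace ℝ (Fin n)) M,
        ∃! ℓ : AlmostConformallySymplectic (EuclideanSpace ℝ (Fin n)) M, P.Determines ℓ) ∧
      (∀ ℓ : AlmostConformallySymplectic (EuclideanSpace ℝ (Fin n)) M,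
        ∃ P : CSpStructure.{max u v} b (EuclideanSpace ℝ (Fin n)) M, P.Determines ℓ) ∧
      (∀ (P : CSpStructure.{w} b (EuclideanSpace ℝ (Fin n)) M)
        (P' : CSpStructure.{w'} b (EuclideanSpace ℝ (Fin n)) M')
        (ℓ : AlmostConformallySymplectic (EuclideanSpace ℝ (Fin n)) M)
        (ℓ' : AlmostConformallySymplectic (EuclideanSpace ℝ (Fin n)) M')
        (f : M → M'), P.Determines ℓ → P'.Determines ℓ' → ContMDiff (𝓡 n) (𝓡 n) ∞ f →
        (ℓ.IsPullback ℓ' f ↔ ∃ F : P.Total → P'.Total, P.IsMorphism P' f F) ∧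
        (∀ F F' : P.Total → P'.Total, P.IsMorphism P' f F → P.IsMorphism P' f F' → F = F'))) ∧
    -- (2) the first prolongation and the cokernel of the Spencer differential
    (lieAlg (ℝ × b.sp) b.CSp.subtype = b.csp ∧
      Nonempty (b.prolongationRep.Equiv b.symCubeRep) ∧
      Nonempty (b.torsionRep.Equiv b.traceFreeRep) ∧
      (n = 4 → Function.Surjective (spencer b.csp))) ∧
    -- (3) vanishing of the intrinsic torsion
    (4 < n → ∀ (ℓ : AlmostConformallySymplectic (EuclideanSpace ℝ (Fin n)) M)
      (P : CSpStructure.{w} b (EuclideanSpace ℝ (Fin n)) M), P.Determines ℓ →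
      (P.HasVanishingIntrinsicTorsion ↔ ℓ.IsConformallySymplectic)) ∧
    -- (4) torsion free compatible connections
    (∀ ℓ : AlmostConformallySymplectic (EuclideanSpace ℝ (Fin n)) M, ℓ.IsConformallySymplectic →
      ∀ D : LinearConnection (EuclideanSpace ℝ (Fin n)) M, D.IsSmooth →
        (∀ x, CovariantDerivative.torsion D x = 0) → D.IsCompatible ℓ →
        D.IsFlatOn ℓ ∧
        ∀ (U : Set M) (τ : TwoForm (EuclideanSpace ℝ (Fin n)) M), IsOpen U → ℓ.IsSectionOn τ U →
          (D.IsParallelOn τ U ↔ ∀ x ∈ U, τ.extDeriv x = 0)) := by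
  have hE : finrank ℝ (EuclideanSpace ℝ (Fin n)) = n := finrank_euclideanSpace_fin
  have : Nontrivial (EuclideanSpace ℝ (Fin n)) :=
    Module.nontrivial_of_finrank_pos (R := ℝ) (by omega)
  -- Together with second countability this gives σ-compactness, as needed for partitions of unity
  -- on M.
  have : LocallyCompactSpace M := ChartedSpace.locallyCompactSpace (EuclideanSpace ℝ (Fin n)) M
  refine ⟨⟨fun P => P.existsUnique_determines,
    fun ℓ => CSpStructure.exists_determines (hE.trans hV.symm) ℓ,
    fun P P' ℓ ℓ' f hP hP' hf => ⟨CSpStructure.isPullback_iff_exists_isMorphism hP hP' hf,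
      fun F F' hF hF' => CSpStructure.isMorphism_unique hf hF hF'⟩⟩,
    ⟨b.lieAlg_CSp, b.nonempty_prolongationRep_equiv (by omega),
      b.nonempty_torsionRep_equiv (by omega), fun h4 => b.spencer_surjective (hV.trans h4)⟩,
    fun h5 ℓ P hP =>
      ⟨CSpStructure.isConformallySymplectic_of_hasVanishingIntrinsicTorsion (by omega) hP,
        CSpStructure.hasVanishingIntrinsicTorsion_of_isConformallySymplectic hP⟩,
    fun ℓ hℓ D hD hT hc =>
      ⟨LinearConnection.isFlatOn_of_isCompatible (by omega) hℓ hc hT,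
        fun U τ hU hτ =>
          LinearConnection.isParallelOn_iff_of_isCompatible (by omega) hℓ hc hT hU hτ⟩⟩
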